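/- Let $(M^n,\sigma)$, $n\ge 2$, be a complete Riemannian manifold (connected, smooth), $\Omega\subset M$ a bounded domain, and $\Psi\in C^2(\overline\Omega\times\mathbb R)$ with $\Psi>0$. Here $C^k(\overline\Omega)$ means: extending to a $C^k$ function near $\overline\Omega$ (and similarly for $\overline\Omega\times\mathbb R$); no regularity of $\partial\Omega$ is needed. Put $\Psi_0=\inf_{\overline\Omega\times\mathbb R}\Psi$ and $\Psi_1=\sup_{\overline\Omega\times\mathbb R}\Psi\in(0,\infty]$. Let $\Gamma\subset\mathbb R^n$ be an open, convex, symmetric cone with vertex at the origin containing the positive cone $\{\kappa:\kappa_i>0\ \forall i\}$, and let $f\in C^2(\Gamma)\cap C^0(\overline\Gamma)$ be symmetric. Write $f_i=\partial f/\partial\kappa_i$ and $\Gamma_\Psi=\{\kappa\in\Gamma:\Psi_0\le f(\kappa)\le\Psi_1\}$. Suppose that $f_i>0$ in $\Gamma$ for all $i$, that $f$ is concave, that $\limsup_{\kappa\to\kappa_0}f(\kappa)\le\bar\Psi_0$ for every $\kappa_0\in\partial\Gamma$, with a constant $\bar\Psi_0<\Psi_0$, and that for some constant $c_0>0$ and all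 $\kappa\in\Gamma_\Psi$ $$\sum_i f_i(\kappa)\ge c_0,\qquad \sum_i f_i(\kappa)\kappa_i\ge c_0,\qquad f_i(\kappa)\ge c_0\ \text{ whenever }\kappa_i<0,\qquad (f_1(\kappa)\cdots f_n(\kappa))^{1/n}\ge c_0 .$$ Suppose finally that there is a locally strictly convex function $\chi\in C^2(\overline\Omega)$, i.e. $\nabla^2\chi>0$ on $\overline\Omega$. For a function $u$ let $\kappa[u]$ be the principal curvatures of its graph in $M\times\mathbb R$ with respect to the upward unit normal, i.e. the eigenvalues of $a_{ij}=u_{i;j}/\sqrt{1+|\nabla u|^2}$ with respect to $g_{ij}=\sigma_{ij}+u_iu_j$, where $u_{i;j}$ are the components of the covariant Hessian $\nabla^2u$. An admissible solution of the Dirichlet problem $$f(\kappa[u])=\Psi(x,u)\ \text{ in }\Omega,\qquad u=\varphi\ \text{ on }\partial\Omega,$$ is a solution with $\kappa[u]\in\Gamma$ at every point of its graph over $\Omega$. Then for all real $K_1,K_2$ there is a constant $C$, depending only on $K_1,K_2$ and the data $M,\sigma,\Omega,\Psi,\Gamma,f,c_0,\bar\Psi_0,\chi$ (and not on $u$, on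 $\varphi$, or on any subsolution), such that every admissible solution $u\in C^4(\Omega)\cap C^2(\overline\Omega)$, for any boundary function $\varphi$, with $$|u|+|\nabla u|\le K_1\ \text{ on }\overline\Omega\qquad\text{and}\qquad \max_{\partial\Omega}|\nabla^2u|\le K_2$$ satisfies $$|\nabla^2u|\le C\quad\text{in }\overline\Omega .$$ -/

import Mathlib

open Set Filter Topology Bundle
open scoped Manifold ContDiff

noncomputable section RiemannianCoordinates

variable {n : ℕ} {M : Type*} [TopologicalSpace M] [ChartedSpace (EuclideanSpace ℝ (Fin n)) M]

/-- The partial derivative `∂ h / ∂ xⁱ` at `z` of a function on `ℝⁿ`. -/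
def partialDeriv (i : Fin n) (h : EuclideanSpace ℝ (Fin n) → ℝ)
    (z : EuclideanSpace ℝ (Fin n)) : ℝ :=
  fderiv ℝ h z (EuclideanSpace.single i 1)

/-- The expression `u ∘ φ_p⁻¹` of a function `u` in the chart `φ_p` of `M` around `p`. -/
def chartExpr (p : M) (u : M → ℝ) : EuclideanSpace ℝ (Fin n) → ℝ :=
  fun z => u ((extChartAt (𝓡 n) p).symm z)

/-- The coordinates of `x` in the preferred chart around `x`. -/
def chartPt (x : M) : EuclideanSpace ℝ (Fin n) := extChartAt (𝓡 n) x x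

/-- The coordinate vector field `∂_i` of the chart around `p`, at the point of coordinates `z`. -/
def coordVec (p : M) (i : Fin n) (z : EuclideanSpace ℝ (Fin n)) :
    TangentSpace (𝓡 n) ((extChartAt (𝓡 n) p).symm z) :=
  mfderiv 𝓘(ℝ, EuclideanSpace ℝ (Fin n)) (𝓡 n) (extChartAt (𝓡 n) p).symm z
    (EuclideanSpace.single i (1 : ℝ))

/-- The components `du_i = u_i` of the differential of `u` at `x`, in the chart around `x`. -/
def diffComp (u : M → ℝ) (x : M) : Fin n → ℝ :=
  fun i => partialDeriv i (chartExpr x u) (chartPt x)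

variable [RiemannianBundle (fun x : M => TangentSpace (𝓡 n) x)]

/-- The matrix `σ_{ij} = ⟨∂_i, ∂_j⟩` of the Riemannian metric in the chart around `p`,
as a function of the coordinates `z`. -/
def metricMatrix (p : M) (z : EuclideanSpace ℝ (Fin n)) : Matrix (Fin n) (Fin n) ℝ :=
  Matrix.of fun i j => inner ℝ (coordVec p i z) (coordVec p j z)

/-- The Christoffel symbols
`Γᵏ_{ij} = ½ σ^{kl} (∂_i σ_{jl} + ∂_j σ_{il} - ∂_l σ_{ij})` of the Levi-Civita connection in the
chart around `p`. -/
def christoffel (p : M) (k i j : Fin n) (z : EuclideanSpace ℝ (Fin n)) : ℝ :=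
  (1 / 2) * ∑ l, (metricMatrix p z)⁻¹ k l *
    (partialDeriv i (fun y => metricMatrix p y j l) z
      + partialDeriv j (fun y => metricMatrix p y i l) z
      - partialDeriv l (fun y => metricMatrix p y i j) z)

/-- The metric matrix at `x` in the chart around `x`. -/
def metricAt (x : M) : Matrix (Fin n) (Fin n) ℝ := metricMatrix x (chartPt x)

/-- The components `u_{i;j} = ∂_i ∂_j u - Γᵏ_{ij} ∂_k u` of the covariant Hessian `∇²u` at `x`,
in the chart around `x`. -/
def hessComp (u : M → ℝ) (x : M) : Matrix (Fin n) (Fin n) ℝ :=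
  Matrix.of fun i j =>
    partialDeriv i (partialDeriv j (chartExpr x u)) (chartPt x)
      - ∑ k, christoffel x k i j (chartPt x) * diffComp u x k

variable (n) in
/-- `|∇u|² = σ^{ij} u_i u_j` at `x`. -/
def gradNormSq (u : M → ℝ) (x : M) : ℝ :=
  ∑ i : Fin n, ∑ j : Fin n, (metricAt (n := n) x)⁻¹ i j * diffComp u x i * diffComp u x j

variable (n) in
/-- `|∇u|` at `x`. -/
def gradNorm (u : M → ℝ) (x : M) : ℝ := √(gradNormSq n u x)

variable (n) in
/-- `|∇²u| = (σ^{ik} σ^{jl} u_{i;j} u_{k;l})^{1/2}` at `x`. -/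
def hessNorm (u : M → ℝ) (x : M) : ℝ :=
  √(∑ i : Fin n, ∑ j : Fin n, ∑ k : Fin n, ∑ l : Fin n,
    (metricAt (n := n) x)⁻¹ i k * (metricAt (n := n) x)⁻¹ j l * hessComp u x i j * hessComp u x k l)

variable (n) in
/-- `W = √(1 + |∇u|²)`. -/
def graphW (u : M → ℝ) (x : M) : ℝ := √(1 + gradNormSq n u x)

/-- The first fundamental form `g_{ij} = σ_{ij} + u_i u_j` of the graph of `u` in `M × ℝ`, in the
frame `Y_i = ∂_i + u_i ∂_t`. -/
def graphMetric (u : M → ℝ) (x : M) : Matrix (Fin n) (Fin n) ℝ :=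
  metricAt x + Matrix.vecMulVec (diffComp u x) (diffComp u x)

/-- The second fundamental form `a_{ij} = ⟨∇̄_{Y_j} Y_i, N⟩ = u_{i;j} / W` of the graph of `u` in
`M × ℝ` with respect to the upward unit normal `N = (∂_t - ∇u) / W`. -/
def graphSecondForm (u : M → ℝ) (x : M) : Matrix (Fin n) (Fin n) ℝ :=
  (graphW n u x)⁻¹ • hessComp u x

/-- `κ` lists the principal curvatures, with multiplicity, of the graph of `u` at `(x, u x)`: the
columns of `P` are a `g`-orthonormal frame of principal directions, and
`a(e_i, e_j) = κ_i δ_{ij}` in this frame. This determines `κ` up to the order of its entries. -/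
def IsPrincipalCurvatures (u : M → ℝ) (x : M) (κ : Fin n → ℝ) : Prop :=
  ∃ P : Matrix (Fin n) (Fin n) ℝ,
    P.transpose * graphMetric u x * P = 1 ∧
    P.transpose * graphSecondForm u x * P = Matrix.diagonal κ

variable (n) in
/-- `χ` is a locally strictly convex `C²` function on the closure of `Ω`: it is `C²` up to the
boundary (that is, near each point of the closure) and `∇²χ` is positive definite there. -/
def IsLocallyStrictlyConvex (Ω : Set M) (χ : M → ℝ) : Prop :=
  ∀ x ∈ closure Ω, ContMDiffAt (𝓡 n) 𝓘(ℝ, ℝ) 2 χ x ∧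
    ∀ v : Fin n → ℝ, v ≠ 0 → 0 < ∑ i, ∑ j, hessComp χ x i j * v i * v j

/-- `u ∈ C⁴(Ω) ∩ C²(Ω̄)` is an admissible solution of the Dirichlet problem
`f(κ[u]) = Ψ(x, u)` in `Ω`, `u = φ` on `∂Ω`. The conditions on `κ` do not depend on the order of
its entries when `Γ` and `f` are symmetric. -/
structure IsAdmissibleSolution (Ω : Set M) (Γ : Set (Fin n → ℝ)) (f : (Fin n → ℝ) → ℝ)
    (Ψ : M → ℝ → ℝ) (φ : M → ℝ) (u : M → ℝ) : Prop where
  contMDiffOn : ContMDiffOn (𝓡 n) 𝓘(ℝ, ℝ) 4 u Ω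
  contMDiffAt_closure : ∀ x ∈ closure Ω, ContMDiffAt (𝓡 n) 𝓘(ℝ, ℝ) 2 u x
  equation : ∀ x ∈ Ω, ∃ κ, IsPrincipalCurvatures u x κ ∧ κ ∈ Γ ∧ f κ = Ψ x (u x)
  boundary : ∀ x ∈ frontier Ω, u x = φ x

end RiemannianCoordinates

noncomputable section CurvatureFunctions

variable {n : ℕ}

/-- `f_i = ∂ f / ∂ κ_i`. -/
def curvDeriv (f : (Fin n → ℝ) → ℝ) (i : Fin n) (κ : Fin n → ℝ) : ℝ :=
  fderiv ℝ f κ (Pi.single i 1)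

/-- `f ∈ C²(Γ) ∩ C⁰(Γ̄)` is a symmetric function on an open, convex, symmetric cone `Γ` with
vertex at the origin that contains the positive cone. -/
structure IsCurvatureFunction (Γ : Set (Fin n → ℝ)) (f : (Fin n → ℝ) → ℝ) : Prop where
  isOpen : IsOpen Γ
  convex : Convex ℝ Γ
  smul_mem : ∀ t : ℝ, 0 < t → ∀ κ ∈ Γ, t • κ ∈ Γ
  perm_mem : ∀ s : Equiv.Perm (Fin n), ∀ κ ∈ Γ, κ ∘ s ∈ Γ
  pos_mem : ∀ κ : Fin n → ℝ, (∀ i, 0 < κ i) → κ ∈ Γ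
  contDiffOn : ContDiffOn ℝ 2 f Γ
  continuousOn : ContinuousOn f (closure Γ)
  symm : ∀ s : Equiv.Perm (Fin n), ∀ κ ∈ Γ, f (κ ∘ s) = f κ

/-- `Γ_Ψ = {κ ∈ Γ : Ψ₀ ≤ f(κ) ≤ Ψ₁}`. -/
def levelRegion (Γ : Set (Fin n → ℝ)) (f : (Fin n → ℝ) → ℝ) (Ψ₀ Ψ₁ : EReal) :
    Set (Fin n → ℝ) :=
  {κ | κ ∈ Γ ∧ Ψ₀ ≤ (f κ : EReal) ∧ (f κ : EReal) ≤ Ψ₁}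

/-- The structure conditions on the curvature function `f`. -/
structure StructureConditions (Γ : Set (Fin n → ℝ)) (f : (Fin n → ℝ) → ℝ) (Ψ₀ Ψ₁ : EReal)
    (c₀ Ψbar : ℝ) : Prop where
  elliptic : ∀ κ ∈ Γ, ∀ i, 0 < curvDeriv f i κ
  concave : ConcaveOn ℝ Γ f
  c₀_pos : 0 < c₀
  sum_ge : ∀ κ ∈ levelRegion Γ f Ψ₀ Ψ₁, c₀ ≤ ∑ i, curvDeriv f i κ
  euler_ge : ∀ κ ∈ levelRegion Γ f Ψ₀ Ψ₁, c₀ ≤ ∑ i, curvDeriv f i κ * κ i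
  limsup_le : ∀ κ₀ ∈ frontier Γ, limsup f (𝓝[Γ] κ₀) ≤ Ψbar
  Ψbar_lt : (Ψbar : EReal) < Ψ₀
  neg_ge : ∀ κ ∈ levelRegion Γ f Ψ₀ Ψ₁, ∀ i, κ i < 0 → c₀ ≤ curvDeriv f i κ
  prod_ge : ∀ κ ∈ levelRegion Γ f Ψ₀ Ψ₁, c₀ ≤ (∏ i, curvDeriv f i κ) ^ (1 / (n : ℝ))

end CurvatureFunctions

/-- `Ψ₀ = inf Ψ` over `Ω̄ × ℝ`, as an extended real. -/
noncomputable def infRHS {M : Type*} [TopologicalSpace M] (Ω : Set M) (Ψ : M → ℝ → ℝ) : EReal :=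
  ⨅ x ∈ closure Ω, ⨅ t : ℝ, (Ψ x t : EReal)

/-- `Ψ₁ = sup Ψ` over `Ω̄ × ℝ`, as an extended real. -/
noncomputable def supRHS {M : Type*} [TopologicalSpace M] (Ω : Set M) (Ψ : M → ℝ → ℝ) : EReal :=
  ⨆ x ∈ closure Ω, ⨆ t : ℝ, (Ψ x t : EReal)

/-!
The second derivatives are estimated by a maximum principle for the function
`Λ exp (β χ) / (1 - a₀ W)` on the closure of `Ω`, where `Λ` is the largest ratio of the covariant
Hessian of `u` and the metric of its graph (so `Λ = W κ_max`), `W = √(1 + |∇u|²)`,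
`a₀ = 1 / (2 √(1 + K₁²))` and `β` is large. By the Hopf–Rinow theorem
(`isCompact_closure_of_isBounded`) the closure of `Ω` is compact, and the maximum is attained
(`exists_testFunction_max`). On the boundary `Λ ≤ K₂`. The point is to bound `κ_max` at an interior
maximum; a bound on `κ_max` bounds the Hessian, because `∑ f_i κ_i > 0` and `f_i` is largest where
`κ_i` is smallest, whence `|κ_i| ≤ n κ_max`.

Derivatives of symmetric functions of eigenvalues are avoided. By Birkhoff's theorem, a symmetric
concave function satisfies `f(κ') ≤ f(κ) + ∑ f_i(κ) (A_ii - κ_i)` whenever `A` is the matrix in some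
orthonormal frame of a form with eigenvalues `κ'` (`IsCurvatureFunction.le_tangent_diag`). Along a
coordinate line through the maximum, with any frame that is orthonormal up to an error `o(t²)`,
`∑ f_i A_ii - Ψ` has therefore a local minimum; its derivatives of first and second order give the
differentiated equation (`differentiated_equation`). The rotation of the frame is a free parameter,
and a suitable choice replaces the second derivatives of `f` in the usual argument. Testing the
maximality of the test function with one direction `ξ`, moved along each coordinate line, gives the
inequalities for `Λ`. The coordinates are normal at the maximum, with axes in the principal
directions, so that all these inequalities are about jets at the origin of `ℝⁿ`
(`IsNormalData`, `IsNormalMaximum`).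

Combining them, the term `∑ f_i κ_i ≥ c₀` contributes `c₀ κ_max` on the good side, `a₀` contributes
a multiple of `∑ f_i κ_i²`, and the convexity of `χ` contributes a multiple of `β ∑ f_i`, which beats
the curvature terms of the ambient metric. If some `κ_i` is below `-κ_max / 4`, the quadratic terms
dominate; otherwise the rotation of the frame absorbs the gradient terms with `f_i > 4 f_1`, and the
term `f_1 κ_1²` the others (`exists_bound_of_maximum_jets`). The constants are uniform because the
normal coordinates depend smoothly on their centre and frame, which range locally over a compact
set (`exists_eventually_isNormalData`); finitely many charts cover the closure of `Ω`.
-/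


/-! ### Bounded closed sets of a complete Riemannian manifold are compact -/

section HopfRinow

/-- The length space property in the form needed for the Hopf–Rinow theorem: a point at distance
less than `r + s` from `x` is at distance less than `s` from the closed ball of radius `r`
around `x`. -/
def BallsChain (X : Type*) [MetricSpace X] : Prop :=
  ∀ (x y : X) (r s : ℝ), 0 ≤ r → 0 < s → dist x y < r + s → ∃ z, dist x z ≤ r ∧ dist z y < s

/-- The Hopf–Rinow–Cohn-Vossen theorem: a complete, locally compact length space is proper. -/
theorem BallsChain.properSpace {X : Type*} [MetricSpace X] [CompleteSpace X]
    [LocallyCompactSpace X] (hX : BallsChain X) : ProperSpace X := by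
  refine ⟨fun x r => ?_⟩
  by_contra hr
  set A : Set ℝ := {r | ¬ IsCompact (Metric.closedBall x r)} with hA
  have hmono : ∀ s t : ℝ, s ≤ t → s ∈ A → t ∈ A := fun s t hst hs ht =>
    hs (ht.of_isClosed_subset Metric.isClosed_closedBall (Metric.closedBall_subset_closedBall hst))
  have hbdd : BddBelow A := by
    refine ⟨0, fun s hs => ?_⟩
    by_contra h
    apply hs
    rw [Metric.closedBall_eq_empty.2 (not_le.1 h)]
    exact isCompact_empty
  have hne : A.Nonempty := ⟨r, hr⟩
  set R := sInf A with hR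
  have hlt : ∀ s < R, IsCompact (Metric.closedBall x s) := fun s hs => by
    by_contra h
    exact absurd (csInf_le hbdd h) (not_le.2 hs)
  have hgt : ∀ s > R, s ∈ A := fun s hs => by
    obtain ⟨t, ht, hts⟩ := exists_lt_of_csInf_lt hne hs
    exact hmono t s hts.le ht
  have hR0 : 0 ≤ R := le_csInf hne fun s hs => by
    by_contra h
    apply hs
    rw [Metric.closedBall_eq_empty.2 (not_le.1 h)]
    exact isCompact_empty
  -- the closed ball of the critical radius is complete and totally bounded
  have hcomp : IsCompact (Metric.closedBall x R) := by
    refine isCompact_iff_totallyBounded_isComplete.2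
      ⟨?_, Metric.isClosed_closedBall.isComplete⟩
    rw [Metric.totallyBounded_iff]
    intro ε hε
    rcases hR0.eq_or_lt with h0 | hpos
    · refine ⟨{x}, finite_singleton x, fun y hy => ?_⟩
      rw [← h0, Metric.closedBall_zero] at hy
      rw [mem_singleton_iff.1 hy]
      simpa using hε
    · set δ := min (ε / 4) (R / 2) with hδ
      have hδ0 : 0 < δ := by positivity
      have hδε : δ ≤ ε / 4 := min_le_left _ _
      have hδR : δ ≤ R / 2 := min_le_right _ _
      obtain ⟨t, ht, htc⟩ := Metric.totallyBounded_iff.1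
        (hlt (R - δ) (by linarith)).totallyBounded (ε / 2) (by linarith)
      refine ⟨t, ht, fun y hy => ?_⟩
      obtain ⟨z, hz1, hz2⟩ := hX x y (R - δ) (2 * δ) (by linarith) (by linarith)
        (by rw [dist_comm]; linarith [Metric.mem_closedBall.1 hy])
      have hz : z ∈ Metric.closedBall x (R - δ) := by rwa [Metric.mem_closedBall, dist_comm]
      obtain ⟨w, hw, hzw⟩ := mem_iUnion₂.1 (htc hz)
      refine mem_iUnion₂.2 ⟨w, hw, ?_⟩
      rw [Metric.mem_ball] at hzw ⊢
      have := dist_triangle y z w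
      rw [dist_comm y z] at this
      linarith
  obtain ⟨K, hK, hsub⟩ := exists_compact_superset hcomp
  obtain ⟨δ, hδ, hδK⟩ := hcomp.exists_cthickening_subset_open isOpen_interior hsub
  refine hgt (R + δ / 2) (by linarith) (hK.of_isClosed_subset Metric.isClosed_closedBall ?_)
  intro y hy
  obtain ⟨z, hz1, hz2⟩ := hX x y R δ hR0 hδ
    (by rw [dist_comm]; linarith [Metric.mem_closedBall.1 hy])
  apply interior_subset
  apply hδK
  refine Metric.mem_cthickening_of_dist_le y z δ _ ?_ (by rw [dist_comm]; exact hz2.le)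
  rwa [Metric.mem_closedBall, dist_comm]

theorem ballsChain_of_isRiemannianManifold
    (n : ℕ) (M : Type*) [MetricSpace M]
    [ChartedSpace (EuclideanSpace ℝ (Fin n)) M] [IsManifold (𝓡 n) ∞ M]
    [RiemannianBundle (fun x : M => TangentSpace (𝓡 n) x)]
    [IsContMDiffRiemannianBundle (𝓡 n) ∞ (EuclideanSpace ℝ (Fin n))
      (fun x : M => TangentSpace (𝓡 n) x)]
    [IsRiemannianManifold (𝓡 n) M] :
    BallsChain M := by
  intro x y r s hr hs hd
  have he : Manifold.riemannianEDist (𝓡 n) x y < ENNReal.ofReal (r + s) := by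
    rw [← IsRiemannianManifold.out, edist_dist]
    exact (ENNReal.ofReal_lt_ofReal_iff (by linarith)).2 hd
  obtain ⟨γ, h0, h1, hγ, hlen⟩ := Manifold.exists_lt_of_riemannianEDist_lt he
  by_cases hxy : dist x y ≤ r
  · exact ⟨y, hxy, by simpa using hs⟩
  push Not at hxy
  have hc : ContinuousOn (fun t => dist x (γ t)) (Icc 0 1) :=
    (continuous_const.dist continuous_id).comp_continuousOn hγ.continuousOn
  obtain ⟨t, ht, htr⟩ := intermediate_value_Icc (zero_le_one (α := ℝ)) hc
    (show r ∈ Icc (dist x (γ 0)) (dist x (γ 1)) by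
      rw [h0, h1, dist_self]; exact ⟨hr, hxy.le⟩)
  refine ⟨γ t, htr.le, ?_⟩
  have l1 : edist x (γ t) ≤ Manifold.pathELength (𝓡 n) γ 0 t := by
    rw [IsRiemannianManifold.out (I := 𝓡 n)]
    exact Manifold.riemannianEDist_le_pathELength (hγ.mono (Icc_subset_Icc le_rfl ht.2)) h0 rfl ht.1
  have l2 : edist (γ t) y ≤ Manifold.pathELength (𝓡 n) γ t 1 := by
    rw [IsRiemannianManifold.out (I := 𝓡 n)]
    exact Manifold.riemannianEDist_le_pathELength (hγ.mono (Icc_subset_Icc ht.1 le_rfl)) rfl h1 ht.2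
  have l3 : edist x (γ t) + edist (γ t) y < ENNReal.ofReal (r + s) := by
    refine lt_of_le_of_lt (add_le_add l1 l2) ?_
    rwa [Manifold.pathELength_add ht.1 ht.2]
  rw [edist_dist, edist_dist, ← ENNReal.ofReal_add dist_nonneg dist_nonneg,
    ENNReal.ofReal_lt_ofReal_iff (by linarith)] at l3
  simp only at htr
  linarith

theorem isCompact_closure_of_isBounded
    (n : ℕ) {M : Type*} [MetricSpace M]
    [ChartedSpace (EuclideanSpace ℝ (Fin n)) M] [IsManifold (𝓡 n) ∞ M]
    [RiemannianBundle (fun x : M => TangentSpace (𝓡 n) x)]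
    [IsContMDiffRiemannianBundle (𝓡 n) ∞ (EuclideanSpace ℝ (Fin n))
      (fun x : M => TangentSpace (𝓡 n) x)]
    [IsRiemannianManifold (𝓡 n) M]
    [CompleteSpace M] {Ω : Set M}
    (hΩ : Bornology.IsBounded Ω) : IsCompact (closure Ω) := by
  have : LocallyCompactSpace M := Manifold.locallyCompact_of_finiteDimensional (𝓡 n)
  have := (ballsChain_of_isRiemannianManifold n M).properSpace
  exact hΩ.isCompact_closure

end HopfRinow

/-! ### Covariant Hessians and changes of coordinates -/

section CoordinateChange

variable {n : ℕ}

theorem sum_swap_outer {ι : Type*} [Fintype ι] (F : ι → ι → ι → ℝ) :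
    ∑ x, ∑ y, ∑ z, F x y z = ∑ z, ∑ y, ∑ x, F x y z := by
  rw [Finset.sum_comm]
  simp_rw [Finset.sum_comm (f := fun x z => F x _ z)]
  exact Finset.sum_comm

/-- The Jacobian matrix of a map of `ℝⁿ`. -/
noncomputable def jacobian (Z : EuclideanSpace ℝ (Fin n) → EuclideanSpace ℝ (Fin n))
    (y : EuclideanSpace ℝ (Fin n)) : Matrix (Fin n) (Fin n) ℝ :=
  Matrix.of fun a i => partialDeriv i (fun w => Z w a) y

/-- The Christoffel symbols of a metric on an open subset of `ℝⁿ`, given by its matrix. -/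
noncomputable def christoffelOf (S : EuclideanSpace ℝ (Fin n) → Matrix (Fin n) (Fin n) ℝ)
    (k i j : Fin n) (z : EuclideanSpace ℝ (Fin n)) : ℝ :=
  (1 / 2) * ∑ l, (S z)⁻¹ k l *
    (partialDeriv i (fun y => S y j l) z + partialDeriv j (fun y => S y i l) z
      - partialDeriv l (fun y => S y i j) z)

/-- The covariant Hessian of `v` with respect to the metric with matrix `S`. -/
noncomputable def covHess (S : EuclideanSpace ℝ (Fin n) → Matrix (Fin n) (Fin n) ℝ)
    (v : EuclideanSpace ℝ (Fin n) → ℝ) (z : EuclideanSpace ℝ (Fin n)) :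
    Matrix (Fin n) (Fin n) ℝ :=
  Matrix.of fun i j =>
    partialDeriv i (partialDeriv j v) z - ∑ k, christoffelOf S k i j z * partialDeriv k v z

variable {h h' : EuclideanSpace ℝ (Fin n) → ℝ} {z : EuclideanSpace ℝ (Fin n)}

theorem partialDeriv_congr (H : h =ᶠ[𝓝 z] h') (i : Fin n) :
    partialDeriv i h z = partialDeriv i h' z := by
  unfold partialDeriv; rw [H.fderiv_eq]

theorem eventuallyEq_partialDeriv (H : h =ᶠ[𝓝 z] h') (i : Fin n) :
    partialDeriv i h =ᶠ[𝓝 z] partialDeriv i h' :=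
  H.eventuallyEq_nhds.mono fun _ hw => partialDeriv_congr hw i

theorem partialDeriv_mul (hh : DifferentiableAt ℝ h z) (hh' : DifferentiableAt ℝ h' z)
    (i : Fin n) :
    partialDeriv i (fun w => h w * h' w) z
      = partialDeriv i h z * h' z + h z * partialDeriv i h' z := by
  unfold partialDeriv
  rw [fderiv_fun_mul hh hh']
  simp; ring

theorem partialDeriv_sum {ι : Type*} (s : Finset ι) {F : ι → EuclideanSpace ℝ (Fin n) → ℝ}
    (hF : ∀ a ∈ s, DifferentiableAt ℝ (F a) z) (i : Fin n) :
    partialDeriv i (fun w => ∑ a ∈ s, F a w) z = ∑ a ∈ s, partialDeriv i (F a) z := by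
  unfold partialDeriv
  rw [fderiv_fun_sum hF]
  simp

theorem fderiv_apply_eq_sum (L : EuclideanSpace ℝ (Fin n) →L[ℝ] ℝ)
    (v : EuclideanSpace ℝ (Fin n)) :
    L v = ∑ a, L (EuclideanSpace.single a 1) * v a := by
  have : v = ∑ a, v a • EuclideanSpace.single a (1 : ℝ) := by
    ext k; simp [Pi.single_apply]
  conv_lhs => rw [this]
  simp [mul_comm]

theorem jacobian_apply {Z : EuclideanSpace ℝ (Fin n) → EuclideanSpace ℝ (Fin n)}
    (hZ : DifferentiableAt ℝ Z z) (a i : Fin n) :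
    jacobian Z z a i = fderiv ℝ Z z (EuclideanSpace.single i 1) a := by
  have h1 := (EuclideanSpace.proj (𝕜 := ℝ) a).hasFDerivAt.comp z hZ.hasFDerivAt
  simp only [jacobian, partialDeriv, Matrix.of_apply]
  have h2 : HasFDerivAt (fun w => Z w a)
    ((EuclideanSpace.proj (𝕜 := ℝ) a).comp (fderiv ℝ Z z)) z := h1
  rw [h2.fderiv]; rfl

theorem partialDeriv_comp {Z : EuclideanSpace ℝ (Fin n) → EuclideanSpace ℝ (Fin n)}
    (hZ : DifferentiableAt ℝ Z z) (hh : DifferentiableAt ℝ h (Z z)) (i : Fin n) :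
    partialDeriv i (fun w => h (Z w)) z = ∑ a, partialDeriv a h (Z z) * jacobian Z z a i := by
  have h1 := hh.hasFDerivAt.comp z hZ.hasFDerivAt
  have h2 : HasFDerivAt (fun w => h (Z w)) ((fderiv ℝ h (Z z)).comp (fderiv ℝ Z z)) z := h1
  unfold partialDeriv
  rw [h2.fderiv, ContinuousLinearMap.comp_apply, fderiv_apply_eq_sum]
  simp_rw [jacobian_apply hZ]

theorem contDiffAt_partialDeriv {m k : WithTop ℕ∞} (hh : ContDiffAt ℝ k h z) (hk : m + 1 ≤ k)
    (i : Fin n) : ContDiffAt ℝ m (partialDeriv i h) z :=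
  (hh.fderiv_right hk).clm_apply contDiffAt_const

theorem partialDeriv_comm (hh : ContDiffAt ℝ 2 h z) (i j : Fin n) :
    partialDeriv i (partialDeriv j h) z = partialDeriv j (partialDeriv i h) z := by
  have hd : DifferentiableAt ℝ (fderiv ℝ h) z :=
    (hh.fderiv_right (m := 1) (by norm_num)).differentiableAt (by norm_num)
  have key : ∀ a b : Fin n, partialDeriv a (partialDeriv b h) z =
      fderiv ℝ (fderiv ℝ h) z (EuclideanSpace.single a 1) (EuclideanSpace.single b 1) := by
    intro a b
    have h2 := hd.hasFDerivAt.clm_apply (hasFDerivAt_const (EuclideanSpace.single b (1 : ℝ)) z)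
    have h3 : HasFDerivAt (partialDeriv b h) _ z := h2
    change fderiv ℝ (partialDeriv b h) z _ = _
    rw [h3.fderiv]
    simp
  rw [key, key]
  exact (hh.isSymmSndFDerivAt (by simp)) _ _

variable {Z : EuclideanSpace ℝ (Fin n) → EuclideanSpace ℝ (Fin n)}

theorem contDiffAt_jacobian {m k : WithTop ℕ∞} (hZ : ContDiffAt ℝ k Z z) (hk : m + 1 ≤ k)
    (a i : Fin n) : ContDiffAt ℝ m (fun w => jacobian Z w a i) z :=
  contDiffAt_partialDeriv
    ((EuclideanSpace.proj (𝕜 := ℝ) a).contDiff.contDiffAt.comp z hZ) hk i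

theorem partialDeriv_jacobian_comm (hZ : ContDiffAt ℝ 2 Z z) (a i j : Fin n) :
    partialDeriv i (fun w => jacobian Z w a j) z
      = partialDeriv j (fun w => jacobian Z w a i) z :=
  partialDeriv_comm ((EuclideanSpace.proj (𝕜 := ℝ) a).contDiff.contDiffAt.comp z hZ) i j

/-- Second partial derivatives of a composition. -/
theorem partialDeriv_partialDeriv_comp (hZ : ContDiffAt ℝ 2 Z z) (hh : ContDiffAt ℝ 2 h (Z z))
    (i j : Fin n) :
    partialDeriv i (partialDeriv j (fun w => h (Z w))) z =
      ∑ b, ((∑ a, partialDeriv a (partialDeriv b h) (Z z) * jacobian Z z a i) * jacobian Z z b j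
        + partialDeriv b h (Z z) * partialDeriv i (fun w => jacobian Z w b j) z) := by
  have hev : partialDeriv j (fun w => h (Z w)) =ᶠ[𝓝 z]
      fun w => ∑ b, partialDeriv b h (Z w) * jacobian Z w b j := by
    have e1 : ∀ᶠ w in 𝓝 z, ContDiffAt ℝ 2 Z w := hZ.eventually (by simp)
    have e2 : ∀ᶠ w in 𝓝 z, ContDiffAt ℝ 2 h (Z w) :=
      hZ.continuousAt.eventually (hh.eventually (by simp))
    filter_upwards [e1, e2] with w w1 w2
    exact partialDeriv_comp (w1.differentiableAt (by norm_num))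
      (w2.differentiableAt (by norm_num)) j
  have hZd : DifferentiableAt ℝ Z z := hZ.differentiableAt (by norm_num)
  have hd1 : ∀ b, DifferentiableAt ℝ (partialDeriv b h) (Z z) := fun b =>
    (contDiffAt_partialDeriv (m := 1) hh (by norm_num) b).differentiableAt (by norm_num)
  have hd2 : ∀ b, DifferentiableAt ℝ (fun w => jacobian Z w b j) z := fun b =>
    (contDiffAt_jacobian (m := 1) hZ (by norm_num) b j).differentiableAt (by norm_num)
  rw [partialDeriv_congr hev, partialDeriv_sum]
  · refine Finset.sum_congr rfl fun b _ => ?_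
    have hc : DifferentiableAt ℝ (fun w => partialDeriv b h (Z w)) z := (hd1 b).comp z hZd
    rw [partialDeriv_mul hc (hd2 b), partialDeriv_comp hZd (hd1 b)]
  · exact fun b _ => ((hd1 b).comp z hZd).mul (hd2 b)

variable {S S' : EuclideanSpace ℝ (Fin n) → Matrix (Fin n) (Fin n) ℝ}

/-- The derivatives of a pulled back metric. -/
theorem partialDeriv_pullback (hZ : ContDiffAt ℝ 2 Z z)
    (hS : ∀ a b, DifferentiableAt ℝ (fun w => S w a b) (Z z))
    (hS' : S' =ᶠ[𝓝 z] fun w => (jacobian Z w).transpose * S (Z w) * jacobian Z w)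
    (k i j : Fin n) :
    partialDeriv k (fun w => S' w i j) z =
      ∑ b, ∑ a, (partialDeriv k (fun w => jacobian Z w a i) z * S (Z z) a b * jacobian Z z b j
        + jacobian Z z a i * S (Z z) a b * partialDeriv k (fun w => jacobian Z w b j) z
        + ∑ c, partialDeriv c (fun w => S w a b) (Z z) * jacobian Z z c k * jacobian Z z a i
            * jacobian Z z b j) := by
  have hZd : DifferentiableAt ℝ Z z := hZ.differentiableAt (by norm_num)
  have hJ : ∀ a i, DifferentiableAt ℝ (fun w => jacobian Z w a i) z := fun a i =>
    (contDiffAt_jacobian (m := 1) hZ (by norm_num) a i).differentiableAt (by norm_num)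
  have hSc : ∀ a b, DifferentiableAt ℝ (fun w => S (Z w) a b) z := fun a b => (hS a b).comp z hZd
  have hev : (fun w => S' w i j) =ᶠ[𝓝 z]
      fun w => ∑ b, ∑ a, jacobian Z w a i * S (Z w) a b * jacobian Z w b j := by
    filter_upwards [hS'] with w hw
    rw [hw, Matrix.mul_apply]
    simp only [Matrix.mul_apply, Matrix.transpose_apply, Finset.sum_mul]
  rw [partialDeriv_congr hev, partialDeriv_sum]
  · refine Finset.sum_congr rfl fun b _ => ?_
    rw [partialDeriv_sum]
    · refine Finset.sum_congr rfl fun a _ => ?_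
      rw [partialDeriv_mul ((hJ a i).fun_mul (hSc a b)) (hJ b j),
        partialDeriv_mul (hJ a i) (hSc a b), partialDeriv_comp hZd (hS a b)]
      simp only [Finset.sum_mul, Finset.mul_sum, add_mul]
      rw [add_right_comm]
      congr 1
      refine Finset.sum_congr rfl fun c _ => ?_
      ring
    · exact fun a _ => ((hJ a i).mul (hSc a b)).mul (hJ b j)
  · exact fun b _ => DifferentiableAt.fun_sum fun a _ => ((hJ a i).mul (hSc a b)).mul (hJ b j)

/-- The Christoffel symbols of the first kind `½ (∂_i S_jl + ∂_j S_il - ∂_l S_ij)`. -/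
noncomputable def christoffelLower (S : EuclideanSpace ℝ (Fin n) → Matrix (Fin n) (Fin n) ℝ)
    (l i j : Fin n) (z : EuclideanSpace ℝ (Fin n)) : ℝ :=
  (1 / 2) * (partialDeriv i (fun y => S y j l) z + partialDeriv j (fun y => S y i l) z
      - partialDeriv l (fun y => S y i j) z)

theorem christoffelOf_eq (k i j : Fin n) (z : EuclideanSpace ℝ (Fin n)) :
    christoffelOf S k i j z = ∑ l, (S z)⁻¹ k l * christoffelLower S l i j z := by
  simp only [christoffelOf, christoffelLower, Finset.mul_sum]
  refine Finset.sum_congr rfl fun l _ => ?_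
  ring

/-- The transformation law of the Christoffel symbols of the first kind. -/
theorem christoffelLower_pullback (hZ : ContDiffAt ℝ 2 Z z)
    (hS : ∀ a b, DifferentiableAt ℝ (fun w => S w a b) (Z z))
    (hsymm : ∀ w a b, S w a b = S w b a)
    (hS' : S' =ᶠ[𝓝 z] fun w => (jacobian Z w).transpose * S (Z w) * jacobian Z w)
    (l i j : Fin n) :
    christoffelLower S' l i j z = ∑ b, jacobian Z z b l *
      (∑ a, S (Z z) b a * partialDeriv i (fun w => jacobian Z w a j) z
        + ∑ a, ∑ c, christoffelLower S b a c (Z z) * jacobian Z z a i * jacobian Z z c j) := by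
  set T : Fin n → Fin n → Fin n → ℝ := fun k i j =>
    ∑ b, ∑ a, partialDeriv k (fun w => jacobian Z w a i) z * S (Z z) a b * jacobian Z z b j
    with hT
  set U : Fin n → Fin n → Fin n → ℝ := fun k i j =>
    ∑ b, ∑ a, ∑ c, partialDeriv c (fun w => S w a b) (Z z) * jacobian Z z c k
      * jacobian Z z a i * jacobian Z z b j with hU
  have hTs : ∀ k i j, T k i j = T i k j := by
    intro k i j
    simp only [hT]
    simp_rw [partialDeriv_jacobian_comm hZ _ k i]
  have hd : ∀ k i j, partialDeriv k (fun w => S' w i j) z = T k i j + T k j i + U k i j := by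
    intro k i j
    rw [partialDeriv_pullback hZ hS hS']
    simp only [Finset.sum_add_distrib]
    congr 2
    rw [Finset.sum_comm]
    refine Finset.sum_congr rfl fun a _ => Finset.sum_congr rfl fun b _ => ?_
    rw [hsymm (Z z) a b]; ring
  have hUlow : (1 / 2) * (U i j l + U j i l - U l i j) =
      ∑ b, jacobian Z z b l *
        ∑ a, ∑ c, christoffelLower S b a c (Z z) * jacobian Z z a i * jacobian Z z c j := by
    have e1 : U i j l = ∑ b, ∑ a, ∑ c, partialDeriv a (fun w => S w c b) (Z z)
        * jacobian Z z a i * jacobian Z z c j * jacobian Z z b l := by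
      simp only [hU]
      exact Finset.sum_congr rfl fun b _ => Finset.sum_comm
    have e2 : U j i l = ∑ b, ∑ a, ∑ c, partialDeriv c (fun w => S w a b) (Z z)
        * jacobian Z z a i * jacobian Z z c j * jacobian Z z b l := by
      simp only [hU]
      refine Finset.sum_congr rfl fun b _ => Finset.sum_congr rfl fun a _ =>
        Finset.sum_congr rfl fun c _ => ?_
      ring
    have e3 : U l i j = ∑ b, ∑ a, ∑ c, partialDeriv b (fun w => S w a c) (Z z)
        * jacobian Z z a i * jacobian Z z c j * jacobian Z z b l := by
      simp only [hU]
      rw [sum_swap_outer]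
      refine Finset.sum_congr rfl fun b _ => Finset.sum_congr rfl fun a _ =>
        Finset.sum_congr rfl fun c _ => ?_
      ring
    rw [e1, e2, e3]
    simp only [christoffelLower, Finset.mul_sum, ← Finset.sum_add_distrib,
      ← Finset.sum_sub_distrib]
    refine Finset.sum_congr rfl fun b _ => Finset.sum_congr rfl fun a _ =>
        Finset.sum_congr rfl fun c _ => ?_
    ring
  have hTlow : T i j l = ∑ b, jacobian Z z b l *
      ∑ a, S (Z z) b a * partialDeriv i (fun w => jacobian Z w a j) z := by
    simp only [hT, Finset.mul_sum]
    refine Finset.sum_congr rfl fun b _ => Finset.sum_congr rfl fun a _ => ?_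
    rw [hsymm (Z z) a b]; ring
  simp only [mul_add, Finset.sum_add_distrib]
  rw [← hTlow, ← hUlow, christoffelLower, hd, hd, hd]
  rw [hTs l i j, hTs l j i, hTs j i l]
  ring

/-- The transformation law of the Christoffel symbols. -/
theorem sum_jacobian_christoffelOf (hZ : ContDiffAt ℝ 2 Z z)
    (hS : ∀ a b, DifferentiableAt ℝ (fun w => S w a b) (Z z))
    (hsymm : ∀ w a b, S w a b = S w b a)
    (hSdet : IsUnit (S (Z z)).det) (hJdet : IsUnit (jacobian Z z).det)
    (hS' : S' =ᶠ[𝓝 z] fun w => (jacobian Z w).transpose * S (Z w) * jacobian Z w)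
    (a i j : Fin n) :
    ∑ k, jacobian Z z a k * christoffelOf S' k i j z =
      partialDeriv i (fun w => jacobian Z w a j) z
        + ∑ b, ∑ c, christoffelOf S a b c (Z z) * jacobian Z z b i * jacobian Z z c j := by
  set J := jacobian Z z
  set A := S (Z z)
  set m : Fin n → ℝ := fun b =>
    ∑ a, A b a * partialDeriv i (fun w => jacobian Z w a j) z
        + ∑ a, ∑ c, christoffelLower S b a c (Z z) * J a i * J c j with hm
  have hS'z : S' z = J.transpose * A * J := hS'.self_of_nhds
  have hlow : ∀ l, christoffelLower S' l i j z = (J.transpose.mulVec m) l := by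
    intro l
    rw [christoffelLower_pullback hZ hS hsymm hS']
    rfl
  have hkey : J.mulVec ((S' z)⁻¹.mulVec (J.transpose.mulVec m)) = A⁻¹.mulVec m := by
    rw [Matrix.mulVec_mulVec, Matrix.mulVec_mulVec]
    congr 1
    have hJT : IsUnit J.transpose.det := by rwa [Matrix.det_transpose]
    rw [hS'z, Matrix.mul_inv_rev, Matrix.mul_inv_rev]
    rw [Matrix.mul_assoc, Matrix.mul_assoc, Matrix.mul_nonsing_inv_cancel_left _ _ hJdet,
      Matrix.mul_assoc, Matrix.nonsing_inv_mul _ hJT, Matrix.mul_one]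
  have h1 : ∑ k, J a k * christoffelOf S' k i j z
      = J.mulVec ((S' z)⁻¹.mulVec (J.transpose.mulVec m)) a := by
    simp only [Matrix.mulVec, dotProduct] at hlow ⊢
    refine Finset.sum_congr rfl fun k _ => ?_
    rw [christoffelOf_eq]
    congr 1
    refine Finset.sum_congr rfl fun l _ => ?_
    rw [hlow]
  rw [h1, hkey]
  have hm2 : m = A.mulVec (fun a => partialDeriv i (fun w => jacobian Z w a j) z)
      + (fun b => ∑ a, ∑ c, christoffelLower S b a c (Z z) * J a i * J c j) := by
    ext b; rfl
  rw [hm2, Matrix.mulVec_add, Matrix.mulVec_mulVec, Matrix.nonsing_inv_mul _ hSdet,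
    Matrix.one_mulVec, Pi.add_apply]
  congr 1
  simp only [Matrix.mulVec, dotProduct, Finset.mul_sum, christoffelOf_eq, Finset.sum_mul]
  rw [Finset.sum_comm]
  refine Finset.sum_congr rfl fun b _ => ?_
  rw [Finset.sum_comm]
  refine Finset.sum_congr rfl fun c _ => Finset.sum_congr rfl fun l _ => ?_
  ring

/-- The covariant Hessian is a tensor. -/
theorem covHess_pullback {v : EuclideanSpace ℝ (Fin n) → ℝ} (hZ : ContDiffAt ℝ 2 Z z)
    (hS : ∀ a b, DifferentiableAt ℝ (fun w => S w a b) (Z z))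
    (hsymm : ∀ w a b, S w a b = S w b a)
    (hSdet : IsUnit (S (Z z)).det) (hJdet : IsUnit (jacobian Z z).det)
    (hS' : S' =ᶠ[𝓝 z] fun w => (jacobian Z w).transpose * S (Z w) * jacobian Z w)
    (hv : ContDiffAt ℝ 2 v (Z z)) :
    covHess S' (fun w => v (Z w)) z =
      (jacobian Z z).transpose * covHess S v (Z z) * jacobian Z z := by
  ext i j
  have hZd : DifferentiableAt ℝ Z z := hZ.differentiableAt (by norm_num)
  have hvd : DifferentiableAt ℝ v (Z z) := hv.differentiableAt (by norm_num)
  have h1 : ∑ k, christoffelOf S' k i j z * partialDeriv k (fun w => v (Z w)) z =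
      ∑ a, partialDeriv a v (Z z) * (partialDeriv i (fun w => jacobian Z w a j) z
        + ∑ b, ∑ c, christoffelOf S a b c (Z z) * jacobian Z z b i * jacobian Z z c j) := by
    simp_rw [← sum_jacobian_christoffelOf hZ hS hsymm hSdet hJdet hS',
      partialDeriv_comp hZd hvd, Finset.mul_sum]
    rw [Finset.sum_comm]
    refine Finset.sum_congr rfl fun b _ => Finset.sum_congr rfl fun c _ => ?_
    ring
  simp only [covHess, Matrix.mul_apply, Matrix.of_apply, Matrix.transpose_apply]
  rw [h1, partialDeriv_partialDeriv_comp hZ hv]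
  simp only [Finset.sum_add_distrib, mul_add, Finset.sum_mul, Finset.mul_sum, mul_sub,
    sub_mul, Finset.sum_sub_distrib]
  have e1 : ∑ x, ∑ x_1, ∑ x_2, partialDeriv x v (Z z) * (christoffelOf S x x_1 x_2 (Z z)
      * jacobian Z z x_1 i * jacobian Z z x_2 j) =
      ∑ x, ∑ x_1, ∑ x_2, jacobian Z z x_1 i * (christoffelOf S x_2 x_1 x (Z z)
        * partialDeriv x_2 v (Z z)) * jacobian Z z x j := by
    rw [sum_swap_outer]
    refine Finset.sum_congr rfl fun b _ => Finset.sum_congr rfl fun a _ =>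
      Finset.sum_congr rfl fun c _ => ?_
    ring
  rw [e1]
  have e2 : ∀ x x_1 : Fin n, partialDeriv x_1 (partialDeriv x v) (Z z) * jacobian Z z x_1 i
      * jacobian Z z x j = jacobian Z z x_1 i * partialDeriv x_1 (partialDeriv x v) (Z z)
      * jacobian Z z x j := fun _ _ => by ring
  simp_rw [e2]
  ring

theorem covHess_congr {v v' : EuclideanSpace ℝ (Fin n) → ℝ} (H : v =ᶠ[𝓝 z] v') :
    covHess S v z = covHess S v' z := by
  ext i j
  simp only [covHess, Matrix.of_apply]
  rw [partialDeriv_congr (eventuallyEq_partialDeriv H j) i]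
  simp_rw [partialDeriv_congr H]

end CoordinateChange

set_option linter.unusedSectionVars false

/-! ### The metric and the covariant Hessian in charts -/

section ChartBridge
variable {n : ℕ} {M : Type*} [TopologicalSpace M] [ChartedSpace (EuclideanSpace ℝ (Fin n)) M]
  [IsManifold (𝓡 n) ∞ M]

theorem contMDiffOn_coordVec (p : M) (i : Fin n) :
    ContMDiffOn 𝓘(ℝ, EuclideanSpace ℝ (Fin n)) ((𝓡 n).prod 𝓘(ℝ, EuclideanSpace ℝ (Fin n))) ∞
      (fun z => (⟨(extChartAt (𝓡 n) p).symm z, coordVec p i z⟩ : TangentBundle (𝓡 n) M))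
      (extChartAt (𝓡 n) p).target := by
  have ho : IsOpen (extChartAt (𝓡 n) p).target := isOpen_extChartAt_target p
  have h1 := (contMDiffOn_extChartAt_symm (I := 𝓡 n) (n := ∞) p).contMDiffOn_tangentMapWithin
    (m := ∞) (by simp) ho.uniqueMDiffOn
  have h2 : ContMDiff 𝓘(ℝ, EuclideanSpace ℝ (Fin n))
      (𝓘(ℝ, EuclideanSpace ℝ (Fin n)).prod 𝓘(ℝ, EuclideanSpace ℝ (Fin n))) ∞
      (fun z => (⟨z, EuclideanSpace.single i (1 : ℝ)⟩ :
        TangentBundle 𝓘(ℝ, EuclideanSpace ℝ (Fin n)) (EuclideanSpace ℝ (Fin n)))) := by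
    intro z
    exact (contMDiffAt_vectorSpace_iff_contDiffAt
      (V := fun _ => (EuclideanSpace.single i (1 : ℝ) : EuclideanSpace ℝ (Fin n)))).2
      contDiffAt_const
  refine (h1.comp h2.contMDiffOn (fun z hz => hz)).congr (fun z hz => ?_)
  simp only [Function.comp, tangentMapWithin, coordVec]
  rw [mfderivWithin_of_mem_nhds (ho.mem_nhds hz)]

theorem contDiffAt_chartExpr {k : WithTop ℕ∞} (hk : k ≤ ∞) (p : M) {u : M → ℝ}
    {z : EuclideanSpace ℝ (Fin n)} (hz : z ∈ (extChartAt (𝓡 n) p).target)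
    (hu : ContMDiffAt (𝓡 n) 𝓘(ℝ, ℝ) k u ((extChartAt (𝓡 n) p).symm z)) :
    ContDiffAt ℝ k (chartExpr p u) z := by
  rw [← contMDiffAt_iff_contDiffAt]
  have h2 : ContMDiffAt 𝓘(ℝ, EuclideanSpace ℝ (Fin n)) (𝓡 n) ∞ (extChartAt (𝓡 n) p).symm z :=
    (contMDiffOn_extChartAt_symm p).contMDiffAt ((isOpen_extChartAt_target p).mem_nhds hz)
  exact hu.comp z (h2.of_le hk)

variable [RiemannianBundle (fun x : M => TangentSpace (𝓡 n) x)]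
    [IsContMDiffRiemannianBundle (𝓡 n) ∞ (EuclideanSpace ℝ (Fin n))
      (fun x : M => TangentSpace (𝓡 n) x)]

theorem contDiffOn_metricMatrix (p : M) (i j : Fin n) :
    ContDiffOn ℝ ∞ (fun z => metricMatrix p z i j) (extChartAt (𝓡 n) p).target := by
  rw [← contMDiffOn_iff_contDiffOn]
  exact (contMDiffOn_coordVec p i).inner_bundle (contMDiffOn_coordVec p j)

theorem metricMatrix_symm (p : M) (z : EuclideanSpace ℝ (Fin n)) (i j : Fin n) :
    metricMatrix p z i j = metricMatrix p z j i :=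
  real_inner_comm (coordVec p j z) (coordVec p i z)

/-- The metric matrix as a quadratic form: `σ(v, v)` is the squared norm of the tangent vector
with components `v`. -/
theorem sum_metricMatrix (p : M) (z : EuclideanSpace ℝ (Fin n)) (v : Fin n → ℝ) :
    ∑ i, ∑ j, metricMatrix p z i j * v i * v j =
      inner ℝ (∑ i, v i • coordVec p i z) (∑ i, v i • coordVec p i z) := by
  rw [sum_inner]
  refine Finset.sum_congr rfl fun i _ => ?_
  rw [inner_sum]
  refine Finset.sum_congr rfl fun j _ => ?_
  rw [inner_smul_left, inner_smul_right]
  simp [metricMatrix]; ring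

theorem sum_smul_coordVec (p : M) (z : EuclideanSpace ℝ (Fin n)) (v : Fin n → ℝ) :
    ∑ i, v i • coordVec p i z =
     mfderiv 𝓘(ℝ, EuclideanSpace ℝ (Fin n)) (𝓡 n) (extChartAt (𝓡 n) p).symm z
    (WithLp.toLp 2 v : EuclideanSpace ℝ (Fin n)) := by
  have : (WithLp.toLp 2 v : EuclideanSpace ℝ (Fin n)) =
    ∑ i, v i • EuclideanSpace.single i (1 : ℝ) := by
    ext k; simp [Pi.single_apply]
  rw [this]
  erw [map_sum]
  refine Finset.sum_congr rfl fun i _ => ?_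
  erw [map_smul]
  rfl

theorem metricMatrix_pos (p : M) {z : EuclideanSpace ℝ (Fin n)}
    (hz : z ∈ (extChartAt (𝓡 n) p).target) {v : Fin n → ℝ} (hv : v ≠ 0) :
    0 < ∑ i, ∑ j, metricMatrix p z i j * v i * v j := by
  rw [sum_metricMatrix, sum_smul_coordVec]
  refine real_inner_self_nonneg.lt_of_ne' ?_
  rw [Ne, inner_self_eq_zero]
  have h := isInvertible_mfderivWithin_extChartAt_symm (I := 𝓡 n) hz
  have hr : range (𝓡 n) = univ := by simp
  rw [hr, mfderivWithin_univ] at h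
  intro h0
  apply hv
  have := h.injective (h0.trans (map_zero _).symm)
  exact congrArg WithLp.ofLp this


theorem isUnit_det_of_pos {A : Matrix (Fin n) (Fin n) ℝ}
    (hA : ∀ v : Fin n → ℝ, v ≠ 0 → 0 < ∑ i, ∑ j, A i j * v i * v j) : IsUnit A.det := by
  rw [isUnit_iff_ne_zero]
  intro h0
  obtain ⟨v, hv, hv0⟩ := Matrix.exists_mulVec_eq_zero_iff.2 h0
  have := hA v hv
  have h2 : ∑ i, ∑ j, A i j * v i * v j = 0 := by
    refine Finset.sum_eq_zero fun i _ => ?_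
    have := congrFun hv0 i
    simp only [Matrix.mulVec, dotProduct, Pi.zero_apply] at this
    calc ∑ j, A i j * v i * v j = v i * ∑ j, A i j * v j := by
          rw [Finset.mul_sum]; exact Finset.sum_congr rfl fun j _ => by ring
      _ = 0 := by rw [this, mul_zero]
  linarith

theorem isUnit_det_metricMatrix (p : M) {z : EuclideanSpace ℝ (Fin n)}
    (hz : z ∈ (extChartAt (𝓡 n) p).target) : IsUnit (metricMatrix p z).det :=
  isUnit_det_of_pos fun _ hv => metricMatrix_pos p hz hv

/-- The change of coordinates from the chart around `p` to the chart around `q`. -/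
noncomputable def chartTransition (p q : M) (z : EuclideanSpace ℝ (Fin n)) :
    EuclideanSpace ℝ (Fin n) :=
  extChartAt (𝓡 n) q ((extChartAt (𝓡 n) p).symm z)

theorem contDiffAt_chartTransition (p q : M) {z : EuclideanSpace ℝ (Fin n)}
    (hz : z ∈ (extChartAt (𝓡 n) p).target)
    (hq : (extChartAt (𝓡 n) p).symm z ∈ (extChartAt (𝓡 n) q).source) :
    ContDiffAt ℝ ∞ (chartTransition p q) z := by
  rw [← contMDiffAt_iff_contDiffAt]
  have h1 : ContMDiffAt (𝓡 n) 𝓘(ℝ, EuclideanSpace ℝ (Fin n)) ∞ (extChartAt (𝓡 n) q)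
      ((extChartAt (𝓡 n) p).symm z) := contMDiffAt_extChartAt' (by simpa using hq)
  have h2 : ContMDiffAt 𝓘(ℝ, EuclideanSpace ℝ (Fin n)) (𝓡 n) ∞ (extChartAt (𝓡 n) p).symm z :=
    (contMDiffOn_extChartAt_symm p).contMDiffAt ((isOpen_extChartAt_target p).mem_nhds hz)
  exact h1.comp z h2

theorem eventually_chart_overlap (p q : M) {z : EuclideanSpace ℝ (Fin n)}
    (hz : z ∈ (extChartAt (𝓡 n) p).target)
    (hq : (extChartAt (𝓡 n) p).symm z ∈ (extChartAt (𝓡 n) q).source) :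
    ∀ᶠ w in 𝓝 z, w ∈ (extChartAt (𝓡 n) p).target ∧
      (extChartAt (𝓡 n) p).symm w ∈ (extChartAt (𝓡 n) q).source := by
  refine (eventually_of_mem ((isOpen_extChartAt_target p).mem_nhds hz) fun _ h => h).and ?_
  exact (continuousAt_extChartAt_symm'' hz).eventually
    ((isOpen_extChartAt_source q).mem_nhds hq)

theorem symm_chartTransition (p q : M) {z : EuclideanSpace ℝ (Fin n)}
    (hq : (extChartAt (𝓡 n) p).symm z ∈ (extChartAt (𝓡 n) q).source) :
    (extChartAt (𝓡 n) q).symm (chartTransition p q z) = (extChartAt (𝓡 n) p).symm z :=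
  (extChartAt (𝓡 n) q).left_inv hq

theorem chartTransition_mem_target (p q : M) {z : EuclideanSpace ℝ (Fin n)}
    (hq : (extChartAt (𝓡 n) p).symm z ∈ (extChartAt (𝓡 n) q).source) :
    chartTransition p q z ∈ (extChartAt (𝓡 n) q).target :=
  (extChartAt (𝓡 n) q).map_source hq

/-- The inner product of two tangent vectors at `x`, read on `ℝⁿ`. -/
noncomputable def tangentInner (x : M) (v w : EuclideanSpace ℝ (Fin n)) : ℝ :=
  @inner ℝ (TangentSpace (𝓡 n) x) _ v w

theorem mfderiv_symm_eq (p q : M) {z : EuclideanSpace ℝ (Fin n)}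
    (hz : z ∈ (extChartAt (𝓡 n) p).target)
    (hq : (extChartAt (𝓡 n) p).symm z ∈ (extChartAt (𝓡 n) q).source)
    (v : EuclideanSpace ℝ (Fin n)) :
    (mfderiv 𝓘(ℝ, EuclideanSpace ℝ (Fin n)) (𝓡 n) (extChartAt (𝓡 n) p).symm z v :
      EuclideanSpace ℝ (Fin n)) =
    (mfderiv 𝓘(ℝ, EuclideanSpace ℝ (Fin n)) (𝓡 n) (extChartAt (𝓡 n) q).symm
      (chartTransition p q z) (fderiv ℝ (chartTransition p q) z v) :
      EuclideanSpace ℝ (Fin n)) := by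
  have hev : (extChartAt (𝓡 n) p).symm =ᶠ[𝓝 z]
      (extChartAt (𝓡 n) q).symm ∘ chartTransition p q := by
    filter_upwards [eventually_chart_overlap p q hz hq] with w hw
    exact (symm_chartTransition p q hw.2).symm
  have hT := contDiffAt_chartTransition p q hz hq
  have h1 : MDifferentiableAt 𝓘(ℝ, EuclideanSpace ℝ (Fin n)) (𝓡 n) (extChartAt (𝓡 n) q).symm
      (chartTransition p q z) :=
    ((contMDiffOn_extChartAt_symm (n := ∞) q).contMDiffAt ((isOpen_extChartAt_target q).mem_nhds
      (chartTransition_mem_target p q hq))).mdifferentiableAt (by simp)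
  have h2 : MDifferentiableAt 𝓘(ℝ, EuclideanSpace ℝ (Fin n)) 𝓘(ℝ, EuclideanSpace ℝ (Fin n))
      (chartTransition p q) z := (hT.differentiableAt (by simp)).mdifferentiableAt
  have h3 := (h1.hasMFDerivAt.comp z h2.hasMFDerivAt).congr_of_eventuallyEq hev
  have h4 := h3.mfderiv
  rw [mfderiv_eq_fderiv] at h4
  exact congrArg (fun L : EuclideanSpace ℝ (Fin n) →L[ℝ] EuclideanSpace ℝ (Fin n) => L v) h4

theorem metricMatrix_eq_tangentInner (p : M) (z : EuclideanSpace ℝ (Fin n)) (i j : Fin n) :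
    metricMatrix p z i j = tangentInner ((extChartAt (𝓡 n) p).symm z)
      (coordVec p i z) (coordVec p j z) := rfl

theorem tangentInner_sum (x : M) (c d : Fin n → ℝ)
    (b b' : Fin n → EuclideanSpace ℝ (Fin n)) :
    tangentInner x (∑ i, c i • b i) (∑ j, d j • b' j) =
      ∑ j, ∑ i, c i * tangentInner x (b i) (b' j) * d j := by
  unfold tangentInner
  have h1 := sum_inner (𝕜 := ℝ) (E := TangentSpace (𝓡 n) x) Finset.univ
    (fun i => c i • b i) (∑ j, d j • b' j)
  refine h1.trans ?_
  rw [Finset.sum_comm]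
  refine Finset.sum_congr rfl fun i _ => ?_
  have h2 := inner_sum (𝕜 := ℝ) (E := TangentSpace (𝓡 n) x) Finset.univ
    (fun j => d j • b' j) (c i • b i)
  refine h2.trans ?_
  refine Finset.sum_congr rfl fun j _ => ?_
  have h3 := inner_smul_left (𝕜 := ℝ) (E := TangentSpace (𝓡 n) x) (b i) (d j • b' j) (c i)
  have h4 := inner_smul_right (𝕜 := ℝ) (E := TangentSpace (𝓡 n) x) (b i) (b' j) (d j)
  refine h3.trans ((congrArg (fun r : ℝ => c i * r) h4).trans ?_)
  exact mul_left_comm _ _ _ |>.trans (mul_comm _ _)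

theorem coordVec_eq_sum (p q : M) {z : EuclideanSpace ℝ (Fin n)}
    (hz : z ∈ (extChartAt (𝓡 n) p).target)
    (hq : (extChartAt (𝓡 n) p).symm z ∈ (extChartAt (𝓡 n) q).source) (i : Fin n) :
    (coordVec p i z : EuclideanSpace ℝ (Fin n)) = ∑ a, jacobian (chartTransition p q) z a i •
      (coordVec q a (chartTransition p q z) : EuclideanSpace ℝ (Fin n)) := by
  have h1 := mfderiv_symm_eq p q hz hq (EuclideanSpace.single i 1)
  refine h1.trans ?_
  have hT := (contDiffAt_chartTransition p q hz hq).differentiableAt (by simp)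
  have h2 := sum_smul_coordVec q (chartTransition p q z)
    (fun a => jacobian (chartTransition p q) z a i)
  refine Eq.trans ?_ h2.symm
  have hv : fderiv ℝ (chartTransition p q) z (EuclideanSpace.single i 1)
      = WithLp.toLp 2 (fun a => jacobian (chartTransition p q) z a i) := by
    ext a
    simp [jacobian_apply hT]
  exact congrArg (fun v : EuclideanSpace ℝ (Fin n) => (mfderiv 𝓘(ℝ, EuclideanSpace ℝ (Fin n))
    (𝓡 n) (extChartAt (𝓡 n) q).symm (chartTransition p q z) v : EuclideanSpace ℝ (Fin n))) hv

theorem metricMatrix_transition (p q : M) {z : EuclideanSpace ℝ (Fin n)}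
    (hz : z ∈ (extChartAt (𝓡 n) p).target)
    (hq : (extChartAt (𝓡 n) p).symm z ∈ (extChartAt (𝓡 n) q).source) :
    metricMatrix p z = (jacobian (chartTransition p q) z).transpose
      * metricMatrix q (chartTransition p q z) * jacobian (chartTransition p q) z := by
  ext i j
  rw [metricMatrix_eq_tangentInner, coordVec_eq_sum p q hz hq, coordVec_eq_sum p q hz hq]
  refine (tangentInner_sum _ _ _ _ _).trans ?_
  simp only [Matrix.mul_apply, Matrix.transpose_apply, Finset.sum_mul,
    metricMatrix_eq_tangentInner, symm_chartTransition p q hq]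

theorem isUnit_det_jacobian_chartTransition (p q : M) {z : EuclideanSpace ℝ (Fin n)}
    (hz : z ∈ (extChartAt (𝓡 n) p).target)
    (hq : (extChartAt (𝓡 n) p).symm z ∈ (extChartAt (𝓡 n) q).source) :
    IsUnit (jacobian (chartTransition p q) z).det := by
  have h := isUnit_det_metricMatrix p hz
  rw [metricMatrix_transition p q hz hq, Matrix.det_mul] at h
  exact isUnit_of_mul_isUnit_right h

/-- The covariant Hessian of `u` in the chart around `p`. -/
theorem covHess_chartExpr (p : M) {u : M → ℝ} {z : EuclideanSpace ℝ (Fin n)}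
    (hz : z ∈ (extChartAt (𝓡 n) p).target)
    (hu : ContMDiffAt (𝓡 n) 𝓘(ℝ, ℝ) 2 u ((extChartAt (𝓡 n) p).symm z)) :
    covHess (metricMatrix p) (chartExpr p u) z =
      (jacobian (chartTransition p ((extChartAt (𝓡 n) p).symm z)) z).transpose
        * hessComp u ((extChartAt (𝓡 n) p).symm z)
        * jacobian (chartTransition p ((extChartAt (𝓡 n) p).symm z)) z := by
  set x := (extChartAt (𝓡 n) p).symm z with hx
  have hq : x ∈ (extChartAt (𝓡 n) x).source := mem_extChartAt_source x
  have hu' : ContDiffAt ℝ 2 (chartExpr x u) (chartTransition p x z) :=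
    contDiffAt_chartExpr (by norm_cast) x
    (chartTransition_mem_target p x hq) (by rwa [symm_chartTransition p x hq])
  have hev : chartExpr p u =ᶠ[𝓝 z] fun w => chartExpr x u (chartTransition p x w) := by
    filter_upwards [eventually_chart_overlap p x hz hq] with w hw
    simp only [chartExpr]
    rw [symm_chartTransition p x hw.2]
  rw [covHess_congr hev]
  exact covHess_pullback ((contDiffAt_chartTransition p x hz hq).of_le (by norm_cast))
    (fun a b => ((contDiffOn_metricMatrix x a b).contDiffAt ((isOpen_extChartAt_target x).mem_nhds
      (chartTransition_mem_target p x hq))).differentiableAt (by simp))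
    (metricMatrix_symm x)
    (isUnit_det_metricMatrix x (chartTransition_mem_target p x hq))
    (isUnit_det_jacobian_chartTransition p x hz hq)
    (by
      filter_upwards [eventually_chart_overlap p x hz hq] with w hw
      exact metricMatrix_transition p x hw.1 hw.2) hu'

theorem metricMatrix_eq_metricAt (p : M) {z : EuclideanSpace ℝ (Fin n)}
    (hz : z ∈ (extChartAt (𝓡 n) p).target) :
    metricMatrix p z =
      (jacobian (chartTransition p ((extChartAt (𝓡 n) p).symm z)) z).transpose
        * metricAt ((extChartAt (𝓡 n) p).symm z)
        * jacobian (chartTransition p ((extChartAt (𝓡 n) p).symm z)) z :=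
  metricMatrix_transition p _ hz (mem_extChartAt_source _)

theorem partialDeriv_chartExpr (p : M) {u : M → ℝ} {z : EuclideanSpace ℝ (Fin n)}
    (hz : z ∈ (extChartAt (𝓡 n) p).target)
    (hu : ContMDiffAt (𝓡 n) 𝓘(ℝ, ℝ) 2 u ((extChartAt (𝓡 n) p).symm z)) (i : Fin n) :
    partialDeriv i (chartExpr p u) z =
      ∑ a, diffComp u ((extChartAt (𝓡 n) p).symm z) a *
        jacobian (chartTransition p ((extChartAt (𝓡 n) p).symm z)) z a i := by
  set x := (extChartAt (𝓡 n) p).symm z with hx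
  have hq : x ∈ (extChartAt (𝓡 n) x).source := mem_extChartAt_source x
  have hu' : ContDiffAt ℝ 2 (chartExpr x u) (chartTransition p x z) :=
    contDiffAt_chartExpr (by norm_cast) x
    (chartTransition_mem_target p x hq) (by rwa [symm_chartTransition p x hq])
  have hev : chartExpr p u =ᶠ[𝓝 z] fun w => chartExpr x u (chartTransition p x w) := by
    filter_upwards [eventually_chart_overlap p x hz hq] with w hw
    simp only [chartExpr]
    rw [symm_chartTransition p x hw.2]
  rw [partialDeriv_congr hev, partialDeriv_comp
    ((contDiffAt_chartTransition p x hz hq).differentiableAt (by simp))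
    (hu'.differentiableAt (by norm_num))]
  rfl

end ChartBridge

/-! ### Second order jets of curves -/

section Jets

open Asymptotics

variable {V W : Type*} [NormedAddCommGroup V] [NormedSpace ℝ V]
  [NormedAddCommGroup W] [NormedSpace ℝ W]

/-- `h t = a + t b + t² c / 2 + o(t²)` as `t → 0`: the curve `h` has value `a`, velocity `b` and
acceleration `c` at `0`, in the weak sense of a Taylor expansion. -/
def HasJet (h : ℝ → V) (a b c : V) : Prop :=
  (fun t => h t - (a + t • b + (t ^ 2 / 2) • c)) =o[𝓝 0] fun t : ℝ => t ^ 2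

variable {h h' : ℝ → V} {a b c a' b' c' : V}

theorem HasJet.of_eq (hh : HasJet h a b c) (ha : a = a') (hb : b = b') (hc : c = c') :
    HasJet h a' b' c' := by
  subst ha hb hc; exact hh

theorem HasJet.congr (hh : HasJet h a b c) (e : h' =ᶠ[𝓝 0] h) : HasJet h' a b c :=
  hh.congr' (e.mono fun t ht => by simp only [ht]) EventuallyEq.rfl

theorem HasJet.value (hh : HasJet h a b c) : h 0 = a := by
  have := (hh.def (c := 1) one_pos).self_of_nhds
  simpa [sub_eq_zero] using this

theorem hasJet_poly (a b c : V) : HasJet (fun t => a + t • b + (t ^ 2 / 2) • c) a b c := by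
  simp only [HasJet, sub_self]; exact isLittleO_zero _ _

theorem hasJet_const (a : V) : HasJet (fun _ => a) a 0 0 :=
  (hasJet_poly a 0 0).congr (Eventually.of_forall fun t => by simp)

theorem HasJet.add (hh : HasJet h a b c) (hh' : HasJet h' a' b' c') :
    HasJet (fun t => h t + h' t) (a + a') (b + b') (c + c') := by
  refine (IsLittleO.add hh hh').congr (fun t => ?_) fun _ => rfl
  simp only [smul_add]; abel

theorem HasJet.map (hh : HasJet h a b c) (L : V →L[ℝ] W) :
    HasJet (fun t => L (h t)) (L a) (L b) (L c) := by
  refine ((L.isBigO_comp _ _).trans_isLittleO hh).congr (fun t => ?_) fun _ => rfl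
  simp

theorem HasJet.neg (hh : HasJet h a b c) : HasJet (fun t => - h t) (-a) (-b) (-c) := by
  simpa using hh.map (-ContinuousLinearMap.id ℝ V)

theorem HasJet.sub (hh : HasJet h a b c) (hh' : HasJet h' a' b' c') :
    HasJet (fun t => h t - h' t) (a - a') (b - b') (c - c') := by
  simpa only [sub_eq_add_neg] using hh.add hh'.neg

theorem HasJet.sum {ι : Type*} (s : Finset ι) {H : ι → ℝ → V} {A B C : ι → V}
    (hH : ∀ i ∈ s, HasJet (H i) (A i) (B i) (C i)) :
    HasJet (fun t => ∑ i ∈ s, H i t) (∑ i ∈ s, A i) (∑ i ∈ s, B i) (∑ i ∈ s, C i) := by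
  classical
  induction s using Finset.induction_on with
  | empty => simpa using hasJet_const (0 : V)
  | insert i s hi ih =>
    simp only [Finset.sum_insert hi]
    exact (hH i (Finset.mem_insert_self _ _)).add
      (ih fun j hj => hH j (Finset.mem_insert_of_mem hj))

theorem HasJet.const_mul {h : ℝ → ℝ} {a b c : ℝ} (hh : HasJet h a b c) (r : ℝ) :
    HasJet (fun t => r * h t) (r * a) (r * b) (r * c) := by
  simpa using hh.map (r • ContinuousLinearMap.id ℝ ℝ)

theorem HasJet.isBigO_one (hh : HasJet h a b c) :
    (fun t => h t - a) =O[𝓝 0] fun t : ℝ => t := by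
  have h1 : (fun t : ℝ => t ^ 2) =O[𝓝 0] fun t : ℝ => t := by
    have : (fun t : ℝ => t ^ 2) =o[𝓝 0] fun t : ℝ => t ^ 1 :=
      isLittleO_pow_pow (by norm_num)
    simpa using this.isBigO
  have h2 : (fun t : ℝ => t • b + (t ^ 2 / 2) • c) =O[𝓝 0] fun t : ℝ => t := by
    refine IsBigO.add ?_ ?_
    · exact IsBigO.of_bound ‖b‖ (Eventually.of_forall fun t => by rw [norm_smul, mul_comm])
    · refine IsBigO.trans (IsBigO.of_bound ‖c‖ (Eventually.of_forall fun t => ?_)) h1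
      rw [norm_smul, norm_div, mul_comm]
      gcongr
      exact div_le_self (norm_nonneg _) (by norm_num)
  refine ((hh.isBigO.trans h1).add h2).congr (fun t => ?_) fun _ => rfl
  abel

theorem HasJet.isLittleO_one (hh : HasJet h a b c) :
    (fun t => h t - (a + t • b)) =o[𝓝 0] fun t : ℝ => t := by
  have h1 : (fun t : ℝ => t ^ 2) =o[𝓝 0] fun t : ℝ => t := by
    have : (fun t : ℝ => t ^ 2) =o[𝓝 0] fun t : ℝ => t ^ 1 :=
      isLittleO_pow_pow (by norm_num)
    simpa using this
  have h2 : (fun t : ℝ => (t ^ 2 / 2) • c) =o[𝓝 0] fun t : ℝ => t := by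
    refine IsBigO.trans_isLittleO (IsBigO.of_bound ‖c‖ (Eventually.of_forall fun t => ?_)) h1
    rw [norm_smul, norm_div, mul_comm]
    gcongr
    exact div_le_self (norm_nonneg _) (by norm_num)
  refine ((hh.trans h1).add h2).congr (fun t => ?_) fun _ => rfl
  abel

theorem HasJet.continuousAt (hh : HasJet h a b c) : Tendsto h (𝓝 0) (𝓝 a) := by
  have : Tendsto (fun t => h t - a) (𝓝 0) (𝓝 0) :=
    hh.isBigO_one.trans_tendsto tendsto_id
  simpa using this.add_const a

theorem HasJet.unique (hh : HasJet h a b c) (hh' : HasJet h a' b' c') :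
    a = a' ∧ b = b' ∧ c = c' := by
  have ha : a = a' := hh.value.symm.trans hh'.value
  subst ha
  have h0 := hh.sub hh'
  simp only [sub_self] at h0
  have key : ∀ v : V, ∀ k : ℕ, (fun t : ℝ => (t ^ k) • v) =o[𝓝 0] (fun t : ℝ => t ^ k) →
      v = 0 := by
    intro v k hv
    by_contra hne
    have h1 := hv.def (c := ‖v‖ / 2) (by positivity)
    obtain ⟨ε, hε, hb⟩ := Metric.eventually_nhds_iff.1 h1
    have h2 := hb (y := ε / 2)
      (by rw [Real.dist_eq, sub_zero, abs_of_pos (by positivity)]; linarith)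
    rw [norm_smul] at h2
    have h3 : 0 < ‖(ε / 2) ^ k‖ := norm_pos_iff.2 (by positivity)
    have h4 : 0 < ‖v‖ := norm_pos_iff.2 hne
    nlinarith
  have hb : b - b' = 0 := by
    apply key _ 1
    refine (h0.isLittleO_one.neg_left).congr (fun t => ?_) fun t => by simp
    simp
  have hc : c - c' = 0 := by
    have h1 : HasJet (fun _ : ℝ => (0 : V)) 0 (b - b') (c - c') := h0
    rw [hb] at h1
    apply key _ 2
    refine (h1.neg_left.const_smul_left (2 : ℝ)).congr (fun t => ?_) fun t => rfl
    simp only [Pi.smul_apply, smul_zero, zero_add, zero_sub, neg_neg, smul_smul, add_zero]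
    congr 1; ring
  exact ⟨rfl, sub_eq_zero.1 hb, sub_eq_zero.1 hc⟩

/-- The second derivative test. -/
theorem HasJet.of_nonneg {h : ℝ → ℝ} {b c : ℝ} (hh : HasJet h 0 b c) (hp : ∀ᶠ t in 𝓝 0, 0 ≤ h t) :
    b = 0 ∧ 0 ≤ c := by
  have hb : b = 0 := by
    by_contra hne
    have h1 := hh.isLittleO_one.def (c := |b| / 2) (by positivity)
    obtain ⟨ε, hε, hb⟩ := Metric.eventually_nhds_iff.1 (h1.and hp)
    have key : ∀ t : ℝ, |t| < ε → |h t - t * b| ≤ |b| / 2 * |t| ∧ 0 ≤ h t := fun t ht => by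
      have := hb (y := t) (by rwa [Real.dist_eq, sub_zero])
      simpa using this
    set s : ℝ := -(ε / 2) * SignType.sign b with hs
    rcases lt_or_gt_of_ne hne with hlt | hgt
    · obtain ⟨h2, h3⟩ := key (ε / 2) (by rw [abs_of_pos (by positivity)]; linarith)
      rw [abs_of_neg hlt, abs_of_pos (show 0 < ε / 2 by positivity)] at h2
      have := (abs_le.1 h2).2
      nlinarith
    · obtain ⟨h2, h3⟩ := key (-(ε / 2)) (by rw [abs_neg, abs_of_pos (by positivity)]; linarith)
      rw [abs_of_pos hgt, abs_neg, abs_of_pos (show 0 < ε / 2 by positivity)] at h2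
      have := (abs_le.1 h2).2
      nlinarith
  refine ⟨hb, ?_⟩
  subst hb
  by_contra hc
  push Not at hc
  have h1 := hh.def (c := -c / 4) (by linarith)
  obtain ⟨ε, hε, hb⟩ := Metric.eventually_nhds_iff.1 (h1.and hp)
  have := hb (y := ε / 2) (by rw [Real.dist_eq, sub_zero, abs_of_pos (by positivity)]; linarith)
  obtain ⟨h2, h3⟩ := this
  simp only [zero_add, Real.norm_eq_abs, smul_eq_mul, abs_pow] at h2
  rw [abs_of_pos (show 0 < ε / 2 by positivity)] at h2
  have h4 := (abs_le.1 h2).2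
  have h5 : 0 < (ε / 2) ^ 2 := by positivity
  nlinarith

/-- The second order Taylor expansion of a `C²` function. -/
theorem taylor_two_isLittleO {F : V → W} {x : V} (hF : ContDiffAt ℝ 2 F x) :
    (fun v => F (x + v) - (F x + fderiv ℝ F x v
      + (1 / 2 : ℝ) • fderiv ℝ (fderiv ℝ F) x v v)) =o[𝓝 0] fun v => ‖v‖ ^ 2 := by
  have hd : DifferentiableAt ℝ (fderiv ℝ F) x :=
    (hF.fderiv_right (m := 1) (by norm_num)).differentiableAt (by norm_num)
  have hsymm := hF.isSymmSndFDerivAt (by simp)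
  set D2 := fderiv ℝ (fderiv ℝ F) x with hD2
  have hG : ∀ᶠ v in 𝓝 (0 : V), HasFDerivAt
      (fun v => F (x + v) - (F x + fderiv ℝ F x v + (1 / 2 : ℝ) • D2 v v))
      (fderiv ℝ F (x + v) - (fderiv ℝ F x + D2 v)) v := by
    have e1 : ∀ᶠ y in 𝓝 x, DifferentiableAt ℝ F y :=
      (hF.eventually (by simp)).mono fun y hy => hy.differentiableAt (by norm_num)
    have e2 : Tendsto (fun v : V => x + v) (𝓝 0) (𝓝 x) := by
      simpa using (tendsto_id (α := V) (x := 𝓝 0)).const_add x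
    filter_upwards [e2.eventually e1] with v hv
    have h1 : HasFDerivAt (fun v => F (x + v)) (fderiv ℝ F (x + v)) v := by
      simpa [Function.comp_def] using hv.hasFDerivAt.comp v ((hasFDerivAt_id v).const_add x)
    have h2 : HasFDerivAt (fun v => D2 v v) (D2 v + D2.flip v) v := by
      have := D2.hasFDerivAt (x := v) |>.clm_apply (hasFDerivAt_id v)
      simpa using this
    have h3 := h1.sub ((((fderiv ℝ F x).hasFDerivAt (x := v)).const_add (F x)).add
      (h2.const_smul (1 / 2 : ℝ)))
    refine HasFDerivAt.congr_fderiv (f := fun v => F (x + v)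
      - (F x + fderiv ℝ F x v + (1 / 2 : ℝ) • D2 v v)) h3 ?_
    ext w
    have : D2 w v = D2 v w := hsymm w v
    have e : (1 / 2 : ℝ) • (D2 v w + D2 w v) = D2 v w := by
      rw [this, ← two_smul ℝ, smul_smul]; norm_num
    change fderiv ℝ F (x + v) w - (fderiv ℝ F x w + (1 / 2 : ℝ) • (D2 v w + D2 w v))
      = fderiv ℝ F (x + v) w - (fderiv ℝ F x w + D2 v w)
    rw [e]
  rw [isLittleO_iff]
  intro ε hε
  have h1 : (fun v => fderiv ℝ F (x + v) - (fderiv ℝ F x + D2 v)) =o[𝓝 0] fun v => v := by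
    have := (hasFDerivAt_iff_isLittleO_nhds_zero.1 hd.hasFDerivAt)
    refine this.congr (fun v => ?_) fun _ => rfl
    abel
  obtain ⟨δ, hδ, hb⟩ := Metric.eventually_nhds_iff_ball.1 ((h1.def hε).and hG)
  refine Metric.eventually_nhds_iff_ball.2 ⟨δ, hδ, fun v hv => ?_⟩
  have hvδ : ‖v‖ < δ := by simpa using hv
  have hsub : Metric.closedBall (0 : V) ‖v‖ ⊆ Metric.ball 0 δ :=
    Metric.closedBall_subset_ball hvδ
  have := (convex_closedBall (0 : V) ‖v‖).norm_image_sub_le_of_norm_hasFDerivWithin_le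
    (f := fun v => F (x + v) - (F x + fderiv ℝ F x v + (1 / 2 : ℝ) • D2 v v))
    (C := ε * ‖v‖) (x := 0) (y := v)
    (fun w hw => ((hb w (hsub hw)).2).hasFDerivWithinAt)
    (fun w hw => (hb w (hsub hw)).1.trans (by
      have : ‖w‖ ≤ ‖v‖ := by simpa using hw
      gcongr))
    (by simp) (by simp)
  simp only [add_zero, map_zero, smul_zero, sub_self,
    sub_zero] at this
  refine this.trans (le_of_eq ?_)
  rw [norm_pow, norm_norm]; ring

/-- The chain rule for second order jets. -/
theorem HasJet.comp {F : V → W} (hF : ContDiffAt ℝ 2 F a) (hh : HasJet h a b c) :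
    HasJet (fun t => F (h t)) (F a) (fderiv ℝ F a b)
      (fderiv ℝ (fderiv ℝ F) a b b + fderiv ℝ F a c) := by
  set D2 := fderiv ℝ (fderiv ℝ F) a with hD2
  have hO := hh.isBigO_one
  have ht0 : Tendsto (fun t => h t - a) (𝓝 0) (𝓝 0) := hO.trans_tendsto tendsto_id
  have h1 := (taylor_two_isLittleO hF).comp_tendsto ht0
  have h1' : (fun t => F (h t) - (F a + fderiv ℝ F a (h t - a)
      + (1 / 2 : ℝ) • D2 (h t - a) (h t - a))) =o[𝓝 0] fun t : ℝ => t ^ 2 := by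
    refine (h1.congr_left fun t => by simp [hD2]).trans_isBigO ?_
    exact hO.norm_left.pow 2
  have h2 : (fun t => fderiv ℝ F a (h t - (a + t • b + (t ^ 2 / 2) • c))) =o[𝓝 0]
      fun t : ℝ => t ^ 2 := ((fderiv ℝ F a).isBigO_comp _ _).trans_isLittleO hh
  have h3 : (fun t => D2 (h t - a) (h t - a - t • b)) =o[𝓝 0] fun t : ℝ => t ^ 2 := by
    have l1 : (fun t => h t - a - t • b) =o[𝓝 0] fun t : ℝ => t :=
      hh.isLittleO_one.congr_left fun t => by abel
    have := (hO.norm_left.mul_isLittleO l1.norm_left)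
    refine IsBigO.trans_isLittleO (IsBigO.of_bound ‖D2‖ (Eventually.of_forall fun t => ?_))
      (this.congr_right fun t => (pow_two t).symm)
    rw [norm_mul, norm_norm, norm_norm, ← mul_assoc]
    exact D2.le_opNorm₂ _ _
  have h4 : (fun t => D2 (h t - a - t • b) (t • b)) =o[𝓝 0] fun t : ℝ => t ^ 2 := by
    have l1 : (fun t => h t - a - t • b) =o[𝓝 0] fun t : ℝ => t :=
      hh.isLittleO_one.congr_left fun t => by abel
    have l2 : (fun t : ℝ => t • b) =O[𝓝 0] fun t : ℝ => t :=
      IsBigO.of_bound ‖b‖ (Eventually.of_forall fun t => by rw [norm_smul, mul_comm])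
    have := (l1.norm_left.mul_isBigO l2.norm_left)
    refine IsBigO.trans_isLittleO (IsBigO.of_bound ‖D2‖ (Eventually.of_forall fun t => ?_))
      (this.congr_right fun t => (pow_two t).symm)
    rw [norm_mul, norm_norm, norm_norm, ← mul_assoc]
    exact D2.le_opNorm₂ _ _
  have h5 := (h1'.add h2).add ((h3.add h4).const_smul_left (1 / 2 : ℝ))
  refine h5.congr_left fun t => ?_
  simp only [Pi.smul_apply, map_sub, map_add, map_smul, sub_apply, smul_apply]
  module

theorem HasJet.mul {h h' : ℝ → ℝ} {a b c a' b' c' : ℝ} (hh : HasJet h a b c)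
    (hh' : HasJet h' a' b' c') :
    HasJet (fun t => h t * h' t) (a * a') (b * a' + a * b') (c * a' + 2 * b * b' + a * c') := by
  have h1 := (hh.isBigO_one.mul hh'.isBigO_one)
  have h0 : (fun t => h t * h' t - (a * h' t + h t * a' - a * a') - t ^ 2 * (b * b')) =o[𝓝 0]
      fun t : ℝ => t ^ 2 := by
    have l1 := hh.isLittleO_one.mul_isBigO hh'.isBigO_one
    have l2 : (fun t : ℝ => t * b) =O[𝓝 0] fun t : ℝ => t :=
      IsBigO.of_bound ‖b‖ (Eventually.of_forall fun t => by rw [norm_mul, mul_comm])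
    have l3 := l2.mul_isLittleO hh'.isLittleO_one
    refine (l1.add l3).congr (fun t => ?_) fun t => by ring
    simp only [smul_eq_mul]; ring
  have h2 := ((hh'.const_mul a).add (hh.const_mul a'))
  refine (h0.add h2).congr_left fun t => ?_
  simp only [smul_eq_mul]; ring

/-- The chain rule for second order jets of real functions. -/
theorem HasJet.comp_real {F : ℝ → ℝ} {h : ℝ → ℝ} {a b c : ℝ} (hF : ContDiffAt ℝ 2 F a)
    (hh : HasJet h a b c) :
    HasJet (fun t => F (h t)) (F a) (deriv F a * b)
      (deriv (deriv F) a * b ^ 2 + deriv F a * c) := by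
  refine (hh.comp hF).of_eq rfl ?_ ?_
  · rw [fderiv_eq_smul_deriv, smul_eq_mul, mul_comm]
  · have hd : DifferentiableAt ℝ (fderiv ℝ F) a :=
      (hF.fderiv_right (m := 1) (by norm_num)).differentiableAt (by norm_num)
    have h1 : deriv (deriv F) a = fderiv ℝ (fderiv ℝ F) a 1 1 := by
      have h2 := (hd.hasFDerivAt.clm_apply (hasFDerivAt_const (1 : ℝ) a)).hasDerivAt.deriv
      have h3 : (fun y => fderiv ℝ F y 1) = deriv F := by ext y; simp
      rw [h3] at h2
      rw [h2]; simp
    have e1 : fderiv ℝ (fderiv ℝ F) a b b = b * (b * fderiv ℝ (fderiv ℝ F) a 1 1) := by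
      conv_lhs => rw [show b = b • (1 : ℝ) by simp]
      rw [map_smul, map_smul, smul_apply]
      simp
    rw [e1, ← h1, fderiv_eq_smul_deriv, smul_eq_mul]
    ring

theorem HasJet.exp {h : ℝ → ℝ} {a b c : ℝ} (hh : HasJet h a b c) :
    HasJet (fun t => Real.exp (h t)) (Real.exp a) (Real.exp a * b)
      (Real.exp a * (b ^ 2 + c)) := by
  refine (hh.comp_real Real.contDiff_exp.contDiffAt).of_eq rfl (by simp only [Real.deriv_exp]) ?_
  simp only [Real.deriv_exp]; ring

variable {n : ℕ}

/-- The second order jet of a `C²` function along a line. -/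
theorem hasJet_line {F : V → ℝ} {x : V} (hF : ContDiffAt ℝ 2 F x) (v : V) :
    HasJet (fun t => F (x + t • v)) (F x) (fderiv ℝ F x v) (fderiv ℝ (fderiv ℝ F) x v v) := by
  have h1 : HasJet (fun t : ℝ => x + t • v) x v 0 :=
    (hasJet_poly x v 0).congr (Eventually.of_forall fun t => by simp)
  exact (h1.comp hF).of_eq rfl rfl (by simp)

/-- The second order jet of a `C²` function on `ℝⁿ` along a coordinate line through the origin. -/
theorem hasJet_coord {F : EuclideanSpace ℝ (Fin n) → ℝ} (hF : ContDiffAt ℝ 2 F 0) (k : Fin n) :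
    HasJet (fun t : ℝ => F (t • EuclideanSpace.single k 1)) (F 0) (partialDeriv k F 0)
      (partialDeriv k (partialDeriv k F) 0) := by
  have h1 := hasJet_line hF (EuclideanSpace.single k (1 : ℝ))
  simp only [zero_add] at h1
  refine h1.of_eq rfl rfl ?_
  have hd : DifferentiableAt ℝ (fderiv ℝ F) 0 :=
    (hF.fderiv_right (m := 1) (by norm_num)).differentiableAt (by norm_num)
  have h2 := hd.hasFDerivAt.clm_apply (hasFDerivAt_const (EuclideanSpace.single k (1 : ℝ)) 0)
  have h3 : HasFDerivAt (partialDeriv k F) _ 0 := h2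
  change _ = fderiv ℝ (partialDeriv k F) 0 _
  rw [h3.fderiv]
  simp

end Jets

/-! ### Symmetric concave functions of the principal curvatures -/

section CurvatureFunctionLemmas

variable {n : ℕ} {Γ : Set (Fin n → ℝ)} {f : (Fin n → ℝ) → ℝ}

theorem fderiv_eq_sum_curvDeriv (κ d : Fin n → ℝ) :
    fderiv ℝ f κ d = ∑ i, curvDeriv f i κ * d i := by
  have : d = ∑ i, d i • (Pi.single i (1 : ℝ) : Fin n → ℝ) := by
    ext k; simp [Finset.sum_apply, Pi.single_apply]
  conv_lhs => rw [this]
  simp [curvDeriv, mul_comm]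

theorem IsCurvatureFunction.differentiableAt (hf : IsCurvatureFunction Γ f) {κ : Fin n → ℝ}
    (hκ : κ ∈ Γ) : DifferentiableAt ℝ f κ :=
  (hf.contDiffOn.contDiffAt (hf.isOpen.mem_nhds hκ)).differentiableAt (by norm_num)

/-- A concave function lies below its tangent planes. -/
theorem IsCurvatureFunction.le_tangent (hf : IsCurvatureFunction Γ f) (hc : ConcaveOn ℝ Γ f)
    {κ κ' : Fin n → ℝ} (hκ : κ ∈ Γ) (hκ' : κ' ∈ Γ) :
    f κ' ≤ f κ + ∑ i, curvDeriv f i κ * (κ' i - κ i) := by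
  have h1 : HasDerivAt (fun t : ℝ => f (κ + t • (κ' - κ))) (fderiv ℝ f κ (κ' - κ)) 0 := by
    have h2 : HasDerivAt (fun t : ℝ => κ + t • (κ' - κ)) (κ' - κ) 0 := by
      simpa using ((hasDerivAt_id (0 : ℝ)).smul_const (κ' - κ)).const_add κ
    have h3 : HasFDerivAt f (fderiv ℝ f κ) (κ + (0 : ℝ) • (κ' - κ)) := by
      simpa using (hf.differentiableAt hκ).hasFDerivAt
    exact h3.comp_hasDerivAt 0 h2
  have h4 := h1.tendsto_slope_zero_right
  have h5 : f κ' - f κ ≤ fderiv ℝ f κ (κ' - κ) := by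
    refine ge_of_tendsto h4 ?_
    filter_upwards [Ioo_mem_nhdsGT (zero_lt_one' ℝ)] with t ht
    have h6 := hc.2 hκ hκ' (show (0 : ℝ) ≤ 1 - t by linarith [ht.2]) ht.1.le (by ring)
    have h7 : (1 - t) • κ + t • κ' = κ + t • (κ' - κ) := by module
    rw [h7] at h6
    simp only [zero_add, zero_smul, add_zero, smul_eq_mul] at h6 ⊢
    rw [le_inv_mul_iff₀ ht.1]
    linarith
  rw [fderiv_eq_sum_curvDeriv] at h5
  simp only [Pi.sub_apply] at h5
  linarith

/-- Larger principal curvatures have smaller weights `f_i`. -/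
theorem IsCurvatureFunction.curvDeriv_anti (hf : IsCurvatureFunction Γ f)
    (hc : ConcaveOn ℝ Γ f) {κ : Fin n → ℝ} (hκ : κ ∈ Γ) {i j : Fin n} (hij : κ j ≤ κ i) :
    curvDeriv f i κ ≤ curvDeriv f j κ := by
  rcases eq_or_ne i j with rfl | hne
  · exact le_rfl
  set s := Equiv.swap i j with hs
  rcases hij.lt_or_eq with hlt | heq
  · have h1 := hf.le_tangent hc hκ (hf.perm_mem s κ hκ)
    rw [hf.symm s κ hκ] at h1
    have h2 : ∑ k, curvDeriv f k κ * ((κ ∘ s) k - κ k) =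
        (curvDeriv f j κ - curvDeriv f i κ) * (κ i - κ j) := by
      rw [Finset.sum_eq_add_of_mem i j (Finset.mem_univ _) (Finset.mem_univ _) hne]
      · simp [hs]; ring
      · intro k _ hk
        simp [hs, Equiv.swap_apply_of_ne_of_ne hk.1 hk.2]
    rw [h2] at h1
    have h3 : 0 < κ i - κ j := by linarith
    nlinarith
  · -- equal curvatures have equal weights, by symmetry
    have hκs : κ ∘ s = κ := by
      ext k
      rcases eq_or_ne k i with rfl | h1
      · simp [hs, heq]
      rcases eq_or_ne k j with rfl | h2
      · simp [hs, heq]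
      simp [hs, Equiv.swap_apply_of_ne_of_ne h1 h2]
    set P : (Fin n → ℝ) →L[ℝ] (Fin n → ℝ) :=
      ContinuousLinearMap.pi fun k => ContinuousLinearMap.proj (s k) with hP
    have hPa : ∀ d, P d = d ∘ s := fun d => rfl
    have hev : (fun d => f (P d)) =ᶠ[𝓝 κ] f := by
      filter_upwards [hf.isOpen.mem_nhds hκ] with d hd
      rw [hPa, hf.symm s d hd]
    have h1 : HasFDerivAt (fun d => f (P d)) ((fderiv ℝ f κ).comp P) κ := by
      have : HasFDerivAt f (fderiv ℝ f κ) (P κ) := by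
        rw [hPa, hκs]; exact (hf.differentiableAt hκ).hasFDerivAt
      exact this.comp κ P.hasFDerivAt
    have h2 : fderiv ℝ f κ = (fderiv ℝ f κ).comp P := by
      conv_lhs => rw [← hev.fderiv_eq, h1.fderiv]
    have h3 : P (Pi.single i 1) = Pi.single j 1 := by
      ext k
      rw [hPa]
      simp only [Function.comp, Pi.single_apply]
      congr 1
      simp only [hs, eq_iff_iff]
      rw [Equiv.swap_apply_eq_iff]
      simp
    have h4 : curvDeriv f i κ = curvDeriv f j κ := by
      unfold curvDeriv
      conv_lhs => rw [h2, ContinuousLinearMap.comp_apply, h3]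
    exact h4.le

/-- The tangent plane inequality survives averaging the argument over permutations. -/
theorem IsCurvatureFunction.le_tangent_doublyStochastic (hf : IsCurvatureFunction Γ f)
    (hc : ConcaveOn ℝ Γ f) {κ κ' : Fin n → ℝ} (hκ : κ ∈ Γ) (hκ' : κ' ∈ Γ)
    {D : Matrix (Fin n) (Fin n) ℝ} (hD : D ∈ doublyStochastic ℝ (Fin n)) :
    f κ' ≤ f κ + ∑ i, curvDeriv f i κ * ((∑ j, D i j * κ' j) - κ i) := by
  have hsub : (doublyStochastic ℝ (Fin n) : Set (Matrix (Fin n) (Fin n) ℝ)) ⊆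
      {D | f κ' ≤ f κ + ∑ i, curvDeriv f i κ * ((∑ j, D i j * κ' j) - κ i)} := by
    rw [doublyStochastic_eq_convexHull_permMatrix]
    refine convexHull_min ?_ ?_
    · rintro _ ⟨s, rfl⟩
      have := hf.le_tangent hc hκ (hf.perm_mem s κ' hκ')
      rw [hf.symm s κ' hκ'] at this
      simpa [Equiv.Perm.permMatrix, PEquiv.toMatrix_apply] using this
    · intro A hA B hB a b ha hb hab
      simp only [mem_ofPred_eq] at hA hB ⊢
      have e : ∑ i, curvDeriv f i κ * ((∑ j, (a • A + b • B) i j * κ' j) - κ i) =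
          a * ∑ i, curvDeriv f i κ * ((∑ j, A i j * κ' j) - κ i)
          + b * ∑ i, curvDeriv f i κ * ((∑ j, B i j * κ' j) - κ i) := by
        rw [Finset.mul_sum, Finset.mul_sum, ← Finset.sum_add_distrib]
        refine Finset.sum_congr rfl fun i _ => ?_
        have e1 : ∑ j, (a • A + b • B) i j * κ' j
            = a * ∑ j, A i j * κ' j + b * ∑ j, B i j * κ' j := by
          rw [Finset.mul_sum, Finset.mul_sum, ← Finset.sum_add_distrib]
          refine Finset.sum_congr rfl fun j _ => ?_
          simp; ring
        rw [e1]
        have : κ i = (a + b) * κ i := by rw [hab, one_mul]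
        linear_combination (-curvDeriv f i κ) * this
      rw [e]
      have hb' : b = 1 - a := by linarith
      subst hb'
      nlinarith
  exact hsub hD

/-- The inequality of Schur and Horn for `f`: if `κ'` are the eigenvalues of a quadratic form
whose matrix in some orthonormal frame is `A`, then `f κ'` is at most the value at the diagonal of
`A` of the tangent plane of `f` at `κ`. The orthonormal frame is `Q`, in coordinates where the form
is diagonal. -/
theorem IsCurvatureFunction.le_tangent_diag (hf : IsCurvatureFunction Γ f)
    (hc : ConcaveOn ℝ Γ f) {κ κ' : Fin n → ℝ} (hκ : κ ∈ Γ) (hκ' : κ' ∈ Γ)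
    {Q : Matrix (Fin n) (Fin n) ℝ} (hQ : Q.transpose * Q = 1) :
    f κ' ≤ f κ + ∑ i, curvDeriv f i κ *
      ((Q.transpose * Matrix.diagonal κ' * Q) i i - κ i) := by
  have hQ' : Q * Q.transpose = 1 := mul_eq_one_comm.1 hQ
  have hD : (Matrix.of fun i j => Q j i ^ 2) ∈ doublyStochastic ℝ (Fin n) := by
    rw [mem_doublyStochastic_iff_sum]
    refine ⟨fun i j => sq_nonneg _, fun i => ?_, fun j => ?_⟩
    · have := congrFun (congrFun hQ i) i
      simpa [Matrix.mul_apply, pow_two] using this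
    · have := congrFun (congrFun hQ' j) j
      simpa [Matrix.mul_apply, pow_two] using this
  have h := hf.le_tangent_doublyStochastic hc hκ hκ' hD
  refine h.trans (le_of_eq ?_)
  congr 1
  refine Finset.sum_congr rfl fun i _ => ?_
  congr 2
  rw [Matrix.mul_apply]
  refine Finset.sum_congr rfl fun j _ => ?_
  simp only [Matrix.of_apply, Matrix.mul_diagonal, Matrix.transpose_apply]
  ring

theorem IsCurvatureFunction.zero_mem_closure (hf : IsCurvatureFunction Γ f) :
    (0 : Fin n → ℝ) ∈ closure Γ := by
  have h1 : Tendsto (fun t : ℝ => (fun _ : Fin n => t)) (𝓝[>] 0) (𝓝 0) := by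
    refine tendsto_pi_nhds.2 fun i => ?_
    exact tendsto_nhdsWithin_of_tendsto_nhds tendsto_id
  refine mem_closure_of_tendsto h1 ?_
  filter_upwards [self_mem_nhdsWithin] with t ht
  exact hf.pos_mem _ fun _ => ht

/-- Concavity bounds `∑ f_i κ_i` from above. -/
theorem IsCurvatureFunction.sum_curvDeriv_mul_le (hf : IsCurvatureFunction Γ f)
    (hc : ConcaveOn ℝ Γ f) {κ : Fin n → ℝ} (hκ : κ ∈ Γ) :
    ∑ i, curvDeriv f i κ * κ i ≤ f κ - f 0 := by
  have h0 := hf.zero_mem_closure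
  have h1 : Tendsto f (𝓝[Γ] 0) (𝓝 (f 0)) := (hf.continuousOn 0 h0).mono_left
    (nhdsWithin_mono _ subset_closure)
  have h2 : Tendsto (fun κ' : Fin n → ℝ => f κ + ∑ i, curvDeriv f i κ * (κ' i - κ i)) (𝓝[Γ] 0)
      (𝓝 (f κ + ∑ i, curvDeriv f i κ * ((0 : Fin n → ℝ) i - κ i))) := by
    refine Tendsto.mono_left ?_ nhdsWithin_le_nhds
    have : Continuous (fun κ' : Fin n → ℝ => f κ + ∑ i, curvDeriv f i κ * (κ' i - κ i)) := by
      fun_prop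
    exact this.tendsto 0
  have : (𝓝[Γ] (0 : Fin n → ℝ)).NeBot := mem_closure_iff_nhdsWithin_neBot.1 h0
  have h3 := le_of_tendsto_of_tendsto h1 h2 (by
    filter_upwards [self_mem_nhdsWithin] with κ' hκ'
    exact hf.le_tangent hc hκ hκ')
  simp only [Pi.zero_apply, zero_sub, mul_neg, Finset.sum_neg_distrib] at h3
  linarith

/-- If `∑ f_i κ_i > 0`, the largest principal curvature is positive. -/
theorem pos_of_sum_curvDeriv_pos {κ w : Fin n → ℝ} (hw : ∀ i, 0 < w i)
    (hs : 0 < ∑ i, w i * κ i) {m : Fin n} (hm : ∀ i, κ i ≤ κ m) : 0 < κ m := by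
  by_contra h
  push Not at h
  have : ∑ i, w i * κ i ≤ 0 := Finset.sum_nonpos fun i _ =>
    mul_nonpos_of_nonneg_of_nonpos (hw i).le ((hm i).trans h)
  linarith

/-- If `∑ f_i κ_i > 0`, the largest principal curvature controls all of them. -/
theorem abs_le_of_sum_curvDeriv_pos {κ w : Fin n → ℝ} (hw : ∀ i, 0 < w i)
    (hanti : ∀ i j, κ j ≤ κ i → w i ≤ w j)
    (hs : 0 < ∑ i, w i * κ i) {m : Fin n} (hm : ∀ i, κ i ≤ κ m) (i : Fin n) :
    |κ i| ≤ n * κ m := by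
  have hpos := pos_of_sum_curvDeriv_pos hw hs hm
  have hn : (1 : ℝ) ≤ n := by
    have : 0 < n := Fin.pos_iff_nonempty.2 ⟨m⟩
    exact_mod_cast this
  obtain ⟨l, -, hl⟩ := Finset.exists_min_image Finset.univ κ ⟨m, Finset.mem_univ m⟩
  have hub : κ i ≤ n * κ m := (hm i).trans (by nlinarith)
  have hlb : -(n * κ m) ≤ κ l := by
    have h1 : ∑ i, w i * κ i ≤ w l * κ l + ∑ i ∈ Finset.univ.erase l, w l * κ m := by
      rw [← Finset.add_sum_erase _ _ (Finset.mem_univ l)]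
      refine add_le_add le_rfl (Finset.sum_le_sum fun j _ => ?_)
      calc w j * κ j ≤ w j * κ m := by
            have := hm j; have := hw j; gcongr
        _ ≤ w l * κ m := by
            have := hanti j l (hl j (Finset.mem_univ _)); gcongr
    rw [Finset.sum_const, Finset.card_erase_of_mem (Finset.mem_univ l), Finset.card_univ,
      Fintype.card_fin, nsmul_eq_mul] at h1
    have h2 : ((n - 1 : ℕ) : ℝ) ≤ n := by exact_mod_cast Nat.sub_le _ _
    have h3 := hw l
    have h4 : ((n - 1 : ℕ) : ℝ) * (w l * κ m) ≤ n * (w l * κ m) := by gcongr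
    have h5 : 0 < w l * (κ l + n * κ m) := by nlinarith
    have := (mul_pos_iff_of_pos_left h3).1 h5
    linarith
  exact abs_le.2 ⟨hlb.trans (hl i (Finset.mem_univ _)), hub⟩

end CurvatureFunctionLemmas

/-! ### The differentiated curvature equation -/

section NearlyOrthonormal

open Asymptotics

variable {n : ℕ}

theorem abs_inv_sqrt_sub_one_le {d : ℝ} (hd : |d| ≤ 1 / 2) :
    |(√(1 + d))⁻¹ - 1| ≤ 2 * |d| := by
  have h1 : (1 : ℝ) / 2 ≤ 1 + d := by linarith [(abs_le.1 hd).1]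
  set s := (√(1 + d))⁻¹ with hs
  have hs0 : 0 < s := inv_pos.2 (Real.sqrt_pos.2 (by linarith))
  have hs2 : s ^ 2 * (1 + d) = 1 := by
    rw [hs, inv_pow, Real.sq_sqrt (by linarith)]
    exact inv_mul_cancel₀ (by linarith)
  have hs3 : s ^ 2 ≤ 2 := by nlinarith [sq_nonneg s]
  have h2 : (s - 1) * (s + 1) = -(d * s ^ 2) := by linear_combination hs2
  have h3 : |s - 1| * (s + 1) = |d| * s ^ 2 := by
    rw [← abs_of_pos (show 0 < s + 1 by linarith), ← abs_mul, h2, abs_neg, abs_mul,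
      abs_of_nonneg (sq_nonneg s)]
  have h4 : |d| * s ^ 2 ≤ |d| * 2 := by gcongr
  nlinarith [abs_nonneg (s - 1)]

/-- A symmetric matrix close to the identity is the Gram matrix of a frame close to the standard
one: the inverse square root of `1 + D` is at a distance `O(D)` from the identity. -/
theorem exists_orthonormalizing {D : Matrix (Fin n) (Fin n) ℝ} (hD : D.transpose = D) {δ : ℝ}
    (hδ : ∀ i j, |D i j| ≤ δ) (hδn : (n : ℝ) ^ 2 * δ ≤ 1 / 2) :
    ∃ R : Matrix (Fin n) (Fin n) ℝ, R.transpose * (1 + D) * R = 1 ∧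
      ∀ i j, |(R - 1) i j| ≤ 2 * n ^ 3 * δ := by
  have hH : D.IsHermitian := by
    rw [Matrix.IsHermitian, Matrix.conjTranspose_eq_transpose_of_trivial]; exact hD
  set U : Matrix (Fin n) (Fin n) ℝ := (hH.eigenvectorUnitary : Matrix (Fin n) (Fin n) ℝ) with hU
  set d := hH.eigenvalues with hd
  have hUU : U.transpose * U = 1 := by
    have := Unitary.coe_star_mul_self hH.eigenvectorUnitary
    simpa [Matrix.star_eq_conjTranspose, Matrix.conjTranspose_eq_transpose_of_trivial] using this
  have hUU' : U * U.transpose = 1 := mul_eq_one_comm.1 hUU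
  have hsp : D = U * Matrix.diagonal d * U.transpose := by
    have := hH.spectral_theorem
    simpa [Unitary.conjStarAlgAut_apply, Matrix.star_eq_conjTranspose,
      Matrix.conjTranspose_eq_transpose_of_trivial, Function.comp_def] using this
  have hUle : ∀ i j, |U i j| ≤ 1 := by
    intro i j
    have h1 : ∑ k, U k j * U k j = 1 := by
      have := congrFun (congrFun hUU j) j
      simpa [Matrix.mul_apply] using this
    have h2 : U i j * U i j ≤ ∑ k, U k j * U k j :=
      Finset.single_le_sum (f := fun k => U k j * U k j) (fun k _ => mul_self_nonneg _)
        (Finset.mem_univ i)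
    rw [abs_le]; constructor <;> nlinarith
  have hdk : ∀ k, |d k| ≤ n ^ 2 * δ := by
    intro k
    have h1 : Matrix.diagonal d = U.transpose * D * U := by
      rw [hsp, Matrix.mul_assoc, Matrix.mul_assoc, Matrix.mul_assoc, hUU, Matrix.mul_one,
        ← Matrix.mul_assoc, hUU, Matrix.one_mul]
    have h2 : d k = ∑ j, (∑ i, U i k * D i j) * U j k := by
      have := congrFun (congrFun h1 k) k
      simpa [Matrix.mul_apply] using this
    rw [h2]
    have hδ0 : 0 ≤ δ := (abs_nonneg _).trans (hδ k k)
    calc |∑ j, (∑ i, U i k * D i j) * U j k| ≤ ∑ j : Fin n, n * δ := by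
          refine (Finset.abs_sum_le_sum_abs _ _).trans (Finset.sum_le_sum fun j _ => ?_)
          rw [abs_mul]
          have h3 : |∑ i, U i k * D i j| ≤ ∑ i : Fin n, δ := by
            refine (Finset.abs_sum_le_sum_abs _ _).trans (Finset.sum_le_sum fun i _ => ?_)
            rw [abs_mul]
            calc |U i k| * |D i j| ≤ 1 * δ := by
                  gcongr
                  · exact hUle i k
                  · exact hδ i j
              _ = δ := one_mul _
          simp only [Finset.sum_const, Finset.card_univ, Fintype.card_fin, nsmul_eq_mul] at h3
          calc |∑ i, U i k * D i j| * |U j k| ≤ (n * δ) * 1 := by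
                gcongr
                exact hUle j k
            _ = n * δ := mul_one _
      _ = n ^ 2 * δ := by simp; ring
  set r : Fin n → ℝ := fun k => (√(1 + d k))⁻¹ with hr
  have hdpos : ∀ k, 0 < 1 + d k := fun k => by
    have := (abs_le.1 ((hdk k).trans hδn)).1
    linarith
  refine ⟨U * Matrix.diagonal r * U.transpose, ?_, ?_⟩
  · have h1 : (1 : Matrix (Fin n) (Fin n) ℝ) + D
        = U * Matrix.diagonal (fun k => 1 + d k) * U.transpose := by
      rw [← Matrix.diagonal_add, Matrix.mul_add, Matrix.add_mul, ← hsp, Matrix.diagonal_one,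
        Matrix.mul_one, hUU']
    rw [h1]
    have h2 : (U * Matrix.diagonal r * U.transpose).transpose
        * (U * Matrix.diagonal (fun k => 1 + d k) * U.transpose)
        * (U * Matrix.diagonal r * U.transpose)
        = U * (Matrix.diagonal r * (U.transpose * U) * Matrix.diagonal (fun k => 1 + d k)
          * (U.transpose * U) * Matrix.diagonal r) * U.transpose := by
      simp only [Matrix.transpose_mul, Matrix.transpose_transpose, Matrix.diagonal_transpose,
        Matrix.mul_assoc]
    rw [h2, hUU, Matrix.mul_one, Matrix.mul_one, Matrix.diagonal_mul_diagonal,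
      Matrix.diagonal_mul_diagonal]
    have h3 : (fun i => r i * (1 + d i) * r i) = fun _ => 1 := by
      ext k
      have h4 : 0 < √(1 + d k) := Real.sqrt_pos.2 (hdpos k)
      have h5 : √(1 + d k) * √(1 + d k) = 1 + d k := Real.mul_self_sqrt (hdpos k).le
      simp only [hr]
      rw [← h5]
      field_simp
      simp
    rw [h3, Matrix.diagonal_one, Matrix.mul_one, hUU']
  · intro i j
    have h1 : U * Matrix.diagonal r * U.transpose - 1
        = U * Matrix.diagonal (fun k => r k - 1) * U.transpose := by
      rw [← Matrix.diagonal_sub, Matrix.mul_sub, Matrix.sub_mul, Matrix.diagonal_one,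
        Matrix.mul_one, hUU']
    rw [h1, Matrix.mul_apply]
    calc |∑ k, (U * Matrix.diagonal (fun k => r k - 1)) i k * U.transpose k j|
        ≤ ∑ k : Fin n, 2 * (n ^ 2 * δ) := by
          refine (Finset.abs_sum_le_sum_abs _ _).trans (Finset.sum_le_sum fun k _ => ?_)
          rw [Matrix.mul_diagonal, Matrix.transpose_apply, abs_mul, abs_mul]
          have h2 : |r k - 1| ≤ 2 * (n ^ 2 * δ) :=
            (abs_inv_sqrt_sub_one_le ((hdk k).trans hδn)).trans (by linarith [hdk k])
          calc |U i k| * |r k - 1| * |U j k| ≤ 1 * (2 * (n ^ 2 * δ)) * 1 := by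
                have := hUle i k
                have := hUle j k
                have : 0 ≤ 2 * (n ^ 2 * δ) := (abs_nonneg _).trans h2
                gcongr
            _ = _ := by ring
      _ = 2 * n ^ 3 * δ := by simp; ring

variable {Γ : Set (Fin n → ℝ)} {f : (Fin n → ℝ) → ℝ}

theorem exists_orthonormalizing_jet {G : ℝ → Matrix (Fin n) (Fin n) ℝ}
    (hGs : ∀ᶠ t in 𝓝 0, (G t).transpose = G t)
    (hG : ∀ i j, HasJet (fun t => G t i j) (if i = j then 1 else 0) 0 0) :
    ∃ R : ℝ → Matrix (Fin n) (Fin n) ℝ, (∀ᶠ t in 𝓝 0, (R t).transpose * G t * R t = 1) ∧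
      ∀ i j, HasJet (fun t => R t i j) (if i = j then 1 else 0) 0 0 := by
  set D : ℝ → Matrix (Fin n) (Fin n) ℝ := fun t => G t - 1 with hDdef
  have hDo : ∀ i j, (fun t => D t i j) =o[𝓝 0] fun t : ℝ => t ^ 2 := by
    intro i j
    refine (hG i j).congr_left fun t => ?_
    simp [hDdef, Matrix.one_apply]
  set δ : ℝ → ℝ := fun t => ∑ i, ∑ j, |D t i j| with hδdef
  have hδo : δ =o[𝓝 0] fun t : ℝ => t ^ 2 :=
    IsLittleO.fun_sum fun i _ => IsLittleO.fun_sum fun j _ => (hDo i j).abs_left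
  have hδ0 : Tendsto δ (𝓝 0) (𝓝 0) := by
    refine hδo.trans_tendsto ?_
    have : Continuous fun t : ℝ => t ^ 2 := by fun_prop
    simpa using this.tendsto 0
  have hδle : ∀ t i j, |D t i j| ≤ δ t := fun t i j =>
    (Finset.single_le_sum (f := fun j => |D t i j|) (fun _ _ => abs_nonneg _)
      (Finset.mem_univ j)).trans
    (Finset.single_le_sum (f := fun i => ∑ j, |D t i j|)
      (fun _ _ => Finset.sum_nonneg fun _ _ => abs_nonneg _) (Finset.mem_univ i))
  have hsmall : ∀ᶠ t in 𝓝 0, (n : ℝ) ^ 2 * δ t ≤ 1 / 2 := by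
    have := hδ0.const_mul ((n : ℝ) ^ 2)
    rw [mul_zero] at this
    exact this.eventually (Iic_mem_nhds (by norm_num))
  have hex : ∀ᶠ t in 𝓝 0, ∃ R : Matrix (Fin n) (Fin n) ℝ, R.transpose * G t * R = 1 ∧
      ∀ i j, |(R - 1) i j| ≤ 2 * n ^ 3 * δ t := by
    filter_upwards [hsmall, hGs] with t ht hst
    have h1 : (D t).transpose = D t := by simp [hDdef, hst]
    obtain ⟨R, hR1, hR2⟩ := exists_orthonormalizing h1 (hδle t) ht
    refine ⟨R, ?_, hR2⟩
    simpa [hDdef] using hR1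
  classical
  refine ⟨fun t => if h : ∃ R : Matrix (Fin n) (Fin n) ℝ, R.transpose * G t * R = 1 ∧
      ∀ i j, |(R - 1) i j| ≤ 2 * n ^ 3 * δ t then h.choose else 1, ?_, ?_⟩
  · filter_upwards [hex] with t ht
    simp only [dif_pos ht]
    exact ht.choose_spec.1
  · intro i j
    have h1 : (fun t => 2 * n ^ 3 * δ t) =o[𝓝 0] fun t : ℝ => t ^ 2 := hδo.const_mul_left _
    refine IsBigO.trans_isLittleO (IsBigO.of_bound 1 ?_) h1
    filter_upwards [hex] with t ht
    simp only [dif_pos ht]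
    have h2 := (ht.choose_spec.2 i j).trans (le_abs_self _)
    rw [Matrix.sub_apply, Matrix.one_apply] at h2
    simp only [smul_zero, add_zero, one_mul, Real.norm_eq_abs]
    exact h2

theorem hasJet_congr_frame {B R : ℝ → Matrix (Fin n) (Fin n) ℝ}
    {B0 B1 B2 : Matrix (Fin n) (Fin n) ℝ}
    (hB : ∀ i j, HasJet (fun t => B t i j) (B0 i j) (B1 i j) (B2 i j))
    (hR : ∀ i j, HasJet (fun t => R t i j) (if i = j then 1 else 0) 0 0) (i : Fin n) :
    HasJet (fun t => ((R t).transpose * B t * R t) i i) (B0 i i) (B1 i i) (B2 i i) := by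
  have h1 : HasJet (fun t => ∑ k, (∑ j, R t j i * B t j k) * R t k i) _ _ _ :=
    HasJet.sum Finset.univ fun k _ =>
      (HasJet.sum Finset.univ fun j _ => (hR j i).mul (hB j k)).mul (hR k i)
  refine (h1.of_eq ?_ ?_ ?_).congr (Eventually.of_forall fun t => ?_)
  · simp
  · simp
  · simp
  · simp [Matrix.mul_apply]

/-- The equation `f(κ) = ψ` along a curve, differentiated twice in a moving frame `E`. No
regularity of the eigenvalues is needed: by the inequality of Schur and Horn the function
`∑ f_i A_ii - ψ`, with `A` the matrix of the second fundamental form in the frame, has a local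
minimum at `0`. The frame has to be orthonormal only up to an error `o(t²)`. -/
theorem IsCurvatureFunction.differentiated_equation (hf : IsCurvatureFunction Γ f)
    (hc : ConcaveOn ℝ Γ f) {κ : Fin n → ℝ} (hκ : κ ∈ Γ)
    {g H E : ℝ → Matrix (Fin n) (Fin n) ℝ} {W ψ : ℝ → ℝ}
    (hP : ∀ᶠ t in 𝓝 0, ∃ (P : Matrix (Fin n) (Fin n) ℝ) (κ' : Fin n → ℝ),
      P.transpose * g t * P = 1 ∧ P.transpose * ((W t)⁻¹ • H t) * P = Matrix.diagonal κ' ∧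
      κ' ∈ Γ ∧ f κ' = ψ t)
    (hgs : ∀ᶠ t in 𝓝 0, (g t).transpose = g t)
    (hG : ∀ i j, HasJet (fun t => ((E t).transpose * g t * E t) i j) (if i = j then 1 else 0) 0 0)
    {B1 B2 : Matrix (Fin n) (Fin n) ℝ} {W0 W1 W2 ψ1 ψ2 : ℝ}
    (hB : ∀ i j, HasJet (fun t => ((E t).transpose * H t * E t) i j)
      ((W0 • Matrix.diagonal κ) i j) (B1 i j) (B2 i j))
    (hW0 : 0 < W0) (hW : HasJet W W0 W1 W2) (hψ : HasJet ψ (f κ) ψ1 ψ2) :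
    ∑ i, curvDeriv f i κ * B1 i i = (∑ i, curvDeriv f i κ * κ i) * W1 + W0 * ψ1 ∧
    (∑ i, curvDeriv f i κ * κ i) * W2 + 2 * W1 * ψ1 + W0 * ψ2
      ≤ ∑ i, curvDeriv f i κ * B2 i i := by
  obtain ⟨R, hR1, hR2⟩ := exists_orthonormalizing_jet
    (G := fun t => (E t).transpose * g t * E t) (by
      filter_upwards [hgs] with t ht
      simp [Matrix.transpose_mul, ht, Matrix.mul_assoc]) hG
  set w : Fin n → ℝ := fun i => curvDeriv f i κ with hw
  have hBR := fun i => hasJet_congr_frame (B := fun t => (E t).transpose * H t * E t) hB hR2 i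
  have hjet : HasJet (fun t => ∑ i, w i * (((R t).transpose * ((E t).transpose * H t * E t)
      * R t) i i - κ i * W t) - W t * (ψ t - f κ)) 0
      (∑ i, w i * (B1 i i - κ i * W1) - W0 * ψ1)
      (∑ i, w i * (B2 i i - κ i * W2) - (2 * W1 * ψ1 + W0 * ψ2)) := by
    refine ((HasJet.sum Finset.univ fun i _ =>
      ((hBR i).sub (hW.const_mul (κ i))).const_mul (w i)).sub
        (hW.mul (hψ.sub (hasJet_const (f κ))))).of_eq ?_ ?_ ?_
    · simp [mul_comm]
    · simp
    · simp
  have hWpos : ∀ᶠ t in 𝓝 0, 0 < W t := hW.continuousAt.eventually (lt_mem_nhds hW0)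
  have hnn := hjet.of_nonneg (by
    filter_upwards [hP, hR1, hWpos] with t ⟨P, κ', hP1, hP2, hκ', hfκ'⟩ hRt hWt
    have hPu : IsUnit P.det := by
      have := congrArg Matrix.det hP1
      rw [Matrix.det_mul, Matrix.det_one] at this
      exact IsUnit.of_mul_eq_one_right _ this
    have hPTu : IsUnit P.transpose.det := by rwa [Matrix.det_transpose]
    set F := E t * R t with hF
    have hg : g t = (P⁻¹).transpose * P⁻¹ := by
      have : P.transpose⁻¹ * (P.transpose * g t * P) * P⁻¹ = P.transpose⁻¹ * 1 * P⁻¹ := by rw [hP1]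
      rw [Matrix.mul_assoc P.transpose, Matrix.nonsing_inv_mul_cancel_left _ _ hPTu,
        Matrix.mul_nonsing_inv_cancel_right _ _ hPu, Matrix.mul_one] at this
      rw [this, Matrix.transpose_nonsing_inv]
    have hH : (W t)⁻¹ • H t = (P⁻¹).transpose * Matrix.diagonal κ' * P⁻¹ := by
      have : P.transpose⁻¹ * (P.transpose * ((W t)⁻¹ • H t) * P) * P⁻¹
          = P.transpose⁻¹ * Matrix.diagonal κ' * P⁻¹ := by rw [hP2]
      rw [Matrix.mul_assoc P.transpose, Matrix.nonsing_inv_mul_cancel_left _ _ hPTu,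
        Matrix.mul_nonsing_inv_cancel_right _ _ hPu] at this
      rw [this, Matrix.transpose_nonsing_inv]
    have hQ : (P⁻¹ * F).transpose * (P⁻¹ * F) = 1 := by
      rw [← hRt, hg]
      simp only [hF, Matrix.transpose_mul, Matrix.mul_assoc]
    have key := hf.le_tangent_diag hc hκ hκ' hQ
    have hdiag : (P⁻¹ * F).transpose * Matrix.diagonal κ' * (P⁻¹ * F)
        = (W t)⁻¹ • ((R t).transpose * ((E t).transpose * H t * E t) * R t) := by
      have : (P⁻¹ * F).transpose * Matrix.diagonal κ' * (P⁻¹ * F)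
          = F.transpose * ((P⁻¹).transpose * Matrix.diagonal κ' * P⁻¹) * F := by
        simp only [Matrix.transpose_mul, Matrix.mul_assoc]
      rw [this, ← hH]
      simp only [hF, Matrix.transpose_mul, Matrix.mul_assoc, Matrix.mul_smul, Matrix.smul_mul]
    rw [hdiag, hfκ'] at key
    have h2 : ∑ i, w i * (((R t).transpose * ((E t).transpose * H t * E t) * R t) i i
        - κ i * W t) = W t * ∑ i, curvDeriv f i κ * (((W t)⁻¹ • ((R t).transpose
          * ((E t).transpose * H t * E t) * R t)) i i - κ i) := by
      rw [Finset.mul_sum]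
      refine Finset.sum_congr rfl fun i _ => ?_
      rw [Matrix.smul_apply, smul_eq_mul]
      simp only [hw]
      field_simp
    rw [h2, ← mul_sub]
    refine mul_nonneg hWt.le ?_
    linarith)
  have e : ∀ (B : Matrix (Fin n) (Fin n) ℝ) (r : ℝ), ∑ i, w i * (B i i - κ i * r)
      = ∑ i, w i * B i i - (∑ i, w i * κ i) * r := by
    intro B r
    rw [Finset.sum_mul, ← Finset.sum_sub_distrib]
    exact Finset.sum_congr rfl fun i _ => by ring
  rw [e, e] at hnn
  exact ⟨by linarith [hnn.1], by linarith [hnn.2]⟩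

end NearlyOrthonormal

/-! ### The inequality at an interior maximum -/

section MaximumInequality

variable {n : ℕ}

/-- The combination of the second order conditions at a maximum of the test function (`hI`,
`hIm`, with first order condition `hc`) and of the twice differentiated equation (`hII2`, with
first order part `hII1`). All third derivatives of `u` cancel, except for those in the quadratic
terms. Here `m` is the direction of the largest principal curvature, `u3 i j k` and `H3 i j k` are
the derivatives of the second partial derivatives and of the covariant Hessian, which differ by
`γ`, `X` and `Z` are the second derivatives `H_mm,kk` and `H_kk,mm`, `Sd` and `Sm` the second
derivatives `S_mm,kk` and `S_kk,mm` of the metric, `ρ` those of its inverse on `p`. -/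
theorem maximum_inequality_of_jets {m : Fin n} {κ w p c χ1 χ2 ρ X Z Sd Sm ψ1 W1 W2 : Fin n → ℝ}
    {u3 H3 γ : Fin n → Fin n → Fin n → ℝ} {W ℓ β ψ2 Am Q : ℝ}
    (hW : W ≠ 0) (hw : ∀ i, 0 < w i)
    (hsym1 : ∀ i j k, u3 i j k = u3 j i k) (hsym2 : ∀ i j k, u3 i j k = u3 i k j)
    (hγ : ∀ i j k, u3 i j k = H3 i j k + γ i j k)
    (hW1 : ∀ k, W1 k = W ^ 2 * κ k * p k)
    (hW2 : ∀ k, W2 k = W * (∑ l, p l * u3 l k k) + W * κ k ^ 2 + ρ k / (2 * W))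
    (hcdef : ∀ k, c k = - ℓ * W1 k - β * χ1 k)
    (hc : ∀ k, H3 m m k = W * κ m * c k + if k = m then 2 * W ^ 2 * κ m ^ 2 * p m else 0)
    (hI : ∀ k, k ≠ m → X k - W * κ m * (Sd k + 2 * p m * u3 m k k)
      ≤ W * κ m * (c k ^ 2 - ℓ ^ 2 * W1 k ^ 2 - ℓ * W2 k - β * χ2 k))
    (hIm : Am ≤ W * κ m * (c m ^ 2 - ℓ ^ 2 * W1 m ^ 2 - ℓ * W2 m - β * χ2 m))
    (hII1 : ∀ l, ∑ i, w i * H3 i i l = W * ψ1 l + 2 * W ^ 2 * w l * κ l ^ 2 * p l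
      + W ^ 2 * κ l * p l * ∑ i, w i * κ i)
    (hII2 : W * (ψ2 + 2 * W * κ m * p m * ψ1 m + (∑ i, w i * κ i) *
        ((∑ l, p l * u3 l m m) + κ m ^ 2 + ρ m / (2 * W ^ 2)))
      ≤ w m * Am + (∑ k ∈ Finset.univ.erase m, w k * (Z k - W * κ k * (Sm k + 2 * p k * u3 k m m)))
        + Q) :
    W * κ m * ((∑ i, w i * κ i) * κ m) + W * ψ2 + W * κ m * (ℓ * W ^ 2 * ∑ l, p l * ψ1 l)
      - W * κ m * (β * (∑ i, w i * κ i) * W * ∑ l, p l * χ1 l)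
      - 2 * W ^ 2 * κ m * β * (∑ k, w k * (κ k * p k * χ1 k)) - Q
      + W * κ m * (ℓ * W * ∑ k, w k * κ k ^ 2)
      + (W * (∑ i, w i * κ i) * (∑ l, p l * γ m m l) + (∑ i, w i * κ i) * ρ m / (2 * W)
        + (∑ k ∈ Finset.univ.erase m, w k * (X k - Z k + W * κ k * Sm k - W * κ m * Sd k
          + 2 * W * κ k * p k * γ m m k - 2 * W * κ m * p m * γ k k m))
        + W * κ m * (ℓ * (W * (∑ l, p l * ∑ k, w k * γ k k l) + (∑ k, w k * ρ k) / (2 * W))))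
    ≤ W * κ m * ∑ k, w k * (c k ^ 2 - ℓ ^ 2 * W1 k ^ 2 - β * χ2 k) := by
  set s1 := ∑ i, w i * κ i with hs1
  have hu : ∀ k, u3 k m m = W * κ m * c k + (if k = m then 2 * W ^ 2 * κ m ^ 2 * p m else 0)
      + γ m m k := by
    intro k
    rw [hsym1, hsym2, hγ, hc]
  have hu' : ∀ l k, u3 l k k = H3 k k l + γ k k l := by
    intro l k
    rw [hsym1, hsym2, hγ]
  have hT1 : ∑ l, p l * u3 l m m = W * κ m * (∑ l, p l * c l) + 2 * W ^ 2 * κ m ^ 2 * p m ^ 2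
      + ∑ l, p l * γ m m l := by
    have e : (2 : ℝ) * W ^ 2 * κ m ^ 2 * p m ^ 2
        = ∑ l, p l * (if l = m then 2 * W ^ 2 * κ m ^ 2 * p m else 0) := by
      simp; ring
    rw [e, Finset.mul_sum, ← Finset.sum_add_distrib, ← Finset.sum_add_distrib]
    refine Finset.sum_congr rfl fun l _ => ?_
    rw [hu]; ring
  have hS : ∀ l, ∑ k, w k * u3 l k k = W * ψ1 l + 2 * W ^ 2 * w l * κ l ^ 2 * p l
      + W ^ 2 * κ l * p l * s1 + ∑ k, w k * γ k k l := by
    intro l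
    rw [← hII1, ← Finset.sum_add_distrib]
    refine Finset.sum_congr rfl fun k _ => ?_
    rw [hu']; ring
  have hT3 : ∑ k ∈ Finset.univ.erase m, w k * u3 m k k = W * ψ1 m + W ^ 2 * κ m * p m * s1
      - w m * (W * κ m * c m) + ∑ k ∈ Finset.univ.erase m, w k * γ k k m := by
    have h1 := hS m
    rw [← Finset.add_sum_erase _ _ (Finset.mem_univ m),
      ← Finset.add_sum_erase _ (fun k => w k * γ k k m) (Finset.mem_univ m), hu m, if_pos rfl] at h1
    linear_combination h1
  have hT2 : ∑ k ∈ Finset.univ.erase m, w k * (κ k * p k * u3 k m m)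
      = W * κ m * (∑ k, w k * (κ k * p k * c k)) - W * κ m * (w m * (κ m * p m * c m))
        + ∑ k ∈ Finset.univ.erase m, w k * (κ k * p k * γ m m k) := by
    rw [← Finset.add_sum_erase _ (fun k => w k * (κ k * p k * c k)) (Finset.mem_univ m),
      mul_add, add_sub_cancel_left, Finset.mul_sum, ← Finset.sum_add_distrib]
    refine Finset.sum_congr rfl fun k hk => ?_
    rw [hu, if_neg (Finset.ne_of_mem_erase hk)]; ring
  have hW2s : ∑ k, w k * W2 k = W * (W * (∑ l, p l * ψ1 l)
      + 2 * W ^ 2 * (∑ l, w l * (κ l ^ 2 * p l ^ 2)) + W ^ 2 * s1 * (∑ l, κ l * p l ^ 2)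
      + ∑ l, p l * ∑ k, w k * γ k k l) + W * (∑ k, w k * κ k ^ 2) + (∑ k, w k * ρ k) / (2 * W) := by
    have h1 : ∑ k, w k * W2 k = W * (∑ l, p l * ∑ k, w k * u3 l k k)
        + W * (∑ k, w k * κ k ^ 2) + (∑ k, w k * ρ k) / (2 * W) := by
      have h2 : ∑ l, p l * ∑ k, w k * u3 l k k = ∑ k, w k * ∑ l, p l * u3 l k k := by
        simp only [Finset.mul_sum]
        rw [Finset.sum_comm]
        exact Finset.sum_congr rfl fun k _ => Finset.sum_congr rfl fun l _ => by ring
      rw [h2, Finset.sum_div, Finset.mul_sum, Finset.mul_sum, ← Finset.sum_add_distrib,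
        ← Finset.sum_add_distrib]
      refine Finset.sum_congr rfl fun k _ => ?_
      rw [hW2]; ring
    rw [h1]
    congr 3
    rw [Finset.mul_sum, Finset.mul_sum, Finset.mul_sum, ← Finset.sum_add_distrib,
      ← Finset.sum_add_distrib, ← Finset.sum_add_distrib]
    refine Finset.sum_congr rfl fun l _ => ?_
    rw [hS]; ring
  have ha1 : ∑ l, p l * c l = -ℓ * W ^ 2 * (∑ l, κ l * p l ^ 2) - β * ∑ l, p l * χ1 l := by
    rw [Finset.mul_sum, Finset.mul_sum, ← Finset.sum_sub_distrib]
    refine Finset.sum_congr rfl fun l _ => ?_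
    rw [hcdef, hW1]; ring
  have hb1 : ∑ k, w k * (κ k * p k * c k) = -ℓ * W ^ 2 * (∑ l, w l * (κ l ^ 2 * p l ^ 2))
      - β * ∑ k, w k * (κ k * p k * χ1 k) := by
    rw [Finset.mul_sum, Finset.mul_sum, ← Finset.sum_sub_distrib]
    refine Finset.sum_congr rfl fun l _ => ?_
    rw [hcdef, hW1]; ring
  have hA : w m * Am + ∑ k ∈ Finset.univ.erase m,
      w k * (X k - W * κ m * (Sd k + 2 * p m * u3 m k k))
      ≤ W * κ m * ((∑ k, w k * (c k ^ 2 - ℓ ^ 2 * W1 k ^ 2 - β * χ2 k)) - ℓ * ∑ k, w k * W2 k) := by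
    have h1 : W * κ m * ((∑ k, w k * (c k ^ 2 - ℓ ^ 2 * W1 k ^ 2 - β * χ2 k))
        - ℓ * ∑ k, w k * W2 k)
        = ∑ k, w k * (W * κ m * (c k ^ 2 - ℓ ^ 2 * W1 k ^ 2 - ℓ * W2 k - β * χ2 k)) := by
      rw [Finset.mul_sum Finset.univ (fun k => w k * W2 k), ← Finset.sum_sub_distrib,
        Finset.mul_sum]
      exact Finset.sum_congr rfl fun k _ => by ring
    rw [h1, ← Finset.add_sum_erase _ _ (Finset.mem_univ m)]
    refine add_le_add (mul_le_mul_of_nonneg_left hIm (hw m).le) ?_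
    exact Finset.sum_le_sum fun k hk =>
      mul_le_mul_of_nonneg_left (hI k (Finset.ne_of_mem_erase hk)) (hw k).le
  have hsplit : (∑ k ∈ Finset.univ.erase m, w k * (X k - W * κ m * (Sd k + 2 * p m * u3 m k k)))
      - (∑ k ∈ Finset.univ.erase m, w k * (Z k - W * κ k * (Sm k + 2 * p k * u3 k m m)))
      = (∑ k ∈ Finset.univ.erase m, w k * (X k - Z k + W * κ k * Sm k - W * κ m * Sd k
          + 2 * W * κ k * p k * γ m m k - 2 * W * κ m * p m * γ k k m))
        + 2 * W * (∑ k ∈ Finset.univ.erase m, w k * (κ k * p k * u3 k m m))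
        - 2 * W * (∑ k ∈ Finset.univ.erase m, w k * (κ k * p k * γ m m k))
        - 2 * W * κ m * p m * (∑ k ∈ Finset.univ.erase m, w k * u3 m k k)
        + 2 * W * κ m * p m * ∑ k ∈ Finset.univ.erase m, w k * γ k k m := by
    simp only [Finset.mul_sum, ← Finset.sum_add_distrib, ← Finset.sum_sub_distrib]
    exact Finset.sum_congr rfl fun k _ => by ring
  rw [hT2, hT3, hb1] at hsplit
  rw [hT1, ha1] at hII2
  rw [hW2s] at hA
  have hdiv : W * (s1 * (ρ m / (2 * W ^ 2))) = s1 * ρ m / (2 * W) := by field_simp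
  have h0 := hcdef m
  rw [hW1] at h0
  linear_combination hA + hII2 - hsplit - hdiv

/-- The quadratic terms in the third derivatives, for one direction `k`. If the weight `wk` is much
larger than the weight `wm` of the largest curvature `K`, they are absorbed by the concavity term
gained from rotating the frame; otherwise they are compared with `wm`. -/
theorem weighted_quadratic_le {wk wm κk K W μ b y B C ℓ₀ : ℝ} (hwk : 0 < wk) (hwm : 0 < wm)
    (hK : 0 < K) (hW : 0 < W) (hκ : -(K / 4) ≤ κk)
    (hr : 2 * μ * b + b ^ 2 ≤ ℓ₀ / 2 * κk ^ 2 + B) (hB : 0 ≤ B) (hℓ : 0 ≤ ℓ₀)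
    (hy : |y / (W * K) - -(μ + b)| ≤ 2 * C) :
    wk * (2 * μ * b + b ^ 2)
      - (wk - wm) * (4 * y * (if 4 * wm < wk then 4 / 5 * (y / (W * K)) else 0)
        - 2 * W * (K - κk) * (if 4 * wm < wk then 4 / 5 * (y / (W * K)) else 0) ^ 2) / (W * K)
      ≤ 24 * C ^ 2 * wk + ℓ₀ / 2 * (wk * κk ^ 2) + 4 * wm * B := by
  split_ifs with h
  · set z := y / (W * K) with hz
    have hyz : y = z * (W * K) := by rw [hz]; field_simp
    have e : (wk - wm) * (4 * y * (4 / 5 * z) - 2 * W * (K - κk) * (4 / 5 * z) ^ 2) / (W * K)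
        = (wk - wm) * (z ^ 2 * (16 / 5 - 32 / 25 * ((K - κk) / K))) := by
      rw [hyz]; field_simp; ring
    rw [e]
    have h1 : (K - κk) / K ≤ 5 / 4 := by
      rw [div_le_iff₀ hK]; linarith
    have h2 : z ^ 2 * (8 / 5) ≤ z ^ 2 * (16 / 5 - 32 / 25 * ((K - κk) / K)) := by
      apply mul_le_mul_of_nonneg_left _ (sq_nonneg z)
      linarith
    have h3 : wk * (6 / 5 * z ^ 2) ≤ (wk - wm) * (z ^ 2 * (16 / 5 - 32 / 25 * ((K - κk) / K))) := by
      have h4 : 3 / 4 * wk ≤ wk - wm := by linarith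
      calc wk * (6 / 5 * z ^ 2) = (3 / 4 * wk) * (z ^ 2 * (8 / 5)) := by ring
        _ ≤ _ := mul_le_mul h4 h2 (by positivity) (by linarith)
    set ε := z - -(μ + b) with hε
    have hε2 : ε ^ 2 ≤ 4 * C ^ 2 := by
      have := sq_le_sq' (by linarith [(abs_le.1 hy).1]) (abs_le.1 hy).2
      nlinarith
    have hzz : z = -(μ + b) + ε := by rw [hε]; ring
    have h5 : 2 * μ * b + b ^ 2 - 6 / 5 * z ^ 2 ≤ 24 * C ^ 2 := by
      rw [hzz]
      nlinarith [sq_nonneg ((μ + b) - 6 * ε), sq_nonneg μ]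
    have h6 : 0 ≤ ℓ₀ / 2 * (wk * κk ^ 2) + 4 * wm * B := by positivity
    have h7 := mul_le_mul_of_nonneg_left h5 hwk.le
    nlinarith
  · push Not at h
    simp only [mul_zero, zero_pow (two_ne_zero), sub_self, zero_div, sub_zero]
    have h1 := mul_le_mul_of_nonneg_left hr hwk.le
    have h2 : wk * B ≤ 4 * wm * B := mul_le_mul_of_nonneg_right h hB
    have h3 : 0 ≤ 24 * C ^ 2 * wk := by positivity
    nlinarith

theorem quadratic_absorb {μ χ κ β C ℓ₀ D : ℝ} (hℓ : 0 < ℓ₀) (hβ : 0 ≤ β)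
    (hμ : |μ| ≤ D * |κ|) (hχ : |χ| ≤ C) (hD : 0 ≤ D) :
    2 * μ * (β * χ) + (β * χ) ^ 2
      ≤ ℓ₀ / 2 * κ ^ 2 + (2 * D ^ 2 / ℓ₀ + 1) * C ^ 2 * β ^ 2 := by
  have hC : 0 ≤ C := (abs_nonneg _).trans hχ
  have h1 : 2 * μ * (β * χ) ≤ 2 * (D * |κ|) * (β * C) := by
    have : μ * χ ≤ (D * |κ|) * C := by
      calc μ * χ ≤ |μ * χ| := le_abs_self _
        _ = |μ| * |χ| := abs_mul _ _
        _ ≤ _ := by gcongr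
    nlinarith
  have h2 : (β * χ) ^ 2 ≤ C ^ 2 * β ^ 2 := by
    have : χ ^ 2 ≤ C ^ 2 := by rw [← sq_abs χ]; gcongr
    nlinarith [sq_nonneg β]
  have h3 : 2 * (D * |κ|) * (β * C) ≤ ℓ₀ / 2 * κ ^ 2 + 2 * D ^ 2 / ℓ₀ * C ^ 2 * β ^ 2 := by
    rw [← sq_abs κ]
    have h4 : 0 ≤ (ℓ₀ * |κ| - 2 * D * C * β) ^ 2 / (2 * ℓ₀) := by positivity
    have h5 : (ℓ₀ * |κ| - 2 * D * C * β) ^ 2 / (2 * ℓ₀)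
        = ℓ₀ / 2 * |κ| ^ 2 + 2 * D ^ 2 / ℓ₀ * C ^ 2 * β ^ 2 - 2 * (D * |κ|) * (β * C) := by
      field_simp; ring
    linarith
  nlinarith

theorem abs_sum_le_card {ι : Type*} (s : Finset ι) {F : ι → ℝ} {D : ℝ} (hF : ∀ i ∈ s, |F i| ≤ D) :
    |∑ i ∈ s, F i| ≤ s.card * D := by
  refine (Finset.abs_sum_le_sum_abs _ _).trans ?_
  rw [← nsmul_eq_mul]
  exact Finset.sum_le_card_nsmul _ _ _ hF

theorem abs_weighted_sum_le {ι : Type*} {s t : Finset ι} (hst : s ⊆ t) {w F : ι → ℝ} {D : ℝ}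
    (hw : ∀ i, 0 < w i) (hD : 0 ≤ D) (hF : ∀ i ∈ s, |F i| ≤ D) :
    |∑ i ∈ s, w i * F i| ≤ D * ∑ i ∈ t, w i := by
  refine (Finset.abs_sum_le_sum_abs _ _).trans ?_
  calc ∑ i ∈ s, |w i * F i| ≤ ∑ i ∈ s, D * w i := by
        refine Finset.sum_le_sum fun i hi => ?_
        rw [abs_mul, abs_of_pos (hw i), mul_comm]
        exact mul_le_mul_of_nonneg_right (hF i hi) (hw i).le
    _ = D * ∑ i ∈ s, w i := by rw [Finset.mul_sum]
    _ ≤ _ := mul_le_mul_of_nonneg_left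
        (Finset.sum_le_sum_of_subset_of_nonneg hst fun i _ _ => (hw i).le) hD

set_option maxHeartbeats 1000000 in
/-- The lower order terms of the inequality at a maximum. -/
theorem error_terms_ge {m : Fin n} {κ w p ρ d Sd Sm ψ1 χ1 : Fin n → ℝ}
    {γ : Fin n → Fin n → Fin n → ℝ} {W Wm ℓ β ψ2 C s1 : ℝ}
    (hw : ∀ i, 0 < w i) (hC : 1 ≤ C) (hW1 : 1 ≤ W) (hWm : W ≤ Wm) (hℓ0 : 0 ≤ ℓ) (hℓ1 : ℓ ≤ 1)
    (hβ : 0 ≤ β) (hs0 : 0 ≤ s1) (hs1 : s1 ≤ C) (hK : 1 ≤ κ m) (hκ : ∀ i, |κ i| ≤ n * κ m)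
    (hp : ∀ i, |p i| ≤ 1) (hγ : ∀ i j k, |γ i j k| ≤ C) (hρ : ∀ k, |ρ k| ≤ C)
    (hd : ∀ k, k ≠ m → |d k| ≤ C * (1 + κ m)) (hSd : ∀ k, |Sd k| ≤ C) (hSm : ∀ k, |Sm k| ≤ C)
    (hψ1 : ∀ k, |ψ1 k| ≤ C) (hψ2 : |ψ2| ≤ C * (1 + κ m)) (hχ1 : ∀ k, |χ1 k| ≤ C) :
    -(W * κ m * ((20 * (n + 1) * Wm ^ 2 * C ^ 2) * (1 + ∑ i, w i) + n * Wm * C ^ 2 * β)) ≤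
      W * ψ2 + W * κ m * (ℓ * W ^ 2 * ∑ l, p l * ψ1 l)
      - W * κ m * (β * s1 * W * ∑ l, p l * χ1 l)
      + (W * s1 * (∑ l, p l * γ m m l) + s1 * ρ m / (2 * W)
        + (∑ k ∈ Finset.univ.erase m, w k * (d k + W * κ k * Sm k - W * κ m * Sd k
          + 2 * W * κ k * p k * γ m m k - 2 * W * κ m * p m * γ k k m))
        + W * κ m * (ℓ * (W * (∑ l, p l * ∑ k, w k * γ k k l) + (∑ k, w k * ρ k) / (2 * W)))) := by
  set σ := ∑ i, w i with hσ
  set K := κ m with hKdef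
  have hn : (1 : ℝ) ≤ n := by
    have : 0 < n := Fin.pos_iff_nonempty.2 ⟨m⟩
    exact_mod_cast this
  have hσ0 : 0 < σ := Finset.sum_pos (fun i _ => hw i) ⟨m, Finset.mem_univ m⟩
  have hW0 : 0 < W := by linarith
  have hC0 : 0 ≤ C := by linarith
  have hK0 : 0 < K := by linarith
  have hWm1 : 1 ≤ Wm := hW1.trans hWm
  have hWK : 1 ≤ W * K := by nlinarith
  have hprod : ∀ (F : Fin n → ℝ) (D : ℝ), (∀ l, |F l| ≤ D) → |∑ l, p l * F l| ≤ n * D := by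
    intro F D hF
    have := abs_sum_le_card Finset.univ (F := fun l => p l * F l) (D := D) (fun l _ => by
      rw [abs_mul]
      calc |p l| * |F l| ≤ 1 * D := by
            have := hp l
            have := hF l
            gcongr
        _ = D := one_mul D)
    simpa using this
  -- each term is at least a multiple of `- W K (1 + σ)`
  have b1 : -(W * K * (2 * C)) ≤ W * ψ2 := by
    have h1 := mul_le_mul_of_nonneg_left (abs_le.1 hψ2).1 hW0.le
    have h2 : 0 ≤ W * C * (K - 1) := mul_nonneg (by positivity) (by linarith)
    linarith
  have b2 : -(W * K * (Wm ^ 2 * (n * C))) ≤ W * K * (ℓ * W ^ 2 * ∑ l, p l * ψ1 l) := by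
    have h1 := hprod ψ1 C hψ1
    have h2 : |ℓ * W ^ 2 * ∑ l, p l * ψ1 l| ≤ 1 * Wm ^ 2 * (n * C) := by
      rw [abs_mul, abs_of_nonneg (by positivity : 0 ≤ ℓ * W ^ 2)]
      gcongr
    have h3 := (abs_le.1 h2).1
    have h4 := mul_le_mul_of_nonneg_left h3 (by positivity : 0 ≤ W * K)
    linarith
  have b3 : -(W * K * (n * Wm * C ^ 2 * β)) ≤ - (W * K * (β * s1 * W * ∑ l, p l * χ1 l)) := by
    have h1 := hprod χ1 C hχ1
    have h2 : |β * s1 * W * ∑ l, p l * χ1 l| ≤ β * C * Wm * (n * C) := by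
      rw [abs_mul, abs_of_nonneg (by positivity : 0 ≤ β * s1 * W)]
      gcongr
    have h3 := (abs_le.1 h2).2
    have h4 := mul_le_mul_of_nonneg_left h3 (by positivity : 0 ≤ W * K)
    nlinarith
  have b4 : -(W * K * (n * C ^ 2)) ≤ W * s1 * (∑ l, p l * γ m m l) := by
    have h1 := hprod (fun l => γ m m l) C (fun l => hγ m m l)
    have h2 : |W * s1 * ∑ l, p l * γ m m l| ≤ W * C * (n * C) := by
      rw [abs_mul, abs_of_nonneg (by positivity : 0 ≤ W * s1)]
      gcongr
    have h3 := (abs_le.1 h2).1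
    have h4 : W * C * (n * C) ≤ W * K * (n * C ^ 2) := by
      have : 0 ≤ W * (n * C ^ 2) := by positivity
      nlinarith
    linarith
  have b5 : -(W * K * C ^ 2) ≤ s1 * ρ m / (2 * W) := by
    have h2 : |s1 * ρ m / (2 * W)| ≤ C * C := by
      rw [abs_div, abs_mul, abs_of_nonneg hs0, abs_of_pos (by positivity : 0 < 2 * W)]
      refine (div_le_self (by positivity) (by linarith)).trans ?_
      have := hρ m
      gcongr
    have h3 := (abs_le.1 h2).1
    have h4 : C * C ≤ W * K * C ^ 2 := by nlinarith [sq_nonneg C]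
    linarith
  have b6 : -(W * K * ((8 * n + 8) * C * σ)) ≤ ∑ k ∈ Finset.univ.erase m,
      w k * (d k + W * κ k * Sm k - W * K * Sd k
          + 2 * W * κ k * p k * γ m m k - 2 * W * K * p m * γ k k m) := by
    have h1 : ∀ k ∈ Finset.univ.erase m, |d k + W * κ k * Sm k - W * K * Sd k
          + 2 * W * κ k * p k * γ m m k - 2 * W * K * p m * γ k k m|
        ≤ W * K * ((8 * n + 8) * C) := by
      intro k hk
      have g1 : |d k| ≤ W * K * (2 * C) := by
        refine (hd k (Finset.ne_of_mem_erase hk)).trans ?_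
        have h1 : 0 ≤ C * (K - 1) := mul_nonneg hC0 (by linarith)
        have h2 : 0 ≤ K * C * (W - 1) := mul_nonneg (by positivity) (by linarith)
        linarith
      have g2 : |W * κ k * Sm k| ≤ W * K * (n * C) := by
        rw [abs_mul, abs_mul, abs_of_pos hW0]
        calc W * |κ k| * |Sm k| ≤ W * (n * K) * C := by
              have := hκ k
              have := hSm k
              gcongr
          _ = _ := by ring
      have g3 : |W * K * Sd k| ≤ W * K * C := by
        rw [abs_mul, abs_of_pos (by positivity : 0 < W * K)]
        have := hSd k
        gcongr
      have g4 : |2 * W * κ k * p k * γ m m k| ≤ W * K * (2 * n * C) := by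
        rw [abs_mul, abs_mul, abs_mul, abs_of_pos (by positivity : 0 < 2 * W)]
        calc 2 * W * |κ k| * |p k| * |γ m m k| ≤ 2 * W * (n * K) * 1 * C := by
              have := hκ k
              have := hp k
              have := hγ m m k
              gcongr
          _ = _ := by ring
      have g5 : |2 * W * K * p m * γ k k m| ≤ W * K * (2 * C) := by
        rw [abs_mul, abs_mul, abs_of_pos (by positivity : 0 < 2 * W * K)]
        calc 2 * W * K * |p m| * |γ k k m| ≤ 2 * W * K * 1 * C := by
              have := hp m
              have := hγ k k m
              gcongr
          _ = _ := by ring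
      have g6 : W * K * (2 * C) + W * K * (n * C) + W * K * C + W * K * (2 * n * C)
          + W * K * (2 * C) ≤ W * K * ((8 * n + 8) * C) := by
        have : 0 ≤ W * K * C := by positivity
        nlinarith
      rw [abs_le] at g1 g2 g3 g4 g5 ⊢
      constructor <;> linarith [g1.1, g1.2, g2.1, g2.2, g3.1, g3.2, g4.1, g4.2, g5.1, g5.2]
    have h2 := abs_weighted_sum_le (Finset.erase_subset m Finset.univ) hw (by positivity) h1
    have h3 := (abs_le.1 h2).1
    linarith
  have b7 : -(W * K * ((n * Wm + 1) * C * σ)) ≤ W * K * (ℓ * (W * (∑ l, p l * ∑ k, w k * γ k k l)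
      + (∑ k, w k * ρ k) / (2 * W))) := by
    have h1 := hprod (fun l => ∑ k, w k * γ k k l) (C * σ)
      (fun l => abs_weighted_sum_le (Finset.Subset.refl _) hw hC0 (fun k _ => hγ k k l))
    have h2 := abs_weighted_sum_le (Finset.Subset.refl Finset.univ) hw hC0 (fun k _ => hρ k)
    have h3 : |W * (∑ l, p l * ∑ k, w k * γ k k l)| ≤ Wm * (n * (C * σ)) := by
      rw [abs_mul, abs_of_pos hW0]; gcongr
    have h4 : |(∑ k, w k * ρ k) / (2 * W)| ≤ C * σ := by
      rw [abs_div, abs_of_pos (by positivity : 0 < 2 * W)]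
      exact (div_le_self (by positivity) (by linarith)).trans h2
    have h5 : |ℓ * (W * (∑ l, p l * ∑ k, w k * γ k k l) + (∑ k, w k * ρ k) / (2 * W))|
        ≤ 1 * (Wm * (n * (C * σ)) + C * σ) := by
      rw [abs_mul, abs_of_nonneg hℓ0]
      refine mul_le_mul hℓ1 ((abs_add_le _ _).trans (add_le_add h3 h4)) (abs_nonneg _) zero_le_one
    have h6 := mul_le_mul_of_nonneg_left (abs_le.1 h5).1 (by positivity : 0 ≤ W * K)
    linarith
  set A := Wm ^ 2 * C ^ 2 with hA
  have hA0 : 0 ≤ A := by positivity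
  have hCC : C ≤ C ^ 2 := by nlinarith
  have hWW : 1 ≤ Wm ^ 2 := one_le_pow₀ hWm1
  have hWW' : Wm ≤ Wm ^ 2 := by nlinarith
  have hC2 : C ^ 2 ≤ A := le_mul_of_one_le_left (sq_nonneg C) hWW
  have hC1 : C ≤ A := hCC.trans hC2
  have hC3 : Wm ^ 2 * C ≤ A := mul_le_mul_of_nonneg_left hCC (by positivity)
  have hC4 : Wm * C ≤ A := (mul_le_mul_of_nonneg_right hWW' hC0).trans hC3
  have total : 2 * C + Wm ^ 2 * (n * C) + n * C ^ 2 + C ^ 2 + (8 * n + 8) * C * σ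
      + (n * Wm + 1) * C * σ ≤ 20 * (n + 1) * A * (1 + σ) := by
    have hn0 : (0 : ℝ) ≤ n := by linarith
    have t1 := mul_le_mul_of_nonneg_left hC3 hn0
    have t2 := mul_le_mul_of_nonneg_left hC2 hn0
    have t3 := mul_le_mul_of_nonneg_left hC1 (by positivity : 0 ≤ (8 * n + 9) * σ)
    have t4 := mul_le_mul_of_nonneg_left hC4 (by positivity : 0 ≤ n * σ)
    have t5 : 0 ≤ A * σ := by positivity
    have t6 : 0 ≤ n * A := by positivity
    have t7 : 0 ≤ n * A * σ := by positivity
    linarith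
  have total' := mul_le_mul_of_nonneg_left total (by positivity : 0 ≤ W * K)
  have e : 20 * (n + 1) * Wm ^ 2 * C ^ 2 = 20 * (n + 1) * A := by rw [hA]; ring
  rw [e]
  linarith

set_option maxHeartbeats 2000000 in
/-- The largest principal curvature at an interior maximum is bounded, provided the parameter `β`
of the test function is large. If some curvature is less than `-κ_m / 4`, then its weight is
comparable to the sum of all weights and the term `∑ w_k κ_k²` dominates. Otherwise the rotations
`s` of the frame are chosen so that their gain absorbs the terms with large weights, and the convex
function absorbs the rest. -/
theorem exists_bound_of_maximum_jets {C Wm ℓ₀ cχ c₀ : ℝ} (hC : 1 ≤ C) (hℓ₀ : 0 < ℓ₀) (hcχ : 0 < cχ)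
    (hc₀ : 0 < c₀) (hn : 0 < n) :
    ∃ β₀ : ℝ, 0 ≤ β₀ ∧ ∀ β, β₀ ≤ β → ∃ C₁ : ℝ, ∀ (m : Fin n)
    (κ w p c χ1 χ2 ρ X Z Sd Sm ψ1 W1 W2 : Fin n → ℝ) (u3 H3 γ : Fin n → Fin n → Fin n → ℝ)
    (W ℓ ψ2 Am : ℝ),
    (∀ i, 0 < w i) → 1 ≤ W → W ≤ Wm → ℓ₀ ≤ ℓ → ℓ ≤ 1 →
    c₀ ≤ ∑ i, w i * κ i → ∑ i, w i * κ i ≤ C → (∀ i, |κ i| ≤ n * κ m) →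
    (∀ i j, κ j ≤ κ i → w i ≤ w j) →
    (∀ i, |p i| ≤ 1) → (∀ i j k, |γ i j k| ≤ C) → (∀ k, |ρ k| ≤ C) →
    (1 ≤ κ m → ∀ k, k ≠ m → |X k - Z k| ≤ C * (1 + κ m)) →
    (∀ k, |Sd k| ≤ C) → (∀ k, |Sm k| ≤ C) →
    (∀ k, |ψ1 k| ≤ C) → (1 ≤ κ m → |ψ2| ≤ C * (1 + κ m)) → (∀ k, |χ1 k| ≤ C) →
    (∀ k, cχ ≤ χ2 k) →
    (∀ i j k, u3 i j k = u3 j i k) → (∀ i j k, u3 i j k = u3 i k j) →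
    (∀ i j k, u3 i j k = H3 i j k + γ i j k) →
    (∀ k, W1 k = W ^ 2 * κ k * p k) →
    (∀ k, W2 k = W * (∑ l, p l * u3 l k k) + W * κ k ^ 2 + ρ k / (2 * W)) →
    (∀ k, c k = - ℓ * W1 k - β * χ1 k) →
    (∀ k, H3 m m k = W * κ m * c k + if k = m then 2 * W ^ 2 * κ m ^ 2 * p m else 0) →
    (∀ k, k ≠ m → X k - W * κ m * (Sd k + 2 * p m * u3 m k k)
      ≤ W * κ m * (c k ^ 2 - ℓ ^ 2 * W1 k ^ 2 - ℓ * W2 k - β * χ2 k)) →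
    (Am ≤ W * κ m * (c m ^ 2 - ℓ ^ 2 * W1 m ^ 2 - ℓ * W2 m - β * χ2 m)) →
    (∀ l, ∑ i, w i * H3 i i l = W * ψ1 l + 2 * W ^ 2 * w l * κ l ^ 2 * p l
      + W ^ 2 * κ l * p l * ∑ i, w i * κ i) →
    (∀ s : Fin n → ℝ, W * (ψ2 + 2 * W * κ m * p m * ψ1 m + (∑ i, w i * κ i) *
        ((∑ l, p l * u3 l m m) + κ m ^ 2 + ρ m / (2 * W ^ 2)))
      ≤ w m * Am + (∑ k ∈ Finset.univ.erase m, w k * (Z k - W * κ k * (Sm k + 2 * p k * u3 k m m)))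
        + ∑ j ∈ Finset.univ.erase m, (w m - w j) * (4 * (H3 m j m - W ^ 2 * κ m * κ j * p j) * s j
          - 2 * W * (κ m - κ j) * s j ^ 2)) →
    κ m ≤ C₁ := by
  have hn0 : (0 : ℝ) < n := by exact_mod_cast hn
  have hC0 : 0 < C := by linarith
  set A₁ := 20 * (n + 1) * Wm ^ 2 * C ^ 2 with hA₁
  set A₂ := n * Wm * C ^ 2 with hA₂
  set B := (2 * (2 * Wm ^ 2) ^ 2 / ℓ₀ + 1) * C ^ 2 with hB
  have hA₁0 : 0 ≤ A₁ := by positivity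
  have hB0 : 0 ≤ B := by positivity
  -- For this `β` the convex function absorbs every remaining term proportional to `∑ w`.
  refine ⟨(24 * C ^ 2 + A₁) / cχ, by positivity, fun β hβ => ?_⟩
  have hβ0 : 0 ≤ β := le_trans (by positivity) hβ
  -- Above this bound `κ_m²` beats the terms of order `β²`, and `c₀ κ_m` the remaining constants.
  refine ⟨1 + 32 * n / ℓ₀ * (B * β ^ 2 + A₁) + |A₁ + A₂ * β| / c₀, ?_⟩
  intro m κ w p c χ1 χ2 ρ X Z Sd Sm ψ1 W1 W2 u3 H3 γ W ℓ ψ2 Am hw hW1 hWm hℓ hℓ1 hs0 hs1 hκ hanti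
    hp hγ hρ hd hSd hSm hψ1 hψ2 hχ1 hχ2 hsym1 hsym2 hu3 hWd hWdd hcdef hc hI hIm hII1 hII2
  by_contra! hlt
  set K := κ m with hKdef
  set σ := ∑ i, w i with hσ
  set T := ∑ k, w k * κ k ^ 2 with hT
  have hp1 : 0 ≤ 32 * n / ℓ₀ * (B * β ^ 2 + A₁) := by positivity
  have hp2 : 0 ≤ |A₁ + A₂ * β| / c₀ := by positivity
  have hK1 : 1 ≤ K := by linarith
  have hK0 : 0 < K := by linarith
  have hW0 : 0 < W := by linarith
  have hWK : 0 < W * K := by positivity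
  have hKsq : 32 * n / ℓ₀ * (B * β ^ 2 + A₁) ≤ K ^ 2 := by nlinarith
  have hlarge : A₁ + A₂ * β < c₀ * K := by
    have : |A₁ + A₂ * β| / c₀ < K := by linarith
    rw [div_lt_iff₀ hc₀] at this
    linarith [le_abs_self (A₁ + A₂ * β)]
  have hσ0 : 0 < σ := Finset.sum_pos (fun i _ => hw i) ⟨m, Finset.mem_univ m⟩
  set μ := fun k => (ℓ * W ^ 2 + W) * (κ k * p k) with hμ
  set r := fun k => 2 * μ k * (β * χ1 k) + (β * χ1 k) ^ 2 with hr
  have hμle : ∀ k, |μ k| ≤ 2 * Wm ^ 2 * |κ k| := by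
    intro k
    have h1 : ℓ * W ^ 2 + W ≤ 2 * Wm ^ 2 := by
      have h2 : W ^ 2 ≤ Wm ^ 2 := pow_le_pow_left₀ hW0.le hWm 2
      have h3 : W ≤ W ^ 2 := by nlinarith
      have h4 : ℓ * W ^ 2 ≤ 1 * W ^ 2 := mul_le_mul_of_nonneg_right hℓ1 (sq_nonneg W)
      linarith
    have h0 : 0 ≤ ℓ * W ^ 2 + W := by
      have : 0 ≤ ℓ := by linarith
      positivity
    rw [hμ]
    simp only [abs_mul, abs_of_nonneg h0]
    have h5 : |κ k| * |p k| ≤ |κ k| := mul_le_of_le_one_right (abs_nonneg _) (hp k)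
    exact mul_le_mul h1 h5 (by positivity) (by positivity)
  have hrle : ∀ k, r k ≤ ℓ₀ / 2 * κ k ^ 2 + B * β ^ 2 := fun k =>
    quadratic_absorb hℓ₀ hβ0 (hμle k) (hχ1 k) (by positivity)
  have hTle : ℓ₀ * T ≤ ℓ * W * T := by
    have hT0 : 0 ≤ T := Finset.sum_nonneg fun k _ => mul_nonneg (hw k).le (sq_nonneg _)
    refine mul_le_mul_of_nonneg_right ?_ hT0
    nlinarith
  have hχle : β * cχ * σ ≤ β * ∑ k, w k * χ2 k := by
    rw [mul_assoc]
    refine mul_le_mul_of_nonneg_left ?_ hβ0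
    rw [hσ, Finset.mul_sum]
    exact Finset.sum_le_sum fun k _ => by
      rw [mul_comm]; exact mul_le_mul_of_nonneg_left (hχ2 k) (hw k).le
  have herr := error_terms_ge (m := m) (κ := κ) (w := w) (d := fun k => X k - Z k) hw hC hW1 hWm
    (by linarith) hℓ1 hβ0 (by linarith) hs1 hK1 hκ hp hγ hρ (hd hK1) hSd hSm hψ1 (hψ2 hK1) hχ1
  have main : ∀ Q, W * (ψ2 + 2 * W * κ m * p m * ψ1 m + (∑ i, w i * κ i) *
        ((∑ l, p l * u3 l m m) + κ m ^ 2 + ρ m / (2 * W ^ 2)))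
      ≤ w m * Am + (∑ k ∈ Finset.univ.erase m, w k * (Z k - W * κ k * (Sm k + 2 * p k * u3 k m m)))
        + Q → c₀ * K + ℓ₀ * T + β * cχ * σ
          ≤ (∑ k, w k * r k) + Q / (W * K) + A₁ * (1 + σ) + A₂ * β := by
    intro Q hQ
    have h := maximum_inequality_of_jets hW0.ne' hw hsym1 hsym2 hu3 hWd hWdd hcdef hc hI hIm
      hII1 hQ
    have hre : W * K * ∑ k, w k * (c k ^ 2 - ℓ ^ 2 * W1 k ^ 2 - β * χ2 k)
        = W * K * (∑ k, w k * r k) - 2 * W ^ 2 * K * β * (∑ k, w k * (κ k * p k * χ1 k))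
          - W * K * (β * ∑ k, w k * χ2 k) := by
      simp only [Finset.mul_sum]
      rw [← Finset.sum_sub_distrib, ← Finset.sum_sub_distrib]
      refine Finset.sum_congr rfl fun k _ => ?_
      simp only [hr, hμ]
      rw [hcdef, hWd]
      ring
    rw [hre] at h
    have h2 : W * K * (c₀ * K + ℓ₀ * T + β * cχ * σ)
        ≤ W * K * ((∑ k, w k * r k) + A₁ * (1 + σ) + A₂ * β) + Q := by
      have h3 := mul_le_mul_of_nonneg_left hTle hWK.le
      have h4 := mul_le_mul_of_nonneg_left hχle hWK.le
      have h5 := mul_le_mul_of_nonneg_left (mul_le_mul_of_nonneg_right hs0 hK0.le) hWK.le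
      linarith
    have h6 : c₀ * K + ℓ₀ * T + β * cχ * σ
        ≤ (W * K * ((∑ k, w k * r k) + A₁ * (1 + σ) + A₂ * β) + Q) / (W * K) := by
      rw [le_div_iff₀ hWK]; linarith
    rw [add_div, mul_div_cancel_left₀ _ hWK.ne'] at h6
    linarith
  by_cases hcase : ∃ l, κ l < -(K / 4)
  · -- No rotation of the frame is needed: the weight of the smallest curvature is at least `σ / n`,
    -- so `T` is at least a multiple of `σ κ_m²`.
    obtain ⟨l, hl⟩ := hcase
    have hm := main 0 (by simpa using hII2 0)
    obtain ⟨q, -, hq⟩ := Finset.exists_min_image Finset.univ κ ⟨m, Finset.mem_univ m⟩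
    have hκq : κ q < -(K / 4) := (hq l (Finset.mem_univ l)).trans_lt hl
    have hσq : σ ≤ n * w q := by
      have := Finset.sum_le_card_nsmul Finset.univ w (w q)
        (fun i _ => hanti i q (hq i (Finset.mem_univ i)))
      simpa using this
    have hTq : w q * κ q ^ 2 ≤ T :=
      Finset.single_le_sum (f := fun k => w k * κ k ^ 2)
        (fun k _ => mul_nonneg (hw k).le (sq_nonneg _)) (Finset.mem_univ q)
    have hκq2 : K ^ 2 / 16 ≤ κ q ^ 2 := by nlinarith
    have hT16 : σ * K ^ 2 ≤ 16 * n * T := by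
      have h1 : w q * (K ^ 2 / 16) ≤ T := (mul_le_mul_of_nonneg_left hκq2 (hw q).le).trans hTq
      have h2 : σ * K ^ 2 ≤ n * w q * K ^ 2 := mul_le_mul_of_nonneg_right hσq (sq_nonneg K)
      have h3 := mul_le_mul_of_nonneg_left h1 hn0.le
      linarith
    have hsum : ∑ k, w k * r k ≤ ℓ₀ / 2 * T + B * β ^ 2 * σ := by
      rw [hT, hσ, Finset.mul_sum, Finset.mul_sum, ← Finset.sum_add_distrib]
      refine Finset.sum_le_sum fun k _ => ?_
      have := mul_le_mul_of_nonneg_left (hrle k) (hw k).le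
      linarith
    have h1 : (B * β ^ 2 + A₁) * σ ≤ ℓ₀ / 2 * T := by
      have h2 := mul_le_mul_of_nonneg_right hKsq hσ0.le
      have h3 : 32 * n / ℓ₀ * (B * β ^ 2 + A₁) * σ ≤ 16 * n * T := by linarith
      have h4 : 32 * n / ℓ₀ * (B * β ^ 2 + A₁) * σ
          = 16 * n * (2 / ℓ₀ * ((B * β ^ 2 + A₁) * σ)) := by ring
      rw [h4] at h3
      have h5 := le_of_mul_le_mul_left h3 (by positivity)
      have h6 := mul_le_mul_of_nonneg_left h5 (by positivity : 0 ≤ ℓ₀ / 2)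
      have h7 : ℓ₀ / 2 * (2 / ℓ₀ * ((B * β ^ 2 + A₁) * σ)) = (B * β ^ 2 + A₁) * σ := by
        field_simp
      linarith
    have h8 : 0 ≤ β * cχ * σ := by positivity
    rw [zero_div] at hm
    linarith
  · push Not at hcase
    -- The frame is rotated only towards directions of large weight. Completing the square there
    -- gains more than the square of the gradient term; elsewhere the weight is at most `4 w_m`.
    set y := fun j => H3 m j m - W ^ 2 * κ m * κ j * p j with hy
    set s := fun j => if 4 * w m < w j then 4 / 5 * (y j / (W * K)) else 0 with hs
    have hm := main _ (hII2 s)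
    set G := fun k => 24 * C ^ 2 * w k + ℓ₀ / 2 * (w k * κ k ^ 2) + 4 * w m * (B * β ^ 2) with hG
    have hsum : (∑ k, w k * r k) + (∑ j ∈ Finset.univ.erase m, (w m - w j) *
        (4 * (H3 m j m - W ^ 2 * κ m * κ j * p j) * s j - 2 * W * (κ m - κ j) * s j ^ 2)) / (W * K)
        ≤ ∑ k, G k := by
      rw [← Finset.add_sum_erase _ _ (Finset.mem_univ m), Finset.sum_div, add_assoc,
        ← Finset.sum_add_distrib, ← Finset.add_sum_erase _ G (Finset.mem_univ m)]
      refine add_le_add ?_ (Finset.sum_le_sum fun j hj => ?_)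
      · have h1 := mul_le_mul_of_nonneg_left (hrle m) (hw m).le
        have h2 : 0 ≤ 24 * C ^ 2 * w m := mul_nonneg (by positivity) (hw m).le
        have h3 : 0 ≤ w m * (B * β ^ 2) := mul_nonneg (hw m).le (by positivity)
        simp only [hG]
        linarith
      · have hjm : j ≠ m := Finset.ne_of_mem_erase hj
        have hyj : y j = W * K * (-(μ j + β * χ1 j)) + (γ m m j - γ m j m) := by
          have h1 : H3 m j m = H3 m m j + γ m m j - γ m j m := by
            have := hu3 m j m
            rw [hsym2, hu3] at this
            linarith
          simp only [hy, hμ]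
          rw [h1, hc, if_neg hjm, hcdef, hWd]
          ring
        have hyj' : |y j / (W * K) - -(μ j + β * χ1 j)| ≤ 2 * C := by
          have h1 : y j / (W * K) - -(μ j + β * χ1 j) = (γ m m j - γ m j m) / (W * K) := by
            rw [hyj]; field_simp; ring
          rw [h1, abs_div, abs_of_pos hWK]
          refine (div_le_self (abs_nonneg _) (by nlinarith)).trans ?_
          refine (abs_sub _ _).trans ?_
          linarith [hγ m m j, hγ m j m]
        have h := weighted_quadratic_le (hw j) (hw m) hK0 hW0 (hcase j) (hrle j)
          (by positivity) hℓ₀.le hyj'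
        refine le_trans (le_of_eq ?_) h
        simp only [hr, hs, hy]
        ring
    have hGs : ∑ k, G k = 24 * C ^ 2 * σ + ℓ₀ / 2 * T + n * (4 * w m * (B * β ^ 2)) := by
      simp only [hG, hσ, hT, Finset.sum_add_distrib, Finset.mul_sum, Finset.sum_const,
        Finset.card_univ, Fintype.card_fin, nsmul_eq_mul]
    have hTm : w m * K ^ 2 ≤ T :=
      Finset.single_le_sum (f := fun k => w k * κ k ^ 2)
        (fun k _ => mul_nonneg (hw k).le (sq_nonneg _)) (Finset.mem_univ m)
    have h1 : n * (4 * w m * (B * β ^ 2)) ≤ ℓ₀ / 2 * T := by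
      have h2 : 32 * n / ℓ₀ * (B * β ^ 2) ≤ K ^ 2 := by
        refine le_trans ?_ hKsq
        gcongr
        linarith
      have h3 := (mul_le_mul_of_nonneg_left h2 (hw m).le).trans hTm
      have h4 := mul_le_mul_of_nonneg_left h3 (by positivity : 0 ≤ ℓ₀ / 2)
      have h5 : ℓ₀ / 2 * (w m * (32 * n / ℓ₀ * (B * β ^ 2)))
          = 4 * (n * (4 * w m * (B * β ^ 2))) := by
        field_simp; ring
      have h6 : 0 ≤ n * (4 * w m * (B * β ^ 2)) := by
        have := hw m
        positivity
      linarith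
    have h2 : (24 * C ^ 2 + A₁) * σ ≤ β * cχ * σ := by
      refine mul_le_mul_of_nonneg_right ?_ hσ0.le
      rwa [div_le_iff₀ hcχ] at hβ
    linarith

end MaximumInequality

/-! ### Moving frames -/

section MovingFrames

variable {n : ℕ} {Γ : Set (Fin n → ℝ)} {f : (Fin n → ℝ) → ℝ}

theorem hasJet_matrix_mul {A B : ℝ → Matrix (Fin n) (Fin n) ℝ}
    {A0 A1 A2 B0 B1 B2 : Matrix (Fin n) (Fin n) ℝ}
    (hA : ∀ i j, HasJet (fun t => A t i j) (A0 i j) (A1 i j) (A2 i j))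
    (hB : ∀ i j, HasJet (fun t => B t i j) (B0 i j) (B1 i j) (B2 i j)) (i j : Fin n) :
    HasJet (fun t => (A t * B t) i j) ((A0 * B0) i j) ((A1 * B0 + A0 * B1) i j)
      ((A2 * B0 + (2 : ℝ) • (A1 * B1) + A0 * B2) i j) := by
  refine ((HasJet.sum Finset.univ fun k _ => (hA i k).mul (hB k j)).of_eq ?_ ?_ ?_).congr
    (Eventually.of_forall fun t => Matrix.mul_apply)
  · rw [Matrix.mul_apply]
  · simp only [Matrix.add_apply, Matrix.mul_apply, Finset.sum_add_distrib]
  · simp only [Matrix.add_apply, Matrix.mul_apply, Finset.sum_add_distrib, Matrix.smul_apply,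
      smul_eq_mul, Finset.mul_sum, mul_assoc]

/-- The moving frame `1 + t N + t² E / 2` with velocity `N` and acceleration `E`. Its columns are
the vectors of the frame. -/
noncomputable def movingFrame (N E : Matrix (Fin n) (Fin n) ℝ) (t : ℝ) :
    Matrix (Fin n) (Fin n) ℝ :=
  1 + t • N + (t ^ 2 / 2) • E

/-- The jet of the matrix of a bilinear form in a moving frame. -/
theorem hasJet_frame {B : ℝ → Matrix (Fin n) (Fin n) ℝ} {B0 B1 B2 N E : Matrix (Fin n) (Fin n) ℝ}
    (hB : ∀ i j, HasJet (fun t => B t i j) (B0 i j) (B1 i j) (B2 i j)) (i j : Fin n) :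
    HasJet (fun t : ℝ => ((movingFrame N E t).transpose * B t * movingFrame N E t) i j) (B0 i j)
      ((B1 + N.transpose * B0 + B0 * N) i j)
      ((B2 + (2 : ℝ) • (N.transpose * B1 + B1 * N) + (2 : ℝ) • (N.transpose * B0 * N)
        + E.transpose * B0 + B0 * E) i j) := by
  have hE : ∀ i j, HasJet (fun t : ℝ => movingFrame N E t i j)
      ((1 : Matrix (Fin n) (Fin n) ℝ) i j) (N i j) (E i j) := fun i j => hasJet_poly _ _ _
  have hET : ∀ i j, HasJet (fun t : ℝ => (movingFrame N E t).transpose i j)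
      ((1 : Matrix (Fin n) (Fin n) ℝ) i j) (N.transpose i j) (E.transpose i j) := fun i j => by
    have := hE j i
    rw [show (1 : Matrix (Fin n) (Fin n) ℝ) j i = (1 : Matrix (Fin n) (Fin n) ℝ) i j by
      rw [← Matrix.transpose_apply (1 : Matrix (Fin n) (Fin n) ℝ), Matrix.transpose_one]] at this
    exact this
  have h1 := hasJet_matrix_mul hET hB
  refine (hasJet_matrix_mul h1 hE i j).of_eq ?_ ?_ ?_
  · simp
  · simp only [Matrix.one_mul, Matrix.mul_one]
    simp only [Matrix.add_apply]
    ring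
  · simp only [Matrix.one_mul, Matrix.mul_one, Matrix.add_mul, smul_add]
    simp only [Matrix.add_apply]
    ring

/-- The differentiated equation in a moving frame with velocity `N`. The acceleration of the frame
is determined by its orthonormality up to second order. -/
theorem IsCurvatureFunction.differentiated_equation_of_velocity (hf : IsCurvatureFunction Γ f)
    (hc : ConcaveOn ℝ Γ f) {κ : Fin n → ℝ} (hκ : κ ∈ Γ)
    {g H : ℝ → Matrix (Fin n) (Fin n) ℝ} {W ψ : ℝ → ℝ}
    (hP : ∀ᶠ t in 𝓝 0, ∃ (P : Matrix (Fin n) (Fin n) ℝ) (κ' : Fin n → ℝ),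
      P.transpose * g t * P = 1 ∧ P.transpose * ((W t)⁻¹ • H t) * P = Matrix.diagonal κ' ∧
      κ' ∈ Γ ∧ f κ' = ψ t)
    (hgs : ∀ᶠ t in 𝓝 0, (g t).transpose = g t)
    {G1 G2 H1 H2 N : Matrix (Fin n) (Fin n) ℝ} {W0 W1 W2 ψ1 ψ2 : ℝ}
    (hG1 : G1.transpose = G1) (hG2 : G2.transpose = G2) (hH1 : H1.transpose = H1)
    (hg : ∀ i j, HasJet (fun t => g t i j) ((1 : Matrix (Fin n) (Fin n) ℝ) i j) (G1 i j) (G2 i j))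
    (hH : ∀ i j, HasJet (fun t => H t i j) ((W0 • Matrix.diagonal κ) i j) (H1 i j) (H2 i j))
    (hN : G1 + N.transpose + N = 0)
    (hW0 : 0 < W0) (hW : HasJet W W0 W1 W2) (hψ : HasJet ψ (f κ) ψ1 ψ2) :
    ∑ i, curvDeriv f i κ * (H1 i i + 2 * W0 * κ i * N i i)
      = (∑ i, curvDeriv f i κ * κ i) * W1 + W0 * ψ1 ∧
    (∑ i, curvDeriv f i κ * κ i) * W2 + 2 * W1 * ψ1 + W0 * ψ2
      ≤ ∑ i, curvDeriv f i κ * (H2 i i + 4 * (∑ a, H1 i a * N a i)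
          + 2 * W0 * (∑ a, κ a * N a i ^ 2)
        - W0 * κ i * (G2 i i + 4 * (∑ a, G1 i a * N a i) + 2 * ∑ a, N a i ^ 2)) := by
  set F : Matrix (Fin n) (Fin n) ℝ :=
    G2 + (2 : ℝ) • (N.transpose * G1 + G1 * N) + (2 : ℝ) • (N.transpose * N) with hF
  set E : Matrix (Fin n) (Fin n) ℝ := -((1 / 2 : ℝ) • F) with hE
  have hFs : F.transpose = F := by
    simp only [hF, Matrix.transpose_add, Matrix.transpose_smul, Matrix.transpose_mul, hG1, hG2,
      Matrix.transpose_transpose, add_comm (N.transpose * G1)]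
  have hEs : E.transpose = E := by rw [hE, Matrix.transpose_neg, Matrix.transpose_smul, hFs]
  have hEE : F + E + E = 0 := by
    rw [hE, add_assoc, ← neg_add, ← add_smul]; norm_num
  have hgF : ∀ i j, HasJet (fun t : ℝ => ((movingFrame N E t).transpose * g t
        * movingFrame N E t) i j) (if i = j then 1 else 0) 0 0 := by
    intro i j
    refine (hasJet_frame hg i j).of_eq Matrix.one_apply ?_ ?_
    · rw [Matrix.mul_one, Matrix.one_mul, hN]; rfl
    · rw [Matrix.mul_one, Matrix.mul_one, Matrix.one_mul, hEs, ← hF, hEE]; rfl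
  obtain ⟨h1, h2⟩ := hf.differentiated_equation hc hκ
    (E := movingFrame N E) hP hgs hgF (hasJet_frame hH) hW0 hW hψ
  have hdiag : ∀ (A : Matrix (Fin n) (Fin n) ℝ) i, (Matrix.diagonal κ * A) i i = κ i * A i i :=
    fun A i => Matrix.diagonal_mul _ _ _ _
  have hdiag' : ∀ (A : Matrix (Fin n) (Fin n) ℝ) i, (A * Matrix.diagonal κ) i i = A i i * κ i :=
    fun A i => Matrix.mul_diagonal _ _ _ _
  have hcomm : ∀ (A : Matrix (Fin n) (Fin n) ℝ), A.transpose = A → ∀ i,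
      (N.transpose * A) i i = ∑ a, A i a * N a i := by
    intro A hA i
    rw [Matrix.mul_apply]
    refine Finset.sum_congr rfl fun a _ => ?_
    rw [Matrix.transpose_apply, ← Matrix.transpose_apply A, hA, mul_comm]
  constructor
  · rw [← h1]
    refine Finset.sum_congr rfl fun i _ => ?_
    simp only [Matrix.add_apply, Matrix.mul_smul, Matrix.smul_mul, Matrix.smul_apply, hdiag, hdiag',
      smul_eq_mul, Matrix.transpose_apply]
    ring
  · refine h2.trans (le_of_eq (Finset.sum_congr rfl fun i _ => ?_))
    have hFi : F i i = G2 i i + 4 * (∑ a, G1 i a * N a i) + 2 * ∑ a, N a i ^ 2 := by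
      simp only [hF, Matrix.add_apply, Matrix.smul_apply, hcomm G1 hG1, Matrix.mul_apply (M := G1),
        Matrix.mul_apply (M := N.transpose) (N := N), Matrix.transpose_apply, smul_eq_mul,
        ← pow_two]
      ring
    have hq : (N.transpose * Matrix.diagonal κ * N) i i = ∑ a, κ a * N a i ^ 2 := by
      rw [Matrix.mul_apply]
      refine Finset.sum_congr rfl fun a _ => ?_
      rw [Matrix.mul_diagonal, Matrix.transpose_apply]; ring
    rw [← hFi]
    congr 1
    simp only [Matrix.add_apply, Matrix.mul_smul, Matrix.smul_mul, Matrix.smul_apply, hdiag, hdiag',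
      hcomm H1 hH1, hq, Matrix.mul_apply (M := H1), hEs]
    simp only [hE, Matrix.neg_apply, Matrix.smul_apply, smul_eq_mul]
    ring

/-- The conditions at a point where `H(ξ, ξ) ≤ W κ_m Y g(ξ, ξ)` for all `ξ`, with equality at the
point for `ξ = e_m`, tested with the vectors `e_m + t v`. -/
theorem quadratic_form_test {κ v : Fin n → ℝ} {m : Fin n} {g H : ℝ → Matrix (Fin n) (Fin n) ℝ}
    {Y : ℝ → ℝ} {G1 G2 H1 H2 : Matrix (Fin n) (Fin n) ℝ} {W0 Y1 Y2 : ℝ}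
    (hG1 : G1.transpose = G1) (hH1 : H1.transpose = H1)
    (hg : ∀ i j, HasJet (fun t => g t i j) ((1 : Matrix (Fin n) (Fin n) ℝ) i j) (G1 i j) (G2 i j))
    (hH : ∀ i j, HasJet (fun t => H t i j) ((W0 • Matrix.diagonal κ) i j) (H1 i j) (H2 i j))
    (hY : HasJet Y 1 Y1 Y2)
    (htest : ∀ᶠ t in 𝓝 0, ∀ ξ : Fin n → ℝ,
      ∑ i, ∑ j, H t i j * ξ i * ξ j ≤ W0 * κ m * (Y t * ∑ i, ∑ j, g t i j * ξ i * ξ j)) :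
    H1 m m + 2 * W0 * κ m * v m = W0 * κ m * (Y1 + (G1 m m + 2 * v m)) ∧
    H2 m m + 4 * (∑ a, H1 m a * v a) + 2 * W0 * (∑ a, κ a * v a ^ 2)
      ≤ W0 * κ m * (Y2 + 2 * Y1 * (G1 m m + 2 * v m)
        + (G2 m m + 4 * (∑ a, G1 m a * v a) + 2 * ∑ a, v a ^ 2)) := by
  set N : Matrix (Fin n) (Fin n) ℝ := Matrix.of fun i j => v i * if j = m then 1 else 0 with hN
  have hNm : ∀ a, N a m = v a := fun a => by simp [hN]
  have hquad : ∀ (B : Matrix (Fin n) (Fin n) ℝ) (t : ℝ),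
      ((movingFrame N 0 t).transpose * B * movingFrame N 0 t) m m
        = ∑ i, ∑ j, B i j * movingFrame N 0 t i m * movingFrame N 0 t j m := by
    intro B t
    simp only [Matrix.mul_apply, Matrix.transpose_apply, Finset.sum_mul]
    rw [Finset.sum_comm]
    exact Finset.sum_congr rfl fun i _ => Finset.sum_congr rfl fun j _ => by ring
  have hcomm : ∀ (A : Matrix (Fin n) (Fin n) ℝ), A.transpose = A →
      (N.transpose * A) m m = ∑ a, A m a * v a := by
    intro A hA
    rw [Matrix.mul_apply]
    refine Finset.sum_congr rfl fun a _ => ?_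
    rw [Matrix.transpose_apply, ← Matrix.transpose_apply A, hA, mul_comm, hNm]
  have h1 := (((hasJet_frame (N := N) (E := 0) hg m m).mul hY).const_mul (W0 * κ m)).sub
    (hasJet_frame (N := N) (E := 0) hH m m)
  have hdiag : ∀ (A : Matrix (Fin n) (Fin n) ℝ) i, (Matrix.diagonal κ * A) i i = κ i * A i i :=
    fun A i => Matrix.diagonal_mul _ _ _ _
  have hdiag' : ∀ (A : Matrix (Fin n) (Fin n) ℝ) i, (A * Matrix.diagonal κ) i i = A i i * κ i :=
    fun A i => Matrix.mul_diagonal _ _ _ _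
  have hq : (N.transpose * Matrix.diagonal κ * N) m m = ∑ a, κ a * v a ^ 2 := by
    rw [Matrix.mul_apply]
    refine Finset.sum_congr rfl fun a _ => ?_
    rw [Matrix.mul_diagonal, Matrix.transpose_apply, hNm]; ring
  have hq' : (N.transpose * N) m m = ∑ a, v a ^ 2 := by
    rw [Matrix.mul_apply]
    refine Finset.sum_congr rfl fun a _ => ?_
    rw [Matrix.transpose_apply, hNm]; ring
  have hr : ∀ A : Matrix (Fin n) (Fin n) ℝ, (A * N) m m = ∑ a, A m a * v a := by
    intro A
    rw [Matrix.mul_apply]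
    exact Finset.sum_congr rfl fun a _ => by rw [hNm]
  have h2 := HasJet.of_nonneg (h1.of_eq (by simp) rfl rfl) (by
    filter_upwards [htest] with t ht
    have := ht fun i => movingFrame N 0 t i m
    rw [← hquad, ← hquad] at this
    linarith)
  simp only [Matrix.add_apply, Matrix.smul_apply, Matrix.mul_smul, Matrix.smul_mul, hdiag, hdiag',
    hcomm _ hG1, hcomm _ hH1, hq, hq', hr H1, hr G1, hNm, Matrix.mul_one, Matrix.one_mul,
    Matrix.transpose_zero, Matrix.zero_mul, Matrix.mul_zero, Matrix.zero_apply, smul_eq_mul,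
    Matrix.one_apply_eq, Matrix.transpose_apply] at h2
  constructor <;> linarith [h2.1, h2.2]

/-- The first order equation, for a metric with the velocity of the graph metric in the direction
of the principal vector `e_l`. -/
theorem first_order_of_velocity {l : Fin n} {κ w p : Fin n → ℝ} {H1 N : Matrix (Fin n) (Fin n) ℝ}
    {W0 W1 ψ1 : ℝ} (hN : N = fun i j => -(W0 * κ l) * p i * (if j = l then 1 else 0))
    (h : ∑ i, w i * (H1 i i + 2 * W0 * κ i * N i i) = (∑ i, w i * κ i) * W1 + W0 * ψ1)
    (hW1 : W1 = W0 ^ 2 * κ l * p l) :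
    ∑ i, w i * H1 i i = W0 * ψ1 + 2 * W0 ^ 2 * w l * κ l ^ 2 * p l
      + W0 ^ 2 * κ l * p l * ∑ i, w i * κ i := by
  have e : ∑ i, w i * (H1 i i + 2 * W0 * κ i * N i i)
      = (∑ i, w i * H1 i i) - 2 * W0 ^ 2 * w l * κ l ^ 2 * p l := by
    have : (2 * W0 ^ 2 * w l * κ l ^ 2 * p l : ℝ)
        = ∑ i, if i = l then 2 * W0 ^ 2 * w i * κ i * κ l * p i else 0 := by
      rw [Finset.sum_ite_eq' Finset.univ l, if_pos (Finset.mem_univ l)]; ring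
    rw [this, ← Finset.sum_sub_distrib]
    refine Finset.sum_congr rfl fun i _ => ?_
    simp only [hN]
    split_ifs with hil
    · subst hil; ring
    · ring
  rw [e, hW1] at h
  linarith

/-- The second order equation in the direction `e_m`, for the frame in which `e_m` moves with
velocity `-W κ_m p + s` and the other vectors `e_j` with velocity `-s_j e_m`. -/
theorem second_order_of_velocity {m : Fin n} {κ w p s Z Sm u3m : Fin n → ℝ}
    {H1 H2 G1 G2 N : Matrix (Fin n) (Fin n) ℝ} {W0 R : ℝ} (hs : s m = 0)
    (hG1 : ∀ i j, G1 i j = W0 * κ m * ((if i = m then 1 else 0) * p j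
      + p i * (if j = m then 1 else 0)))
    (hH1 : H1.transpose = H1)
    (hN : N = fun i j => (-(W0 * κ m) * p i + s i) * (if j = m then 1 else 0)
      - (if i = m then 1 else 0) * s j)
    (hG2 : ∀ i, i ≠ m → G2 i i = Sm i + 2 * p i * u3m i) (hH2 : ∀ i, i ≠ m → H2 i i = Z i)
    (h : R ≤ ∑ i, w i * (H2 i i + 4 * (∑ a, H1 i a * N a i)
          + 2 * W0 * (∑ a, κ a * N a i ^ 2)
        - W0 * κ i * (G2 i i + 4 * (∑ a, G1 i a * N a i) + 2 * ∑ a, N a i ^ 2))) :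
    R ≤ w m * (H2 m m - 4 * W0 * κ m * (∑ a, H1 m a * p a)
          + 2 * W0 ^ 3 * κ m ^ 2 * (∑ a, κ a * p a ^ 2)
        - W0 * κ m * (G2 m m - 4 * W0 * κ m * (∑ a, G1 m a * p a)
          + 2 * W0 ^ 2 * κ m ^ 2 * ∑ a, p a ^ 2))
      + (∑ k ∈ Finset.univ.erase m, w k * (Z k - W0 * κ k * (Sm k + 2 * p k * u3m k)))
      + ∑ j ∈ Finset.univ.erase m, (w m - w j) * (4 * (H1 m j - W0 ^ 2 * κ m * κ j * p j) * s j
          - 2 * W0 * (κ m - κ j) * s j ^ 2) := by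
  refine h.trans (le_of_eq ?_)
  rw [← Finset.add_sum_erase _ _ (Finset.mem_univ m)]
  have hNm : ∀ a, N a m = -(W0 * κ m) * p a + s a := by intro a; simp [hN, hs]
  have hNi : ∀ i, i ≠ m → ∀ a, N a i = if a = m then - s i else 0 := by
    intro i hi a
    simp only [hN, if_neg hi]
    split_ifs <;> ring
  have hoff : ∀ i ∈ Finset.univ.erase m, w i * (H2 i i + 4 * (∑ a, H1 i a * N a i)
          + 2 * W0 * (∑ a, κ a * N a i ^ 2)
        - W0 * κ i * (G2 i i + 4 * (∑ a, G1 i a * N a i) + 2 * ∑ a, N a i ^ 2))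
      = w i * (Z i - W0 * κ i * (Sm i + 2 * p i * u3m i))
        - w i * (4 * (H1 m i - W0 ^ 2 * κ m * κ i * p i) * s i
          - 2 * W0 * (κ m - κ i) * s i ^ 2) := by
    intro i hi
    have him : i ≠ m := Finset.ne_of_mem_erase hi
    have e1 : ∑ a, H1 i a * N a i = - (H1 m i * s i) := by
      simp only [hNi i him, mul_ite, mul_zero, Finset.sum_ite_eq', Finset.mem_univ, if_true]
      rw [← Matrix.transpose_apply H1, hH1]; ring
    have e2 : ∑ a, κ a * N a i ^ 2 = κ m * s i ^ 2 := by
      simp [hNi i him]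
    have e3 : ∑ a, G1 i a * N a i = - (W0 * κ m * p i * s i) := by
      simp only [hNi i him, mul_ite, mul_zero, Finset.sum_ite_eq', Finset.mem_univ, if_true, hG1,
        if_neg him]
      ring
    have e4 : ∑ a, N a i ^ 2 = s i ^ 2 := by simp [hNi i him]
    rw [e1, e2, e3, e4, hG2 i him, hH2 i him]
    ring
  rw [Finset.sum_congr rfl hoff, Finset.sum_sub_distrib]
  have hsplit : ∀ (F : Fin n → ℝ), F m = 0 → ∑ j ∈ Finset.univ.erase m, F j = ∑ j, F j := by
    intro F hF
    rw [← Finset.add_sum_erase _ _ (Finset.mem_univ m), hF, zero_add]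
  have hm : H2 m m + 4 * (∑ a, H1 m a * N a m) + 2 * W0 * (∑ a, κ a * N a m ^ 2)
        - W0 * κ m * (G2 m m + 4 * (∑ a, G1 m a * N a m) + 2 * ∑ a, N a m ^ 2)
      = H2 m m - 4 * W0 * κ m * (∑ a, H1 m a * p a)
          + 2 * W0 ^ 3 * κ m ^ 2 * (∑ a, κ a * p a ^ 2)
        - W0 * κ m * (G2 m m - 4 * W0 * κ m * (∑ a, G1 m a * p a)
          + 2 * W0 ^ 2 * κ m ^ 2 * ∑ a, p a ^ 2)
        + ∑ j ∈ Finset.univ.erase m, (4 * (H1 m j - W0 ^ 2 * κ m * κ j * p j) * s j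
          - 2 * W0 * (κ m - κ j) * s j ^ 2) := by
    rw [hsplit _ (by simp [hs])]
    have hGs : ∑ a, G1 m a * s a = W0 * κ m * ∑ a, p a * s a := by
      rw [Finset.mul_sum]
      refine Finset.sum_congr rfl fun a _ => ?_
      rw [hG1]
      by_cases ha : a = m
      · simp [ha, hs]
      · simp [ha]; ring
    have e1 : ∑ a, H1 m a * N a m = -(W0 * κ m) * (∑ a, H1 m a * p a) + ∑ a, H1 m a * s a := by
      rw [Finset.mul_sum, ← Finset.sum_add_distrib]
      exact Finset.sum_congr rfl fun a _ => by rw [hNm]; ring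
    have e2 : ∑ a, κ a * N a m ^ 2 = W0 ^ 2 * κ m ^ 2 * (∑ a, κ a * p a ^ 2)
        - 2 * W0 * κ m * (∑ a, κ a * p a * s a) + ∑ a, κ a * s a ^ 2 := by
      simp only [Finset.mul_sum]
      rw [← Finset.sum_sub_distrib, ← Finset.sum_add_distrib]
      exact Finset.sum_congr rfl fun a _ => by rw [hNm]; ring
    have e3 : ∑ a, G1 m a * N a m = -(W0 * κ m) * (∑ a, G1 m a * p a)
        + W0 * κ m * ∑ a, p a * s a := by
      rw [← hGs, Finset.mul_sum, ← Finset.sum_add_distrib]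
      exact Finset.sum_congr rfl fun a _ => by rw [hNm]; ring
    have e4 : ∑ a, N a m ^ 2 = W0 ^ 2 * κ m ^ 2 * (∑ a, p a ^ 2)
        - 2 * W0 * κ m * (∑ a, p a * s a) + ∑ a, s a ^ 2 := by
      simp only [Finset.mul_sum]
      rw [← Finset.sum_sub_distrib, ← Finset.sum_add_distrib]
      exact Finset.sum_congr rfl fun a _ => by rw [hNm]; ring
    have e5 : ∑ j, (4 * (H1 m j - W0 ^ 2 * κ m * κ j * p j) * s j
          - 2 * W0 * (κ m - κ j) * s j ^ 2) = 4 * (∑ a, H1 m a * s a)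
          - 4 * W0 ^ 2 * κ m * (∑ a, κ a * p a * s a) - 2 * W0 * κ m * (∑ a, s a ^ 2)
          + 2 * W0 * ∑ a, κ a * s a ^ 2 := by
      simp only [Finset.mul_sum]
      rw [← Finset.sum_sub_distrib, ← Finset.sum_sub_distrib, ← Finset.sum_add_distrib]
      exact Finset.sum_congr rfl fun a _ => by ring
    rw [e1, e2, e3, e4, e5]
    ring
  rw [hm]
  have e6 : ∑ j ∈ Finset.univ.erase m, (w m - w j) *
        (4 * (H1 m j - W0 ^ 2 * κ m * κ j * p j) * s j - 2 * W0 * (κ m - κ j) * s j ^ 2)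
      = w m * (∑ j ∈ Finset.univ.erase m, (4 * (H1 m j - W0 ^ 2 * κ m * κ j * p j) * s j
          - 2 * W0 * (κ m - κ j) * s j ^ 2))
        - ∑ j ∈ Finset.univ.erase m, w j * (4 * (H1 m j - W0 ^ 2 * κ m * κ j * p j) * s j
          - 2 * W0 * (κ m - κ j) * s j ^ 2) := by
    rw [Finset.mul_sum, ← Finset.sum_sub_distrib]
    exact Finset.sum_congr rfl fun a _ => by ring
  rw [e6]
  ring

end MovingFrames

/-! ### Graphs in normal coordinates -/

section NormalCoordinates

variable {n : ℕ}

/-- The metric `g = S + du ⊗ du` of the graph of `u`, for the metric `S` on `ℝⁿ`. -/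
noncomputable def coordMetric (S : EuclideanSpace ℝ (Fin n) → Matrix (Fin n) (Fin n) ℝ)
    (u : EuclideanSpace ℝ (Fin n) → ℝ) (z : EuclideanSpace ℝ (Fin n)) : Matrix (Fin n) (Fin n) ℝ :=
  S z + Matrix.vecMulVec (fun i => partialDeriv i u z) (fun i => partialDeriv i u z)

/-- `W = √(1 + |∇u|²)`, for the metric `S` on `ℝⁿ`. -/
noncomputable def coordW (S : EuclideanSpace ℝ (Fin n) → Matrix (Fin n) (Fin n) ℝ)
    (u : EuclideanSpace ℝ (Fin n) → ℝ) (z : EuclideanSpace ℝ (Fin n)) : ℝ :=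
  √(1 + ∑ i, ∑ j, (S z)⁻¹ i j * partialDeriv i u z * partialDeriv j u z)

/-- The data of the problem in coordinates that are normal at the origin: a metric `S` with
vanishing first derivatives, a strictly convex function `χ` and a right hand side `Φ`, with bounds
on their derivatives of second order at the origin. -/
structure IsNormalData (S : EuclideanSpace ℝ (Fin n) → Matrix (Fin n) (Fin n) ℝ)
    (χ : EuclideanSpace ℝ (Fin n) → ℝ) (Φ : EuclideanSpace ℝ (Fin n) × ℝ → ℝ)
    (t₀ D cχ : ℝ) : Prop where
  symm : ∀ z i j, S z i j = S z j i
  contDiffAt : ∀ i j, ContDiffAt ℝ 3 (fun z => S z i j) 0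
  contDiffAt_inv : ∀ i j, ContDiffAt ℝ 3 (fun z => (S z)⁻¹ i j) 0
  isUnit : ∀ᶠ z in 𝓝 0, IsUnit (S z).det
  first : ∀ i j k, partialDeriv k (fun z => S z i j) 0 = 0
  second : ∀ i j k, |partialDeriv k (partialDeriv k fun z => S z i j) 0| ≤ D
  inv_second : ∀ i j k, |partialDeriv k (partialDeriv k fun z => (S z)⁻¹ i j) 0| ≤ D
  christoffel_first : ∀ l i j k, |partialDeriv k (christoffelOf S l i j) 0| ≤ D
  christoffel_second : ∀ l i j k, |partialDeriv k (partialDeriv k (christoffelOf S l i j)) 0| ≤ D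
  contDiffAt_convex : ContDiffAt ℝ 2 χ 0
  convex_first : ∀ k, |partialDeriv k χ 0| ≤ D
  convex_second : ∀ k, cχ ≤ partialDeriv k (partialDeriv k χ) 0
  contDiffAt_rhs : ContDiffAt ℝ 2 Φ (0, t₀)
  rhs_first : ‖fderiv ℝ Φ (0, t₀)‖ ≤ D
  rhs_second : ‖fderiv ℝ (fderiv ℝ Φ) (0, t₀)‖ ≤ D

variable {S : EuclideanSpace ℝ (Fin n) → Matrix (Fin n) (Fin n) ℝ}
  {χ u : EuclideanSpace ℝ (Fin n) → ℝ} {Φ : EuclideanSpace ℝ (Fin n) × ℝ → ℝ} {t₀ D cχ : ℝ}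

theorem IsNormalData.inv_first (h : IsNormalData S χ Φ t₀ D cχ) (i j k : Fin n) :
    partialDeriv k (fun z => (S z)⁻¹ i j) 0 = 0 := by
  have hu : IsUnit (S 0).det := h.isUnit.self_of_nhds
  have hd1 : ∀ a b, DifferentiableAt ℝ (fun z => S z a b) 0 := fun a b =>
    (h.contDiffAt a b).differentiableAt (by norm_num)
  have hd2 : ∀ a b, DifferentiableAt ℝ (fun z => (S z)⁻¹ a b) 0 := fun a b =>
    (h.contDiffAt_inv a b).differentiableAt (by norm_num)
  have h1 : ∀ b, ∑ a, partialDeriv k (fun z => (S z)⁻¹ i a) 0 * S 0 a b = 0 := by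
    intro b
    have e : (fun z => ∑ a, (S z)⁻¹ i a * S z a b) =ᶠ[𝓝 0]
        fun _ => (1 : Matrix (Fin n) (Fin n) ℝ) i b := by
      filter_upwards [h.isUnit] with z hz
      rw [← Matrix.nonsing_inv_mul _ hz, Matrix.mul_apply]
    have h2 := partialDeriv_congr e k
    rw [partialDeriv_sum (F := fun a z => (S z)⁻¹ i a * S z a b) _
      fun a _ => (hd2 i a).mul (hd1 a b)] at h2
    have h3 : partialDeriv k (fun _ => (1 : Matrix (Fin n) (Fin n) ℝ) i b) 0 = 0 := by
      simp [partialDeriv]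
    rw [h3] at h2
    rw [← h2]
    refine Finset.sum_congr rfl fun a _ => ?_
    rw [partialDeriv_mul (hd2 i a) (hd1 a b), h.first, mul_zero, add_zero]
  set A : Matrix (Fin n) (Fin n) ℝ := Matrix.of fun i a =>
    partialDeriv k (fun z => (S z)⁻¹ i a) 0 with hA
  have h4 : ∀ b, (A * S 0) i b = 0 := fun b => by rw [Matrix.mul_apply]; exact h1 b
  have h5 : A = A * S 0 * (S 0)⁻¹ := by
    rw [Matrix.mul_assoc, Matrix.mul_nonsing_inv _ hu, Matrix.mul_one]
  change A i j = 0
  rw [h5, Matrix.mul_apply]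
  exact Finset.sum_eq_zero fun b _ => by rw [h4, zero_mul]

theorem IsNormalData.christoffelOf_zero (h : IsNormalData S χ Φ t₀ D cχ) (l i j : Fin n) :
    christoffelOf S l i j 0 = 0 := by
  simp [christoffelOf, h.first]

theorem contDiffAt_christoffelOf {k m : WithTop ℕ∞} {z : EuclideanSpace ℝ (Fin n)}
    (h1 : ∀ i j, ContDiffAt ℝ k (fun z => S z i j) z)
    (h2 : ∀ i j, ContDiffAt ℝ k (fun z => (S z)⁻¹ i j) z) (hk : m + 1 ≤ k) (l i j : Fin n) :
    ContDiffAt ℝ m (christoffelOf S l i j) z := by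
  have hm : m ≤ k := le_self_add.trans hk
  refine contDiffAt_const.mul (ContDiffAt.sum fun a _ => ((h2 l a).of_le hm).mul ?_)
  exact ((contDiffAt_partialDeriv (h1 j a) hk i).add (contDiffAt_partialDeriv (h1 i a) hk j)).sub
    (contDiffAt_partialDeriv (h1 i j) hk a)

/-- The third derivative `∂_k ∂_j ∂_i u` at the origin. -/
noncomputable def thirdDeriv (u : EuclideanSpace ℝ (Fin n) → ℝ) (i j k : Fin n) : ℝ :=
  partialDeriv k (partialDeriv j (partialDeriv i u)) 0

theorem thirdDeriv_comm_left (hu : ContDiffAt ℝ 4 u 0) (i j k : Fin n) :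
    thirdDeriv u i j k = thirdDeriv u j i k := by
  refine partialDeriv_congr ?_ k
  filter_upwards [hu.eventually (by simp)] with z hz
  exact partialDeriv_comm (hz.of_le (by norm_num)) _ _

theorem thirdDeriv_comm_right (hu : ContDiffAt ℝ 4 u 0) (i j k : Fin n) :
    thirdDeriv u i j k = thirdDeriv u i k j :=
  partialDeriv_comm (contDiffAt_partialDeriv hu (m := 2) (by norm_num) i) _ _

theorem partialDeriv_four_comm (hu : ContDiffAt ℝ 4 u 0) (i k : Fin n) :
    partialDeriv k (partialDeriv k (partialDeriv i (partialDeriv i u))) 0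
      = partialDeriv i (partialDeriv i (partialDeriv k (partialDeriv k u))) 0 := by
  have h3 : ∀ a, ContDiffAt ℝ 3 (partialDeriv a u) 0 := fun a =>
    contDiffAt_partialDeriv hu (by norm_num) a
  have h2 : ∀ a b, ContDiffAt ℝ 2 (partialDeriv b (partialDeriv a u)) 0 := fun a b =>
    contDiffAt_partialDeriv (h3 a) (by norm_num) b
  have e1 : partialDeriv k (partialDeriv i (partialDeriv i u)) =ᶠ[𝓝 0]
      partialDeriv i (partialDeriv k (partialDeriv i u)) := by
    filter_upwards [(h3 i).eventually (by simp)] with z hz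
    exact partialDeriv_comm (hz.of_le (by norm_num)) _ _
  have e2 : partialDeriv k (partialDeriv i u) =ᶠ[𝓝 0] partialDeriv i (partialDeriv k u) := by
    filter_upwards [hu.eventually (by simp)] with z hz
    exact partialDeriv_comm (hz.of_le (by norm_num)) _ _
  have e3 : partialDeriv k (partialDeriv i (partialDeriv k u)) =ᶠ[𝓝 0]
      partialDeriv i (partialDeriv k (partialDeriv k u)) := by
    filter_upwards [(h3 k).eventually (by simp)] with z hz
    exact partialDeriv_comm (hz.of_le (by norm_num)) _ _
  rw [partialDeriv_congr e1 k, partialDeriv_comm (h2 i k) k i]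
  rw [partialDeriv_congr (eventuallyEq_partialDeriv e2 k) i, partialDeriv_congr e3 i]

theorem hasJet_coordMetric (h : IsNormalData S χ Φ t₀ D cχ) (hu : ContDiffAt ℝ 4 u 0)
    (k i j : Fin n) :
    HasJet (fun t : ℝ => coordMetric S u (t • EuclideanSpace.single k 1) i j)
      (coordMetric S u 0 i j)
      (partialDeriv k (partialDeriv i u) 0 * partialDeriv j u 0
        + partialDeriv i u 0 * partialDeriv k (partialDeriv j u) 0)
      (partialDeriv k (partialDeriv k fun z => S z i j) 0 + (thirdDeriv u i k k * partialDeriv j u 0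
        + 2 * partialDeriv k (partialDeriv i u) 0 * partialDeriv k (partialDeriv j u) 0
        + partialDeriv i u 0 * thirdDeriv u j k k)) := by
  have h1 : ∀ a, HasJet (fun t : ℝ => partialDeriv a u (t • EuclideanSpace.single k 1))
      (partialDeriv a u 0) (partialDeriv k (partialDeriv a u) 0) (thirdDeriv u a k k) := fun a =>
    hasJet_coord (contDiffAt_partialDeriv hu (by norm_num) a) k
  refine ((hasJet_coord ((h.contDiffAt i j).of_le (by norm_num)) k).add
    ((h1 i).mul (h1 j))).of_eq rfl ?_ rfl
  rw [h.first, zero_add]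

theorem hasJet_covHess (h : IsNormalData S χ Φ t₀ D cχ) (hu : ContDiffAt ℝ 4 u 0)
    (k i j : Fin n) :
    HasJet (fun t : ℝ => covHess S u (t • EuclideanSpace.single k 1) i j)
      (covHess S u 0 i j)
      (thirdDeriv u j i k - ∑ l, partialDeriv k (christoffelOf S l i j) 0 * partialDeriv l u 0)
      (partialDeriv k (partialDeriv k (partialDeriv i (partialDeriv j u))) 0
        - ∑ l, (partialDeriv k (partialDeriv k (christoffelOf S l i j)) 0 * partialDeriv l u 0
          + 2 * partialDeriv k (christoffelOf S l i j) 0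
            * partialDeriv k (partialDeriv l u) 0)) := by
  have h1 : ∀ a, ContDiffAt ℝ 3 (partialDeriv a u) 0 := fun a =>
    contDiffAt_partialDeriv hu (by norm_num) a
  have h2 : ∀ l, ContDiffAt ℝ 2 (christoffelOf S l i j) 0 := fun l =>
    contDiffAt_christoffelOf h.contDiffAt h.contDiffAt_inv (by norm_num) l i j
  refine ((hasJet_coord (contDiffAt_partialDeriv (h1 j) (m := 2) (by norm_num) i) k).sub
    (HasJet.sum Finset.univ fun l _ => (hasJet_coord (h2 l) k).mul
      (hasJet_coord ((h1 l).of_le (by norm_num)) k))).of_eq ?_ ?_ ?_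
  · rfl
  · congr 1
    refine Finset.sum_congr rfl fun l _ => ?_
    rw [h.christoffelOf_zero, zero_mul, add_zero]
  · congr 1
    refine Finset.sum_congr rfl fun l _ => ?_
    rw [h.christoffelOf_zero, zero_mul, add_zero]

theorem covHess_zero (h : IsNormalData S χ Φ t₀ D cχ) (i j : Fin n) :
    covHess S u 0 i j = partialDeriv i (partialDeriv j u) 0 := by
  simp [covHess, h.christoffelOf_zero]

theorem christoffelOf_symm (hS : ∀ z i j, S z i j = S z j i) (l i j : Fin n) :
    christoffelOf S l i j = christoffelOf S l j i := by
  funext z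
  simp only [christoffelOf]
  congr 1
  refine Finset.sum_congr rfl fun a _ => ?_
  rw [show (fun y => S y i j) = fun y => S y j i from funext fun y => hS y i j]
  ring

/-- The inverse of a metric `A` whose graph metric `A + p ⊗ p` is the identity. -/
theorem inv_of_add_vecMulVec_eq_one {A : Matrix (Fin n) (Fin n) ℝ} {p : Fin n → ℝ} {W : ℝ}
    (hA : IsUnit A.det) (hg : A + Matrix.vecMulVec p p = 1)
    (hW : W ^ 2 = 1 + ∑ i, ∑ j, A⁻¹ i j * p i * p j) :
    W ^ 2 * (1 - ∑ i, p i ^ 2) = 1 ∧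
    (∀ i j, A⁻¹ i j = (if i = j then 1 else 0) + W ^ 2 * p i * p j) ∧
    ∀ i, ∑ j, A⁻¹ i j * p j = W ^ 2 * p i := by
  set r := ∑ i, p i ^ 2 with hr
  set q : Fin n → ℝ := fun i => ∑ j, A⁻¹ i j * p j with hq
  have hA0 : ∀ a b, A a b = (if a = b then 1 else 0) - p a * p b := by
    intro a b
    have := congrFun (congrFun hg a) b
    simp only [Matrix.add_apply, Matrix.vecMulVec_apply, Matrix.one_apply] at this
    linarith
  have hinv : ∀ i b, A⁻¹ i b = (if i = b then 1 else 0) + q i * p b := by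
    intro i b
    have h1 := congrFun (congrFun (Matrix.nonsing_inv_mul _ hA) i) b
    rw [Matrix.mul_apply, Matrix.one_apply] at h1
    have h2 : ∑ a, A⁻¹ i a * A a b = A⁻¹ i b - q i * p b := by
      have : ∀ a, A⁻¹ i a * A a b
          = (if a = b then A⁻¹ i a else 0) - (A⁻¹ i a * p a) * p b := by
        intro a; rw [hA0]; split_ifs <;> ring
      simp_rw [this]
      rw [Finset.sum_sub_distrib, Finset.sum_ite_eq', if_pos (Finset.mem_univ b),
        ← Finset.sum_mul]
    linarith
  have hqi : ∀ i, q i = p i + q i * r := by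
    intro i
    calc q i = ∑ b, A⁻¹ i b * p b := rfl
      _ = ∑ b, ((if i = b then p b else 0) + q i * p b ^ 2) := by
          refine Finset.sum_congr rfl fun b _ => ?_
          rw [hinv]; split_ifs <;> ring
      _ = p i + q i * r := by
          rw [Finset.sum_add_distrib, ← Finset.mul_sum, ← hr]; simp
  have hsq : W ^ 2 = 1 + ∑ i, p i * q i := by
    rw [hW]
    congr 1
    refine Finset.sum_congr rfl fun i _ => ?_
    rw [Finset.mul_sum]
    exact Finset.sum_congr rfl fun j _ => by ring
  have hpq : ∑ i, p i * q i = r + (∑ i, p i * q i) * r := by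
    rw [hr, Finset.sum_mul, ← Finset.sum_add_distrib]
    refine Finset.sum_congr rfl fun i _ => ?_
    have := hqi i
    linear_combination p i * this
  have hWr : W ^ 2 * (1 - r) = 1 := by
    rw [hsq]; linarith
  have hqW : ∀ i, q i = W ^ 2 * p i := by
    intro i
    have h1 := hqi i
    linear_combination (-(q i)) * hWr + W ^ 2 * h1
  refine ⟨hWr, fun i j => ?_, hqW⟩
  rw [hinv, hqW]

/-- The inverse metric at a point where the graph metric is the identity. -/
theorem inv_metric_of_coordMetric_eq_one (hS : IsUnit (S 0).det) (hg : coordMetric S u 0 = 1)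
    (hW : 1 ≤ coordW S u 0) :
    (coordW S u 0) ^ 2 * (1 - ∑ i, partialDeriv i u 0 ^ 2) = 1 ∧
    (∀ i j, (S 0)⁻¹ i j = (if i = j then 1 else 0)
      + coordW S u 0 ^ 2 * partialDeriv i u 0 * partialDeriv j u 0) ∧
    ∀ i, ∑ j, (S 0)⁻¹ i j * partialDeriv j u 0 = coordW S u 0 ^ 2 * partialDeriv i u 0 := by
  refine inv_of_add_vecMulVec_eq_one hS hg (Real.sq_sqrt ?_)
  by_contra hlt
  have : coordW S u 0 = 0 := Real.sqrt_eq_zero_of_nonpos (not_le.1 hlt).le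
  linarith

/-- The jet of `W` along the `k`-th coordinate line. -/
theorem hasJet_coordW (h : IsNormalData S χ Φ t₀ D cχ) (hu : ContDiffAt ℝ 4 u 0)
    (hg : coordMetric S u 0 = 1) (hW : 1 ≤ coordW S u 0) {κ : Fin n → ℝ}
    (hH : covHess S u 0 = coordW S u 0 • Matrix.diagonal κ) (k : Fin n) :
    HasJet (fun t : ℝ => coordW S u (t • EuclideanSpace.single k 1)) (coordW S u 0)
      (coordW S u 0 ^ 2 * κ k * partialDeriv k u 0)
      (coordW S u 0 * (∑ l, partialDeriv l u 0 * thirdDeriv u l k k) + coordW S u 0 * κ k ^ 2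
        + (∑ i, ∑ j, partialDeriv k (partialDeriv k fun z => (S z)⁻¹ i j) 0
            * partialDeriv i u 0 * partialDeriv j u 0) / (2 * coordW S u 0)) := by
  obtain ⟨hWr, hinv, hq⟩ := inv_metric_of_coordMetric_eq_one h.isUnit.self_of_nhds hg hW
  set W0 := coordW S u 0 with hW0
  set p : Fin n → ℝ := fun i => partialDeriv i u 0 with hp
  have hu2 : ∀ i, partialDeriv k (partialDeriv i u) 0 = if k = i then W0 * κ k else 0 := by
    intro i
    have := congrFun (congrFun hH k) i
    rw [covHess_zero h, Matrix.smul_apply, Matrix.diagonal_apply, smul_eq_mul] at this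
    rw [this]; split_ifs <;> simp
  have h1 : ∀ a, HasJet (fun t : ℝ => partialDeriv a u (t • EuclideanSpace.single k 1))
      (p a) (if k = a then W0 * κ k else 0) (thirdDeriv u a k k) := fun a =>
    (hasJet_coord (contDiffAt_partialDeriv hu (by norm_num) a) k).of_eq rfl (hu2 a) rfl
  have h2 : ∀ i j, HasJet (fun t : ℝ => (S (t • EuclideanSpace.single k 1))⁻¹ i j)
      ((S 0)⁻¹ i j) 0 (partialDeriv k (partialDeriv k fun z => (S z)⁻¹ i j) 0) := fun i j =>
    (hasJet_coord ((h.contDiffAt_inv i j).of_le (by norm_num)) k).of_eq rfl (h.inv_first i j k) rfl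
  have h3 := (hasJet_const (1 : ℝ)).add (HasJet.sum Finset.univ fun i _ =>
    HasJet.sum Finset.univ fun j _ => ((h2 i j).mul (h1 i)).mul (h1 j))
  set ρ := ∑ i, ∑ j, partialDeriv k (partialDeriv k fun z => (S z)⁻¹ i j) 0 * p i * p j with hρ
  set T := ∑ l, p l * thirdDeriv u l k k with hT
  have hSs : ∀ i j, (S 0)⁻¹ i j = (S 0)⁻¹ j i := by
    intro i j
    rw [hinv, hinv]
    simp only [eq_comm (a := i) (b := j)]
    ring
  have hW0sq : W0 ^ 2 = 1 + ∑ i, ∑ j, (S 0)⁻¹ i j * p i * p j := by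
    have : ∑ i, ∑ j, (S 0)⁻¹ i j * p i * p j = W0 ^ 2 * ∑ i, p i ^ 2 := by
      rw [Finset.mul_sum]
      refine Finset.sum_congr rfl fun i _ => ?_
      have := hq i
      calc ∑ j, (S 0)⁻¹ i j * p i * p j = (∑ j, (S 0)⁻¹ i j * p j) * p i := by
            rw [Finset.sum_mul]; exact Finset.sum_congr rfl fun j _ => by ring
        _ = _ := by rw [this]; ring
    rw [this]; linarith
  have hfirst : ∑ i, ∑ j, ((0 * p i + (S 0)⁻¹ i j * (if k = i then W0 * κ k else 0)) * p j
      + (S 0)⁻¹ i j * p i * (if k = j then W0 * κ k else 0)) = 2 * W0 ^ 3 * κ k * p k := by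
    simp only [zero_mul, zero_add, Finset.sum_add_distrib]
    have e1 : ∑ i, ∑ j, (S 0)⁻¹ i j * (if k = i then W0 * κ k else 0) * p j
        = W0 ^ 3 * κ k * p k := by
      rw [Finset.sum_eq_single k]
      · have := hq k
        calc ∑ j, (S 0)⁻¹ k j * (if k = k then W0 * κ k else 0) * p j
            = (∑ j, (S 0)⁻¹ k j * p j) * (W0 * κ k) := by
              rw [Finset.sum_mul]; exact Finset.sum_congr rfl fun j _ => by rw [if_pos rfl]; ring
          _ = _ := by rw [this]; ring
      · intro i _ hi; simp [Ne.symm hi]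
      · simp
    have e2 : ∑ i, ∑ j, (S 0)⁻¹ i j * p i * (if k = j then W0 * κ k else 0)
        = W0 ^ 3 * κ k * p k := by
      rw [← e1, Finset.sum_comm]
      refine Finset.sum_congr rfl fun i _ => Finset.sum_congr rfl fun j _ => ?_
      rw [hSs j i]; ring
    rw [e1, e2]; ring
  have hsecond : ∑ i, ∑ j, ((partialDeriv k (partialDeriv k fun z => (S z)⁻¹ i j) 0 * p i
        + 2 * 0 * (if k = i then W0 * κ k else 0) + (S 0)⁻¹ i j * thirdDeriv u i k k) * p j
      + 2 * (0 * p i + (S 0)⁻¹ i j * (if k = i then W0 * κ k else 0))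
        * (if k = j then W0 * κ k else 0) + (S 0)⁻¹ i j * p i * thirdDeriv u j k k)
      = ρ + 2 * W0 ^ 2 * T + 2 * W0 ^ 2 * κ k ^ 2 * (1 + W0 ^ 2 * p k ^ 2) := by
    have e0 : ∀ i j, ((partialDeriv k (partialDeriv k fun z => (S z)⁻¹ i j) 0 * p i
        + 2 * 0 * (if k = i then W0 * κ k else 0) + (S 0)⁻¹ i j * thirdDeriv u i k k) * p j
      + 2 * (0 * p i + (S 0)⁻¹ i j * (if k = i then W0 * κ k else 0))
        * (if k = j then W0 * κ k else 0) + (S 0)⁻¹ i j * p i * thirdDeriv u j k k)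
        = partialDeriv k (partialDeriv k fun z => (S z)⁻¹ i j) 0 * p i * p j
          + (S 0)⁻¹ i j * p j * thirdDeriv u i k k + (S 0)⁻¹ j i * p i * thirdDeriv u j k k
          + (if k = i then (if k = j then 2 * (S 0)⁻¹ i j * W0 ^ 2 * κ k ^ 2 else 0) else 0) := by
      intro i j
      rw [hSs j i]
      split_ifs <;> ring
    simp_rw [e0, Finset.sum_add_distrib]
    have e1 : ∑ i, ∑ j, (S 0)⁻¹ i j * p j * thirdDeriv u i k k = W0 ^ 2 * T := by
      rw [hT, Finset.mul_sum]
      refine Finset.sum_congr rfl fun i _ => ?_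
      rw [← Finset.sum_mul, hq i]; ring
    have e2 : ∑ i, ∑ j, (S 0)⁻¹ j i * p i * thirdDeriv u j k k = W0 ^ 2 * T := by
      rw [Finset.sum_comm]; exact e1
    have e3 : ∑ i, ∑ j, (if k = i then (if k = j then 2 * (S 0)⁻¹ i j * W0 ^ 2 * κ k ^ 2 else 0)
        else 0) = 2 * W0 ^ 2 * κ k ^ 2 * (1 + W0 ^ 2 * p k ^ 2) := by
      rw [Finset.sum_eq_single k]
      · simp only [if_true]
        rw [Finset.sum_ite_eq, if_pos (Finset.mem_univ k), hinv, if_pos rfl]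
        ring
      · intro i _ hi; simp [Ne.symm hi]
      · simp
    rw [e1, e2, e3]; ring
  have hsq := h3.of_eq hW0sq.symm ((zero_add _).trans hfirst) ((zero_add _).trans hsecond)
  have hW0pos : 0 < W0 := by linarith
  have hsqrt := hsq.comp_real (F := Real.sqrt)
    (Real.contDiffAt_sqrt (by positivity : W0 ^ 2 ≠ 0))
  have hfun : (fun t : ℝ => coordW S u (t • EuclideanSpace.single k 1)) = fun t : ℝ =>
      √(1 + ∑ i, ∑ j, (S (t • EuclideanSpace.single k 1))⁻¹ i j
        * partialDeriv i u (t • EuclideanSpace.single k 1)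
        * partialDeriv j u (t • EuclideanSpace.single k 1)) := rfl
  rw [← hfun, Real.sqrt_sq hW0pos.le] at hsqrt
  set b := deriv Real.sqrt (W0 ^ 2) * (2 * W0 ^ 3 * κ k * p k) with hb
  set c := deriv (deriv Real.sqrt) (W0 ^ 2) * (2 * W0 ^ 3 * κ k * p k) ^ 2
    + deriv Real.sqrt (W0 ^ 2) * (ρ + 2 * W0 ^ 2 * T
      + 2 * W0 ^ 2 * κ k ^ 2 * (1 + W0 ^ 2 * p k ^ 2)) with hc
  have hpos : ∀ᶠ t : ℝ in 𝓝 0, 0 < coordW S u (t • EuclideanSpace.single k 1) :=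
    hsqrt.continuousAt.eventually (lt_mem_nhds hW0pos)
  -- the derivatives of `W` are determined by those of its square
  have huniq := (hsqrt.mul hsqrt).unique (hsq.congr (by
    filter_upwards [hpos] with t ht
    rw [← pow_two, coordW, Real.sq_sqrt]
    by_contra hlt
    rw [coordW, Real.sqrt_eq_zero_of_nonpos (not_le.1 hlt).le] at ht
    exact lt_irrefl _ ht))
  obtain ⟨-, hb', hc'⟩ := huniq
  have hbv : b = W0 ^ 2 * κ k * p k := by
    have : W0 * (b - W0 ^ 2 * κ k * p k) = 0 := by linear_combination hb' / 2
    rcases mul_eq_zero.1 this with h | h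
    · exact absurd h hW0pos.ne'
    · linarith
  refine hsqrt.of_eq rfl hbv ?_
  rw [hbv] at hc'
  have : c = (ρ + 2 * W0 ^ 2 * T + 2 * W0 ^ 2 * κ k ^ 2 * (1 + W0 ^ 2 * p k ^ 2)
      - 2 * (W0 ^ 2 * κ k * p k) ^ 2) / (2 * W0) := by
    rw [eq_div_iff (by positivity)]
    linarith
  rw [this]
  field_simp
  ring

end NormalCoordinates

/-! ### The estimate at a maximum of the test function -/

section EstimateAtMaximum

variable {n : ℕ} {Γ : Set (Fin n → ℝ)} {f : (Fin n → ℝ) → ℝ}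
  {S : EuclideanSpace ℝ (Fin n) → Matrix (Fin n) (Fin n) ℝ}
  {χ u : EuclideanSpace ℝ (Fin n) → ℝ} {Φ : EuclideanSpace ℝ (Fin n) × ℝ → ℝ}
  {κ : Fin n → ℝ} {m : Fin n} {t₀ D cχ c₀ a₀ β Wm : ℝ}

/-- An admissible solution `u` in normal coordinates in which the axes are the principal
directions at the origin, where the principal curvatures are `κ`, the largest of them being `κ_m`,
and where the maximum over `z` and `ξ` of
`H(ξ, ξ) / g(ξ, ξ) * exp (β χ) / (1 - a₀ W)` is attained. -/
structure IsNormalMaximum (Γ : Set (Fin n → ℝ)) (f : (Fin n → ℝ) → ℝ)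
    (S : EuclideanSpace ℝ (Fin n) → Matrix (Fin n) (Fin n) ℝ)
    (χ u : EuclideanSpace ℝ (Fin n) → ℝ) (Φ : EuclideanSpace ℝ (Fin n) × ℝ → ℝ)
    (κ : Fin n → ℝ) (m : Fin n) (D c₀ a₀ β Wm : ℝ) : Prop where
  contDiffAt : ContDiffAt ℝ 4 u 0
  mem : κ ∈ Γ
  curvDeriv_pos : ∀ i, 0 < curvDeriv f i κ
  euler_ge : c₀ ≤ ∑ i, curvDeriv f i κ * κ i
  euler_le : ∑ i, curvDeriv f i κ * κ i ≤ D
  le_max : ∀ i, κ i ≤ κ m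
  value : f κ = Φ (0, u 0)
  metric : coordMetric S u 0 = 1
  form : covHess S u 0 = coordW S u 0 • Matrix.diagonal κ
  one_le : 1 ≤ coordW S u 0
  le_bound : coordW S u 0 ≤ Wm
  equation : ∀ᶠ z in 𝓝 0, ∃ (P : Matrix (Fin n) (Fin n) ℝ) (κ' : Fin n → ℝ),
    P.transpose * coordMetric S u z * P = 1 ∧
    P.transpose * ((coordW S u z)⁻¹ • covHess S u z) * P = Matrix.diagonal κ' ∧
    κ' ∈ Γ ∧ f κ' = Φ (z, u z)
  maximum : ∀ᶠ z in 𝓝 0, ∀ ξ : Fin n → ℝ,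
    (∑ i, ∑ j, covHess S u z i j * ξ i * ξ j) * Real.exp (β * (χ z - χ 0))
        * (1 - a₀ * coordW S u 0)
      ≤ coordW S u 0 * κ m * (∑ i, ∑ j, coordMetric S u z i j * ξ i * ξ j)
        * (1 - a₀ * coordW S u z)

theorem tendsto_smul_single (k : Fin n) :
    Tendsto (fun t : ℝ => t • EuclideanSpace.single k (1 : ℝ)) (𝓝 0)
      (𝓝 (0 : EuclideanSpace ℝ (Fin n))) := by
  have : Continuous fun t : ℝ => t • EuclideanSpace.single k (1 : ℝ) := by fun_prop
  simpa using this.tendsto 0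

/-- The jet of the right hand side along the `k`-th coordinate line. -/
theorem hasJet_rhs (hΦ : ContDiffAt ℝ 2 Φ (0, u 0)) (hu : ContDiffAt ℝ 2 u 0) (k : Fin n) :
    HasJet (fun t : ℝ => Φ (t • EuclideanSpace.single k 1, u (t • EuclideanSpace.single k 1)))
      (Φ (0, u 0))
      (fderiv ℝ Φ (0, u 0) (EuclideanSpace.single k 1, partialDeriv k u 0))
      (fderiv ℝ (fderiv ℝ Φ) (0, u 0) (EuclideanSpace.single k 1, partialDeriv k u 0)
          (EuclideanSpace.single k 1, partialDeriv k u 0)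
        + fderiv ℝ Φ (0, u 0) (0, partialDeriv k (partialDeriv k u) 0)) := by
  have h1 : HasJet (fun t : ℝ => t • EuclideanSpace.single k (1 : ℝ)) 0
      (EuclideanSpace.single k (1 : ℝ)) 0 :=
    (hasJet_poly 0 (EuclideanSpace.single k (1 : ℝ)) 0).congr
      (Eventually.of_forall fun t => by simp)
  have h2 := (h1.map (ContinuousLinearMap.inl ℝ (EuclideanSpace ℝ (Fin n)) ℝ)).add
    ((hasJet_coord hu k).map (ContinuousLinearMap.inr ℝ (EuclideanSpace ℝ (Fin n)) ℝ))
  have h3 := h2.of_eq (a' := ((0 : EuclideanSpace ℝ (Fin n)), u 0))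
    (b' := (EuclideanSpace.single k (1 : ℝ), partialDeriv k u 0))
    (c' := ((0 : EuclideanSpace ℝ (Fin n)), partialDeriv k (partialDeriv k u) 0))
    (by simp) (by simp) (by simp)
  refine (h3.comp hΦ).congr (Eventually.of_forall fun t => ?_)
  simp

/-- The jet of the factor `Y = (1 - a₀ W) / (1 - a₀ W(0)) * exp (-β (χ - χ(0)))`. -/
theorem hasJet_test_factor {W χ : ℝ → ℝ} {W0 W1 W2 χ0 χ1 χ2 ℓ β : ℝ} (hW : HasJet W W0 W1 W2)
    (hχ : HasJet χ χ0 χ1 χ2) :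
    HasJet (fun t => (1 - ℓ * (W t - W0)) * Real.exp (-β * (χ t - χ0))) 1 (-ℓ * W1 - β * χ1)
      ((-ℓ * W1 - β * χ1) ^ 2 - ℓ ^ 2 * W1 ^ 2 - ℓ * W2 - β * χ2) := by
  refine (((hasJet_const 1).sub ((hW.sub (hasJet_const W0)).const_mul ℓ)).mul
    ((hχ.sub (hasJet_const χ0)).const_mul (-β)).exp).of_eq ?_ ?_ ?_
  · simp
  · simp; ring
  · simp; ring

set_option maxHeartbeats 2000000 in
/-- The estimate of the largest principal curvature, with a bound that depends only on the bounds
of the data at the maximum. -/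
theorem exists_bound_of_isNormalMaximum (hf : IsCurvatureFunction Γ f) (hc : ConcaveOn ℝ Γ f)
    (hn : 0 < n) (hD : 0 ≤ D) (hWm : 1 ≤ Wm) (ha₀ : 0 < a₀) (ha₀' : a₀ * Wm ≤ 1 / 2)
    (hcχ : 0 < cχ) (hc₀ : 0 < c₀) :
    ∃ β₀ : ℝ, 0 ≤ β₀ ∧ ∀ β, β₀ ≤ β → ∃ C₁ : ℝ, ∀ S χ Φ u κ m,
      IsNormalData S χ Φ (u 0) D cχ → IsNormalMaximum Γ f S χ u Φ κ m D c₀ a₀ β Wm → κ m ≤ C₁ := by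
  have hn1 : (1 : ℝ) ≤ n := by exact_mod_cast hn
  set C := 1 + 4 * n ^ 2 * D * Wm with hC
  have hC1 : 1 ≤ C := by
    have : 0 ≤ 4 * n ^ 2 * D * Wm := by positivity
    linarith
  have hle : ∀ a b c : ℝ, 0 ≤ a → a ≤ 4 → 0 ≤ b → b ≤ n ^ 2 → 0 ≤ c → c ≤ Wm →
      a * b * D * c ≤ C := by
    intro a b c h1 h2 h3 h4 h5 h6
    have : a * b * D * c ≤ 4 * n ^ 2 * D * Wm := by gcongr
    linarith
  have hnn : (1 : ℝ) ≤ n ^ 2 := one_le_pow₀ hn1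
  have hDC : D ≤ C := by
    have := hle 1 1 1 zero_le_one (by norm_num) zero_le_one hnn zero_le_one hWm
    linarith
  obtain ⟨β₀, hβ₀, hmain⟩ := exists_bound_of_maximum_jets (n := n) (Wm := Wm) hC1 ha₀ hcχ hc₀ hn
  refine ⟨β₀, hβ₀, fun β hβ => ?_⟩
  obtain ⟨C₁, hC₁⟩ := hmain β hβ
  refine ⟨C₁, fun S χ Φ u κ m h hu => ?_⟩
  set W := coordW S u 0 with hW
  set p : Fin n → ℝ := fun i => partialDeriv i u 0 with hp
  set w : Fin n → ℝ := fun i => curvDeriv f i κ with hw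
  have hu4 := hu.contDiffAt
  have hW1 : 1 ≤ W := hu.one_le
  have hWm' : W ≤ Wm := hu.le_bound
  have hW0 : 0 < W := by linarith
  obtain ⟨hWr, -, -⟩ := inv_metric_of_coordMetric_eq_one h.isUnit.self_of_nhds hu.metric hW1
  have hp1 : ∀ i, |p i| ≤ 1 := by
    intro i
    have h1 : p i ^ 2 ≤ ∑ j, p j ^ 2 :=
      Finset.single_le_sum (f := fun j => p j ^ 2) (fun j _ => sq_nonneg _) (Finset.mem_univ i)
    have h2 : ∑ j, p j ^ 2 ≤ 1 := by
      by_contra hlt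
      push Not at hlt
      have : W ^ 2 * (1 - ∑ i, p i ^ 2) ≤ 0 :=
        mul_nonpos_of_nonneg_of_nonpos (sq_nonneg _) (by linarith)
      linarith
    rw [← sq_le_one_iff_abs_le_one]
    linarith
  have hanti : ∀ i j, κ j ≤ κ i → w i ≤ w j := fun i j hij => hf.curvDeriv_anti hc hu.mem hij
  have hs0 : 0 < ∑ i, w i * κ i := hc₀.trans_le hu.euler_ge
  have hκ := abs_le_of_sum_curvDeriv_pos hu.curvDeriv_pos hanti hs0 hu.le_max
  have hK0 : 0 < κ m := pos_of_sum_curvDeriv_pos hu.curvDeriv_pos hs0 hu.le_max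
  have hu2 : ∀ k i, partialDeriv k (partialDeriv i u) 0 = if k = i then W * κ k else 0 := by
    intro k i
    have := congrFun (congrFun hu.form k) i
    rw [covHess_zero h, Matrix.smul_apply, Matrix.diagonal_apply, smul_eq_mul] at this
    rw [this]; split_ifs <;> simp [hW]
  set ℓ := a₀ / (1 - a₀ * W) with hℓ
  have haW : a₀ * W ≤ 1 / 2 := (mul_le_mul_of_nonneg_left hWm' ha₀.le).trans ha₀'
  have haW' : 0 < 1 - a₀ * W := by linarith
  have ha1 : a₀ ≤ 1 / 2 := by nlinarith
  have hℓ0 : a₀ ≤ ℓ := by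
    rw [hℓ, le_div_iff₀ haW']
    have : 0 ≤ a₀ * W := by positivity
    nlinarith
  have hℓ1 : ℓ ≤ 1 := by
    rw [hℓ, div_le_one haW']; linarith
  -- the jets along the coordinate lines
  set Γ1 := fun l i j k => partialDeriv k (christoffelOf S l i j) 0 with hΓ1
  set Γ2 := fun l i j k => partialDeriv k (partialDeriv k (christoffelOf S l i j)) 0 with hΓ2
  set S2 := fun i j k => partialDeriv k (partialDeriv k fun z => S z i j) 0 with hS2
  set χ1 : Fin n → ℝ := fun k => partialDeriv k χ 0 with hχ1
  set χ2 : Fin n → ℝ := fun k => partialDeriv k (partialDeriv k χ) 0 with hχ2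
  set u4 := fun i k => partialDeriv k (partialDeriv k (partialDeriv i (partialDeriv i u))) 0
    with hu4'
  set ρ : Fin n → ℝ := fun k => ∑ i, ∑ j, partialDeriv k (partialDeriv k fun z => (S z)⁻¹ i j) 0
            * p i * p j with hρ
  set γ := fun i j k => ∑ l, Γ1 l i j k * p l with hγ
  set H3 := fun i j k => thirdDeriv u i j k - γ i j k with hH3
  set X : Fin n → ℝ := fun k => u4 m k - ∑ l, (Γ2 l m m k * p l
    + 2 * Γ1 l m m k * (if k = l then W * κ k else 0)) with hX
  set Z : Fin n → ℝ := fun k => u4 k m - ∑ l, (Γ2 l k k m * p l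
    + 2 * Γ1 l k k m * (if m = l then W * κ m else 0)) with hZ
  set W1 : Fin n → ℝ := fun k => W ^ 2 * κ k * p k with hW1'
  set W2 : Fin n → ℝ := fun k => W * (∑ l, p l * thirdDeriv u l k k) + W * κ k ^ 2
    + ρ k / (2 * W) with hW2'
  set c : Fin n → ℝ := fun k => -ℓ * W1 k - β * χ1 k with hcdef
  set G1 : Fin n → Matrix (Fin n) (Fin n) ℝ := fun k => Matrix.of fun i j =>
    W * κ k * ((if i = k then 1 else 0) * p j + p i * (if j = k then 1 else 0)) with hG1
  set G2 : Fin n → Matrix (Fin n) (Fin n) ℝ := fun k => Matrix.of fun i j =>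
    S2 i j k + (thirdDeriv u i k k * p j
        + 2 * (if k = i then W * κ k else 0) * (if k = j then W * κ k else 0)
        + p i * thirdDeriv u j k k) with hG2
  set H1 : Fin n → Matrix (Fin n) (Fin n) ℝ := fun k => Matrix.of fun i j => H3 i j k with hH1
  set H2 : Fin n → Matrix (Fin n) (Fin n) ℝ := fun k => Matrix.of fun i j =>
    partialDeriv k (partialDeriv k (partialDeriv i (partialDeriv j u))) 0
      - ∑ l, (Γ2 l i j k * p l + 2 * Γ1 l i j k * (if k = l then W * κ k else 0)) with hH2
  set ψ1 : Fin n → ℝ := fun k => fderiv ℝ Φ (0, u 0) (EuclideanSpace.single k 1, p k) with hψ1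
  set ψ2 : ℝ := fderiv ℝ (fderiv ℝ Φ) (0, u 0) (EuclideanSpace.single m 1, p m)
          (EuclideanSpace.single m 1, p m)
        + fderiv ℝ Φ (0, u 0) (0, partialDeriv m (partialDeriv m u) 0) with hψ2
  have jg : ∀ k i j, HasJet (fun t : ℝ => coordMetric S u (t • EuclideanSpace.single k 1) i j)
      ((1 : Matrix (Fin n) (Fin n) ℝ) i j) (G1 k i j) (G2 k i j) := by
    intro k i j
    refine (hasJet_coordMetric h hu4 k i j).of_eq (by rw [hu.metric]) ?_ ?_
    · rw [hu2, hu2]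
      simp only [hG1, Matrix.of_apply, eq_comm (a := k)]
      split_ifs <;> ring
    · rw [hu2, hu2]; rfl
  have jH : ∀ k i j, HasJet (fun t : ℝ => covHess S u (t • EuclideanSpace.single k 1) i j)
      ((W • Matrix.diagonal κ) i j) (H1 k i j) (H2 k i j) := by
    intro k i j
    refine (hasJet_covHess h hu4 k i j).of_eq (by rw [hu.form]) ?_ ?_
    · rw [thirdDeriv_comm_left hu4]; rfl
    · simp only [hu2]; rfl
  have jW : ∀ k, HasJet (fun t : ℝ => coordW S u (t • EuclideanSpace.single k 1)) W (W1 k) (W2 k) :=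
    fun k => hasJet_coordW h hu4 hu.metric hW1 hu.form k
  have jψ : ∀ k, HasJet (fun t : ℝ => Φ (t • EuclideanSpace.single k 1,
      u (t • EuclideanSpace.single k 1))) (f κ) (ψ1 k)
      (fderiv ℝ (fderiv ℝ Φ) (0, u 0) (EuclideanSpace.single k 1, p k)
          (EuclideanSpace.single k 1, p k)
        + fderiv ℝ Φ (0, u 0) (0, partialDeriv k (partialDeriv k u) 0)) := fun k =>
    (hasJet_rhs h.contDiffAt_rhs (hu4.of_le (by norm_num)) k).of_eq hu.value.symm rfl rfl
  have jY : ∀ k, HasJet (fun t : ℝ => (1 - ℓ * (coordW S u (t • EuclideanSpace.single k 1) - W))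
      * Real.exp (-β * (χ (t • EuclideanSpace.single k 1) - χ 0))) 1 (c k)
      (c k ^ 2 - ℓ ^ 2 * W1 k ^ 2 - ℓ * W2 k - β * χ2 k) := fun k =>
    hasJet_test_factor (jW k) (hasJet_coord h.contDiffAt_convex k)
  have hΓs : ∀ l i j, christoffelOf S l i j = christoffelOf S l j i := fun l i j =>
    christoffelOf_symm h.symm l i j
  have hH3s : ∀ i j k, H3 i j k = H3 j i k := by
    intro i j k
    simp only [hH3, hγ, hΓ1, thirdDeriv_comm_left hu4 i j k]
    congr 1
    exact Finset.sum_congr rfl fun l _ => by rw [hΓs]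
  have hG1t : ∀ k, (G1 k).transpose = G1 k := by
    intro k; ext i j
    simp only [hG1, Matrix.transpose_apply, Matrix.of_apply]; ring
  have hG2t : ∀ k, (G2 k).transpose = G2 k := by
    intro k; ext i j
    simp only [hG2, hS2, Matrix.transpose_apply, Matrix.of_apply]
    rw [show (fun z => S z j i) = fun z => S z i j from funext fun z => h.symm z j i]
    ring
  have hH1t : ∀ k, (H1 k).transpose = H1 k := by
    intro k; ext i j
    exact hH3s j i k
  have hgs : ∀ z, (coordMetric S u z).transpose = coordMetric S u z := by
    intro z; ext i j
    simp only [coordMetric, Matrix.transpose_apply, Matrix.add_apply, Matrix.vecMulVec_apply,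
      h.symm z j i]
    ring
  -- the conditions at the maximum
  have htest : ∀ k, ∀ᶠ t : ℝ in 𝓝 0, ∀ ξ : Fin n → ℝ,
      ∑ i, ∑ j, covHess S u (t • EuclideanSpace.single k 1) i j * ξ i * ξ j
      ≤ W * κ m * ((1 - ℓ * (coordW S u (t • EuclideanSpace.single k 1) - W))
        * Real.exp (-β * (χ (t • EuclideanSpace.single k 1) - χ 0))
        * ∑ i, ∑ j, coordMetric S u (t • EuclideanSpace.single k 1) i j * ξ i * ξ j) := by
    intro k
    filter_upwards [(tendsto_smul_single k).eventually hu.maximum] with t ht ξ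
    have h1 := ht ξ
    set z : EuclideanSpace ℝ (Fin n) := t • EuclideanSpace.single k 1
    set e := Real.exp (β * (χ z - χ 0)) with he
    have he0 : 0 < e := Real.exp_pos _
    have he' : Real.exp (-β * (χ z - χ 0)) = e⁻¹ := by rw [he, ← Real.exp_neg]; congr 1; ring
    have hℓW : 1 - ℓ * (coordW S u z - W) = (1 - a₀ * coordW S u z) / (1 - a₀ * W) := by
      rw [hℓ]; field_simp; ring
    rw [he', hℓW]
    have h2 : W * κ m * ((1 - a₀ * coordW S u z) / (1 - a₀ * W) * e⁻¹
        * ∑ i, ∑ j, coordMetric S u z i j * ξ i * ξ j)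
        = (W * κ m * (∑ i, ∑ j, coordMetric S u z i j * ξ i * ξ j) * (1 - a₀ * coordW S u z))
          / (e * (1 - a₀ * W)) := by
      field_simp
    rw [h2, le_div_iff₀ (by positivity), ← mul_assoc]
    exact h1
  have T0 : ∀ k, H1 k m m = W * κ m * (c k + G1 k m m) ∧ H2 k m m
      ≤ W * κ m * (c k ^ 2 - ℓ ^ 2 * W1 k ^ 2 - ℓ * W2 k - β * χ2 k + 2 * c k * G1 k m m
        + G2 k m m) := by
    intro k
    have := quadratic_form_test (v := 0) (hG1t k) (hH1t k) (jg k) (jH k) (jY k) (htest k)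
    simpa using this
  -- The velocity of the test vector cancels the variation of the metric in the direction `m`, as in
  -- the frame to be used for the differentiated equation.
  have Tm := (quadratic_form_test (v := fun a => -(W * κ m) * p a) (hG1t m) (hH1t m) (jg m) (jH m)
    (jY m) (htest m)).2
  have hG1m : G1 m m m = 2 * (W * κ m) * p m := by
    simp only [hG1, Matrix.of_apply, if_true]; ring
  have hG1k : ∀ k, k ≠ m → G1 k m m = 0 := by
    intro k hk
    simp [hG1, Ne.symm hk]
  have hG2i : ∀ k i, i ≠ k → G2 k i i = S2 i i k + 2 * p i * thirdDeriv u i k k := by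
    intro k i hik
    simp only [hG2, Matrix.of_apply, if_neg (Ne.symm hik)]; ring
  -- the differentiated equation
  have hD2 : ∀ k N, G1 k + N.transpose + N = 0 → _ := fun k N hN =>
    hf.differentiated_equation_of_velocity hc hu.mem
      ((tendsto_smul_single k).eventually hu.equation) (Eventually.of_forall fun t => hgs _)
      (hG1t k) (hG2t k) (hH1t k) (jg k) (jH k) hN hW0 (jW k) (jψ k)
  have E1 : ∀ l, ∑ i, w i * H3 i i l = W * ψ1 l + 2 * W ^ 2 * w l * κ l ^ 2 * p l
      + W ^ 2 * κ l * p l * ∑ i, w i * κ i := by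
    intro l
    refine first_order_of_velocity (H1 := H1 l) rfl (hD2 l
      (fun i j => -(W * κ l) * p i * (if j = l then 1 else 0)) ?_).1 rfl
    ext i j
    change W * κ l * ((if i = l then 1 else 0) * p j + p i * (if j = l then 1 else 0))
      + -(W * κ l) * p j * (if i = l then 1 else 0)
      + -(W * κ l) * p i * (if j = l then 1 else 0) = 0
    ring
  have hγle : ∀ i j k, |γ i j k| ≤ n * D := by
    intro i j k
    have := abs_sum_le_card Finset.univ (F := fun l => Γ1 l i j k * p l) (D := D) (fun l _ => by
      rw [abs_mul]
      exact (mul_le_of_le_one_right (abs_nonneg _) (hp1 l)).trans (h.christoffel_first l i j k))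
    simpa using this
  have hρle : ∀ k, |ρ k| ≤ n ^ 2 * D := by
    intro k
    have h1 : ∀ i, |∑ j, partialDeriv k (partialDeriv k fun z => (S z)⁻¹ i j) 0 * p i * p j|
        ≤ n * D := by
      intro i
      have := abs_sum_le_card Finset.univ (F := fun j =>
        partialDeriv k (partialDeriv k fun z => (S z)⁻¹ i j) 0 * p i * p j) (D := D) (fun j _ => by
          rw [abs_mul, abs_mul]
          exact (mul_le_of_le_one_right (by positivity) (hp1 j)).trans
            ((mul_le_of_le_one_right (abs_nonneg _) (hp1 i)).trans (h.inv_second i j k)))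
      simpa using this
    have := abs_sum_le_card Finset.univ (fun i _ => h1 i)
    simp only [Finset.card_univ, Fintype.card_fin] at this
    refine this.trans (le_of_eq ?_); ring
  have hsum : ∀ a k, |∑ l, (Γ2 l a a k * p l + 2 * Γ1 l a a k * (if k = l then W * κ k else 0))|
      ≤ n * D + 2 * D * (Wm * (n * κ m)) := by
    intro a k
    rw [Finset.sum_add_distrib]
    refine (abs_add_le _ _).trans (add_le_add ?_ ?_)
    · have := abs_sum_le_card Finset.univ (F := fun l => Γ2 l a a k * p l) (D := D) (fun l _ => by
        rw [abs_mul]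
        exact (mul_le_of_le_one_right (abs_nonneg _) (hp1 l)).trans
          (h.christoffel_second l a a k))
      simpa using this
    · simp only [mul_ite, mul_zero, Finset.sum_ite_eq, Finset.mem_univ, if_true]
      rw [abs_mul, abs_mul, abs_mul, abs_of_pos hW0, abs_two]
      have h1 := h.christoffel_first k a a k
      have h2 := hκ k
      gcongr
  have hsingle : ∀ k : Fin n, ‖(EuclideanSpace.single k (1 : ℝ), p k)‖ ≤ 1 := by
    intro k
    rw [Prod.norm_def]
    refine max_le ?_ (hp1 k)
    simp
  have hψ1le : ∀ k, |ψ1 k| ≤ D := by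
    intro k
    refine ((fderiv ℝ Φ (0, u 0)).le_opNorm _).trans ?_
    calc _ ≤ D * 1 := mul_le_mul h.rhs_first (hsingle k) (norm_nonneg _) hD
      _ = D := mul_one D
  have hψ2le : |ψ2| ≤ D * (1 + Wm * κ m) := by
    have h1 : |fderiv ℝ (fderiv ℝ Φ) (0, u 0) (EuclideanSpace.single m 1, p m)
          (EuclideanSpace.single m 1, p m)| ≤ D := by
      refine ((fderiv ℝ (fderiv ℝ Φ) (0, u 0)).le_opNorm₂ _ _).trans ?_
      calc _ ≤ D * 1 * 1 := by
            have h2 := h.rhs_second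
            have h3 := hsingle m
            gcongr
        _ = D := by ring
    have h2 : |fderiv ℝ Φ (0, u 0) (0, partialDeriv m (partialDeriv m u) 0)| ≤ D * (Wm * κ m) := by
      refine ((fderiv ℝ Φ (0, u 0)).le_opNorm _).trans ?_
      rw [hu2, if_pos rfl, Prod.norm_def, norm_zero, max_eq_right (norm_nonneg _),
        Real.norm_of_nonneg (by positivity)]
      exact mul_le_mul h.rhs_first (mul_le_mul_of_nonneg_right hWm' hK0.le) (by positivity) hD
    refine (abs_add_le _ _).trans ?_
    linarith
  refine hC₁ m κ w p c χ1 χ2 ρ X Z (fun k => S2 m m k) (fun k => S2 k k m) ψ1 W1 W2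
    (thirdDeriv u) H3 γ W ℓ ψ2
    (H2 m m m - 4 * W * κ m * (∑ a, H1 m m a * p a) + 2 * W ^ 3 * κ m ^ 2 * (∑ a, κ a * p a ^ 2)
        - W * κ m * (G2 m m m - 4 * W * κ m * (∑ a, G1 m m a * p a)
          + 2 * W ^ 2 * κ m ^ 2 * ∑ a, p a ^ 2))
    hu.curvDeriv_pos hW1 hWm' hℓ0 hℓ1 hu.euler_ge (hu.euler_le.trans hDC) hκ hanti hp1 ?_ ?_ ?_ ?_
    ?_ ?_ ?_ ?_ h.convex_second (thirdDeriv_comm_left hu4) (thirdDeriv_comm_right hu4) ?_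
    (fun _ => rfl) (fun _ => rfl) (fun _ => rfl) ?_ ?_ ?_ E1 ?_
  · intro i j k
    have := hle 1 n 1 zero_le_one (by norm_num) (by positivity) (by nlinarith) zero_le_one hWm
    linarith [hγle i j k]
  · intro k
    have := hle 1 (n ^ 2) 1 zero_le_one (by norm_num) (by positivity) le_rfl zero_le_one hWm
    linarith [hρle k]
  · intro hK k hk
    have e : X k - Z k
        = (∑ l, (Γ2 l k k m * p l + 2 * Γ1 l k k m * (if m = l then W * κ m else 0)))
          - ∑ l, (Γ2 l m m k * p l + 2 * Γ1 l m m k * (if k = l then W * κ k else 0)) := by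
      simp only [hX, hZ, hu4', partialDeriv_four_comm hu4 m k]
      ring
    rw [e]
    refine (abs_sub _ _).trans ((add_le_add (hsum k m) (hsum m k)).trans ?_)
    have h1 := hle 4 n Wm (by norm_num) le_rfl (by positivity) (by nlinarith) (by linarith) le_rfl
    have h2 : n * D ≤ n * D * Wm := le_mul_of_one_le_right (by positivity) hWm
    have h3 := mul_le_mul_of_nonneg_right h1 (by linarith : 0 ≤ 1 + κ m)
    have h4 : 0 ≤ n * D * Wm := by positivity
    linarith
  · exact fun k => (h.second m m k).trans hDC
  · exact fun k => (h.second k k m).trans hDC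
  · exact fun k => (hψ1le k).trans hDC
  · intro hK
    refine hψ2le.trans ?_
    have h1 := hle 1 1 Wm zero_le_one (by norm_num) zero_le_one hnn (by linarith) le_rfl
    have h2 : D ≤ D * Wm := le_mul_of_one_le_right hD hWm
    have h3 := mul_le_mul_of_nonneg_right h1 (by linarith : 0 ≤ 1 + κ m)
    linarith
  · exact fun k => (h.convex_first k).trans hDC
  · intro i j k
    simp only [hH3]; ring
  · intro k
    have h1 : H3 m m k = H1 k m m := rfl
    rw [h1, (T0 k).1]
    split_ifs with hk
    · subst hk; rw [hG1m]; ring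
    · rw [hG1k k hk]; ring
  · intro k hk
    have h1 := (T0 k).2
    rw [hG1k k hk, hG2i k m (Ne.symm hk)] at h1
    have h2 : X k = H2 k m m := rfl
    rw [h2]
    linarith
  · have e1 : ∑ a, H1 m m a * (-(W * κ m) * p a) = -(W * κ m) * ∑ a, H1 m m a * p a := by
      rw [Finset.mul_sum]; exact Finset.sum_congr rfl fun a _ => by ring
    have e2 : ∑ a, κ a * (-(W * κ m) * p a) ^ 2 = W ^ 2 * κ m ^ 2 * ∑ a, κ a * p a ^ 2 := by
      rw [Finset.mul_sum]; exact Finset.sum_congr rfl fun a _ => by ring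
    have e3 : ∑ a, G1 m m a * (-(W * κ m) * p a) = -(W * κ m) * ∑ a, G1 m m a * p a := by
      rw [Finset.mul_sum]; exact Finset.sum_congr rfl fun a _ => by ring
    have e4 : ∑ a, (-(W * κ m) * p a) ^ 2 = W ^ 2 * κ m ^ 2 * ∑ a, p a ^ 2 := by
      rw [Finset.mul_sum]; exact Finset.sum_congr rfl fun a _ => by ring
    rw [e1, e2, e3, e4, hG1m] at Tm
    linarith
  · intro s
    set s' : Fin n → ℝ := fun i => if i = m then 0 else s i with hs'
    have h1 := (hD2 m (fun i j => (-(W * κ m) * p i + s' i) * (if j = m then 1 else 0)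
      - (if i = m then 1 else 0) * s' j) (by
        ext i j
        change W * κ m * ((if i = m then 1 else 0) * p j + p i * (if j = m then 1 else 0))
          + ((-(W * κ m) * p j + s' j) * (if i = m then 1 else 0)
            - (if j = m then 1 else 0) * s' i)
          + ((-(W * κ m) * p i + s' i) * (if j = m then 1 else 0)
            - (if i = m then 1 else 0) * s' j) = 0
        ring)).2
    have h2 := second_order_of_velocity (m := m) (p := p) (s := s') (Z := Z)
      (Sm := fun k => S2 k k m) (u3m := fun k => thirdDeriv u k m m) (by simp [hs'])
      (fun i j => rfl) (hH1t m) rfl (fun i hi => hG2i m i hi) (fun i _ => rfl) h1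
    have h3 : ∑ j ∈ Finset.univ.erase m, (w m - w j) *
        (4 * (H1 m m j - W ^ 2 * κ m * κ j * p j) * s' j - 2 * W * (κ m - κ j) * s' j ^ 2)
        = ∑ j ∈ Finset.univ.erase m, (w m - w j) *
        (4 * (H3 m j m - W ^ 2 * κ m * κ j * p j) * s j - 2 * W * (κ m - κ j) * s j ^ 2) := by
      refine Finset.sum_congr rfl fun j hj => ?_
      have : s' j = s j := by simp [hs', Finset.ne_of_mem_erase hj]
      rw [this]; rfl
    rw [h3] at h2
    refine le_trans (le_of_eq ?_) h2
    simp only [hW1', hW2', hψ2]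
    field_simp
    ring

end EstimateAtMaximum

/-! ### Normal coordinates -/

section NormalMap

variable {n : ℕ}

section Parameters

variable {V X Y : Type*} [NormedAddCommGroup V] [NormedSpace ℝ V] [NormedAddCommGroup X]
  [NormedSpace ℝ X] [NormedAddCommGroup Y] [NormedSpace ℝ Y]

theorem contDiffAt_det {A : V → Matrix (Fin n) (Fin n) ℝ} {v : V} {k : WithTop ℕ∞}
    (hA : ∀ i j, ContDiffAt ℝ k (fun v => A v i j) v) :
    ContDiffAt ℝ k (fun v => (A v).det) v := by
  simp only [Matrix.det_apply']
  exact ContDiffAt.sum fun s _ => contDiffAt_const.mul (contDiffAt_prod fun i _ => hA (s i) i)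

theorem contDiffAt_matrix_inv {A : V → Matrix (Fin n) (Fin n) ℝ} {v : V} {k : WithTop ℕ∞}
    (hA : ∀ i j, ContDiffAt ℝ k (fun v => A v i j) v) (hv : IsUnit (A v).det) (i j : Fin n) :
    ContDiffAt ℝ k (fun v => (A v)⁻¹ i j) v := by
  simp only [Matrix.inv_def, Matrix.smul_apply, Ring.inverse_eq_inv', smul_eq_mul,
    Matrix.adjugate_apply]
  refine ((contDiffAt_det hA).inv hv.ne_zero).mul (contDiffAt_det fun a b => ?_)
  simp only [Matrix.updateRow_apply]
  split_ifs
  · exact contDiffAt_const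
  · exact hA a b

/-- The derivative along the fibres of a function on a product. -/
theorem contDiffAt_fibre_fderiv {F : X → V → Y} {q : X × V} {m k : WithTop ℕ∞}
    (hF : ContDiffAt ℝ k (fun q : X × V => F q.1 q.2) q) (hk : m + 1 ≤ k) :
    ContDiffAt ℝ m (fun q : X × V => fderiv ℝ (F q.1) q.2) q := by
  refine ContDiffAt.fderiv (f := fun q : X × V => F q.1) (g := Prod.snd) (n := k) ?_
    contDiffAt_snd hk
  exact ContDiffAt.comp (q, q.2) (g := fun q : X × V => F q.1 q.2)
    (f := fun r : (X × V) × V => (r.1.1, r.2)) hF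
    ((contDiffAt_fst.comp _ contDiffAt_fst).prodMk contDiffAt_snd)

theorem contDiffAt_fibre_partialDeriv {F : X → EuclideanSpace ℝ (Fin n) → ℝ}
    {q : X × EuclideanSpace ℝ (Fin n)} {m k : WithTop ℕ∞}
    (hF : ContDiffAt ℝ k (fun q : X × EuclideanSpace ℝ (Fin n) => F q.1 q.2) q) (hk : m + 1 ≤ k)
    (i : Fin n) :
    ContDiffAt ℝ m (fun q : X × EuclideanSpace ℝ (Fin n) => partialDeriv i (F q.1) q.2) q :=
  (contDiffAt_fibre_fderiv hF hk).clm_apply contDiffAt_const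

theorem eventually_contDiffAt_fibre {Z : Type*} [TopologicalSpace Z] {F : X → V → Y} {z : Z}
    {a : Z → X} {b : Z → V} {k : WithTop ℕ∞} (ha : ContinuousAt a z) (hb : ContinuousAt b z)
    (hF : ContDiffAt ℝ k (fun q : X × V => F q.1 q.2) (a z, b z)) (hk : k ≠ ∞) :
    ∀ᶠ z' in 𝓝 z, ContDiffAt ℝ k (F (a z')) (b z') := by
  filter_upwards [(ha.prodMk hb).eventually (hF.eventually hk)] with z' hz'
  exact ContDiffAt.comp (b z') (g := fun q : X × V => F q.1 q.2) (f := fun v => (a z', v)) hz'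
    (contDiffAt_const.prodMk contDiffAt_id)

theorem exists_eventually_abs_le {ι Z : Type*} [Finite ι] [TopologicalSpace Z] {g : ι → Z → ℝ}
    {z : Z} (hg : ∀ i, ContinuousAt (g i) z) :
    ∃ D : ℝ, 0 ≤ D ∧ ∀ᶠ z' in 𝓝 z, ∀ i, |g i z'| ≤ D := by
  obtain ⟨B, hB⟩ := (finite_range fun i => |g i z|).bddAbove
  refine ⟨|B| + 1, by positivity, eventually_all.2 fun i => ?_⟩
  have h1 : |g i z| < |B| + 1 :=
    lt_of_le_of_lt ((hB (mem_range_self i)).trans (le_abs_self B)) (by linarith)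
  exact ((hg i).abs.eventually (gt_mem_nhds h1)).mono fun _ h => h.le

theorem exists_eventually_pos_le {ι Z : Type*} [Finite ι] [TopologicalSpace Z] {g : ι → Z → ℝ}
    {z : Z} (hg : ∀ i, ContinuousAt (g i) z) (hpos : ∀ i, 0 < g i z) :
    ∃ c : ℝ, 0 < c ∧ ∀ᶠ z' in 𝓝 z, ∀ i, c ≤ g i z' := by
  obtain ⟨D, hD, h⟩ := exists_eventually_abs_le (g := fun i z => (g i z)⁻¹)
    (fun i => (hg i).inv₀ (hpos i).ne')
  refine ⟨(D + 1)⁻¹, by positivity, ?_⟩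
  filter_upwards [h, eventually_all.2 fun i => (hg i).eventually (lt_mem_nhds (hpos i))]
    with z' h1 h2 i
  rw [inv_le_comm₀ (by positivity) (h2 i)]
  exact (le_abs_self _).trans ((h1 i).trans (by linarith))

end Parameters

variable {S : EuclideanSpace ℝ (Fin n) → Matrix (Fin n) (Fin n) ℝ}
  {θ : EuclideanSpace ℝ (Fin n) × (Fin n → Fin n → ℝ)}

/-- Normal coordinates of second order for the metric `S`: the map
`y ↦ z + P y - ½ Γ(z)(P y, P y)`, where `z = θ.1` is the centre and the columns of `P = θ.2` are
the images of the coordinate axes. -/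
noncomputable def normalMap (S : EuclideanSpace ℝ (Fin n) → Matrix (Fin n) (Fin n) ℝ)
    (θ : EuclideanSpace ℝ (Fin n) × (Fin n → Fin n → ℝ)) (y : EuclideanSpace ℝ (Fin n)) :
    EuclideanSpace ℝ (Fin n) :=
  WithLp.toLp 2 fun a => θ.1 a + ∑ i, θ.2 a i * y i
    - 1 / 2 * ∑ b, ∑ c, christoffelOf S a b c θ.1 * ((∑ i, θ.2 b i * y i) * ∑ i, θ.2 c i * y i)

/-- The metric `S` in normal coordinates. -/
noncomputable def normalMetric (S : EuclideanSpace ℝ (Fin n) → Matrix (Fin n) (Fin n) ℝ)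
    (θ : EuclideanSpace ℝ (Fin n) × (Fin n → Fin n → ℝ)) (y : EuclideanSpace ℝ (Fin n)) :
    Matrix (Fin n) (Fin n) ℝ :=
  (jacobian (normalMap S θ) y).transpose * S (normalMap S θ y) * jacobian (normalMap S θ) y

theorem normalMap_zero : normalMap S θ 0 = θ.1 := by
  ext a; simp [normalMap]

theorem contDiff_normalMap {k : WithTop ℕ∞} : ContDiff ℝ k (normalMap S θ) := by
  rw [contDiff_euclidean]
  intro a
  simp only [normalMap]
  fun_prop

theorem partialDeriv_normalMap (a i : Fin n) (y : EuclideanSpace ℝ (Fin n)) :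
    partialDeriv i (fun w => normalMap S θ w a) y = θ.2 a i
      - 1 / 2 * ∑ b, ∑ c, christoffelOf S a b c θ.1
        * (θ.2 b i * (∑ j, θ.2 c j * y j) + (∑ j, θ.2 b j * y j) * θ.2 c i) := by
  set L : Fin n → EuclideanSpace ℝ (Fin n) →L[ℝ] ℝ := fun b =>
    ∑ j, θ.2 b j • EuclideanSpace.proj (𝕜 := ℝ) j with hL
  have hl : ∀ b, HasFDerivAt (fun w : EuclideanSpace ℝ (Fin n) => ∑ j, θ.2 b j * w j)
      (L b) y := fun b =>
    HasFDerivAt.fun_sum fun j _ => ((EuclideanSpace.proj (𝕜 := ℝ) j).hasFDerivAt).const_mul _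
  have hli : ∀ b, L b (EuclideanSpace.single i 1) = θ.2 b i := fun b => by simp [hL]
  have h := ((hl a).const_add (θ.1 a)).sub (((HasFDerivAt.fun_sum (u := Finset.univ) fun b _ =>
    HasFDerivAt.fun_sum (u := Finset.univ) fun c _ =>
      ((hl b).mul (hl c)).const_mul (christoffelOf S a b c θ.1))).const_mul (1 / 2))
  unfold partialDeriv
  refine (congrArg (fun L : EuclideanSpace ℝ (Fin n) →L[ℝ] ℝ => L (EuclideanSpace.single i 1))
    (HasFDerivAt.fderiv h)).trans ?_
  simp only [sub_apply, smul_apply, sum_apply, add_apply, smul_eq_mul, hli]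
  congr 2
  refine Finset.sum_congr rfl fun b _ => Finset.sum_congr rfl fun c _ => ?_
  ring

theorem jacobian_normalMap_zero (a i : Fin n) : jacobian (normalMap S θ) 0 a i = θ.2 a i := by
  change partialDeriv i (fun w => normalMap S θ w a) 0 = _
  rw [partialDeriv_normalMap]; simp

theorem partialDeriv_jacobian_normalMap (hS : ∀ z i j, S z i j = S z j i) (a i j : Fin n) :
    partialDeriv i (fun w => jacobian (normalMap S θ) w a j) 0
      = - ∑ b, ∑ c, christoffelOf S a b c θ.1 * θ.2 b i * θ.2 c j := by
  have e : (fun w => jacobian (normalMap S θ) w a j) = fun y : EuclideanSpace ℝ (Fin n) => θ.2 a j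
      - 1 / 2 * ∑ b, ∑ c, christoffelOf S a b c θ.1
        * (θ.2 b j * (∑ j, θ.2 c j * y j) + (∑ j, θ.2 b j * y j) * θ.2 c j) :=
    funext fun y => partialDeriv_normalMap a j y
  rw [e]
  set L : Fin n → EuclideanSpace ℝ (Fin n) →L[ℝ] ℝ := fun b =>
    ∑ j, θ.2 b j • EuclideanSpace.proj (𝕜 := ℝ) j with hL
  have hl : ∀ b, HasFDerivAt (fun w : EuclideanSpace ℝ (Fin n) => ∑ j, θ.2 b j * w j)
      (L b) 0 := fun b =>
    HasFDerivAt.fun_sum fun j _ => ((EuclideanSpace.proj (𝕜 := ℝ) j).hasFDerivAt).const_mul _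
  have hli : ∀ b, L b (EuclideanSpace.single i 1) = θ.2 b i := fun b => by simp [hL]
  have h := ((HasFDerivAt.fun_sum (u := Finset.univ) fun b _ =>
    HasFDerivAt.fun_sum (u := Finset.univ) fun c _ =>
      (((hl c).const_mul (θ.2 b j)).add ((hl b).mul_const (θ.2 c j))).const_mul
        (christoffelOf S a b c θ.1)).const_mul (1 / 2 : ℝ)).const_sub (θ.2 a j)
  unfold partialDeriv
  refine (congrArg (fun L : EuclideanSpace ℝ (Fin n) →L[ℝ] ℝ => L (EuclideanSpace.single i 1))
    (HasFDerivAt.fderiv h)).trans ?_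
  simp only [neg_apply, smul_apply, sum_apply, add_apply, smul_eq_mul, hli]
  have e1 : ∑ b, ∑ c, christoffelOf S a b c θ.1 * (θ.2 b j * θ.2 c i + θ.2 c j * θ.2 b i)
      = 2 * ∑ b, ∑ c, christoffelOf S a b c θ.1 * θ.2 b i * θ.2 c j := by
    have e2 : ∑ b, ∑ c, christoffelOf S a b c θ.1 * (θ.2 b j * θ.2 c i)
        = ∑ b, ∑ c, christoffelOf S a b c θ.1 * θ.2 b i * θ.2 c j := by
      rw [Finset.sum_comm]
      refine Finset.sum_congr rfl fun b _ => Finset.sum_congr rfl fun c _ => ?_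
      rw [christoffelOf_symm hS a c b]; ring
    simp only [mul_add, Finset.sum_add_distrib]
    rw [e2, two_mul]
    congr 1
    refine Finset.sum_congr rfl fun b _ => Finset.sum_congr rfl fun c _ => ?_
    ring
  rw [e1]
  ring

theorem normalMetric_symm (hS : ∀ z i j, S z i j = S z j i) (y : EuclideanSpace ℝ (Fin n))
    (i j : Fin n) : normalMetric S θ y i j = normalMetric S θ y j i := by
  have hSt : (S (normalMap S θ y)).transpose = S (normalMap S θ y) := by
    ext a b; exact hS _ b a
  have : (normalMetric S θ y).transpose = normalMetric S θ y := by
    simp only [normalMetric, Matrix.transpose_mul, Matrix.transpose_transpose, hSt,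
      Matrix.mul_assoc]
  exact congrFun (congrFun this j) i

/-- The Christoffel symbols vanish at the centre of normal coordinates. -/
theorem christoffelOf_normalMetric (hS : ∀ z i j, S z i j = S z j i)
    (hSd : ∀ i j, DifferentiableAt ℝ (fun z => S z i j) θ.1) (hdet : IsUnit (S θ.1).det)
    (hP : IsUnit (Matrix.of θ.2).det) (k i j : Fin n) :
    christoffelOf (normalMetric S θ) k i j 0 = 0 := by
  have hJ : jacobian (normalMap S θ) 0 = Matrix.of θ.2 := by
    ext a b; exact jacobian_normalMap_zero a b
  have h1 : ∀ a, (Matrix.of θ.2).mulVec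
      (fun k => christoffelOf (normalMetric S θ) k i j 0) a = 0 := by
    intro a
    have h := sum_jacobian_christoffelOf (S := S) (S' := normalMetric S θ) (Z := normalMap S θ)
      (z := 0) contDiff_normalMap.contDiffAt (by rwa [normalMap_zero]) hS (by rwa [normalMap_zero])
      (by rwa [hJ]) EventuallyEq.rfl a i j
    rw [hJ, partialDeriv_jacobian_normalMap hS, normalMap_zero] at h
    rw [Matrix.mulVec, dotProduct, h]
    simp
  have h2 : (fun k => christoffelOf (normalMetric S θ) k i j 0) = 0 :=
    Matrix.eq_zero_of_mulVec_eq_zero hP.ne_zero (funext h1)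
  exact congrFun h2 k

/-- The first derivatives of the metric vanish at the centre of normal coordinates. -/
theorem partialDeriv_normalMetric (hS : ∀ z i j, S z i j = S z j i)
    (hSd : ∀ i j, DifferentiableAt ℝ (fun z => S z i j) θ.1) (hdet : IsUnit (S θ.1).det)
    (hP : IsUnit (Matrix.of θ.2).det) (i j k : Fin n) :
    partialDeriv k (fun y => normalMetric S θ y i j) 0 = 0 := by
  have hJ : jacobian (normalMap S θ) 0 = Matrix.of θ.2 := by
    ext a b; exact jacobian_normalMap_zero a b
  have hdet' : IsUnit (normalMetric S θ 0).det := by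
    rw [normalMetric, hJ, normalMap_zero, Matrix.det_mul, Matrix.det_mul, Matrix.det_transpose]
    exact (hP.mul hdet).mul hP
  have hlow : ∀ l i j, christoffelLower (normalMetric S θ) l i j 0 = 0 := by
    intro l i j
    have h1 : (normalMetric S θ 0)⁻¹.mulVec
        (fun l => christoffelLower (normalMetric S θ) l i j 0) = 0 := by
      funext k
      have := christoffelOf_normalMetric hS hSd hdet hP k i j
      rw [christoffelOf_eq] at this
      exact this
    exact congrFun (Matrix.eq_zero_of_mulVec_eq_zero
      (Matrix.isUnit_nonsing_inv_det _ hdet').ne_zero h1) l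
  have h1 := hlow j k i
  have h2 := hlow i k j
  simp only [christoffelLower] at h1 h2
  have e : ∀ a b, (fun y => normalMetric S θ y a b) = fun y => normalMetric S θ y b a :=
    fun a b => funext fun y => normalMetric_symm hS y a b
  rw [e j i, e k i] at h2
  rw [e k i] at h1
  linarith

variable {T : Set (EuclideanSpace ℝ (Fin n))}
  {θ₀ : EuclideanSpace ℝ (Fin n) × (Fin n → Fin n → ℝ)}

theorem contDiffAt_christoffelOf_of_mem (hT : IsOpen T)
    (hS : ∀ i j, ContDiffOn ℝ ∞ (fun z => S z i j) T)
    (hdet : ∀ z ∈ T, IsUnit (S z).det) {z : EuclideanSpace ℝ (Fin n)} (hz : z ∈ T)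
    (k i j : Fin n) : ContDiffAt ℝ ∞ (christoffelOf S k i j) z := by
  have h1 : ∀ i j, ContDiffAt ℝ ∞ (fun z => S z i j) z := fun i j =>
    (hS i j).contDiffAt (hT.mem_nhds hz)
  exact contDiffAt_christoffelOf h1 (contDiffAt_matrix_inv h1 (hdet z hz)) (by simp) k i j

/-- Normal coordinates depend smoothly on the centre and on the frame. -/
theorem contDiffAt_normalMap (hT : IsOpen T) (hS : ∀ i j, ContDiffOn ℝ ∞ (fun z => S z i j) T)
    (hdet : ∀ z ∈ T, IsUnit (S z).det) (hθ : θ₀.1 ∈ T) (y : EuclideanSpace ℝ (Fin n)) :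
    ContDiffAt ℝ ∞ (fun q : (EuclideanSpace ℝ (Fin n) × (Fin n → Fin n → ℝ))
      × EuclideanSpace ℝ (Fin n) => normalMap S q.1 q.2) (θ₀, y) := by
  rw [contDiffAt_euclidean]
  intro a
  have hΓ : ∀ b c, ContDiffAt ℝ ∞ (fun q : (EuclideanSpace ℝ (Fin n) × (Fin n → Fin n → ℝ))
      × EuclideanSpace ℝ (Fin n) => christoffelOf S a b c q.1.1) (θ₀, y) := fun b c =>
    (contDiffAt_christoffelOf_of_mem hT hS hdet hθ a b c).comp (θ₀, y)
      (f := fun q : (EuclideanSpace ℝ (Fin n) × (Fin n → Fin n → ℝ))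
        × EuclideanSpace ℝ (Fin n) => q.1.1) (by fun_prop)
  simp only [normalMap]
  refine ContDiffAt.sub (by fun_prop) (contDiffAt_const.mul
    (ContDiffAt.sum fun b _ => ContDiffAt.sum fun c _ => (hΓ b c).mul (by fun_prop)))

theorem IsNormalData.mono {χ : EuclideanSpace ℝ (Fin n) → ℝ}
    {Φ : EuclideanSpace ℝ (Fin n) × ℝ → ℝ} {t₀ D D' c c' : ℝ} (h : IsNormalData S χ Φ t₀ D c)
    (hD : D ≤ D') (hc : c' ≤ c) : IsNormalData S χ Φ t₀ D' c' where
  symm := h.symm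
  contDiffAt := h.contDiffAt
  contDiffAt_inv := h.contDiffAt_inv
  isUnit := h.isUnit
  first := h.first
  second i j k := (h.second i j k).trans hD
  inv_second i j k := (h.inv_second i j k).trans hD
  christoffel_first l i j k := (h.christoffel_first l i j k).trans hD
  christoffel_second l i j k := (h.christoffel_second l i j k).trans hD
  contDiffAt_convex := h.contDiffAt_convex
  convex_first k := (h.convex_first k).trans hD
  convex_second k := hc.trans (h.convex_second k)
  contDiffAt_rhs := h.contDiffAt_rhs
  rhs_first := h.rhs_first.trans hD
  rhs_second := h.rhs_second.trans hD

local notation "𝔼" => EuclideanSpace ℝ (Fin n)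

/-- The data in normal coordinates are bounded locally uniformly in the centre, the frame and the
value of the solution. -/
theorem eventually_isNormalData (hT : IsOpen T)
    (hS : ∀ i j, ContDiffOn ℝ ∞ (fun z => S z i j) T) (hsymm : ∀ z i j, S z i j = S z j i)
    (hdet : ∀ z ∈ T, IsUnit (S z).det) {χ : EuclideanSpace ℝ (Fin n) → ℝ}
    {Φ : EuclideanSpace ℝ (Fin n) × ℝ → ℝ} {t₀ : ℝ} (hθ : θ₀.1 ∈ T)
    (hP : IsUnit (Matrix.of θ₀.2).det) (hχ : ContDiffAt ℝ 2 χ θ₀.1)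
    (hχ2 : ∀ v : Fin n → ℝ, v ≠ 0 → 0 < ∑ i, ∑ j, covHess S χ θ₀.1 i j * v i * v j)
    (hΦ : ContDiffAt ℝ 2 Φ (θ₀.1, t₀)) :
    ∃ D c : ℝ, 0 ≤ D ∧ 0 < c ∧ ∀ᶠ q : (EuclideanSpace ℝ (Fin n) × (Fin n → Fin n → ℝ)) × ℝ in
      𝓝 (θ₀, t₀), IsNormalData (normalMetric S q.1) (fun y => χ (normalMap S q.1 y))
        (fun r => Φ (normalMap S q.1 r.1, r.2)) q.2 D c := by
  -- joint regularity in the parameters and the coordinates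
  have hZ := contDiffAt_normalMap hT hS hdet hθ 0
  have hZ0 : normalMap S θ₀ 0 = θ₀.1 := normalMap_zero
  have hSd : ∀ z ∈ T, ∀ i j, ContDiffAt ℝ ∞ (fun z => S z i j) z := fun z hz i j =>
    (hS i j).contDiffAt (hT.mem_nhds hz)
  have jJ : ∀ a i, ContDiffAt ℝ 4 (fun q : (𝔼 × (Fin n → Fin n → ℝ)) × 𝔼 =>
      jacobian (normalMap S q.1) q.2 a i) (θ₀, 0) := fun a i =>
    contDiffAt_fibre_partialDeriv (F := fun θ w => normalMap S θ w a) (k := 5)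
      (((contDiffAt_euclidean.1 hZ) a).of_le (by norm_cast)) (by norm_num) i
  have jM : ∀ i j, ContDiffAt ℝ 4 (fun q : (𝔼 × (Fin n → Fin n → ℝ)) × 𝔼 =>
      normalMetric S q.1 q.2 i j) (θ₀, 0) := by
    intro i j
    have hSZ : ∀ a b, ContDiffAt ℝ 4 (fun q : (𝔼 × (Fin n → Fin n → ℝ)) × 𝔼 =>
        S (normalMap S q.1 q.2) a b) (θ₀, 0) := fun a b =>
      ContDiffAt.comp (θ₀, (0 : 𝔼)) (g := fun z => S z a b)
        ((hSd _ (by rwa [hZ0]) a b).of_le (by norm_cast)) (hZ.of_le (by norm_cast))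
    simp only [normalMetric, Matrix.mul_apply, Matrix.transpose_apply]
    exact ContDiffAt.sum fun b _ => (ContDiffAt.sum fun a _ => (jJ a i).mul (hSZ a b)).mul (jJ b j)
  have hJ0 : ∀ θ, jacobian (normalMap S θ) 0 = Matrix.of θ.2 := by
    intro θ; ext a b; exact jacobian_normalMap_zero a b
  have hM0 : IsUnit (normalMetric S θ₀ 0).det := by
    rw [normalMetric, hJ0, hZ0, Matrix.det_mul, Matrix.det_mul, Matrix.det_transpose]
    exact (hP.mul (hdet _ hθ)).mul hP
  have jI : ∀ i j, ContDiffAt ℝ 4 (fun q : (𝔼 × (Fin n → Fin n → ℝ)) × 𝔼 =>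
      (normalMetric S q.1 q.2)⁻¹ i j) (θ₀, 0) := fun i j =>
    contDiffAt_matrix_inv (A := fun q : (𝔼 × (Fin n → Fin n → ℝ)) × 𝔼 => normalMetric S q.1 q.2)
      jM hM0 i j
  have jΓ : ∀ l i j, ContDiffAt ℝ 3 (fun q : (𝔼 × (Fin n → Fin n → ℝ)) × 𝔼 =>
      christoffelOf (normalMetric S q.1) l i j q.2) (θ₀, 0) := by
    intro l i j
    have hd : ∀ i j k, ContDiffAt ℝ 3 (fun q : (𝔼 × (Fin n → Fin n → ℝ)) × 𝔼 =>
        partialDeriv k (fun y => normalMetric S q.1 y i j) q.2) (θ₀, 0) := fun i j k =>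
      contDiffAt_fibre_partialDeriv (F := fun θ y => normalMetric S θ y i j) (jM i j)
        (by norm_num) k
    simp only [christoffelOf]
    exact contDiffAt_const.mul (ContDiffAt.sum fun a _ =>
      ((jI l a).of_le (by norm_num)).mul (((hd j a i).add (hd i a j)).sub (hd i j a)))
  have jχ : ContDiffAt ℝ 2 (fun q : (𝔼 × (Fin n → Fin n → ℝ)) × 𝔼 =>
      χ (normalMap S q.1 q.2)) (θ₀, 0) :=
    ContDiffAt.comp (θ₀, (0 : 𝔼)) (g := χ) (by rwa [hZ0]) (hZ.of_le (by norm_cast))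
  have jΦ : ContDiffAt ℝ 2 (fun q : (𝔼 × (Fin n → Fin n → ℝ)) × (𝔼 × ℝ) =>
      Φ (normalMap S q.1 q.2.1, q.2.2)) (θ₀, (0, t₀)) := by
    refine ContDiffAt.comp (θ₀, ((0 : 𝔼), t₀)) (g := Φ)
      (f := fun q : (𝔼 × (Fin n → Fin n → ℝ)) × (𝔼 × ℝ) => (normalMap S q.1 q.2.1, q.2.2))
      (by rwa [hZ0]) (ContDiffAt.prodMk ?_ (by fun_prop))
    exact ContDiffAt.comp (θ₀, ((0 : 𝔼), t₀))
      (g := fun q : (𝔼 × (Fin n → Fin n → ℝ)) × 𝔼 => normalMap S q.1 q.2)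
      (f := fun q : (𝔼 × (Fin n → Fin n → ℝ)) × (𝔼 × ℝ) => (q.1, q.2.1))
      (hZ.of_le (by norm_cast)) (by fun_prop)
  -- continuity at the centre
  have ha : ContinuousAt (fun q : (𝔼 × (Fin n → Fin n → ℝ)) × ℝ => q.1) (θ₀, t₀) :=
    continuousAt_fst
  have hb : ContinuousAt (fun _ : (𝔼 × (Fin n → Fin n → ℝ)) × ℝ => (0 : 𝔼)) (θ₀, t₀) :=
    continuousAt_const
  have hb' : ContinuousAt (fun q : (𝔼 × (Fin n → Fin n → ℝ)) × ℝ => ((0 : 𝔼), q.2)) (θ₀, t₀) := by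
    fun_prop
  have cont : ∀ {F : 𝔼 × (Fin n → Fin n → ℝ) → 𝔼 → ℝ},
      ContDiffAt ℝ 0 (fun q : (𝔼 × (Fin n → Fin n → ℝ)) × 𝔼 => F q.1 q.2) (θ₀, 0) →
      ContinuousAt (fun q : (𝔼 × (Fin n → Fin n → ℝ)) × ℝ => F q.1 0) (θ₀, t₀) := by
    intro F hF
    exact ContinuousAt.comp (x := (θ₀, t₀)) (f := fun q : (𝔼 × (Fin n → Fin n → ℝ)) × ℝ =>
      (q.1, (0 : 𝔼))) (g := fun q : (𝔼 × (Fin n → Fin n → ℝ)) × 𝔼 => F q.1 q.2)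
      hF.continuousAt (ha.prodMk hb)
  have first : ∀ {F : 𝔼 × (Fin n → Fin n → ℝ) → 𝔼 → ℝ} (k : Fin n),
      ContDiffAt ℝ 1 (fun q : (𝔼 × (Fin n → Fin n → ℝ)) × 𝔼 => F q.1 q.2) (θ₀, 0) →
      ContinuousAt (fun q : (𝔼 × (Fin n → Fin n → ℝ)) × ℝ => partialDeriv k (F q.1) 0) (θ₀, t₀) :=
    fun {F} k hF => cont (F := fun θ => partialDeriv k (F θ))
      (contDiffAt_fibre_partialDeriv (m := 0) hF (by norm_num) k)
  have second : ∀ {F : 𝔼 × (Fin n → Fin n → ℝ) → 𝔼 → ℝ} (k : Fin n),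
      ContDiffAt ℝ 2 (fun q : (𝔼 × (Fin n → Fin n → ℝ)) × 𝔼 => F q.1 q.2) (θ₀, 0) →
      ContinuousAt (fun q : (𝔼 × (Fin n → Fin n → ℝ)) × ℝ =>
        partialDeriv k (partialDeriv k (F q.1)) 0) (θ₀, t₀) :=
    fun {F} k hF => first (F := fun θ => partialDeriv k (F θ)) k
      (contDiffAt_fibre_partialDeriv (m := 1) hF (by norm_num) k)
  obtain ⟨D1, hD1, b1⟩ := exists_eventually_abs_le (ι := Fin n × Fin n × Fin n) (fun x =>
    second (F := fun θ y => normalMetric S θ y x.1 x.2.1) x.2.2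
      ((jM x.1 x.2.1).of_le (by norm_num)))
  obtain ⟨D2, hD2, b2⟩ := exists_eventually_abs_le (ι := Fin n × Fin n × Fin n) (fun x =>
    second (F := fun θ y => (normalMetric S θ y)⁻¹ x.1 x.2.1) x.2.2
      ((jI x.1 x.2.1).of_le (by norm_num)))
  obtain ⟨D3, hD3, b3⟩ := exists_eventually_abs_le (ι := Fin n × Fin n × Fin n × Fin n) (fun x =>
    first (F := fun θ => christoffelOf (normalMetric S θ) x.1 x.2.1 x.2.2.1) x.2.2.2
      ((jΓ x.1 x.2.1 x.2.2.1).of_le (by norm_num)))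
  obtain ⟨D4, hD4, b4⟩ := exists_eventually_abs_le (ι := Fin n × Fin n × Fin n × Fin n) (fun x =>
    second (F := fun θ => christoffelOf (normalMetric S θ) x.1 x.2.1 x.2.2.1) x.2.2.2
      ((jΓ x.1 x.2.1 x.2.2.1).of_le (by norm_num)))
  obtain ⟨D5, hD5, b5⟩ := exists_eventually_abs_le (fun k : Fin n =>
    first (F := fun θ y => χ (normalMap S θ y)) k (jχ.of_le (by norm_num)))
  have hθd : ∀ i j, DifferentiableAt ℝ (fun z => S z i j) θ₀.1 := fun i j =>
    (hSd _ hθ i j).differentiableAt (by simp)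
  have hχpos : ∀ k, 0 < partialDeriv k (partialDeriv k fun y => χ (normalMap S θ₀ y)) 0 := by
    intro k
    have h1 := covHess_pullback (S := S) (S' := normalMetric S θ₀) (Z := normalMap S θ₀) (z := 0)
      (v := χ) contDiff_normalMap.contDiffAt (by rwa [hZ0]) hsymm (by rw [hZ0]; exact hdet _ hθ)
      (by rwa [hJ0]) EventuallyEq.rfl (by rwa [hZ0])
    have h2 := congrFun (congrFun h1 k) k
    simp only [covHess, Matrix.of_apply, christoffelOf_normalMetric hsymm hθd (hdet _ hθ) hP,
      zero_mul, Finset.sum_const_zero, sub_zero] at h2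
    rw [h2]
    have h3 : (fun a => θ₀.2 a k) ≠ 0 := by
      intro h0
      apply hP.ne_zero
      exact Matrix.det_eq_zero_of_column_eq_zero k fun a => congrFun h0 a
    refine (hχ2 _ h3).trans_eq ?_
    rw [hJ0, hZ0]
    simp only [Matrix.mul_apply, Matrix.transpose_apply, Matrix.of_apply, Finset.sum_mul]
    rw [Finset.sum_comm]
    refine Finset.sum_congr rfl fun a _ => Finset.sum_congr rfl fun b _ => ?_
    simp only [covHess, Matrix.of_apply]
    ring
  obtain ⟨c, hc, b6⟩ := exists_eventually_pos_le (fun k : Fin n =>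
    second (F := fun θ y => χ (normalMap S θ y)) k jχ) hχpos
  have cΦ1 : ContinuousAt (fun q : (𝔼 × (Fin n → Fin n → ℝ)) × ℝ =>
      ‖fderiv ℝ (fun r : 𝔼 × ℝ => Φ (normalMap S q.1 r.1, r.2)) (0, q.2)‖) (θ₀, t₀) := by
    have h := contDiffAt_fibre_fderiv (m := 1)
      (F := fun θ (r : 𝔼 × ℝ) => Φ (normalMap S θ r.1, r.2)) jΦ (by norm_num)
    exact (ContinuousAt.comp (x := (θ₀, t₀)) (f := fun q : (𝔼 × (Fin n → Fin n → ℝ)) × ℝ =>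
      (q.1, ((0 : 𝔼), q.2))) h.continuousAt (ha.prodMk hb')).norm
  have cΦ2 : ContinuousAt (fun q : (𝔼 × (Fin n → Fin n → ℝ)) × ℝ =>
      ‖fderiv ℝ (fderiv ℝ (fun r : 𝔼 × ℝ => Φ (normalMap S q.1 r.1, r.2))) (0, q.2)‖)
      (θ₀, t₀) := by
    have h := contDiffAt_fibre_fderiv (m := 0)
      (F := fun θ => fderiv ℝ (fun r : 𝔼 × ℝ => Φ (normalMap S θ r.1, r.2)))
      (contDiffAt_fibre_fderiv (m := 1) (F := fun θ (r : 𝔼 × ℝ) => Φ (normalMap S θ r.1, r.2))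
        jΦ (by norm_num)) (by norm_num)
    exact (ContinuousAt.comp (x := (θ₀, t₀)) (f := fun q : (𝔼 × (Fin n → Fin n → ℝ)) × ℝ =>
      (q.1, ((0 : 𝔼), q.2))) h.continuousAt (ha.prodMk hb')).norm
  obtain ⟨D6, hD6, b7⟩ := exists_eventually_abs_le (fun _ : Unit => cΦ1)
  obtain ⟨D7, hD7, b8⟩ := exists_eventually_abs_le (fun _ : Unit => cΦ2)
  have e1 : ∀ᶠ q : (𝔼 × (Fin n → Fin n → ℝ)) × ℝ in 𝓝 (θ₀, t₀), ∀ i j,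
      ContDiffAt ℝ 4 (fun y => normalMetric S q.1 y i j) 0 :=
    eventually_all.2 fun i => eventually_all.2 fun j => eventually_contDiffAt_fibre
      (F := fun θ y => normalMetric S θ y i j) ha hb (jM i j) (by norm_num)
  have e2 : ∀ᶠ q : (𝔼 × (Fin n → Fin n → ℝ)) × ℝ in 𝓝 (θ₀, t₀), ∀ i j,
      ContDiffAt ℝ 4 (fun y => (normalMetric S q.1 y)⁻¹ i j) 0 :=
    eventually_all.2 fun i => eventually_all.2 fun j => eventually_contDiffAt_fibre
      (F := fun θ y => (normalMetric S θ y)⁻¹ i j) ha hb (jI i j) (by norm_num)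
  have e3 : ∀ᶠ q : (𝔼 × (Fin n → Fin n → ℝ)) × ℝ in 𝓝 (θ₀, t₀),
      ContDiffAt ℝ 2 (fun y => χ (normalMap S q.1 y)) 0 :=
    eventually_contDiffAt_fibre (F := fun θ y => χ (normalMap S θ y)) ha hb jχ (by norm_num)
  have e4 : ∀ᶠ q : (𝔼 × (Fin n → Fin n → ℝ)) × ℝ in 𝓝 (θ₀, t₀),
      ContDiffAt ℝ 2 (fun r : 𝔼 × ℝ => Φ (normalMap S q.1 r.1, r.2)) (0, q.2) :=
    eventually_contDiffAt_fibre (F := fun θ (r : 𝔼 × ℝ) => Φ (normalMap S θ r.1, r.2)) ha hb' jΦ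
      (by norm_num)
  have hdetc : ContinuousAt (fun q : (𝔼 × (Fin n → Fin n → ℝ)) × 𝔼 =>
      (normalMetric S q.1 q.2).det) (θ₀, 0) := (contDiffAt_det jM).continuousAt
  have e5 : ∀ᶠ q : (𝔼 × (Fin n → Fin n → ℝ)) × ℝ in 𝓝 (θ₀, t₀), ∀ᶠ y in 𝓝 (0 : 𝔼),
      IsUnit (normalMetric S q.1 y).det := by
    have h1 := ((hdetc.eventually_ne hM0.ne_zero)).eventually_nhds
    have h2 : ContinuousAt (fun q : (𝔼 × (Fin n → Fin n → ℝ)) × ℝ => (q.1, (0 : 𝔼))) (θ₀, t₀) :=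
      ha.prodMk hb
    filter_upwards [h2.eventually h1] with q hq
    have h3 : ContinuousAt (fun y : 𝔼 => (q.1, y)) 0 := by fun_prop
    filter_upwards [h3.eventually hq] with y hy
    exact isUnit_iff_ne_zero.2 hy
  have hT' : ∀ᶠ q : (𝔼 × (Fin n → Fin n → ℝ)) × ℝ in 𝓝 (θ₀, t₀), q.1.1 ∈ T := by
    have : ContinuousAt (fun q : (𝔼 × (Fin n → Fin n → ℝ)) × ℝ => q.1.1) (θ₀, t₀) := by fun_prop
    exact this.eventually (hT.mem_nhds hθ)
  have hP' : ∀ᶠ q : (𝔼 × (Fin n → Fin n → ℝ)) × ℝ in 𝓝 (θ₀, t₀),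
      IsUnit (Matrix.of q.1.2).det := by
    have h1 : ContDiffAt ℝ 0 (fun q : (𝔼 × (Fin n → Fin n → ℝ)) × ℝ => (Matrix.of q.1.2).det)
        (θ₀, t₀) := contDiffAt_det fun i j => by
      simp only [Matrix.of_apply]; fun_prop
    filter_upwards [h1.continuousAt.eventually_ne hP.ne_zero] with q hq
    exact isUnit_iff_ne_zero.2 hq
  refine ⟨D1 + D2 + D3 + D4 + D5 + D6 + D7, c, by positivity, hc, ?_⟩
  filter_upwards [b1, b2, b3, b4, b5, b6, b7, b8, e1, e2, e3, e4, e5, hT', hP'] with q b1 b2 b3 b4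
    b5 b6 b7 b8 e1 e2 e3 e4 e5 hq hqP
  exact {
    symm := normalMetric_symm hsymm
    contDiffAt := fun i j => (e1 i j).of_le (by norm_num)
    contDiffAt_inv := fun i j => (e2 i j).of_le (by norm_num)
    isUnit := e5
    first := partialDeriv_normalMetric hsymm
      (fun i j => (hSd _ hq i j).differentiableAt (by simp)) (hdet _ hq) hqP
    second := fun i j k => (b1 (i, j, k)).trans (by linarith)
    inv_second := fun i j k => (b2 (i, j, k)).trans (by linarith)
    christoffel_first := fun l i j k => (b3 (l, i, j, k)).trans (by linarith)
    christoffel_second := fun l i j k => (b4 (l, i, j, k)).trans (by linarith)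
    contDiffAt_convex := e3
    convex_first := fun k => (b5 k).trans (by linarith)
    convex_second := b6
    contDiffAt_rhs := e4
    rhs_first := (le_abs_self _).trans ((b7 ()).trans (by linarith))
    rhs_second := (le_abs_self _).trans ((b8 ()).trans (by linarith)) }

end NormalMap

/-! ### Quadratic forms and frames -/

section QuadraticForms

variable {n : ℕ}

/-- The value `A(v, v)` of the quadratic form with matrix `A`. -/
def quadForm (A : Matrix (Fin n) (Fin n) ℝ) (v : Fin n → ℝ) : ℝ :=
  ∑ i, ∑ j, A i j * v i * v j

theorem quadForm_eq_dotProduct (A : Matrix (Fin n) (Fin n) ℝ) (v : Fin n → ℝ) :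
    quadForm A v = v ⬝ᵥ A.mulVec v := by
  simp only [quadForm, dotProduct, Matrix.mulVec, Finset.mul_sum]
  exact Finset.sum_congr rfl fun i _ => Finset.sum_congr rfl fun j _ => by ring

theorem quadForm_conj (A L : Matrix (Fin n) (Fin n) ℝ) (v : Fin n → ℝ) :
    quadForm (L.transpose * A * L) v = quadForm A (L.mulVec v) := by
  rw [quadForm_eq_dotProduct, quadForm_eq_dotProduct, ← Matrix.mulVec_mulVec,
    ← Matrix.mulVec_mulVec, Matrix.dotProduct_mulVec, Matrix.vecMul_transpose]

theorem quadForm_add (A B : Matrix (Fin n) (Fin n) ℝ) (v : Fin n → ℝ) :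
    quadForm (A + B) v = quadForm A v + quadForm B v := by
  simp only [quadForm_eq_dotProduct, Matrix.add_mulVec, dotProduct_add]

theorem quadForm_sub (A B : Matrix (Fin n) (Fin n) ℝ) (v : Fin n → ℝ) :
    quadForm (A - B) v = quadForm A v - quadForm B v := by
  simp only [quadForm_eq_dotProduct, Matrix.sub_mulVec, dotProduct_sub]

theorem quadForm_smul (c : ℝ) (A : Matrix (Fin n) (Fin n) ℝ) (v : Fin n → ℝ) :
    quadForm (c • A) v = c * quadForm A v := by
  simp only [quadForm_eq_dotProduct, Matrix.smul_mulVec, dotProduct_smul, smul_eq_mul]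

theorem quadForm_diagonal (κ v : Fin n → ℝ) :
    quadForm (Matrix.diagonal κ) v = ∑ i, κ i * v i ^ 2 := by
  rw [quadForm_eq_dotProduct]
  simp only [dotProduct, Matrix.mulVec_diagonal]
  exact Finset.sum_congr rfl fun i _ => by ring

theorem quadForm_one (v : Fin n → ℝ) : quadForm 1 v = ∑ i, v i ^ 2 := by
  rw [← Matrix.diagonal_one, quadForm_diagonal]; simp

theorem quadForm_vecMulVec (p v : Fin n → ℝ) :
    quadForm (Matrix.vecMulVec p p) v = (∑ i, p i * v i) ^ 2 := by
  rw [sq, Finset.sum_mul_sum]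
  exact Finset.sum_congr rfl fun i _ => Finset.sum_congr rfl fun j _ => by
    rw [Matrix.vecMulVec_apply]; ring

theorem quadForm_smul_right (A : Matrix (Fin n) (Fin n) ℝ) (c : ℝ) (v : Fin n → ℝ) :
    quadForm A (c • v) = c ^ 2 * quadForm A v := by
  simp only [quadForm, Finset.mul_sum, Pi.smul_apply, smul_eq_mul]
  exact Finset.sum_congr rfl fun i _ => Finset.sum_congr rfl fun j _ => by ring

theorem quadForm_zero_right (A : Matrix (Fin n) (Fin n) ℝ) : quadForm A 0 = 0 := by
  simp [quadForm]

/-- Change of coordinates for the squared length of a covector. -/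
theorem quadForm_inv_conj {A L : Matrix (Fin n) (Fin n) ℝ} (hL : IsUnit L.det) (d : Fin n → ℝ) :
    quadForm (L.transpose * A * L)⁻¹ (L.transpose.mulVec d) = quadForm A⁻¹ d := by
  rw [← quadForm_conj, Matrix.mul_inv_rev, Matrix.mul_inv_rev, Matrix.transpose_transpose]
  have hLt : IsUnit L.transpose.det := by rwa [Matrix.det_transpose]
  rw [Matrix.mul_nonsing_inv_cancel_left _ _ hL, Matrix.mul_assoc,
    Matrix.nonsing_inv_mul _ hLt, Matrix.mul_one]

theorem conj_add_vecMulVec (A L : Matrix (Fin n) (Fin n) ℝ) (d : Fin n → ℝ) :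
    L.transpose * (A + Matrix.vecMulVec d d) * L = L.transpose * A * L
      + Matrix.vecMulVec (L.transpose.mulVec d) (L.transpose.mulVec d) := by
  rw [Matrix.mul_add, Matrix.add_mul]
  congr 1
  ext i j
  simp only [Matrix.vecMulVec_apply, Matrix.mul_apply, Matrix.mulVec, dotProduct,
    Matrix.transpose_apply, Finset.sum_mul, Finset.mul_sum]
  exact Finset.sum_congr rfl fun k _ => Finset.sum_congr rfl fun l _ => by ring

theorem transpose_conj_conj (A L Q : Matrix (Fin n) (Fin n) ℝ) :
    Q.transpose * (L.transpose * A * L) * Q = (L * Q).transpose * A * (L * Q) := by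
  rw [Matrix.transpose_mul L]
  simp only [Matrix.mul_assoc]

theorem isUnit_det_of_conj_eq_one {A P : Matrix (Fin n) (Fin n) ℝ}
    (h : P.transpose * A * P = 1) : IsUnit P.det := by
  have h := congrArg Matrix.det h
  rw [Matrix.det_mul, Matrix.det_one] at h
  exact IsUnit.of_mul_eq_one_right _ h

theorem quadForm_inv_nonneg {A : Matrix (Fin n) (Fin n) ℝ}
    (hA : ∀ v, v ≠ 0 → 0 < quadForm A v) (d : Fin n → ℝ) : 0 ≤ quadForm A⁻¹ d := by
  have h1 : quadForm A⁻¹ d = quadForm A (A⁻¹.mulVec d) := by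
    rw [quadForm_eq_dotProduct, quadForm_eq_dotProduct, Matrix.mulVec_mulVec,
      Matrix.mul_nonsing_inv _ (isUnit_det_of_pos hA), Matrix.one_mulVec, dotProduct_comm]
  rw [h1]
  rcases eq_or_ne (A⁻¹.mulVec d) 0 with h0 | h0
  · rw [h0, quadForm_zero_right]
  · exact (hA _ h0).le

/-- Negative definiteness is an open condition. -/
theorem eventually_quadForm_neg {X : Type*} [TopologicalSpace X]
    {A : X → Matrix (Fin n) (Fin n) ℝ} {x₀ : X}
    (hA : ∀ i j, ContinuousAt (fun x => A x i j) x₀)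
    (h : ∀ v, v ≠ 0 → quadForm (A x₀) v < 0) :
    ∀ᶠ x in 𝓝 x₀, ∀ v, v ≠ 0 → quadForm (A x) v < 0 := by
  have h1 : ∀ᶠ x in 𝓝 x₀, ∀ v ∈ Metric.sphere (0 : Fin n → ℝ) 1, quadForm (A x) v < 0 := by
    refine (isCompact_sphere _ _).eventually_forall_of_forall_eventually fun v hv => ?_
    have hc : ContinuousAt (fun z : X × (Fin n → ℝ) => quadForm (A z.1) z.2) (x₀, v) := by
      unfold quadForm
      refine tendsto_finsetSum _ fun i _ => tendsto_finsetSum _ fun j _ => ?_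
      have h2 : ContinuousAt (fun z : X × (Fin n → ℝ) => A z.1 i j) (x₀, v) :=
        ContinuousAt.comp (x := (x₀, v)) (g := fun x => A x i j) (f := Prod.fst) (hA i j)
          continuousAt_fst
      have h3 : ∀ i, ContinuousAt (fun z : X × (Fin n → ℝ) => z.2 i) (x₀, v) := fun i => by
        fun_prop
      exact (h2.mul (h3 i)).mul (h3 j)
    refine hc.eventually_lt continuousAt_const (h v ?_)
    rintro rfl
    simp at hv
  filter_upwards [h1] with x hx v hv
  have hv' : 0 < ‖v‖ := norm_pos_iff.2 hv
  have h2 := hx (‖v‖⁻¹ • v) (by simp [norm_smul, hv'.ne'])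
  rw [quadForm_smul_right] at h2
  by_contra h3
  have : 0 ≤ ‖v‖⁻¹ ^ 2 * quadForm (A x) v := mul_nonneg (by positivity) (not_lt.1 h3)
  linarith

/-- A continuous positive definite metric is locally bounded from below. -/
theorem exists_eventually_le_quadForm {X : Type*} [TopologicalSpace X]
    {A : X → Matrix (Fin n) (Fin n) ℝ} {x₀ : X}
    (hA : ∀ i j, ContinuousAt (fun x => A x i j) x₀)
    (h : ∀ v, v ≠ 0 → 0 < quadForm (A x₀) v) :
    ∃ c > 0, ∀ᶠ x in 𝓝 x₀, ∀ v, c * ∑ i, v i ^ 2 ≤ quadForm (A x) v := by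
  have h1 : ∀ᶠ q : ℝ × X in 𝓝 (0, x₀), ∀ v, v ≠ 0 →
      quadForm (q.1 • (1 : Matrix (Fin n) (Fin n) ℝ) - A q.2) v < 0 := by
    refine eventually_quadForm_neg (A := fun q : ℝ × X => q.1 • (1 : Matrix (Fin n) (Fin n) ℝ)
      - A q.2) (fun i j => ?_) fun v hv => ?_
    · simp only [Matrix.sub_apply, Matrix.smul_apply]
      have h2 : ContinuousAt (fun z : ℝ × X => A z.2 i j) (0, x₀) :=
        ContinuousAt.comp (x := ((0 : ℝ), x₀)) (g := fun x => A x i j) (f := Prod.snd) (hA i j)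
          continuousAt_snd
      exact (continuousAt_fst.smul continuousAt_const).sub h2
    · rw [quadForm_sub, quadForm_smul]
      have := h v hv
      linarith
  rw [nhds_prod_eq, eventually_prod_iff] at h1
  obtain ⟨pa, ha, pb, hb, hab⟩ := h1
  have ha' : ∀ᶠ c in 𝓝[>] (0 : ℝ), pa c := ha.filter_mono nhdsWithin_le_nhds
  obtain ⟨c, hc, hc0⟩ := (ha'.and self_mem_nhdsWithin).exists
  refine ⟨c, hc0, hb.mono fun x hx v => ?_⟩
  rcases eq_or_ne v 0 with rfl | hv
  · simp [quadForm_zero_right]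
  · have := hab hc hx v hv
    rw [quadForm_sub, quadForm_smul, quadForm_one] at this
    linarith

theorem abs_mul_apply_le {A B : Matrix (Fin n) (Fin n) ℝ} {a b : ℝ} (ha : 0 ≤ a)
    (hA : ∀ i j, |A i j| ≤ a) (hB : ∀ i j, |B i j| ≤ b) (i j : Fin n) :
    |(A * B) i j| ≤ n * (a * b) := by
  rw [Matrix.mul_apply]
  refine (Finset.abs_sum_le_sum_abs _ _).trans ?_
  refine (Finset.sum_le_sum (g := fun _ => a * b) fun k _ => ?_).trans (by simp)
  rw [abs_mul]
  exact mul_le_mul (hA i k) (hB k j) (abs_nonneg _) ha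

/-- The metric `S` and its inverse, in a frame that is orthonormal for the graph metric
`S + d ⊗ d`. -/
theorem bounds_of_orthonormal_frame {S P : Matrix (Fin n) (Fin n) ℝ} {d : Fin n → ℝ}
    (hS : ∀ v, v ≠ 0 → 0 < quadForm S v)
    (hP : P.transpose * (S + Matrix.vecMulVec d d) * P = 1) :
    IsUnit (P.transpose * S * P).det ∧
    (∀ v, quadForm (P.transpose * S * P) v ≤ ∑ i, v i ^ 2) ∧
    ∀ i j, |(P.transpose * S * P)⁻¹ i j| ≤ 2 + quadForm S⁻¹ d := by
  have hPdet := isUnit_det_of_conj_eq_one hP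
  rw [conj_add_vecMulVec] at hP
  have hw : quadForm (P.transpose * S * P)⁻¹ (P.transpose.mulVec d) = quadForm S⁻¹ d :=
    quadForm_inv_conj hPdet d
  have hAdet : IsUnit (P.transpose * S * P).det := by
    rw [Matrix.det_mul, Matrix.det_mul, Matrix.det_transpose]
    exact (hPdet.mul (isUnit_det_of_pos hS)).mul hPdet
  set p := P.transpose.mulVec d
  set A := P.transpose * S * P
  have hw0 : 0 ≤ 1 + quadForm S⁻¹ d := add_nonneg zero_le_one (quadForm_inv_nonneg hS d)
  obtain ⟨h1, h2, -⟩ := inv_of_add_vecMulVec_eq_one (W := √(1 + quadForm S⁻¹ d)) hAdet hP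
    (by rw [Real.sq_sqrt hw0, ← hw]; rfl)
  rw [Real.sq_sqrt hw0] at h1 h2
  have hr : ∑ i, p i ^ 2 ≤ 1 := by
    by_contra h
    have : (1 + quadForm S⁻¹ d) * (1 - ∑ i, p i ^ 2) ≤ 0 :=
      mul_nonpos_of_nonneg_of_nonpos hw0 (by linarith)
    linarith
  have hpi : ∀ i, |p i| ≤ 1 := fun i => by
    rw [← sq_le_one_iff_abs_le_one]
    exact (Finset.single_le_sum (f := fun i => p i ^ 2) (fun _ _ => sq_nonneg _)
      (Finset.mem_univ i)).trans hr
  refine ⟨hAdet, fun v => ?_, fun i j => ?_⟩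
  · have e2 := congrArg (fun M => quadForm M v) hP
    simp only [quadForm_add, quadForm_one, quadForm_vecMulVec] at e2
    linarith [sq_nonneg (∑ i, p i * v i)]
  · have h3 : |(if i = j then (1 : ℝ) else 0)| ≤ 1 := by split_ifs <;> simp
    have h4 : |p i| * |p j| ≤ 1 := mul_le_one₀ (hpi i) (abs_nonneg _) (hpi j)
    have h5 : |(1 + quadForm S⁻¹ d) * p i * p j| ≤ 1 + quadForm S⁻¹ d := by
      rw [mul_assoc, abs_mul, abs_of_nonneg hw0, abs_mul]
      exact mul_le_of_le_one_right hw0 h4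
    rw [h2]
    linarith [abs_add_le (if i = j then (1 : ℝ) else 0) ((1 + quadForm S⁻¹ d) * p i * p j)]

/-- A frame that is orthonormal for the graph metric `S + d ⊗ d` is bounded together with its
inverse, in terms of the ellipticity of `S` and of the slope of the graph. -/
theorem exists_frame_bound (n : ℕ) {c B w : ℝ} (hc : 0 < c) (hB : 0 ≤ B) :
    ∃ R : ℝ, ∀ (S P : Matrix (Fin n) (Fin n) ℝ) (d : Fin n → ℝ),
      (∀ v, c * ∑ i, v i ^ 2 ≤ quadForm S v) → (∀ i j, |S i j| ≤ B) →
      quadForm S⁻¹ d ≤ w → P.transpose * (S + Matrix.vecMulVec d d) * P = 1 →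
      (∀ i j, |P i j| ≤ R) ∧ ∃ Q : Matrix (Fin n) (Fin n) ℝ, (∀ i j, |Q i j| ≤ R) ∧ Q * P = 1 := by
  set R₁ := √(1 / c) with hR₁
  have hR₁0 : 0 ≤ R₁ := Real.sqrt_nonneg _
  set R₂ := n * (n * (|2 + w| * R₁) * B) with hR₂
  have hR₂0 : 0 ≤ R₂ := by positivity
  refine ⟨R₁ + R₂, fun S P d hS hSB hd hP => ?_⟩
  have hSpos : ∀ v : Fin n → ℝ, v ≠ 0 → 0 < quadForm S v := by
    intro v hv
    refine lt_of_lt_of_le (mul_pos hc ?_) (hS v)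
    obtain ⟨i, hi⟩ := Function.ne_iff.1 hv
    exact Finset.sum_pos' (fun _ _ => sq_nonneg _) ⟨i, Finset.mem_univ i, by
      have : v i ≠ 0 := hi
      positivity⟩
  obtain ⟨hAdet, h1, h2⟩ := bounds_of_orthonormal_frame hSpos hP
  have hPb : ∀ i j, |P i j| ≤ R₁ := by
    intro i j
    have e1 := h1 (Pi.single j 1)
    rw [quadForm_conj] at e1
    have e2 := (hS _).trans e1
    have e4 : ∑ i, (Pi.single j (1 : ℝ) : Fin n → ℝ) i ^ 2 = 1 := by
      rw [Finset.sum_eq_single j] <;> simp +contextual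
    have e3 : P i j ^ 2 ≤ ∑ i, (P.mulVec (Pi.single j 1)) i ^ 2 := by
      refine le_trans (le_of_eq ?_) (Finset.single_le_sum
        (f := fun i => (P.mulVec (Pi.single j 1)) i ^ 2) (fun _ _ => sq_nonneg _)
        (Finset.mem_univ i))
      simp
    refine Real.abs_le_sqrt ?_
    rw [le_div_iff₀ hc]
    nlinarith
  refine ⟨fun i j => (hPb i j).trans (by linarith),
    (P.transpose * S * P)⁻¹ * P.transpose * S, fun i j => ?_, ?_⟩
  · have e1 : ∀ i j, |(P.transpose * S * P)⁻¹ i j| ≤ |2 + w| := fun i j =>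
      (h2 i j).trans ((add_le_add_right hd 2).trans (le_abs_self _))
    have e2 := abs_mul_apply_le (B := P.transpose) (by positivity) e1 (fun i j => hPb j i)
    have e3 := abs_mul_apply_le (B := S) (by positivity) e2 hSB i j
    linarith
  · rw [Matrix.mul_assoc, Matrix.mul_assoc, ← Matrix.mul_assoc P.transpose,
      Matrix.nonsing_inv_mul _ hAdet]

open scoped MatrixOrder Matrix.Norms.L2Operator in
/-- A metric has an orthonormal frame. -/
theorem exists_conj_eq_one {S : Matrix (Fin n) (Fin n) ℝ} (hsymm : S.transpose = S)
    (hS : ∀ v, v ≠ 0 → 0 < quadForm S v) :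
    ∃ P : Matrix (Fin n) (Fin n) ℝ, P.transpose * S * P = 1 := by
  have h1 : S.PosSemidef := by
    refine Matrix.PosSemidef.of_dotProduct_mulVec_nonneg ?_ fun v => ?_
    · rw [Matrix.IsHermitian, Matrix.conjTranspose_eq_transpose_of_trivial, hsymm]
    · rw [star_trivial, ← quadForm_eq_dotProduct]
      rcases eq_or_ne v 0 with rfl | hv
      · rw [quadForm_zero_right]
      · exact (hS v hv).le
  obtain ⟨B, hB⟩ := CStarAlgebra.nonneg_iff_eq_star_mul_self.mp h1.nonneg
  rw [Matrix.star_eq_conjTranspose, Matrix.conjTranspose_eq_transpose_of_trivial] at hB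
  have hBdet : IsUnit B.det := by
    have h := isUnit_det_of_pos hS
    rw [hB, Matrix.det_mul] at h
    exact isUnit_of_mul_isUnit_right h
  refine ⟨B⁻¹, ?_⟩
  have h2 := transpose_conj_conj 1 B B⁻¹
  rw [Matrix.mul_one] at h2
  rw [hB, h2, Matrix.mul_nonsing_inv _ hBdet]
  simp

/-- The squared norm of a bilinear form `H` with respect to a metric `S`, computed in a frame. -/
theorem sum_inv_inv_mul_mul_conj {S H Q : Matrix (Fin n) (Fin n) ℝ} (hQ : IsUnit Q.det) :
    ∑ i, ∑ j, ∑ k, ∑ l, S⁻¹ i k * S⁻¹ j l * H i j * H k l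
      = ∑ i, ∑ j, ∑ k, ∑ l, (Q.transpose * S * Q)⁻¹ i k * (Q.transpose * S * Q)⁻¹ j l
        * (Q.transpose * H * Q) i j * (Q.transpose * H * Q) k l := by
  have key : ∀ A H : Matrix (Fin n) (Fin n) ℝ,
      ∑ i, ∑ j, ∑ k, ∑ l, A i k * A j l * H i j * H k l
        = (A.transpose * (H * (A * H.transpose))).trace := by
    intro A H
    simp only [Matrix.trace, Matrix.diag, Matrix.mul_apply, Matrix.transpose_apply,
      Finset.mul_sum]
    calc _ = ∑ i, ∑ k, ∑ j, ∑ l, A i k * A j l * H i j * H k l :=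
          Finset.sum_congr rfl fun i _ => Finset.sum_comm
      _ = ∑ k, ∑ i, ∑ j, ∑ l, A i k * A j l * H i j * H k l := Finset.sum_comm
      _ = _ := Finset.sum_congr rfl fun k _ => Finset.sum_congr rfl fun i _ =>
          Finset.sum_congr rfl fun j _ => Finset.sum_congr rfl fun l _ => by ring
  have hQt : IsUnit Q.transpose.det := by rwa [Matrix.det_transpose]
  have e1 : (Q.transpose * S * Q)⁻¹ = Q⁻¹ * (S⁻¹ * Q.transpose⁻¹) := by
    rw [Matrix.mul_inv_rev, Matrix.mul_inv_rev]
  have e2 : (Q.transpose * S * Q)⁻¹.transpose = Q⁻¹ * (S⁻¹.transpose * Q.transpose⁻¹) := by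
    rw [e1, Matrix.transpose_mul, Matrix.transpose_mul, Matrix.transpose_nonsing_inv,
      Matrix.transpose_transpose, Matrix.transpose_nonsing_inv Q, Matrix.mul_assoc]
  rw [key, key, e2, e1, Matrix.transpose_mul (Q.transpose * H), Matrix.transpose_mul Q.transpose,
    Matrix.transpose_transpose]
  have e3 : Q⁻¹ * (S⁻¹.transpose * Q.transpose⁻¹) * (Q.transpose * H * Q
      * (Q⁻¹ * (S⁻¹ * Q.transpose⁻¹) * (Q.transpose * (H.transpose * Q))))
      = Q⁻¹ * ((S⁻¹.transpose * (H * (S⁻¹ * H.transpose))) * Q) := by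
    simp only [Matrix.mul_assoc]
    rw [Matrix.nonsing_inv_mul_cancel_left _ _ hQt, Matrix.mul_nonsing_inv_cancel_left _ _ hQ,
      Matrix.nonsing_inv_mul_cancel_left _ _ hQt]
  rw [e3, Matrix.trace_mul_comm Q⁻¹, Matrix.mul_assoc, Matrix.mul_nonsing_inv _ hQ, Matrix.mul_one]

/-- A bilinear form is bounded by its norm with respect to a metric. -/
theorem quadForm_le_sqrt_mul {S : Matrix (Fin n) (Fin n) ℝ} (hsymm : S.transpose = S)
    (hS : ∀ v, v ≠ 0 → 0 < quadForm S v) (H : Matrix (Fin n) (Fin n) ℝ) (v : Fin n → ℝ) :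
    quadForm H v
      ≤ √(∑ i, ∑ j, ∑ k, ∑ l, S⁻¹ i k * S⁻¹ j l * H i j * H k l) * quadForm S v := by
  obtain ⟨Q, hQ⟩ := exists_conj_eq_one hsymm hS
  have hQdet := isUnit_det_of_conj_eq_one hQ
  rw [sum_inv_inv_mul_mul_conj hQdet, hQ, inv_one]
  set D := Q.transpose * H * Q with hD
  set w := Q⁻¹.mulVec v
  have hv : v = Q.mulVec w := by
    rw [Matrix.mulVec_mulVec, Matrix.mul_nonsing_inv _ hQdet, Matrix.one_mulVec]
  have e1 : quadForm H v = quadForm D w := by rw [hD, quadForm_conj, ← hv]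
  have e2 : quadForm S v = ∑ i, w i ^ 2 := by rw [← quadForm_one, ← hQ, quadForm_conj, ← hv]
  have e3 : ∑ i, ∑ j, ∑ k, ∑ l, (1 : Matrix (Fin n) (Fin n) ℝ) i k
      * (1 : Matrix (Fin n) (Fin n) ℝ) j l * D i j * D k l = ∑ i, ∑ j, D i j ^ 2 := by
    simp [Matrix.one_apply, sq]
  rw [e1, e2, e3]
  have hw : 0 ≤ ∑ i, w i ^ 2 := Finset.sum_nonneg fun _ _ => sq_nonneg _
  rw [← Real.sqrt_sq hw, ← Real.sqrt_mul
    (Finset.sum_nonneg fun i _ => Finset.sum_nonneg fun j _ => sq_nonneg (D i j))]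
  refine Real.le_sqrt_of_sq_le ?_
  have h1 := Finset.sum_mul_sq_le_sq_mul_sq (Finset.univ : Finset (Fin n × Fin n))
    (fun x => D x.1 x.2) (fun x => w x.1 * w x.2)
  rw [Fintype.sum_prod_type, Fintype.sum_prod_type, Fintype.sum_prod_type] at h1
  have e4 : ∑ i, ∑ j, (w i * w j) ^ 2 = (∑ i, w i ^ 2) ^ 2 := by
    rw [sq (∑ i, w i ^ 2), Finset.sum_mul_sum]
    exact Finset.sum_congr rfl fun i _ => Finset.sum_congr rfl fun j _ => by ring
  have e5 : quadForm D w = ∑ i, ∑ j, D i j * (w i * w j) :=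
    Finset.sum_congr rfl fun i _ => Finset.sum_congr rfl fun j _ => by ring
  rw [e5, ← e4]
  exact h1

end QuadraticForms

section LocalData

variable {n : ℕ} {S : EuclideanSpace ℝ (Fin n) → Matrix (Fin n) (Fin n) ℝ}
  {T : Set (EuclideanSpace ℝ (Fin n))}

/-- The data in normal coordinates are bounded uniformly in the centre near a point, in all bounded
frames with bounded inverse, and in a bounded range of values of the solution. -/
theorem exists_eventually_isNormalData (hT : IsOpen T)
    (hS : ∀ i j, ContDiffOn ℝ ∞ (fun z => S z i j) T) (hsymm : ∀ z i j, S z i j = S z j i)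
    (hdet : ∀ z ∈ T, IsUnit (S z).det) {χ : EuclideanSpace ℝ (Fin n) → ℝ}
    {Φ : EuclideanSpace ℝ (Fin n) × ℝ → ℝ} {z₀ : EuclideanSpace ℝ (Fin n)} (hz₀ : z₀ ∈ T)
    (hχ : ContDiffAt ℝ 2 χ z₀)
    (hχ2 : ∀ v : Fin n → ℝ, v ≠ 0 → 0 < ∑ i, ∑ j, covHess S χ z₀ i j * v i * v j)
    (hΦ : ∀ t, ContDiffAt ℝ 2 Φ (z₀, t)) (R K : ℝ) :
    ∃ D c : ℝ, 0 ≤ D ∧ 0 < c ∧ ∀ᶠ z in 𝓝 z₀, ∀ P Q : Matrix (Fin n) (Fin n) ℝ,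
      (∀ i j, |P i j| ≤ R) → (∀ i j, |Q i j| ≤ R) → Q * P = 1 → ∀ t, |t| ≤ K →
      IsNormalData (normalMetric S (z, P)) (fun y => χ (normalMap S (z, P) y))
        (fun r => Φ (normalMap S (z, P) r.1, r.2)) t D c := by
  set box : Set (Matrix (Fin n) (Fin n) ℝ) :=
    Set.pi univ fun _ => Set.pi univ fun _ => Icc (-R) R with hbox
  have hboxc : IsCompact box := isCompact_univ_pi fun _ => isCompact_univ_pi fun _ => isCompact_Icc
  set F : Set ((Matrix (Fin n) (Fin n) ℝ × Matrix (Fin n) (Fin n) ℝ) × ℝ) :=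
    ((box ×ˢ box) ∩ {q | q.2 * q.1 = 1}) ×ˢ Icc (-K) K with hF
  have hFc : IsCompact F := by
    refine IsCompact.prod ((hboxc.prod hboxc).inter_right ?_) isCompact_Icc
    exact isClosed_eq (by fun_prop) continuous_const
  have key : ∃ D c : ℝ, 0 ≤ D ∧ 0 < c ∧ ∀ᶠ z in 𝓝 z₀, ∀ q ∈ F,
      IsNormalData (normalMetric S (z, q.1.1)) (fun y => χ (normalMap S (z, q.1.1) y))
        (fun r => Φ (normalMap S (z, q.1.1) r.1, r.2)) q.2 D c := by
    refine hFc.induction_on (p := fun s => ∃ D c : ℝ, 0 ≤ D ∧ 0 < c ∧ ∀ᶠ z in 𝓝 z₀, ∀ q ∈ s,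
      IsNormalData (normalMetric S (z, q.1.1)) (fun y => χ (normalMap S (z, q.1.1) y))
        (fun r => Φ (normalMap S (z, q.1.1) r.1, r.2)) q.2 D c) ?_ ?_ ?_ ?_
    · exact ⟨0, 1, le_rfl, one_pos, by simp⟩
    · rintro s s' hss ⟨D, c, hD, hc, h⟩
      exact ⟨D, c, hD, hc, h.mono fun z hz q hq => hz q (hss hq)⟩
    · rintro s s' ⟨D, c, hD, hc, h⟩ ⟨D', c', hD', hc', h'⟩
      refine ⟨max D D', min c c', hD.trans (le_max_left _ _), lt_min hc hc', ?_⟩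
      filter_upwards [h, h'] with z hz hz' q hq
      rcases hq with hq | hq
      · exact (hz q hq).mono (le_max_left _ _) (min_le_left _ _)
      · exact (hz' q hq).mono (le_max_right _ _) (min_le_right _ _)
    · rintro ⟨⟨P, Q⟩, t⟩ ⟨⟨-, hQP⟩, -⟩
      have hP : IsUnit P.det := by
        have h := congrArg Matrix.det (show Q * P = 1 from hQP)
        rw [Matrix.det_mul, Matrix.det_one] at h
        exact IsUnit.of_mul_eq_one_right _ h
      obtain ⟨D, c, hD, hc, h⟩ := eventually_isNormalData (θ₀ := (z₀, P)) (t₀ := t) hT hS hsymm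
        hdet hz₀ hP hχ hχ2 (hΦ t)
      have hcont : Tendsto (fun q : EuclideanSpace ℝ (Fin n) ×
          ((Matrix (Fin n) (Fin n) ℝ × Matrix (Fin n) (Fin n) ℝ) × ℝ) =>
          (((q.1, q.2.1.1), q.2.2) :
            (EuclideanSpace ℝ (Fin n) × (Fin n → Fin n → ℝ)) × ℝ))
          (𝓝 (z₀, ((P, Q), t))) (𝓝 ((z₀, P), t)) := by
        have : Continuous (fun q : EuclideanSpace ℝ (Fin n) ×
          ((Matrix (Fin n) (Fin n) ℝ × Matrix (Fin n) (Fin n) ℝ) × ℝ) =>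
          (((q.1, q.2.1.1), q.2.2) :
            (EuclideanSpace ℝ (Fin n) × (Fin n → Fin n → ℝ)) × ℝ)) := by fun_prop
        exact this.tendsto _
      have h2 := hcont.eventually h
      rw [nhds_prod_eq, eventually_prod_iff] at h2
      obtain ⟨pa, ha, pb, hb, hab⟩ := h2
      exact ⟨{q | pb q}, mem_nhdsWithin_of_mem_nhds hb, D, c, hD, hc,
        ha.mono fun z hz q hq => hab hz hq⟩
  obtain ⟨D, c, hD, hc, h⟩ := key
  refine ⟨D, c, hD, hc, h.mono fun z hz P Q hP hQ hQP t ht => hz ((P, Q), t) ⟨⟨⟨?_, ?_⟩, hQP⟩, ?_⟩⟩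
  · exact fun i _ j _ => abs_le.1 (hP i j)
  · exact fun i _ j _ => abs_le.1 (hQ i j)
  · exact abs_le.1 ht

end LocalData

/-! ### Normal coordinates on the manifold -/

section ManifoldCoordinates

variable {n : ℕ} {M : Type*} [TopologicalSpace M] [ChartedSpace (EuclideanSpace ℝ (Fin n)) M]
  [IsManifold (𝓡 n) ∞ M] [RiemannianBundle (fun x : M => TangentSpace (𝓡 n) x)]
  [IsContMDiffRiemannianBundle (𝓡 n) ∞ (EuclideanSpace ℝ (Fin n))
    (fun x : M => TangentSpace (𝓡 n) x)]

theorem partialDeriv_chartExpr_eq_mulVec (p : M) {u : M → ℝ} {z : EuclideanSpace ℝ (Fin n)}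
    (hz : z ∈ (extChartAt (𝓡 n) p).target)
    (hu : ContMDiffAt (𝓡 n) 𝓘(ℝ, ℝ) 2 u ((extChartAt (𝓡 n) p).symm z)) :
    (fun i => partialDeriv i (chartExpr p u) z)
      = (jacobian (chartTransition p ((extChartAt (𝓡 n) p).symm z)) z).transpose.mulVec
        (diffComp u ((extChartAt (𝓡 n) p).symm z)) := by
  funext i
  rw [partialDeriv_chartExpr p hz hu]
  exact Finset.sum_congr rfl fun a _ => mul_comm _ _

/-- The metric of the graph in the chart around `p`. -/
theorem coordMetric_chartExpr (p : M) {u : M → ℝ} {z : EuclideanSpace ℝ (Fin n)}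
    (hz : z ∈ (extChartAt (𝓡 n) p).target)
    (hu : ContMDiffAt (𝓡 n) 𝓘(ℝ, ℝ) 2 u ((extChartAt (𝓡 n) p).symm z)) :
    coordMetric (metricMatrix p) (chartExpr p u) z
      = (jacobian (chartTransition p ((extChartAt (𝓡 n) p).symm z)) z).transpose
        * graphMetric u ((extChartAt (𝓡 n) p).symm z)
        * jacobian (chartTransition p ((extChartAt (𝓡 n) p).symm z)) z := by
  rw [coordMetric, partialDeriv_chartExpr_eq_mulVec p hz hu, metricMatrix_eq_metricAt p hz,
    graphMetric, conj_add_vecMulVec]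

theorem quadForm_inv_metricMatrix (p : M) {u : M → ℝ} {z : EuclideanSpace ℝ (Fin n)}
    (hz : z ∈ (extChartAt (𝓡 n) p).target)
    (hu : ContMDiffAt (𝓡 n) 𝓘(ℝ, ℝ) 2 u ((extChartAt (𝓡 n) p).symm z)) :
    quadForm (metricMatrix p z)⁻¹ (fun i => partialDeriv i (chartExpr p u) z)
      = gradNormSq n u ((extChartAt (𝓡 n) p).symm z) := by
  rw [partialDeriv_chartExpr_eq_mulVec p hz hu, metricMatrix_eq_metricAt p hz, quadForm_inv_conj
    (isUnit_det_jacobian_chartTransition p _ hz (mem_extChartAt_source _))]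
  rfl

/-- The Jacobian of the change from normal coordinates, built on the chart around `p`, to the
preferred chart around the point of normal coordinates `y`. -/
noncomputable def normalFrame (p : M) (θ : EuclideanSpace ℝ (Fin n) × (Fin n → Fin n → ℝ))
    (y : EuclideanSpace ℝ (Fin n)) : Matrix (Fin n) (Fin n) ℝ :=
  jacobian (chartTransition p ((extChartAt (𝓡 n) p).symm (normalMap (metricMatrix p) θ y)))
      (normalMap (metricMatrix p) θ y)
    * jacobian (normalMap (metricMatrix p) θ) y

variable {p : M} {θ : EuclideanSpace ℝ (Fin n) × (Fin n → Fin n → ℝ)}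
  {y : EuclideanSpace ℝ (Fin n)} {u : M → ℝ}

theorem isUnit_det_normalFrame
    (hz : normalMap (metricMatrix p) θ y ∈ (extChartAt (𝓡 n) p).target)
    (hJ : IsUnit (jacobian (normalMap (metricMatrix p) θ) y).det) :
    IsUnit (normalFrame p θ y).det := by
  rw [normalFrame, Matrix.det_mul]
  exact (isUnit_det_jacobian_chartTransition p _ hz (mem_extChartAt_source _)).mul hJ

theorem normalMetric_eq_metricAt
    (hz : normalMap (metricMatrix p) θ y ∈ (extChartAt (𝓡 n) p).target) :
    normalMetric (metricMatrix p) θ y = (normalFrame p θ y).transpose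
      * metricAt ((extChartAt (𝓡 n) p).symm (normalMap (metricMatrix p) θ y))
      * normalFrame p θ y := by
  rw [normalMetric, metricMatrix_eq_metricAt p hz, normalFrame, Matrix.transpose_mul]
  simp only [Matrix.mul_assoc]

theorem covHess_normalMap
    (hz : normalMap (metricMatrix p) θ y ∈ (extChartAt (𝓡 n) p).target)
    (hJ : IsUnit (jacobian (normalMap (metricMatrix p) θ) y).det)
    (hu : ContMDiffAt (𝓡 n) 𝓘(ℝ, ℝ) 2 u
      ((extChartAt (𝓡 n) p).symm (normalMap (metricMatrix p) θ y))) :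
    covHess (normalMetric (metricMatrix p) θ)
        (fun w => chartExpr p u (normalMap (metricMatrix p) θ w)) y
      = (normalFrame p θ y).transpose
        * hessComp u ((extChartAt (𝓡 n) p).symm (normalMap (metricMatrix p) θ y))
        * normalFrame p θ y := by
  rw [covHess_pullback (S := metricMatrix p) (S' := normalMetric (metricMatrix p) θ)
    contDiff_normalMap.contDiffAt
    (fun a b => ((contDiffOn_metricMatrix p a b).contDiffAt
      ((isOpen_extChartAt_target p).mem_nhds hz)).differentiableAt (by simp))
    (metricMatrix_symm p) (isUnit_det_metricMatrix p hz) hJ EventuallyEq.rfl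
    (contDiffAt_chartExpr (by norm_cast) p hz hu), covHess_chartExpr p hz hu, normalFrame,
    Matrix.transpose_mul]
  simp only [Matrix.mul_assoc]

theorem partialDeriv_normalMap_comp
    (hz : normalMap (metricMatrix p) θ y ∈ (extChartAt (𝓡 n) p).target)
    (hu : ContMDiffAt (𝓡 n) 𝓘(ℝ, ℝ) 2 u
      ((extChartAt (𝓡 n) p).symm (normalMap (metricMatrix p) θ y))) :
    (fun i => partialDeriv i (fun w => chartExpr p u (normalMap (metricMatrix p) θ w)) y)
      = (normalFrame p θ y).transpose.mulVec
        (diffComp u ((extChartAt (𝓡 n) p).symm (normalMap (metricMatrix p) θ y))) := by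
  funext i
  have hv := contDiffAt_chartExpr (k := 2) (by norm_cast) p hz hu
  rw [partialDeriv_comp ((contDiff_normalMap (k := 2)).contDiffAt.differentiableAt (by norm_num))
    (hv.differentiableAt (by norm_num))]
  simp only [partialDeriv_chartExpr p hz hu, normalFrame, Matrix.mulVec, dotProduct,
    Matrix.transpose_apply, Matrix.mul_apply, Finset.sum_mul]
  rw [Finset.sum_comm]
  exact Finset.sum_congr rfl fun a _ => Finset.sum_congr rfl fun b _ => by ring

theorem coordMetric_normalMap
    (hz : normalMap (metricMatrix p) θ y ∈ (extChartAt (𝓡 n) p).target)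
    (hu : ContMDiffAt (𝓡 n) 𝓘(ℝ, ℝ) 2 u
      ((extChartAt (𝓡 n) p).symm (normalMap (metricMatrix p) θ y))) :
    coordMetric (normalMetric (metricMatrix p) θ)
        (fun w => chartExpr p u (normalMap (metricMatrix p) θ w)) y
      = (normalFrame p θ y).transpose
        * graphMetric u ((extChartAt (𝓡 n) p).symm (normalMap (metricMatrix p) θ y))
        * normalFrame p θ y := by
  rw [coordMetric, partialDeriv_normalMap_comp hz hu, normalMetric_eq_metricAt hz, graphMetric,
    conj_add_vecMulVec]

theorem coordW_normalMap
    (hz : normalMap (metricMatrix p) θ y ∈ (extChartAt (𝓡 n) p).target)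
    (hJ : IsUnit (jacobian (normalMap (metricMatrix p) θ) y).det)
    (hu : ContMDiffAt (𝓡 n) 𝓘(ℝ, ℝ) 2 u
      ((extChartAt (𝓡 n) p).symm (normalMap (metricMatrix p) θ y))) :
    coordW (normalMetric (metricMatrix p) θ)
        (fun w => chartExpr p u (normalMap (metricMatrix p) θ w)) y
      = graphW n u ((extChartAt (𝓡 n) p).symm (normalMap (metricMatrix p) θ y)) := by
  have h := quadForm_inv_conj (isUnit_det_normalFrame hz hJ) (A := metricAt
    ((extChartAt (𝓡 n) p).symm (normalMap (metricMatrix p) θ y)))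
    (diffComp u ((extChartAt (𝓡 n) p).symm (normalMap (metricMatrix p) θ y)))
  rw [← normalMetric_eq_metricAt hz, ← partialDeriv_normalMap_comp hz hu] at h
  exact congrArg (fun s => √(1 + s)) h

theorem gradNormSq_nonneg (u : M → ℝ) (x : M) : 0 ≤ gradNormSq n u x :=
  quadForm_inv_nonneg (fun _ hv => metricMatrix_pos x (mem_extChartAt_target x) hv) _

theorem one_le_graphW (u : M → ℝ) (x : M) : 1 ≤ graphW n u x :=
  Real.one_le_sqrt.2 (by linarith [gradNormSq_nonneg (n := n) u x])

theorem tendsto_normalMap (hz : θ.1 ∈ (extChartAt (𝓡 n) p).target) :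
    Tendsto (fun y => (extChartAt (𝓡 n) p).symm (normalMap (metricMatrix p) θ y)) (𝓝 0)
      (𝓝 ((extChartAt (𝓡 n) p).symm θ.1)) := by
  have h1 : Tendsto (normalMap (metricMatrix p) θ) (𝓝 0) (𝓝 θ.1) := by
    have := (contDiff_normalMap (k := 0) (S := metricMatrix p) (θ := θ)).continuous.tendsto 0
    rwa [normalMap_zero] at this
  exact (continuousAt_extChartAt_symm'' hz).tendsto.comp h1

/-- Normal coordinates are regular near their centre. -/
theorem eventually_normalMap (hz : θ.1 ∈ (extChartAt (𝓡 n) p).target)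
    (hP : IsUnit (Matrix.of θ.2).det) :
    ∀ᶠ y in 𝓝 0, normalMap (metricMatrix p) θ y ∈ (extChartAt (𝓡 n) p).target ∧
      IsUnit (jacobian (normalMap (metricMatrix p) θ) y).det := by
  refine Eventually.and ?_ ?_
  · have h1 : Tendsto (normalMap (metricMatrix p) θ) (𝓝 0) (𝓝 θ.1) := by
      have := (contDiff_normalMap (k := 0) (S := metricMatrix p) (θ := θ)).continuous.tendsto 0
      rwa [normalMap_zero] at this
    exact h1.eventually ((isOpen_extChartAt_target p).mem_nhds hz)
  · have h1 : ContinuousAt (fun y => (jacobian (normalMap (metricMatrix p) θ) y).det) 0 :=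
      (contDiffAt_det (k := 0) fun i j => contDiffAt_jacobian
        (contDiff_normalMap (k := 1)).contDiffAt (by norm_num) i j).continuousAt
    have h2 : (jacobian (normalMap (metricMatrix p) θ) 0).det ≠ 0 := by
      have : jacobian (normalMap (metricMatrix p) θ) 0 = Matrix.of θ.2 := by
        ext a b; exact jacobian_normalMap_zero a b
      rw [this]
      exact hP.ne_zero
    exact (h1.eventually_ne h2).mono fun y hy => isUnit_iff_ne_zero.2 hy

/-- At the point `x`, where the principal curvatures of the graph of `u` are `κ`, the largest of
them being `κ_m`, the equation holds nearby and the function `Λ exp (β χ) / (1 - a₀ W)` has a local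
maximum, `Λ` being the largest ratio of the covariant Hessian and the metric of the graph. -/
structure IsCurvatureMaximum (Γ : Set (Fin n → ℝ)) (f : (Fin n → ℝ) → ℝ) (Ψ : M → ℝ → ℝ)
    (χ : M → ℝ) (K D c₀ a₀ Wm β : ℝ) (u : M → ℝ) (x : M) (κ : Fin n → ℝ) (m : Fin n) :
    Prop where
  contMDiffAt : ContMDiffAt (𝓡 n) 𝓘(ℝ, ℝ) 4 u x
  isPrincipalCurvatures : IsPrincipalCurvatures u x κ
  mem : κ ∈ Γ
  value : f κ = Ψ x (u x)
  curvDeriv_pos : ∀ i, 0 < curvDeriv f i κ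
  euler_ge : c₀ ≤ ∑ i, curvDeriv f i κ * κ i
  euler_le : ∑ i, curvDeriv f i κ * κ i ≤ D
  le_max : ∀ i, κ i ≤ κ m
  abs_le : |u x| ≤ K
  le_bound : graphW n u x ≤ Wm
  equation : ∀ᶠ x' in 𝓝 x, ∃ κ', IsPrincipalCurvatures u x' κ' ∧ κ' ∈ Γ ∧ f κ' = Ψ x' (u x')
  maximum : ∀ᶠ x' in 𝓝 x, ∀ ξ : Fin n → ℝ, quadForm (hessComp u x') ξ
      * Real.exp (β * (χ x' - χ x)) * (1 - a₀ * graphW n u x)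
    ≤ graphW n u x * κ m * quadForm (graphMetric u x') ξ * (1 - a₀ * graphW n u x')

theorem IsCurvatureMaximum.mono_euler {Γ : Set (Fin n → ℝ)} {f : (Fin n → ℝ) → ℝ}
    {Ψ : M → ℝ → ℝ} {χ : M → ℝ} {κ : Fin n → ℝ} {m : Fin n} {x : M} {K D D' c₀ a₀ β Wm : ℝ}
    (h : IsCurvatureMaximum Γ f Ψ χ K D c₀ a₀ Wm β u x κ m) (hD : D ≤ D') :
    IsCurvatureMaximum Γ f Ψ χ K D' c₀ a₀ Wm β u x κ m :=
  { h with euler_le := h.euler_le.trans hD }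

/-- In the normal coordinates whose axes are the principal directions, a maximum of the test
function is a normal maximum. -/
theorem IsCurvatureMaximum.isNormalMaximum {Γ : Set (Fin n → ℝ)} {f : (Fin n → ℝ) → ℝ}
    {Ψ : M → ℝ → ℝ} {χ : M → ℝ} {κ : Fin n → ℝ} {m : Fin n} {P : Matrix (Fin n) (Fin n) ℝ}
    {x : M} {K D c₀ a₀ β Wm : ℝ} (h : IsCurvatureMaximum Γ f Ψ χ K D c₀ a₀ Wm β u x κ m)
    (hx : x ∈ (extChartAt (𝓡 n) p).source)
    (hP : jacobian (chartTransition p x) (extChartAt (𝓡 n) p x) * Matrix.of θ.2 = P)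
    (hθ : θ.1 = extChartAt (𝓡 n) p x)
    (hPg : P.transpose * graphMetric u x * P = 1)
    (hPa : P.transpose * graphSecondForm u x * P = Matrix.diagonal κ) :
    IsNormalMaximum Γ f (normalMetric (metricMatrix p) θ)
      (fun y => chartExpr p χ (normalMap (metricMatrix p) θ y))
      (fun y => chartExpr p u (normalMap (metricMatrix p) θ y))
      (fun r => Ψ ((extChartAt (𝓡 n) p).symm (normalMap (metricMatrix p) θ r.1)) r.2)
      κ m D c₀ a₀ β Wm := by
  have hu := h.contMDiffAt
  have hθT : θ.1 ∈ (extChartAt (𝓡 n) p).target := by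
    rw [hθ]; exact (extChartAt (𝓡 n) p).map_source hx
  have hz0 : normalMap (metricMatrix p) θ 0 = extChartAt (𝓡 n) p x := by
    rw [normalMap_zero, hθ]
  have hx0 : (extChartAt (𝓡 n) p).symm (normalMap (metricMatrix p) θ 0) = x := by
    rw [hz0]; exact (extChartAt (𝓡 n) p).left_inv hx
  have hPdet := isUnit_det_of_conj_eq_one hPg
  have hθdet : IsUnit (Matrix.of θ.2).det := by
    rw [← hP, Matrix.det_mul] at hPdet
    exact isUnit_of_mul_isUnit_right hPdet
  have hreg := eventually_normalMap hθT hθdet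
  have htend := tendsto_normalMap (p := p) hθT
  have hxθ : (extChartAt (𝓡 n) p).symm θ.1 = x := by
    rw [hθ]; exact (extChartAt (𝓡 n) p).left_inv hx
  rw [hxθ] at htend
  have hu2 : ∀ᶠ y in 𝓝 0, ContMDiffAt (𝓡 n) 𝓘(ℝ, ℝ) 2 u
      ((extChartAt (𝓡 n) p).symm (normalMap (metricMatrix p) θ y)) :=
    htend.eventually ((contMDiffAt_iff_contMDiffAt_nhds
      (by simp)).1 hu |>.mono fun _ h => h.of_le (by norm_num))
  have hJ0 : jacobian (normalMap (metricMatrix p) θ) 0 = Matrix.of θ.2 := by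
    ext a b; exact jacobian_normalMap_zero a b
  have hL0 : normalFrame p θ 0 = P := by
    rw [normalFrame, hx0, hz0, hJ0, hP]
  obtain ⟨hz0T, hdet0⟩ := hreg.self_of_nhds
  have hu20 := hu2.self_of_nhds
  have hW0 : coordW (normalMetric (metricMatrix p) θ)
      (fun y => chartExpr p u (normalMap (metricMatrix p) θ y)) 0 = graphW n u x := by
    rw [coordW_normalMap hz0T hdet0 hu20, hx0]
  have hWne : graphW n u x ≠ 0 := (lt_of_lt_of_le one_pos (one_le_graphW u x)).ne'
  constructor
  · refine ContDiffAt.comp (g := chartExpr p u) 0 ?_ contDiff_normalMap.contDiffAt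
    exact contDiffAt_chartExpr (by norm_cast) p hz0T (by rwa [hx0])
  · exact h.mem
  · exact h.curvDeriv_pos
  · exact h.euler_ge
  · exact h.euler_le
  · exact h.le_max
  · simp only [chartExpr, hx0, h.value]
  · rw [coordMetric_normalMap hz0T hu20, hx0, hL0, hPg]
  · rw [covHess_normalMap hz0T hdet0 hu20, hx0, hL0, hW0, ← hPa, graphSecondForm,
      Matrix.mul_smul, Matrix.smul_mul, smul_smul, mul_inv_cancel₀ hWne, one_smul]
  · rw [hW0]; exact one_le_graphW u x
  · rw [hW0]; exact h.le_bound
  · filter_upwards [hreg, hu2, htend.eventually h.equation] with y hy huy hEy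
    obtain ⟨κ', ⟨P', h1, h2⟩, h3, h4⟩ := hEy
    have hL := isUnit_det_normalFrame hy.1 hy.2
    have e1 : ∀ A : Matrix (Fin n) (Fin n) ℝ, ((normalFrame p θ y)⁻¹ * P').transpose *
        ((normalFrame p θ y).transpose * A * normalFrame p θ y) * ((normalFrame p θ y)⁻¹ * P')
        = P'.transpose * A * P' := fun A => by
      rw [transpose_conj_conj, Matrix.mul_nonsing_inv_cancel_left _ _ hL]
    refine ⟨(normalFrame p θ y)⁻¹ * P', κ', ?_, ?_, h3, h4⟩
    · rw [coordMetric_normalMap hy.1 huy, e1, h1]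
    · rw [covHess_normalMap hy.1 hy.2 huy, coordW_normalMap hy.1 hy.2 huy, ← h2, graphSecondForm,
        Matrix.mul_smul, Matrix.smul_mul, e1, Matrix.mul_smul, Matrix.smul_mul]
  · filter_upwards [hreg, hu2, htend.eventually h.maximum] with y hy huy hEy ξ
    have h1 := hEy ((normalFrame p θ y).mulVec ξ)
    rw [← quadForm_conj, ← quadForm_conj, ← covHess_normalMap hy.1 hy.2 huy,
      ← coordMetric_normalMap hy.1 huy, ← coordW_normalMap hy.1 hy.2 huy, ← hW0] at h1
    simpa only [chartExpr, hx0, quadForm] using h1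

end ManifoldCoordinates

/-! ### The estimate near a point -/

section LocalBound

variable {n : ℕ} {M : Type*} [TopologicalSpace M] [ChartedSpace (EuclideanSpace ℝ (Fin n)) M]
  [IsManifold (𝓡 n) ∞ M] [RiemannianBundle (fun x : M => TangentSpace (𝓡 n) x)]
  [IsContMDiffRiemannianBundle (𝓡 n) ∞ (EuclideanSpace ℝ (Fin n))
    (fun x : M => TangentSpace (𝓡 n) x)]

theorem contDiffAt_rhs_chart {Ψ : M → ℝ → ℝ} {p : M} {t : ℝ}
    (hΨ : ContMDiffAt ((𝓡 n).prod 𝓘(ℝ, ℝ)) 𝓘(ℝ, ℝ) 2 (fun q : M × ℝ => Ψ q.1 q.2) (p, t)) :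
    ContDiffAt ℝ 2 (fun r : EuclideanSpace ℝ (Fin n) × ℝ => Ψ ((extChartAt (𝓡 n) p).symm r.1) r.2)
      (chartPt p, t) := by
  rw [← contMDiffAt_iff_contDiffAt]
  have hz : chartPt (n := n) p ∈ (extChartAt (𝓡 n) p).target := mem_extChartAt_target p
  have h1 : ContMDiffAt 𝓘(ℝ, EuclideanSpace ℝ (Fin n)) (𝓡 n) 2 (extChartAt (𝓡 n) p).symm
      (chartPt (n := n) p) :=
    ((contMDiffOn_extChartAt_symm (n := ∞) p).contMDiffAt
      ((isOpen_extChartAt_target p).mem_nhds hz)).of_le (by norm_cast)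
  have h2 : ContMDiffAt 𝓘(ℝ, EuclideanSpace ℝ (Fin n) × ℝ) ((𝓡 n).prod 𝓘(ℝ, ℝ)) 2
      (fun r : EuclideanSpace ℝ (Fin n) × ℝ => ((extChartAt (𝓡 n) p).symm r.1, r.2))
      (chartPt (n := n) p, t) := by
    refine ContMDiffAt.prodMk ?_ contDiff_snd.contMDiff.contMDiffAt
    exact ContMDiffAt.comp (chartPt (n := n) p, t) h1 contDiff_fst.contMDiff.contMDiffAt
  have h3 : (((extChartAt (𝓡 n) p).symm (chartPt (n := n) p), t) : M × ℝ) = (p, t) := by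
    rw [chartPt, extChartAt_to_inv]
  refine ContMDiffAt.comp (chartPt (n := n) p, t) (g := fun q : M × ℝ => Ψ q.1 q.2)
    (f := fun r : EuclideanSpace ℝ (Fin n) × ℝ => ((extChartAt (𝓡 n) p).symm r.1, r.2)) ?_ h2
  rwa [h3]

/-- The largest principal curvature is bounded at a maximum of the test function near `p`. -/
theorem exists_local_bound {Γ : Set (Fin n → ℝ)} {f : (Fin n → ℝ) → ℝ} {Ψ : M → ℝ → ℝ}
    {χ : M → ℝ} {K D₀ c₀ a₀ Wm : ℝ} (hf : IsCurvatureFunction Γ f) (hc : ConcaveOn ℝ Γ f)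
    (hn : 0 < n) (hWm : 1 ≤ Wm) (ha₀ : 0 < a₀) (ha₀' : a₀ * Wm ≤ 1 / 2) (hc₀ : 0 < c₀) (p : M)
    (hχ : ContMDiffAt (𝓡 n) 𝓘(ℝ, ℝ) 2 χ p)
    (hχ2 : ∀ v : Fin n → ℝ, v ≠ 0 → 0 < ∑ i, ∑ j, hessComp χ p i j * v i * v j)
    (hΨ : ∀ t, ContMDiffAt ((𝓡 n).prod 𝓘(ℝ, ℝ)) 𝓘(ℝ, ℝ) 2 (fun q : M × ℝ => Ψ q.1 q.2) (p, t)) :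
    ∃ V ∈ 𝓝 p, ∃ β₀ : ℝ, ∀ β, β₀ ≤ β → ∃ C₁ : ℝ, ∀ u, ∀ x ∈ V, ∀ κ m,
      IsCurvatureMaximum Γ f Ψ χ K D₀ c₀ a₀ Wm β u x κ m → κ m ≤ C₁ := by
  have hz₀ : chartPt (n := n) p ∈ (extChartAt (𝓡 n) p).target := mem_extChartAt_target p
  have hp : (extChartAt (𝓡 n) p).symm (chartPt (n := n) p) = p := extChartAt_to_inv (I := 𝓡 n) p
  have hSc : ∀ i j, ContinuousAt (fun z => metricMatrix p z i j) (chartPt p) := fun i j =>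
    ((contDiffOn_metricMatrix p i j).contDiffAt
      ((isOpen_extChartAt_target p).mem_nhds hz₀)).continuousAt
  obtain ⟨c, hcpos, hlow⟩ := exists_eventually_le_quadForm hSc
    fun v hv => metricMatrix_pos p hz₀ hv
  obtain ⟨B, hB, hup⟩ := exists_eventually_abs_le (ι := Fin n × Fin n)
    (g := fun x z => metricMatrix p z x.1 x.2) fun x => hSc x.1 x.2
  obtain ⟨R, hR⟩ := exists_frame_bound (w := Wm ^ 2 - 1) n hcpos hB
  obtain ⟨D, cχ, hD, hcχ, hdata⟩ := exists_eventually_isNormalData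
    (isOpen_extChartAt_target (I := 𝓡 n) p) (contDiffOn_metricMatrix p) (metricMatrix_symm p)
    (fun z hz => isUnit_det_metricMatrix p hz) hz₀ (χ := chartExpr p χ)
    (Φ := fun r => Ψ ((extChartAt (𝓡 n) p).symm r.1) r.2)
    (contDiffAt_chartExpr (by norm_cast) p hz₀ (by rwa [hp])) hχ2
    (fun t => contDiffAt_rhs_chart (hΨ t)) R K
  obtain ⟨β₀, -, hβ⟩ := exists_bound_of_isNormalMaximum (D := max D D₀) (Wm := Wm) (a₀ := a₀)
    (cχ := cχ) (c₀ := c₀) hf hc hn (hD.trans (le_max_left _ _)) hWm ha₀ ha₀' hcχ hc₀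
  have hV : ∀ᶠ x in 𝓝 p, x ∈ (extChartAt (𝓡 n) p).source ∧
      ((∀ v, c * ∑ i, v i ^ 2 ≤ quadForm (metricMatrix p (extChartAt (𝓡 n) p x)) v) ∧
      (∀ q : Fin n × Fin n, |metricMatrix p (extChartAt (𝓡 n) p x) q.1 q.2| ≤ B) ∧
      ∀ P Q : Matrix (Fin n) (Fin n) ℝ,
      (∀ i j, |P i j| ≤ R) → (∀ i j, |Q i j| ≤ R) → Q * P = 1 → ∀ t, |t| ≤ K →
      IsNormalData (normalMetric (metricMatrix p) (extChartAt (𝓡 n) p x, P))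
        (fun y => chartExpr p χ (normalMap (metricMatrix p) (extChartAt (𝓡 n) p x, P) y))
        (fun r => Ψ ((extChartAt (𝓡 n) p).symm
          (normalMap (metricMatrix p) (extChartAt (𝓡 n) p x, P) r.1)) r.2) t D cχ) := by
    refine (eventually_of_mem (extChartAt_source_mem_nhds p) fun _ h => h).and ?_
    exact (continuousAt_extChartAt (I := 𝓡 n) p).eventually (hlow.and (hup.and hdata))
  refine ⟨_, hV, β₀, fun β hβ₀ => ?_⟩
  obtain ⟨C₁, hC₁⟩ := hβ β hβ₀
  refine ⟨C₁, fun u x hx κ m h => ?_⟩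
  obtain ⟨hxs, hS, hSB, hN⟩ := hx
  obtain ⟨P, hPg, hPa⟩ := h.isPrincipalCurvatures
  set z := extChartAt (𝓡 n) p x with hzdef
  have hz : z ∈ (extChartAt (𝓡 n) p).target := (extChartAt (𝓡 n) p).map_source hxs
  have hzx : (extChartAt (𝓡 n) p).symm z = x := (extChartAt (𝓡 n) p).left_inv hxs
  set J := jacobian (chartTransition p x) z with hJ
  have hJdet : IsUnit J.det :=
    isUnit_det_jacobian_chartTransition p x hz (by rw [hzx]; exact mem_extChartAt_source x)
  have hu2 : ContMDiffAt (𝓡 n) 𝓘(ℝ, ℝ) 2 u ((extChartAt (𝓡 n) p).symm z) := by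
    rw [hzx]; exact h.contMDiffAt.of_le (by norm_num)
  have hJP : J * (J⁻¹ * P) = P := Matrix.mul_nonsing_inv_cancel_left _ _ hJdet
  -- the principal frame at `x`, expressed in the chart at `p`
  have hframe : (J⁻¹ * P).transpose * coordMetric (metricMatrix p) (chartExpr p u) z * (J⁻¹ * P)
      = 1 := by
    rw [coordMetric_chartExpr p hz hu2, hzx, transpose_conj_conj, hJP, hPg]
  have hslope : quadForm (metricMatrix p z)⁻¹ (fun i => partialDeriv i (chartExpr p u) z)
      ≤ Wm ^ 2 - 1 := by
    rw [quadForm_inv_metricMatrix p hz hu2, hzx]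
    linarith [(Real.sqrt_le_iff.1 h.le_bound).2]
  obtain ⟨hPR, Q, hQR, hQP⟩ := hR _ (J⁻¹ * P) _ hS (fun i j => hSB (i, j)) hslope hframe
  have hux : chartExpr p u (normalMap (metricMatrix p) (z, J⁻¹ * P) 0) = u x := by
    simp only [normalMap_zero, chartExpr, hzx]
  exact hC₁ _ _ _ (fun y => chartExpr p u (normalMap (metricMatrix p) (z, J⁻¹ * P) y)) κ m
    ((hN (J⁻¹ * P) Q hPR hQR hQP _ ((congrArg abs hux).trans_le h.abs_le)).mono
      (le_max_left D D₀) le_rfl)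
    ((h.mono_euler (le_max_right D D₀)).isNormalMaximum (p := p) (θ := (z, J⁻¹ * P)) hxs hJP rfl
      hPg hPa)

end LocalBound

/-! ### The maximum principle -/

/-- A semicontinuous family of conditions on a compact set has a critical level. When `R x c` says
that `c` exceeds the value at `x` of an upper semicontinuous function, this is the existence of a
maximum of the function. -/
theorem IsCompact.exists_critical_level {X : Type*} [TopologicalSpace X] {K : Set X}
    (hK : IsCompact K) (hne : K.Nonempty) {R : X → ℝ → Prop}
    (hmono : ∀ x ∈ K, ∀ c c', c ≤ c' → R x c → R x c')
    (hopen : ∀ x ∈ K, ∀ c, R x c → ∀ᶠ q : X × ℝ in 𝓝 (x, c), R q.1 q.2)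
    (hex : ∀ x ∈ K, ∃ c, R x c) (hlow : ∀ x ∈ K, ∃ c, ¬ R x c) :
    ∃ x ∈ K, ∃ c, ¬ R x c ∧ ∀ x' ∈ K, ∀ c', c < c' → R x' c' := by
  set Y : Set ℝ := {c | ∀ x ∈ K, R x c} with hY
  have hYne : Y.Nonempty := by
    have h : ∃ c, ∀ x ∈ K, x ∈ K → R x c := by
      refine hK.induction_on (p := fun s => ∃ c, ∀ x ∈ s, x ∈ K → R x c) ⟨0, by simp⟩ ?_ ?_ ?_
      · rintro s t hst ⟨c, hc⟩
        exact ⟨c, fun x hx => hc x (hst hx)⟩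
      · rintro s t ⟨c, hc⟩ ⟨c', hc'⟩
        refine ⟨max c c', fun x hx hxK => ?_⟩
        rcases hx with hx | hx
        · exact hmono x hxK _ _ (le_max_left _ _) (hc x hx hxK)
        · exact hmono x hxK _ _ (le_max_right _ _) (hc' x hx hxK)
      · intro x hx
        obtain ⟨c, hc⟩ := hex x hx
        have h := hopen x hx c hc
        rw [nhds_prod_eq] at h
        have h2 : ∀ᶠ x' in 𝓝 x, R x' c := h.curry.mono fun _ h => h.self_of_nhds
        exact ⟨{x' | R x' c}, mem_nhdsWithin_of_mem_nhds h2, c, fun x' hx' _ => hx'⟩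
    obtain ⟨c, hc⟩ := h
    exact ⟨c, fun x hx => hc x hx hx⟩
  have hYb : BddBelow Y := by
    obtain ⟨x, hx⟩ := hne
    obtain ⟨c, hc⟩ := hlow x hx
    refine ⟨c, fun c' hc' => ?_⟩
    by_contra h
    exact hc (hmono x hx _ _ (not_le.1 h).le (hc' x hx))
  have hnot : sInf Y ∉ Y := by
    intro hmem
    have h : ∀ᶠ c in 𝓝 (sInf Y), ∀ x ∈ K, R x c := by
      refine hK.eventually_forall_of_forall_eventually fun x hx => ?_
      exact (continuous_swap.tendsto (sInf Y, x)).eventually (hopen x hx _ (hmem x hx))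
    have h2 : ∀ᶠ c in 𝓝[<] (sInf Y), ∀ x ∈ K, R x c := h.filter_mono nhdsWithin_le_nhds
    obtain ⟨c, hc, hlt⟩ := (h2.and self_mem_nhdsWithin).exists
    exact absurd (csInf_le hYb hc) (not_le.2 hlt)
  have hnot' : ¬ ∀ x ∈ K, R x (sInf Y) := hnot
  push Not at hnot'
  obtain ⟨x, hx, hxc⟩ := hnot'
  refine ⟨x, hx, _, hxc, fun x' hx' c' hc' => ?_⟩
  obtain ⟨y, hy, hyc⟩ := exists_lt_of_csInf_lt hYne hc'
  exact hmono x' hx' _ _ hyc.le (hy x' hx')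

section MaximumPrinciple

variable {n : ℕ}

section Continuity

variable {S : EuclideanSpace ℝ (Fin n) → Matrix (Fin n) (Fin n) ℝ}
  {T : Set (EuclideanSpace ℝ (Fin n))} {u : EuclideanSpace ℝ (Fin n) → ℝ}
  {z : EuclideanSpace ℝ (Fin n)}

theorem continuousAt_covHess (hT : IsOpen T) (hS : ∀ i j, ContDiffOn ℝ ∞ (fun z => S z i j) T)
    (hdet : ∀ z ∈ T, IsUnit (S z).det) (hz : z ∈ T) (hu : ContDiffAt ℝ 2 u z) (i j : Fin n) :
    ContinuousAt (fun z => covHess S u z i j) z := by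
  have h1 : ∀ k, ContDiffAt ℝ 1 (partialDeriv k u) z := fun k =>
    contDiffAt_partialDeriv hu (by norm_num) k
  have h2 : ContDiffAt ℝ 0 (partialDeriv i (partialDeriv j u)) z :=
    contDiffAt_partialDeriv (h1 j) (by norm_num) i
  refine h2.continuousAt.sub (tendsto_finsetSum _ fun k _ => ?_)
  exact (contDiffAt_christoffelOf_of_mem hT hS hdet hz k i j).continuousAt.mul (h1 k).continuousAt

theorem continuousAt_coordMetric (hT : IsOpen T)
    (hS : ∀ i j, ContDiffOn ℝ ∞ (fun z => S z i j) T) (hz : z ∈ T) (hu : ContDiffAt ℝ 2 u z)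
    (i j : Fin n) : ContinuousAt (fun z => coordMetric S u z i j) z := by
  have h1 : ∀ k, ContinuousAt (partialDeriv k u) z := fun k =>
    (contDiffAt_partialDeriv hu (m := 1) (by norm_num) k).continuousAt
  exact ((hS i j).contDiffAt (hT.mem_nhds hz)).continuousAt.add ((h1 i).mul (h1 j))

theorem continuousAt_coordW (hT : IsOpen T) (hS : ∀ i j, ContDiffOn ℝ ∞ (fun z => S z i j) T)
    (hdet : ∀ z ∈ T, IsUnit (S z).det) (hz : z ∈ T) (hu : ContDiffAt ℝ 2 u z) :
    ContinuousAt (coordW S u) z := by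
  have h1 : ∀ k, ContinuousAt (partialDeriv k u) z := fun k =>
    (contDiffAt_partialDeriv hu (m := 1) (by norm_num) k).continuousAt
  have h2 : ∀ i j, ContinuousAt (fun z => (S z)⁻¹ i j) z := fun i j =>
    (contDiffAt_matrix_inv (fun i j => (hS i j).contDiffAt (hT.mem_nhds hz)) (hdet z hz)
      i j).continuousAt
  refine ContinuousAt.sqrt (continuousAt_const.add ?_)
  exact tendsto_finsetSum _ fun i _ => tendsto_finsetSum _ fun j _ =>
    ((h2 i j).mul (h1 i)).mul (h1 j)

end Continuity

variable {M : Type*} [TopologicalSpace M] [ChartedSpace (EuclideanSpace ℝ (Fin n)) M]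
  [IsManifold (𝓡 n) ∞ M] [RiemannianBundle (fun x : M => TangentSpace (𝓡 n) x)]
  [IsContMDiffRiemannianBundle (𝓡 n) ∞ (EuclideanSpace ℝ (Fin n))
    (fun x : M => TangentSpace (𝓡 n) x)]

/-- The function `Λ exp (β χ) / (1 - a₀ W)` is less than `c` at `x`, where `Λ` is the largest ratio
of the covariant Hessian of `u` and the metric of its graph. -/
def TestFunctionLT (χ : M → ℝ) (a₀ β : ℝ) (u : M → ℝ) (x : M) (c : ℝ) : Prop :=
  ∀ ξ : Fin n → ℝ, ξ ≠ 0 → quadForm (hessComp u x) ξ * Real.exp (β * χ x)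
    < c * (1 - a₀ * graphW n u x) * quadForm (graphMetric u x) ξ

theorem metricAt_pos (x : M) (v : Fin n → ℝ) (hv : v ≠ 0) : 0 < quadForm (metricAt x) v :=
  metricMatrix_pos x (mem_extChartAt_target x) hv

theorem metricAt_le_graphMetric (u : M → ℝ) (x : M) (v : Fin n → ℝ) :
    quadForm (metricAt x) v ≤ quadForm (graphMetric u x) v := by
  rw [graphMetric, quadForm_add, quadForm_vecMulVec]
  exact le_add_of_nonneg_right (sq_nonneg _)

theorem graphMetric_pos (u : M → ℝ) (x : M) (v : Fin n → ℝ) (hv : v ≠ 0) :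
    0 < quadForm (graphMetric u x) v :=
  (metricAt_pos x v hv).trans_le (metricAt_le_graphMetric u x v)

variable {χ u : M → ℝ} {a₀ β c : ℝ} {x : M}

theorem TestFunctionLT.eventually (hu : ContMDiffAt (𝓡 n) 𝓘(ℝ, ℝ) 2 u x)
    (hχ : ContMDiffAt (𝓡 n) 𝓘(ℝ, ℝ) 2 χ x) (h : TestFunctionLT (n := n) χ a₀ β u x c) :
    ∀ᶠ q : M × ℝ in 𝓝 (x, c), TestFunctionLT (n := n) χ a₀ β u q.1 q.2 := by
  have hz : chartPt (n := n) x ∈ (extChartAt (𝓡 n) x).target := mem_extChartAt_target x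
  have hx : (extChartAt (𝓡 n) x).symm (chartPt (n := n) x) = x := extChartAt_to_inv (I := 𝓡 n) x
  have hT := isOpen_extChartAt_target (I := 𝓡 n) x
  have hdet : ∀ z ∈ (extChartAt (𝓡 n) x).target, IsUnit (metricMatrix x z).det := fun z hz =>
    isUnit_det_metricMatrix x hz
  have hu' : ContDiffAt ℝ 2 (chartExpr x u) (chartPt (n := n) x) :=
    contDiffAt_chartExpr (by norm_cast) x hz (by rwa [hx])
  have hχ' : ContDiffAt ℝ 2 (chartExpr x χ) (chartPt (n := n) x) :=
    contDiffAt_chartExpr (by norm_cast) x hz (by rwa [hx])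
  set A : EuclideanSpace ℝ (Fin n) × ℝ → Matrix (Fin n) (Fin n) ℝ := fun q =>
    Real.exp (β * chartExpr x χ q.1) • covHess (metricMatrix x) (chartExpr x u) q.1
      - (q.2 * (1 - a₀ * coordW (metricMatrix x) (chartExpr x u) q.1))
        • coordMetric (metricMatrix x) (chartExpr x u) q.1 with hA
  have hlift : ∀ {g : EuclideanSpace ℝ (Fin n) → ℝ}, ContinuousAt g (chartPt (n := n) x) →
      ContinuousAt (fun q : EuclideanSpace ℝ (Fin n) × ℝ => g q.1) (chartPt (n := n) x, c) :=
    fun hg => ContinuousAt.comp (x := (chartPt (n := n) x, c)) (f := Prod.fst) hg continuousAt_fst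
  have hAc : ∀ i j, ContinuousAt (fun q => A q i j) (chartPt (n := n) x, c) := by
    intro i j
    simp only [hA, Matrix.sub_apply, Matrix.smul_apply, smul_eq_mul]
    have e1 := hlift hχ'.continuousAt
    have e2 := hlift (continuousAt_covHess hT (contDiffOn_metricMatrix x) hdet hz hu' i j)
    have e3 := hlift (continuousAt_coordMetric hT (contDiffOn_metricMatrix x) hz hu' i j)
    have e4 := hlift (continuousAt_coordW hT (contDiffOn_metricMatrix x) hdet hz hu')
    exact (((continuousAt_const.mul e1).rexp).mul e2).sub
      ((continuousAt_snd.mul (continuousAt_const.sub (continuousAt_const.mul e4))).mul e3)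
  have hneg : ∀ v, v ≠ 0 → quadForm (A (chartPt (n := n) x, c)) v < 0 := by
    intro v hv
    have h1 := h v hv
    have h2 : chartExpr x χ (chartPt (n := n) x) = χ x := by rw [chartExpr, hx]
    simp only [hA, quadForm_sub, quadForm_smul, h2]
    change Real.exp (β * χ x) * quadForm (hessComp u x) v
      - c * (1 - a₀ * graphW n u x) * quadForm (graphMetric u x) v < 0
    linarith
  have hev := eventually_quadForm_neg hAc hneg
  have htend : Tendsto (fun q : M × ℝ => (extChartAt (𝓡 n) x q.1, q.2)) (𝓝 (x, c))
      (𝓝 (chartPt (n := n) x, c)) := by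
    have h1 : ContinuousAt (fun q : M × ℝ => extChartAt (𝓡 n) x q.1) (x, c) :=
      ContinuousAt.comp (x := (x, c)) (continuousAt_extChartAt (I := 𝓡 n) x) continuousAt_fst
    exact h1.prodMk continuousAt_snd
  have hloc : ∀ᶠ x' in 𝓝 x, x' ∈ (extChartAt (𝓡 n) x).source ∧
      ContMDiffAt (𝓡 n) 𝓘(ℝ, ℝ) 2 u x' :=
    (eventually_of_mem (extChartAt_source_mem_nhds x) fun _ h => h).and
      ((contMDiffAt_iff_contMDiffAt_nhds (by simp)).1 hu)
  filter_upwards [htend.eventually hev, (continuous_fst.tendsto (x, c)).eventually hloc]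
    with q hq hq' ξ hξ
  obtain ⟨hqs, hqu⟩ := hq'
  set z := extChartAt (𝓡 n) x q.1 with hzdef
  have hzT : z ∈ (extChartAt (𝓡 n) x).target := (extChartAt (𝓡 n) x).map_source hqs
  have hzq : (extChartAt (𝓡 n) x).symm z = q.1 := (extChartAt (𝓡 n) x).left_inv hqs
  rw [← hzq] at hqu
  set J := jacobian (chartTransition x q.1) z with hJ
  have hJdet : IsUnit J.det :=
    isUnit_det_jacobian_chartTransition x q.1 hzT (by rw [hzq]; exact mem_extChartAt_source _)
  have hJξ : J.mulVec (J⁻¹.mulVec ξ) = ξ := by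
    rw [Matrix.mulVec_mulVec, Matrix.mul_nonsing_inv _ hJdet, Matrix.one_mulVec]
  have hne : J⁻¹.mulVec ξ ≠ 0 := by
    intro h0
    rw [h0, Matrix.mulVec_zero] at hJξ
    exact hξ hJξ.symm
  have h1 := hq _ hne
  have hW : coordW (metricMatrix x) (chartExpr x u) z = graphW n u q.1 := by
    have h2 := quadForm_inv_metricMatrix x hzT hqu
    rw [hzq] at h2
    exact congrArg (fun s => √(1 + s)) h2
  simp only [hA, quadForm_sub, quadForm_smul, hW, covHess_chartExpr x hzT hqu,
    coordMetric_chartExpr x hzT hqu, hzq, quadForm_conj] at h1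
  have h3 : chartExpr x χ z = χ q.1 := by rw [chartExpr, hzq]
  rw [← hJ, hJξ, h3] at h1
  linarith

theorem exists_testFunctionLT (χ : M → ℝ) (β : ℝ) (u : M → ℝ) (x : M)
    (ha : 0 < 1 - a₀ * graphW n u x) : ∃ c, TestFunctionLT (n := n) χ a₀ β u x c := by
  have h1 : ∀ᶠ s in 𝓝 (0 : ℝ), ∀ v, v ≠ 0 →
      quadForm (s • (Real.exp (β * χ x) • hessComp (n := n) u x)
      - (1 - a₀ * graphW n u x) • graphMetric u x) v < 0 := by
    refine eventually_quadForm_neg (A := fun s : ℝ => s • (Real.exp (β * χ x) • hessComp u x)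
      - (1 - a₀ * graphW n u x) • graphMetric u x) (fun i j => ?_) fun v hv => ?_
    · simp only [Matrix.sub_apply, Matrix.smul_apply, smul_eq_mul]
      fun_prop
    · simp only [quadForm_sub, quadForm_smul, zero_mul, zero_sub]
      exact neg_neg_of_pos (mul_pos ha (graphMetric_pos u x v hv))
  have h2 := h1.filter_mono (nhdsWithin_le_nhds (s := Ioi 0))
  obtain ⟨s, hs, hs0⟩ := (h2.and self_mem_nhdsWithin).exists
  have hs0 : 0 < s := hs0
  refine ⟨s⁻¹, fun ξ hξ => ?_⟩
  have h3 := hs ξ hξ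
  rw [quadForm_sub, quadForm_smul, quadForm_smul, quadForm_smul] at h3
  rw [mul_assoc, inv_mul_eq_div, lt_div_iff₀ hs0]
  linarith

/-- The test function attains its maximum on a compact set. -/
theorem exists_testFunction_max (hn : 0 < n) {X : Set M} (hX : IsCompact X) (hne : X.Nonempty)
    (hu : ∀ x ∈ X, ContMDiffAt (𝓡 n) 𝓘(ℝ, ℝ) 2 u x)
    (hχ : ∀ x ∈ X, ContMDiffAt (𝓡 n) 𝓘(ℝ, ℝ) 2 χ x)
    (ha : ∀ x ∈ X, 0 < 1 - a₀ * graphW n u x) :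
    ∃ x ∈ X, ∃ c : ℝ, (∃ ξ : Fin n → ℝ, ξ ≠ 0 ∧
        c * (1 - a₀ * graphW n u x) * quadForm (graphMetric u x) ξ
          ≤ quadForm (hessComp u x) ξ * Real.exp (β * χ x)) ∧
      ∀ x' ∈ X, ∀ ξ : Fin n → ℝ, quadForm (hessComp u x') ξ * Real.exp (β * χ x')
        ≤ c * (1 - a₀ * graphW n u x') * quadForm (graphMetric u x') ξ := by
  obtain ⟨x, hx, c, hnot, hall⟩ := hX.exists_critical_level hne
    (R := TestFunctionLT (n := n) χ a₀ β u)
    (fun x hx c c' hc h ξ hξ => (h ξ hξ).trans_le (mul_le_mul_of_nonneg_right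
      (mul_le_mul_of_nonneg_right hc (ha x hx).le) (graphMetric_pos u x ξ hξ).le))
    (fun x hx c h => h.eventually (hu x hx) (hχ x hx))
    (fun x hx => exists_testFunctionLT χ β u x (ha x hx))
    (fun x hx => by
      set ξ : Fin n → ℝ := Pi.single ⟨0, hn⟩ 1
      have hξ : ξ ≠ 0 := by simp [ξ]
      have hg := graphMetric_pos u x ξ hξ
      refine ⟨quadForm (hessComp u x) ξ * Real.exp (β * χ x)
        / ((1 - a₀ * graphW n u x) * quadForm (graphMetric u x) ξ), fun h => ?_⟩
      have h1 := h ξ hξ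
      rw [mul_assoc, div_mul_cancel₀ _ (mul_pos (ha x hx) hg).ne'] at h1
      exact lt_irrefl _ h1)
  refine ⟨x, hx, c, ?_, fun x' hx' ξ => ?_⟩
  · unfold TestFunctionLT at hnot
    push Not at hnot
    exact hnot
  · rcases eq_or_ne ξ 0 with rfl | hξ
    · simp [quadForm_zero_right]
    · have hp := mul_pos (ha x' hx') (graphMetric_pos u x' ξ hξ)
      rw [mul_assoc, ← div_le_iff₀ hp]
      refine le_of_forall_gt_imp_ge_of_dense fun c' hc' => ?_
      rw [div_le_iff₀ hp, ← mul_assoc]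
      exact (hall x' hx' c' hc' ξ hξ).le

/-- The norm of the covariant Hessian is controlled by the principal curvatures and the slope. -/
theorem hessNorm_le_of_isPrincipalCurvatures {κ : Fin n → ℝ} {A Wm : ℝ}
    (hκ : IsPrincipalCurvatures u x κ) (hA : ∀ i, |κ i| ≤ A) (hA0 : 0 ≤ A)
    (hW : graphW n u x ≤ Wm) :
    hessNorm n u x ≤
      √(n * (n * (n * (n * ((1 + Wm ^ 2) * (1 + Wm ^ 2) * (Wm * A) * (Wm * A)))))) := by
  obtain ⟨P, hPg, hPa⟩ := hκ
  have hPdet := isUnit_det_of_conj_eq_one hPg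
  obtain ⟨-, -, hB⟩ := bounds_of_orthonormal_frame (metricAt_pos x) hPg
  have hW1 := one_le_graphW (n := n) u x
  have hs : 2 + quadForm (metricAt (n := n) x)⁻¹ (diffComp u x) ≤ 1 + Wm ^ 2 := by
    have h1 := (Real.sqrt_le_iff.1 hW).2
    change 2 + gradNormSq n u x ≤ _
    linarith
  have hD : ∀ i j, |(P.transpose * hessComp (n := n) u x * P) i j| ≤ Wm * A := by
    intro i j
    have h1 : P.transpose * hessComp u x * P = graphW n u x • Matrix.diagonal κ := by
      rw [← hPa, graphSecondForm, Matrix.mul_smul, Matrix.smul_mul, smul_smul,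
        mul_inv_cancel₀ (by linarith), one_smul]
    rw [h1, Matrix.smul_apply, smul_eq_mul, abs_mul, abs_of_nonneg (by linarith)]
    have h2 : |Matrix.diagonal κ i j| ≤ A := by
      rw [Matrix.diagonal_apply]
      split_ifs
      · exact hA i
      · simpa using hA0
    exact mul_le_mul hW h2 (abs_nonneg _) (by linarith)
  have hB' : ∀ i j, |(P.transpose * metricAt (n := n) x * P)⁻¹ i j| ≤ 1 + Wm ^ 2 := fun i j =>
    (hB i j).trans hs
  have hWA : 0 ≤ Wm * A := mul_nonneg (by linarith) hA0
  refine Real.sqrt_le_sqrt ?_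
  rw [sum_inv_inv_mul_mul_conj hPdet]
  have hsum : ∀ (b : ℝ) (g : Fin n → ℝ), (∀ i, g i ≤ b) → ∑ i, g i ≤ n * b := fun b g hg =>
    (Finset.sum_le_sum fun i _ => hg i).trans (by simp)
  refine hsum _ _ fun i => hsum _ _ fun j => hsum _ _ fun k => hsum _ _ fun l => ?_
  refine (le_abs_self _).trans ?_
  rw [abs_mul, abs_mul, abs_mul]
  have h0 : 0 ≤ 1 + Wm ^ 2 := by positivity
  exact mul_le_mul (mul_le_mul (mul_le_mul (hB' i k) (hB' j l) (abs_nonneg _) h0) (hD i j)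
    (abs_nonneg _) (by positivity)) (hD k l) (abs_nonneg _) (by positivity)

theorem quadForm_hessComp_le (u : M → ℝ) (x : M) (v : Fin n → ℝ) :
    quadForm (hessComp u x) v ≤ hessNorm n u x * quadForm (metricAt x) v :=
  quadForm_le_sqrt_mul (by ext i j; exact metricMatrix_symm x _ j i) (metricAt_pos x) _ v

end MaximumPrinciple

/-! ### The global estimate -/

section GlobalBound

variable {n : ℕ} {M : Type*} [TopologicalSpace M] [ChartedSpace (EuclideanSpace ℝ (Fin n)) M]
  [IsManifold (𝓡 n) ∞ M] [RiemannianBundle (fun x : M => TangentSpace (𝓡 n) x)]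
  [IsContMDiffRiemannianBundle (𝓡 n) ∞ (EuclideanSpace ℝ (Fin n))
    (fun x : M => TangentSpace (𝓡 n) x)]

/-- The local bounds at a maximum of the test function hold uniformly on a compact set, for some
choice of `β`. -/
theorem exists_bound_of_isCurvatureMaximum {Γ : Set (Fin n → ℝ)} {f : (Fin n → ℝ) → ℝ}
    {Ψ : M → ℝ → ℝ} {χ : M → ℝ} {K D₀ c₀ a₀ Wm : ℝ} (hf : IsCurvatureFunction Γ f)
    (hc : ConcaveOn ℝ Γ f) (hn : 0 < n) (hWm : 1 ≤ Wm) (ha₀ : 0 < a₀) (ha₀' : a₀ * Wm ≤ 1 / 2)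
    (hc₀ : 0 < c₀) {X : Set M} (hX : IsCompact X)
    (hχ : ∀ x ∈ X, ContMDiffAt (𝓡 n) 𝓘(ℝ, ℝ) 2 χ x)
    (hχ2 : ∀ x ∈ X, ∀ v : Fin n → ℝ, v ≠ 0 → 0 < ∑ i, ∑ j, hessComp χ x i j * v i * v j)
    (hΨ : ∀ x ∈ X, ∀ t, ContMDiffAt ((𝓡 n).prod 𝓘(ℝ, ℝ)) 𝓘(ℝ, ℝ) 2
      (fun q : M × ℝ => Ψ q.1 q.2) (x, t)) :
    ∃ β C₁ : ℝ, ∀ u, ∀ x ∈ X, ∀ κ m,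
      IsCurvatureMaximum Γ f Ψ χ K D₀ c₀ a₀ Wm β u x κ m → κ m ≤ C₁ := by
  have key : ∃ β₀ : ℝ, ∀ β, β₀ ≤ β → ∃ C₁ : ℝ, ∀ u, ∀ x ∈ X, ∀ κ m,
      IsCurvatureMaximum Γ f Ψ χ K D₀ c₀ a₀ Wm β u x κ m → κ m ≤ C₁ := by
    refine hX.induction_on (p := fun s => ∃ β₀ : ℝ, ∀ β, β₀ ≤ β → ∃ C₁ : ℝ, ∀ u, ∀ x ∈ s, ∀ κ m,
      IsCurvatureMaximum Γ f Ψ χ K D₀ c₀ a₀ Wm β u x κ m → κ m ≤ C₁) ⟨0, fun _ _ => ⟨0, by simp⟩⟩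
      ?_ ?_ ?_
    · rintro s t hst ⟨β₀, h⟩
      refine ⟨β₀, fun β hβ => ?_⟩
      obtain ⟨C₁, hC₁⟩ := h β hβ
      exact ⟨C₁, fun u x hx => hC₁ u x (hst hx)⟩
    · rintro s t ⟨β₀, h⟩ ⟨β₁, h'⟩
      refine ⟨max β₀ β₁, fun β hβ => ?_⟩
      obtain ⟨C₁, hC₁⟩ := h β ((le_max_left _ _).trans hβ)
      obtain ⟨C₂, hC₂⟩ := h' β ((le_max_right _ _).trans hβ)
      refine ⟨max C₁ C₂, fun u x hx κ m hm => ?_⟩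
      rcases hx with hx | hx
      · exact (hC₁ u x hx κ m hm).trans (le_max_left _ _)
      · exact (hC₂ u x hx κ m hm).trans (le_max_right _ _)
    · intro x hx
      obtain ⟨V, hV, h⟩ := exists_local_bound (K := K) (D₀ := D₀) hf hc hn hWm ha₀ ha₀' hc₀ x
        (hχ x hx) (hχ2 x hx) (hΨ x hx)
      exact ⟨V, mem_nhdsWithin_of_mem_nhds hV, h⟩
  obtain ⟨β, h⟩ := key
  exact ⟨β, h β le_rfl⟩

/-- The covariant Hessian in a frame of principal directions. -/
theorem quadForm_hessComp_mulVec {u : M → ℝ} {x : M} {κ : Fin n → ℝ}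
    {P : Matrix (Fin n) (Fin n) ℝ}
    (hP : P.transpose * graphSecondForm u x * P = Matrix.diagonal κ) (η : Fin n → ℝ) :
    quadForm (hessComp u x) (P.mulVec η) = graphW n u x * ∑ i, κ i * η i ^ 2 := by
  have hW := one_le_graphW (n := n) u x
  rw [← quadForm_conj, ← quadForm_diagonal, ← quadForm_smul, ← hP, graphSecondForm,
    Matrix.mul_smul, Matrix.smul_mul, smul_smul, mul_inv_cancel₀ (by linarith), one_smul]

theorem quadForm_graphMetric_mulVec {u : M → ℝ} {x : M} {P : Matrix (Fin n) (Fin n) ℝ}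
    (hP : P.transpose * graphMetric u x * P = 1) (η : Fin n → ℝ) :
    quadForm (graphMetric u x) (P.mulVec η) = ∑ i, η i ^ 2 := by
  rw [← quadForm_conj, hP, quadForm_one]

/-- The largest principal curvature determines the largest ratio of the covariant Hessian and the
metric of the graph. -/
theorem graphW_mul_le_of_quadForm_le {u : M → ℝ} {x : M} {κ : Fin n → ℝ} {c : ℝ}
    (hκ : IsPrincipalCurvatures u x κ)
    (h : ∀ ξ : Fin n → ℝ, quadForm (hessComp u x) ξ ≤ c * quadForm (graphMetric u x) ξ)
    (m : Fin n) :
    graphW n u x * κ m ≤ c := by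
  obtain ⟨P, hPg, hPa⟩ := hκ
  have h1 := h (P.mulVec (Pi.single m 1))
  rw [quadForm_hessComp_mulVec hPa, quadForm_graphMetric_mulVec hPg] at h1
  simpa [Pi.single_apply, ite_pow] using h1

/-- The converse bound, from a direction in which the ratio is attained. -/
theorem le_graphW_mul_of_le_quadForm {u : M → ℝ} {x : M} {κ : Fin n → ℝ} {c : ℝ} {m : Fin n}
    (hκ : IsPrincipalCurvatures u x κ) (hm : ∀ i, κ i ≤ κ m)
    (h : ∃ ξ : Fin n → ℝ, ξ ≠ 0 ∧
      c * quadForm (graphMetric u x) ξ ≤ quadForm (hessComp u x) ξ) :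
    c ≤ graphW n u x * κ m := by
  obtain ⟨P, hPg, hPa⟩ := hκ
  obtain ⟨ξ, hξ, h⟩ := h
  have hP := isUnit_det_of_conj_eq_one hPg
  have h1 : P.mulVec (P⁻¹.mulVec ξ) = ξ := by
    rw [Matrix.mulVec_mulVec, Matrix.mul_nonsing_inv _ hP, Matrix.one_mulVec]
  have hpos := graphMetric_pos u x ξ hξ
  rw [← h1, quadForm_graphMetric_mulVec hPg, quadForm_hessComp_mulVec hPa] at h
  rw [← h1, quadForm_graphMetric_mulVec hPg] at hpos
  set η := P⁻¹.mulVec ξ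
  have h2 : ∑ i, κ i * η i ^ 2 ≤ κ m * ∑ i, η i ^ 2 := by
    rw [Finset.mul_sum]
    exact Finset.sum_le_sum fun i _ => mul_le_mul_of_nonneg_right (hm i) (sq_nonneg _)
  have hW := one_le_graphW (n := n) u x
  have h3 := mul_le_mul_of_nonneg_left h2 (zero_le_one.trans hW)
  refine le_of_mul_le_mul_right ?_ hpos
  linarith

end GlobalBound

theorem mainTheorem4
    {n : ℕ} (hn : 2 ≤ n)
    {M : Type*} [MetricSpace M] [CompleteSpace M]
    [ChartedSpace (EuclideanSpace ℝ (Fin n)) M] [IsManifold (𝓡 n) ∞ M]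
    [RiemannianBundle (fun x : M => TangentSpace (𝓡 n) x)]
    [IsContMDiffRiemannianBundle (𝓡 n) ∞ (EuclideanSpace ℝ (Fin n))
      (fun x : M => TangentSpace (𝓡 n) x)]
    [IsRiemannianManifold (𝓡 n) M]
    (Ω : Set M) (hΩo : IsOpen Ω) (hΩc : IsConnected Ω) (hΩb : Bornology.IsBounded Ω)
    (Ψ : M → ℝ → ℝ)
    (hΨ : ∀ q ∈ closure Ω ×ˢ (univ : Set ℝ),
      ContMDiffAt ((𝓡 n).prod 𝓘(ℝ, ℝ)) 𝓘(ℝ, ℝ) 2 (fun q : M × ℝ => Ψ q.1 q.2) q)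
    (hΨpos : ∀ x ∈ closure Ω, ∀ t : ℝ, 0 < Ψ x t)
    (Γ : Set (Fin n → ℝ)) (f : (Fin n → ℝ) → ℝ) (hf : IsCurvatureFunction Γ f)
    (c₀ Ψbar : ℝ)
    (hcond : StructureConditions Γ f (infRHS Ω Ψ) (supRHS Ω Ψ) c₀ Ψbar)
    (hχ : ∃ χ : M → ℝ, IsLocallyStrictlyConvex n Ω χ)
    (K₁ K₂ : ℝ) :
    ∃ C : ℝ, ∀ φ u : M → ℝ, IsAdmissibleSolution Ω Γ f Ψ φ u →
      (∀ x ∈ closure Ω, |u x| + gradNorm n u x ≤ K₁) →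
      (∀ x ∈ frontier Ω, hessNorm n u x ≤ K₂) →
      ∀ x ∈ closure Ω, hessNorm n u x ≤ C := by
  obtain ⟨χ, hχ⟩ := hχ
  have hn0 : 0 < n := by omega
  have hX : IsCompact (closure Ω) := isCompact_closure_of_isBounded n hΩb
  have hXne : (closure Ω).Nonempty := hΩc.nonempty.closure
  have hc₀ := hcond.c₀_pos
  -- bounds for `χ` and for the right hand side
  obtain ⟨B, hB⟩ := hX.exists_bound_of_continuousOn (f := χ)
    fun x hx => (hχ x hx).1.continuousAt.continuousWithinAt
  obtain ⟨A, hA⟩ := (hX.prod (isCompact_Icc (a := -K₁) (b := K₁))).exists_bound_of_continuousOn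
    (f := fun q : M × ℝ => Ψ q.1 q.2)
    fun q hq => (hΨ q ⟨hq.1, mem_univ _⟩).continuousAt.continuousWithinAt
  set Wm := √(1 + K₁ ^ 2) with hWm
  have hWm1 : 1 ≤ Wm := Real.one_le_sqrt.2 (by nlinarith)
  set a₀ := 1 / (2 * Wm) with ha₀def
  have ha₀ : 0 < a₀ := by positivity
  have ha₀' : a₀ * Wm = 1 / 2 := by rw [ha₀def]; field_simp
  obtain ⟨β, C₁, hC₁⟩ := exists_bound_of_isCurvatureMaximum (Ψ := Ψ) (K := K₁)
    (D₀ := A - f 0) hf hcond.concave hn0 hWm1 ha₀ ha₀'.le hc₀ hX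
    (fun x hx => (hχ x hx).1) (fun x hx => (hχ x hx).2) (fun x hx t => hΨ (x, t) ⟨hx, mem_univ _⟩)
  -- `E` bounds `exp (± β χ)`, `N` bounds `Λ` at the maximum and on the boundary, `L` everywhere.
  set E := Real.exp (|β| * B) with hE
  set N := max (Wm * max C₁ 0) (max K₂ 0) with hN
  have hN0 : 0 ≤ N := (le_max_right _ _).trans (le_max_right _ _)
  have hE0 : 0 < E := Real.exp_pos _
  set L := 2 * (N * E) * E with hL
  have hL0 : 0 ≤ L := by positivity
  refine ⟨max K₂ √(n * (n * (n * (n * ((1 + Wm ^ 2) * (1 + Wm ^ 2) * (Wm * (n * L))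
    * (Wm * (n * L))))))), fun φ u hu hK₁ hK₂ => ?_⟩
  -- the slope of the graph
  have huK : ∀ x ∈ closure Ω, |u x| ≤ K₁ := fun x hx => by
    linarith [hK₁ x hx, Real.sqrt_nonneg (gradNormSq n u x), show gradNorm n u x =
      √(gradNormSq n u x) from rfl]
  have hW : ∀ x ∈ closure Ω, graphW n u x ≤ Wm := fun x hx => by
    have h1 : √(gradNormSq n u x) ≤ K₁ := by
      linarith [hK₁ x hx, abs_nonneg (u x), show gradNorm n u x = √(gradNormSq n u x) from rfl]
    have h2 := (Real.sqrt_le_iff.1 h1).2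
    exact Real.sqrt_le_sqrt (by linarith)
  have hW1 : ∀ x, 1 ≤ graphW n u x := one_le_graphW u
  have ha : ∀ x ∈ closure Ω, 1 / 2 ≤ 1 - a₀ * graphW n u x := fun x hx => by
    have := mul_le_mul_of_nonneg_left (hW x hx) ha₀.le
    linarith
  have hexp : ∀ x ∈ closure Ω, Real.exp (β * χ x) ≤ E ∧ 1 ≤ Real.exp (β * χ x) * E := by
    intro x hx
    have h1 : |β * χ x| ≤ |β| * B := by
      rw [abs_mul]
      exact mul_le_mul_of_nonneg_left (hB x hx) (abs_nonneg _)
    refine ⟨Real.exp_le_exp.2 ((le_abs_self _).trans h1), ?_⟩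
    rw [hE, ← Real.exp_add]
    exact Real.one_le_exp (by linarith [neg_abs_le (β * χ x)])
  -- the structure conditions at the curvatures of the graph
  have hlevel : ∀ x ∈ Ω, ∀ κ ∈ Γ, f κ = Ψ x (u x) →
      κ ∈ levelRegion Γ f (infRHS Ω Ψ) (supRHS Ω Ψ) := by
    intro x hx κ hκ hfκ
    have hx' := subset_closure hx
    refine ⟨hκ, ?_, ?_⟩
    · rw [hfκ]
      exact (iInf₂_le x hx').trans (iInf_le _ (u x))
    · rw [hfκ]
      exact (le_iSup (fun t : ℝ => (Ψ x t : EReal)) (u x)).trans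
        (le_iSup₂ (f := fun x (_ : x ∈ closure Ω) => ⨆ t : ℝ, (Ψ x t : EReal)) x hx')
  have heuler : ∀ x ∈ Ω, ∀ κ ∈ Γ, f κ = Ψ x (u x) →
      c₀ ≤ ∑ i, curvDeriv f i κ * κ i ∧ ∑ i, curvDeriv f i κ * κ i ≤ A - f 0 := by
    intro x hx κ hκ hfκ
    refine ⟨hcond.euler_ge κ (hlevel x hx κ hκ hfκ), ?_⟩
    have h1 := hf.sum_curvDeriv_mul_le hcond.concave hκ
    have h2 := hA (x, u x) ⟨subset_closure hx, abs_le.1 (huK x (subset_closure hx))⟩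
    rw [Real.norm_eq_abs] at h2
    linarith [le_abs_self (Ψ x (u x))]
  have hargmax : ∀ κ : Fin n → ℝ, ∃ m, ∀ i, κ i ≤ κ m := fun κ => by
    have : Nonempty (Fin n) := ⟨⟨0, hn0⟩⟩
    exact Finite.exists_max κ
  -- the maximum of the test function
  obtain ⟨x₀, hx₀, c, hlow, hup⟩ := exists_testFunction_max (a₀ := a₀) (β := β) hn0 hX hXne
    hu.contMDiffAt_closure (fun x hx => (hχ x hx).1)
    (fun x hx => lt_of_lt_of_le one_half_pos (ha x hx))
  have hc : c * (1 - a₀ * graphW n u x₀) ≤ N * E := by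
    have hex₀ := (hexp x₀ hx₀).1
    have hexp0 := Real.exp_pos (β * χ x₀)
    by_cases hx₀Ω : x₀ ∈ Ω
    · obtain ⟨κ, hκp, hκ, hfκ⟩ := hu.equation x₀ hx₀Ω
      obtain ⟨m, hm⟩ := hargmax κ
      obtain ⟨he1, he2⟩ := heuler x₀ hx₀Ω κ hκ hfκ
      -- the value of the maximum in terms of the largest principal curvature
      have hval : graphW n u x₀ * κ m * Real.exp (β * χ x₀) = c * (1 - a₀ * graphW n u x₀) := by
        refine le_antisymm ?_ ?_
        · rw [← le_div_iff₀ hexp0]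
          refine graphW_mul_le_of_quadForm_le hκp (fun ξ => ?_) m
          rw [div_mul_eq_mul_div, le_div_iff₀ hexp0]
          exact hup x₀ hx₀ ξ
        · rw [← div_le_iff₀ hexp0]
          refine le_graphW_mul_of_le_quadForm hκp hm ?_
          obtain ⟨ξ, hξ, h⟩ := hlow
          refine ⟨ξ, hξ, ?_⟩
          rw [div_mul_eq_mul_div, div_le_iff₀ hexp0]
          exact h
      have hmax : IsCurvatureMaximum Γ f Ψ χ K₁ (A - f 0) c₀ a₀ Wm β u x₀ κ m := by
        refine ⟨hu.contMDiffOn.contMDiffAt (hΩo.mem_nhds hx₀Ω), hκp, hκ, hfκ,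
          hcond.elliptic κ hκ, he1, he2, hm, huK x₀ hx₀, hW x₀ hx₀, ?_, ?_⟩
        · filter_upwards [hΩo.mem_nhds hx₀Ω] with x hx
          exact hu.equation x hx
        · filter_upwards [hΩo.mem_nhds hx₀Ω] with x hx ξ
          have h1 := hup x (subset_closure hx) ξ
          have h2 : 0 < 1 - a₀ * graphW n u x₀ := lt_of_lt_of_le one_half_pos (ha x₀ hx₀)
          have h3 := mul_le_mul_of_nonneg_right h1 h2.le
          rw [mul_sub β, Real.exp_sub, ← mul_div_assoc, div_mul_eq_mul_div, div_le_iff₀ hexp0]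
          refine h3.trans (le_of_eq ?_)
          linear_combination (-(1 - a₀ * graphW n u x) * quadForm (graphMetric u x) ξ) * hval
      have hκm := hC₁ u x₀ hx₀ κ m hmax
      rw [← hval]
      refine mul_le_mul ?_ hex₀ hexp0.le hN0
      refine le_trans ?_ (le_max_left _ _)
      calc graphW n u x₀ * κ m ≤ graphW n u x₀ * max C₁ 0 :=
            mul_le_mul_of_nonneg_left (hκm.trans (le_max_left _ _)) (by linarith [hW1 x₀])
        _ ≤ Wm * max C₁ 0 := mul_le_mul_of_nonneg_right (hW x₀ hx₀) (le_max_right _ _)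
    · have hfr : x₀ ∈ frontier Ω := by
        rw [frontier, hΩo.interior_eq]; exact ⟨hx₀, hx₀Ω⟩
      obtain ⟨ξ, hξ, h⟩ := hlow
      have hg := graphMetric_pos u x₀ ξ hξ
      refine le_of_mul_le_mul_right (h.trans ?_) hg
      have h1 : quadForm (hessComp u x₀) ξ ≤ N * quadForm (graphMetric u x₀) ξ := by
        refine (quadForm_hessComp_le u x₀ ξ).trans ?_
        refine mul_le_mul ?_ (metricAt_le_graphMetric u x₀ ξ) (metricAt_pos x₀ ξ hξ).le hN0
        exact (hK₂ x₀ hfr).trans ((le_max_left _ _).trans (le_max_right _ _))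
      calc quadForm (hessComp u x₀) ξ * Real.exp (β * χ x₀)
          ≤ N * quadForm (graphMetric u x₀) ξ * Real.exp (β * χ x₀) :=
            mul_le_mul_of_nonneg_right h1 hexp0.le
        _ ≤ N * quadForm (graphMetric u x₀) ξ * E :=
            mul_le_mul_of_nonneg_left hex₀ (mul_nonneg hN0 hg.le)
        _ = N * E * quadForm (graphMetric u x₀) ξ := by ring
  have hc2 : c ≤ 2 * (N * E) := by
    by_contra hlt
    have h1 : 0 < c := lt_of_le_of_lt (by positivity) (not_le.1 hlt)
    have h2 := mul_le_mul_of_nonneg_left (ha x₀ hx₀) h1.le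
    linarith [not_le.1 hlt]
  -- the bound at the other points
  intro x hx
  by_cases hxΩ : x ∈ Ω
  · refine le_trans ?_ (le_max_right _ _)
    obtain ⟨κ, hκp, hκ, hfκ⟩ := hu.equation x hxΩ
    obtain ⟨m, hm⟩ := hargmax κ
    obtain ⟨he1, -⟩ := heuler x hxΩ κ hκ hfκ
    have hpos := pos_of_sum_curvDeriv_pos (hcond.elliptic κ hκ) (hc₀.trans_le he1) hm
    have hκL : κ m ≤ L := by
      have h1 : graphW n u x * κ m ≤ L := by
        refine graphW_mul_le_of_quadForm_le hκp (fun ξ => ?_) m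
        have h2 := hup x hx ξ
        have hg : 0 ≤ quadForm (graphMetric u x) ξ := by
          rcases eq_or_ne ξ 0 with rfl | hξ
          · rw [quadForm_zero_right]
          · exact (graphMetric_pos u x ξ hξ).le
        have hex := (hexp x hx).2
        have h3 : 1 - a₀ * graphW n u x ≤ 1 := by
          linarith [mul_nonneg ha₀.le (zero_le_one.trans (hW1 x))]
        have h4 : c * (1 - a₀ * graphW n u x) ≤ 2 * (N * E) := by
          have h5 : 0 ≤ 1 - a₀ * graphW n u x := by linarith [ha x hx]
          calc _ ≤ 2 * (N * E) * (1 - a₀ * graphW n u x) := mul_le_mul_of_nonneg_right hc2 h5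
            _ ≤ 2 * (N * E) := mul_le_of_le_one_right (by positivity) h3
        have h6 : quadForm (hessComp u x) ξ * Real.exp (β * χ x)
            ≤ 2 * (N * E) * quadForm (graphMetric u x) ξ :=
          h2.trans (mul_le_mul_of_nonneg_right h4 hg)
        rcases le_or_gt (quadForm (hessComp u x) ξ) 0 with hneg | hpos'
        · exact hneg.trans (mul_nonneg hL0 hg)
        · calc quadForm (hessComp u x) ξ
              ≤ quadForm (hessComp u x) ξ * (Real.exp (β * χ x) * E) :=
                le_mul_of_one_le_right hpos'.le hex
            _ = quadForm (hessComp u x) ξ * Real.exp (β * χ x) * E := by ring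
            _ ≤ 2 * (N * E) * quadForm (graphMetric u x) ξ * E :=
                mul_le_mul_of_nonneg_right h6 hE0.le
            _ = L * quadForm (graphMetric u x) ξ := by rw [hL]; ring
      exact (le_mul_of_one_le_left hpos.le (hW1 x)).trans h1
    refine hessNorm_le_of_isPrincipalCurvatures hκp (fun i => ?_) (by positivity) (hW x hx)
    have h1 := abs_le_of_sum_curvDeriv_pos (hcond.elliptic κ hκ)
      (fun i j hij => hf.curvDeriv_anti hcond.concave hκ hij) (hc₀.trans_le he1) hm i
    exact h1.trans (mul_le_mul_of_nonneg_left hκL (Nat.cast_nonneg n))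
  · refine (hK₂ x ?_).trans (le_max_left _ _)
    rw [frontier, hΩo.interior_eq]
    exact ⟨hx, hxΩ⟩
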